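/- **Notation.** Let $n,m\ge 0$ be integers and write $X=(x,y,\zeta)\in\mathbf R^{2n+m}$ with $x,y\in\mathbf R^n$, $\zeta\in\mathbf R^m$. Let $\mathscr P(\mathbf R^N)$ be the set of positive measurable functions $\omega$ on $\mathbf R^N$ such that $\omega(x+y)\le C\omega(x)(1+|y|)^k$ for some constants $C,k$; a weight $v$ is submultiplicative if $v(x+y)\le Cv(x)v(y)$ for some constant $C$. With $\widehat f(\xi)=(2\pi)^{-N/2}\int f(x)e^{-i\langle x,\xi\rangle}dx$ and a fixed window $\chi\in\mathscr S(\mathbf R^N)\setminus 0$, put $$H_{f,\omega,p}(\xi)=\big\|\,\mathscr F(f\,\chi(\cdot-x))(\xi)\,\omega(x,\xi)\,\big\|_{L^p(dx)},\qquad \|f\|_{M^{p,q}_{(\omega)}}=\|H_{f,\omega,p}\|_{L^q},$$ for $\omega\in\mathscr P(\mathbf R^{2N})$; $M^{p,q}_{(\omega)}(\mathbf R^N)$ is the set of $f\in\mathscr S'(\mathbf R^N)$ with finite norm, and $M^p_{(\omega)}=M^{p,p}_{(\omega)}$. A sequence $a_j\in M^{\infty,1}_{(\omega)}$ converges narrowly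 to $a\in M^{\infty,1}_{(\omega)}$ if $a_j\to a$ in $\mathscr S'$ and $H_{a_j,\omega,\infty}\to H_{a,\omega,\infty}$ in $L^1$. For $a\in\mathscr S(\mathbf R^{2n+m})$ and real-valued $\varphi\in C^2(\mathbf R^{2n+m})$, $$\operatorname{Op}_\varphi(a)f(x)=(2\pi)^{-n}\iint a(x,y,\zeta)f(y)e^{i\varphi(x,y,\zeta)}\,dy\,d\zeta ,\qquad f\in\mathscr S(\mathbf R^n),$$ as an element of $\mathscr L(\mathscr S(\mathbf R^n),\mathscr S'(\mathbf R^n))$. **Theorem.** Let $1<p<\infty$, $\mathsf d>0$, $\omega,v\in\mathscr P(\mathbf R^{2n+m}\times\mathbf R^{2n+m})$ and $\omega_1,\omega_2\in\mathscr P(\mathbf R^{2n})$. Assume that $v$ is submultiplicative, that $v(X,\Xi)=v(\Xi)$ does not depend on $X$ and satisfies $v(t\Xi)\le Cv(\Xi)$ for $0\le t\le 1$ with $C$ independent of $t$ and $\Xi$, and that $\omega$ is $v$-moderate in the dual variable: $\omega(X,\Xi+\Xi')\le C\omega(X,\Xi)v(\Xi')$. Let $\varphi\in C^2(\mathbf R^{2n+m})$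 be real-valued with $\partial^\alpha\varphi\in M^{\infty,1}_{(v)}(\mathbf R^{2n+m})$ for $|\alpha|=2$, with $$\left|\det\begin{pmatrix}\varphi''_{x,y}(X)&\varphi''_{x,\zeta}(X)\\ \varphi''_{\zeta,y}(X)&\varphi''_{\zeta,\zeta}(X)\end{pmatrix}\right|\ge\mathsf d\qquad\text{for all }X$$ (rows are indexed by the variables $(x,\zeta)$, columns by $(y,\zeta)$), and such that, for a constant $C_0$, $$\frac{\omega_2(x,\xi)}{\omega_1(y,-\eta)}\le C_0\,\omega\big(X,\ \xi-\varphi'_x(X),\ \eta-\varphi'_y(X),\ -\varphi'_\zeta(X)\big),\qquad X=(x,y,\zeta)\in\mathbf R^{2n+m},\ \xi,\eta\in\mathbf R^n .$$ Then the following is true. 1. The map $a\mapsto\operatorname{Op}_\varphi(a)$ from $\mathscr S(\mathbf R^{2n+m})$ to $\mathscr L(\mathscr S(\mathbf R^n),\mathscr S'(\mathbf R^n))$ extends to a linear map from $M^{\infty,1}_{(\omega)}(\mathbf R^{2n+m})$ to $\mathscr L(\mathscr S(\mathbf R^n),\mathscr S'(\mathbf R^n))$ which is continuous for the norm of $M^{\infty,1}_{(\omega)}$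 and (sequentially) continuous for narrow convergence, and it is the only extension that is continuous for narrow convergence. 2. If $a\in M^{\infty,1}_{(\omega)}(\mathbf R^{2n+m})$, then $\operatorname{Op}_\varphi(a)$ extends uniquely to a continuous map from $M^p_{(\omega_1)}(\mathbf R^n)$ to $M^p_{(\omega_2)}(\mathbf R^n)$; the extension is linear, and $$\|\operatorname{Op}_\varphi(a)\|_{M^p_{(\omega_1)}\to M^p_{(\omega_2)}}\le C\,\mathsf d^{-1}\,\|a\|_{M^{\infty,1}_{(\omega)}}\exp\big(C\|\varphi''\|_{M^{\infty,1}_{(v)}}\big),$$ where $\|\varphi''\|_{M^{\infty,1}_{(v)}}$ is the sum of the norms of the second order partial derivatives of $\varphi$, and the constant $C>0$ depends only on $n,m,p$, the weights, $C_0$ and the windows, but not on $a$, $\varphi$ and $\mathsf d$. -/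

import Mathlib

open MeasureTheory Filter Topology SchwartzMap
open scoped ENNReal

/-! ### Time-frequency atoms and the short-time Fourier transform -/

/-- `e^{-it}` is a function of temperate growth of `t ∈ ℝ`. -/
theorem hasTemperateGrowth_cexp_neg_I_mul :
    Function.HasTemperateGrowth (fun t : ℝ => Complex.exp (-Complex.I * (t : ℂ))) := by
  have hd : ∀ t : ℝ, HasDerivAt (fun t : ℝ => Complex.exp (-Complex.I * (t : ℂ)))
      (-Complex.I * Complex.exp (-Complex.I * (t : ℂ))) t := by
    intro t
    have h1 : HasDerivAt (fun t : ℝ => -Complex.I * (t : ℂ)) (-Complex.I * 1) t :=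
      (Complex.ofRealCLM.hasDerivAt (x := t)).const_mul (-Complex.I)
    have h2 := h1.cexp
    rw [mul_one, mul_comm] at h2
    exact h2
  have hit : ∀ k : ℕ, iteratedDeriv k (fun t : ℝ => Complex.exp (-Complex.I * (t : ℂ))) =
      fun t : ℝ => (-Complex.I) ^ k * Complex.exp (-Complex.I * (t : ℂ)) := by
    intro k
    induction k with
    | zero => simp
    | succ k ih =>
      rw [iteratedDeriv_succ, ih]
      funext t
      rw [((hd t).const_mul ((-Complex.I) ^ k)).deriv]
      ring
  refine ⟨?_, fun k => ⟨0, 1, fun t => ?_⟩⟩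
  · exact Complex.contDiff_exp.comp (contDiff_const.mul Complex.ofRealCLM.contDiff)
  · rw [norm_iteratedFDeriv_eq_norm_iteratedDeriv, hit]
    have : ‖Complex.exp (-Complex.I * (t : ℂ))‖ = 1 := by
      rw [show -Complex.I * (t : ℂ) = ((-t : ℝ) : ℂ) * Complex.I by push_cast; ring]
      exact Complex.norm_exp_ofReal_mul_I _
    rw [norm_mul, this]
    simp

theorem hasTemperateGrowth_cexp_inner {V : Type*} [NormedAddCommGroup V] [InnerProductSpace ℝ V]
    (ξ : V) : Function.HasTemperateGrowth
      (fun y : V => Complex.exp (-Complex.I * ((inner ℝ y ξ : ℝ) : ℂ))) :=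
  hasTemperateGrowth_cexp_neg_I_mul.comp (Function.hasTemperateGrowth_inner_left ξ)

/-- The Schwartz function `y ↦ e^{-i⟨y, ξ⟩} χ(y - x)`. -/
noncomputable def tfAtom {ι : Type} [Fintype ι] (χ : 𝓢(EuclideanSpace ℝ ι, ℂ))
    (x ξ : EuclideanSpace ℝ ι) : 𝓢(EuclideanSpace ℝ ι, ℂ) :=
  SchwartzMap.smulLeftCLM ℂ (fun y : EuclideanSpace ℝ ι =>
    Complex.exp (-Complex.I * ((inner ℝ y ξ : ℝ) : ℂ))) (SchwartzMap.compSubConstCLM ℂ x χ)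

theorem tfAtom_apply {ι : Type} [Fintype ι] (χ : 𝓢(EuclideanSpace ℝ ι, ℂ))
    (x ξ y : EuclideanSpace ℝ ι) :
    tfAtom χ x ξ y = Complex.exp (-Complex.I * ((inner ℝ y ξ : ℝ) : ℂ)) * χ (y - x) := by
  rw [tfAtom, SchwartzMap.smulLeftCLM_apply_apply (hasTemperateGrowth_cexp_inner ξ),
    SchwartzMap.compSubConstCLM_apply, smul_eq_mul]

/-- The short-time Fourier transform `𝓕(u · χ(· - x))(ξ)` of a tempered distribution `u` on `ℝ^N`,
for the Fourier transform `𝓕f(ξ) = (2π)^{-N/2} ∫ f(y) e^{-i⟨y, ξ⟩} dy`. -/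
noncomputable def stft {ι : Type} [Fintype ι] (χ : 𝓢(EuclideanSpace ℝ ι, ℂ))
    (u : 𝓢'(EuclideanSpace ℝ ι, ℂ)) (x ξ : EuclideanSpace ℝ ι) : ℂ :=
  (((2 * Real.pi) ^ (-(Fintype.card ι : ℝ) / 2) : ℝ) : ℂ) * u (tfAtom χ x ξ)

/-! ### Weights -/

/-- The class `𝒫(V)` of polynomially moderate weights: positive (Lebesgue) measurable `ω` with
`ω(x + y) ≤ C ω(x) (1 + |y|)^k`; such functions are automatically locally bounded. -/
structure IsPolyWeight {V : Type*} [NormedAddCommGroup V] [MeasureSpace V] (ω : V → ℝ) :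
    Prop where
  pos : ∀ x, 0 < ω x
  aemeasurable : AEMeasurable ω (volume : Measure V)
  moderate : ∃ (C : ℝ) (k : ℕ), ∀ x y, ω (x + y) ≤ C * ω x * (1 + ‖y‖) ^ k

/-- `v(x + y) ≤ C v(x) v(y)` for some constant `C`. -/
def IsSubmultiplicative {V : Type*} [AddCommGroup V] (v : V → ℝ) : Prop :=
  ∃ C : ℝ, ∀ x y, v (x + y) ≤ C * v x * v y

/-! ### Modulation spaces -/

/-- `H_{u,ω,p}(ξ) = ‖𝓕(u · χ(· - x))(ξ) ω(x, ξ)‖_{L^p(dx)}`. -/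
noncomputable def modSlice {ι : Type} [Fintype ι] (χ : 𝓢(EuclideanSpace ℝ ι, ℂ))
    (ω : EuclideanSpace ℝ ι × EuclideanSpace ℝ ι → ℝ) (p : ℝ≥0∞)
    (u : 𝓢'(EuclideanSpace ℝ ι, ℂ)) (ξ : EuclideanSpace ℝ ι) : ℝ≥0∞ :=
  eLpNorm (fun x => stft χ u x ξ * (ω (x, ξ) : ℂ)) p volume

/-- The norm of `M^{p,q}_{(ω)}` with window `χ`, with value `∞` outside the space. -/
noncomputable def modNorm {ι : Type} [Fintype ι] (χ : 𝓢(EuclideanSpace ℝ ι, ℂ))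
    (ω : EuclideanSpace ℝ ι × EuclideanSpace ℝ ι → ℝ) (p q : ℝ≥0∞)
    (u : 𝓢'(EuclideanSpace ℝ ι, ℂ)) : ℝ≥0∞ :=
  eLpNorm (fun ξ => modSlice χ ω p u ξ) q volume

/-- The modulation space `M^{p,q}_{(ω)}`. -/
def modSpace {ι : Type} [Fintype ι] (χ : 𝓢(EuclideanSpace ℝ ι, ℂ))
    (ω : EuclideanSpace ℝ ι × EuclideanSpace ℝ ι → ℝ) (p q : ℝ≥0∞) :
    Set 𝓢'(EuclideanSpace ℝ ι, ℂ) :=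
  {u | modNorm χ ω p q u < ∞}

/-- The neighbourhoods of `u` in `M^{p,q}_{(ω)}` for the norm topology. -/
noncomputable def modNhds {ι : Type} [Fintype ι] (χ : 𝓢(EuclideanSpace ℝ ι, ℂ))
    (ω : EuclideanSpace ℝ ι × EuclideanSpace ℝ ι → ℝ) (p q : ℝ≥0∞)
    (u : 𝓢'(EuclideanSpace ℝ ι, ℂ)) : Filter 𝓢'(EuclideanSpace ℝ ι, ℂ) :=
  comap (fun w => modNorm χ ω p q (w - u)) (𝓝 0) ⊓ 𝓟 (modSpace χ ω p q)

/-- Narrow convergence `u_j → u` in `M^{p,q}_{(ω)}`: convergence in `𝒮'`, together with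
convergence of `H_{u_j,ω,p}` to `H_{u,ω,p}` in `L^q`. -/
def NarrowTendsto {ι : Type} [Fintype ι] (χ : 𝓢(EuclideanSpace ℝ ι, ℂ))
    (ω : EuclideanSpace ℝ ι × EuclideanSpace ℝ ι → ℝ) (p q : ℝ≥0∞)
    (u : ℕ → 𝓢'(EuclideanSpace ℝ ι, ℂ)) (u₀ : 𝓢'(EuclideanSpace ℝ ι, ℂ)) : Prop :=
  (∀ j, u j ∈ modSpace χ ω p q) ∧ u₀ ∈ modSpace χ ω p q ∧
  Tendsto u atTop (𝓝 u₀) ∧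
  Tendsto (fun j => eLpNorm (fun ξ => (modSlice χ ω p (u j) ξ).toReal -
    (modSlice χ ω p u₀ ξ).toReal) q volume) atTop (𝓝 0)

/-- The distribution `u` is given by the function `g` (used for continuous `g`). -/
def IsGivenBy {ι : Type} [Fintype ι] (u : 𝓢'(EuclideanSpace ℝ ι, ℂ))
    (g : EuclideanSpace ℝ ι → ℂ) : Prop :=
  ∀ ψ : 𝓢(EuclideanSpace ℝ ι, ℂ), HasCompactSupport ψ → u ψ = ∫ y, g y * ψ y

/-- The `M^{p,q}_{(ω)}` norm of a continuous function; it is `∞` unless the function is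
(given by) a tempered distribution in `M^{p,q}_{(ω)}`, which is then unique. -/
noncomputable def modNormFun {ι : Type} [Fintype ι] (χ : 𝓢(EuclideanSpace ℝ ι, ℂ))
    (ω : EuclideanSpace ℝ ι × EuclideanSpace ℝ ι → ℝ) (p q : ℝ≥0∞)
    (g : EuclideanSpace ℝ ι → ℂ) : ℝ≥0∞ :=
  ⨅ (u : 𝓢'(EuclideanSpace ℝ ι, ℂ)) (_ : IsGivenBy u g), modNorm χ ω p q u

/-! ### Maps between subsets of spaces of distributions -/

/-- `T` is linear on the subspace `M`. -/
def IsLinearOnSet {A B : Type*} [AddCommGroup A] [Module ℂ A] [AddCommGroup B] [Module ℂ B]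
    (T : A → B) (M : Set A) : Prop :=
  ∀ a ∈ M, ∀ b ∈ M, ∀ c : ℂ, T (a + c • b) = T a + c • T b

/-- `S` maps `M^p_{(ω₁)}` to `M^p_{(ω₂)}` and is continuous for the norms of these spaces. -/
def IsContinuousModMap {ι : Type} [Fintype ι] (χ : 𝓢(EuclideanSpace ℝ ι, ℂ))
    (ω₁ ω₂ : EuclideanSpace ℝ ι × EuclideanSpace ℝ ι → ℝ) (p : ℝ≥0∞)
    (S : 𝓢'(EuclideanSpace ℝ ι, ℂ) → 𝓢'(EuclideanSpace ℝ ι, ℂ)) : Prop :=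
  Set.MapsTo S (modSpace χ ω₁ p p) (modSpace χ ω₂ p p) ∧
  ∀ f ∈ modSpace χ ω₁ p p,
    Tendsto (fun h => modNorm χ ω₂ p p (S h - S f)) (modNhds χ ω₁ p p f) (𝓝 0)

/-! ### Phase functions and Fourier integral operators on `ℝ^{2n+m}` -/

/-- Coordinates of `X = (x, y, ζ) ∈ ℝ^n × ℝ^n × ℝ^m`. -/
abbrev TripleIdx (n m : ℕ) : Type := Fin n ⊕ Fin n ⊕ Fin m

/-- The space `ℝ^{2n+m}` of triples `(x, y, ζ)`. -/
abbrev TripleSpace (n m : ℕ) : Type := EuclideanSpace ℝ (TripleIdx n m)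

/-- The triple `(x, y, ζ)` as a point of `ℝ^{2n+m}`. -/
noncomputable def triple {n m : ℕ} (x y : EuclideanSpace ℝ (Fin n))
    (ζ : EuclideanSpace ℝ (Fin m)) : TripleSpace n m :=
  WithLp.toLp 2 (Sum.elim (fun i => x i) (Sum.elim (fun i => y i) (fun i => ζ i)))

/-- The component `x` of `X = (x, y, ζ)`. -/
noncomputable def xPart {n m : ℕ} (X : TripleSpace n m) : EuclideanSpace ℝ (Fin n) :=
  WithLp.toLp 2 (fun i => X (Sum.inl i))

/-- The component `y` of `X = (x, y, ζ)`. -/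
noncomputable def yPart {n m : ℕ} (X : TripleSpace n m) : EuclideanSpace ℝ (Fin n) :=
  WithLp.toLp 2 (fun i => X (Sum.inr (Sum.inl i)))

/-- The partial derivative `∂_i φ`. -/
noncomputable def pderivAt {ι : Type} [Fintype ι] [DecidableEq ι] (i : ι)
    (φ : EuclideanSpace ℝ ι → ℝ) (X : EuclideanSpace ℝ ι) : ℝ :=
  fderiv ℝ φ X (EuclideanSpace.single i 1)

/-- The second order partial derivative `∂_i ∂_j φ`. -/
noncomputable def pderiv2 {ι : Type} [Fintype ι] [DecidableEq ι] (i j : ι)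
    (φ : EuclideanSpace ℝ ι → ℝ) : EuclideanSpace ℝ ι → ℝ :=
  pderivAt i (pderivAt j φ)

/-- The vector `φ'(X)` of first order partial derivatives. -/
noncomputable def gradVec {ι : Type} [Fintype ι] [DecidableEq ι]
    (φ : EuclideanSpace ℝ ι → ℝ) (X : EuclideanSpace ℝ ι) : EuclideanSpace ℝ ι :=
  WithLp.toLp 2 (fun i => pderivAt i φ X)

/-- `‖φ''‖_{M^{∞,1}_{(v)}}`; finite exactly when all second order derivatives of `φ` belong to
`M^{∞,1}_{(v)}`. -/
noncomputable def hessNorm {ι : Type} [Fintype ι] [DecidableEq ι]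
    (χ : 𝓢(EuclideanSpace ℝ ι, ℂ)) (v : EuclideanSpace ℝ ι × EuclideanSpace ℝ ι → ℝ)
    (φ : EuclideanSpace ℝ ι → ℝ) : ℝ≥0∞ :=
  ∑ i, ∑ j, modNormFun χ v ∞ 1 (fun X => (pderiv2 i j φ X : ℂ))

/-- The mixed Hessian: rows indexed by `(x, ζ)`, columns indexed by `(y, ζ)`. -/
noncomputable def mixedHessian {n m : ℕ} (φ : TripleSpace n m → ℝ) (X : TripleSpace n m) :
    Matrix (Fin n ⊕ Fin m) (Fin n ⊕ Fin m) ℝ :=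
  Matrix.fromBlocks
    (Matrix.of fun i j => pderiv2 (Sum.inl i) (Sum.inr (Sum.inl j)) φ X)
    (Matrix.of fun i k => pderiv2 (Sum.inl i) (Sum.inr (Sum.inr k)) φ X)
    (Matrix.of fun k j => pderiv2 (Sum.inr (Sum.inr k)) (Sum.inr (Sum.inl j)) φ X)
    (Matrix.of fun k l => pderiv2 (Sum.inr (Sum.inr k)) (Sum.inr (Sum.inr l)) φ X)

/-- The pairing `⟨Op_φ(a) f, g⟩ = (2π)^{-n} ∭ a(x,y,ζ) e^{iφ(x,y,ζ)} f(y) g(x) dx dy dζ` for a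
symbol `a ∈ 𝒮(ℝ^{2n+m})`. -/
noncomputable def fioPairing {n m : ℕ} (φ : TripleSpace n m → ℝ) (a : 𝓢(TripleSpace n m, ℂ))
    (f g : 𝓢(EuclideanSpace ℝ (Fin n), ℂ)) : ℂ :=
  (((2 * Real.pi) ^ (-(n : ℝ)) : ℝ) : ℂ) *
    ∫ X : TripleSpace n m,
      a X * Complex.exp (Complex.I * (φ X : ℂ)) * f (yPart X) * g (xPart X)

/-- `T` extends the map `a ↦ Op_φ(a)` from `𝒮(ℝ^{2n+m})` to `ℒ(𝒮(ℝ^n), 𝒮'(ℝ^n))`. -/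
def ExtendsFIO {n m : ℕ} (φ : TripleSpace n m → ℝ)
    (T : 𝓢'(TripleSpace n m, ℂ) →
      (𝓢(EuclideanSpace ℝ (Fin n), ℂ) →L[ℂ] 𝓢'(EuclideanSpace ℝ (Fin n), ℂ))) : Prop :=
  ∀ (a : 𝓢(TripleSpace n m, ℂ)) (f g : 𝓢(EuclideanSpace ℝ (Fin n), ℂ)),
    T (a : 𝓢'(TripleSpace n m, ℂ)) f g = fioPairing φ a f g

/-- `T` is continuous on `M^{∞,1}_{(ω)}` with respect to narrow convergence of sequences. -/
def IsNarrowlyContinuous {n m : ℕ} (χ : 𝓢(TripleSpace n m, ℂ))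
    (ω : TripleSpace n m × TripleSpace n m → ℝ)
    (T : 𝓢'(TripleSpace n m, ℂ) →
      (𝓢(EuclideanSpace ℝ (Fin n), ℂ) →L[ℂ] 𝓢'(EuclideanSpace ℝ (Fin n), ℂ))) : Prop :=
  ∀ (a : ℕ → 𝓢'(TripleSpace n m, ℂ)) (a₀ : 𝓢'(TripleSpace n m, ℂ)),
    NarrowTendsto χ ω ∞ 1 a a₀ → Tendsto (fun j => T (a j)) atTop (𝓝 (T a₀))

/-!
The proof works in phase space. Write `V_χ a (X, Ξ)` for the short-time Fourier transform of the
symbol. Localising all factors by windows whose product has nonzero mean (`exists_windows`,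
`exists_fioPairing_eq`) turns the pairing `⟨Op_φ(a) f, g⟩` into an absolutely convergent integral
over phase space of the short-time Fourier transforms of `a`, `f`, `g` and `e^{iφ}` (`fioForm`).
This formula makes sense for every `a` in `M^{∞,1}_{(ω)}`, and it defines the extension.

*The phase.* By Taylor's formula with integral remainder, `φ` near `X` is an affine function with
gradient `φ'(X)` plus a quadratic remainder whose coefficients are superpositions of characters with
`v`-weighted total mass at most a multiple of `‖φ''‖_{M^{∞,1}_{(v)}}`. Expanding the exponential of
the remainder into its power series bounds the short-time Fourier transform of `e^{iφ}` at `(X, Ξ)`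
by `h (Ξ - φ'(X))`, where `h` does not depend on `X` and its `v`-weighted integral is at most
`C exp (C ‖φ''‖)` (`exists_phase_bound`). Moderateness of `ω` and the hypothesis on
`ω₂ / ω₁` move the weights onto the three factors (`exists_weight_bound`).

*The operator.* The form is then dominated by a positive kernel operator between the weighted
transforms of `f` and `g` (`fioMajorant_le`), whose kernel `fioKernel` integrates an integrable
function of `Ξ - φ'(X)` over the variable `ζ` and its dual. The lower bound `d` on the determinant
enters through the maps `(y, ζ) ↦ (φ'_x, φ'_ζ)` at fixed `x` and `(x, ζ) ↦ (φ'_y, φ'_ζ)` at fixed `y`: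
their derivatives are bounded and have determinant at least `d` in absolute value, so that they are
globally injective (`injective_of_det_ge`, by a discretised path lifting argument), and a change of
variables costs the factor `d⁻¹` (`lintegral_comp_le_of_det_ge`). Hence both marginals of the kernel
are bounded by `d⁻¹` times the masses of `h` and of `H_{a,ω,∞}`, and Schur's test
gives the `L^p` bound (`lintegral_schur`, `FioSetting.lintegral_kernel_rpow_le`). The `M^p` norm of
the image is recovered by testing with time-frequency atoms (`exists_eLpNorm_wstft_le`).

*Continuity and uniqueness.* Narrow convergence dominates the transforms of the symbols in `L¹` of
the dual variable, which gives narrow continuity by dominated convergence. Uniqueness holds because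
Schwartz functions are narrowly dense in `M^{∞,1}_{(ω)}` (`exists_narrowTendsto`) and norm dense in
`M^p_{(ω₁)}` for `p < ∞` (`exists_seq_tendsto_modNorm`).
-/

set_option maxSynthPendingDepth 3

/-- Euclidean space indexed by a finite type. -/
local notation "ℰ" => EuclideanSpace ℝ

/-! ### Integrals of families of Schwartz functions -/

section SchwartzIntegral

variable {V : Type*} [NormedAddCommGroup V] [NormedSpace ℝ V]

/-- The norm on `𝓢(V, ℂ)` that is the supremum of all Schwartz seminorms of order at most `M`. -/
noncomputable def schwartzNorm (M : ℕ) : Seminorm ℂ 𝓢(V, ℂ) :=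
  (Finset.Iic (M, M)).sup (schwartzSeminormFamily ℂ V ℂ)

theorem seminorm_le_schwartzNorm {k l M : ℕ} (hk : k ≤ M) (hl : l ≤ M) (f : 𝓢(V, ℂ)) :
    SchwartzMap.seminorm ℂ k l f ≤ schwartzNorm M f := by
  have : schwartzSeminormFamily ℂ V ℂ (k, l) ≤ schwartzNorm M :=
    Finset.le_sup (f := schwartzSeminormFamily ℂ V ℂ) (Finset.mem_Iic.2 (Prod.mk_le_mk.2 ⟨hk, hl⟩))
  exact this f

theorem schwartzNorm_nonneg (M : ℕ) (f : 𝓢(V, ℂ)) : 0 ≤ schwartzNorm M f := apply_nonneg _ _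

theorem schwartzNorm_le_of_forall {M : ℕ} {f : 𝓢(V, ℂ)} {B : ℝ} (hB : 0 ≤ B)
    (h : ∀ k l, k ≤ M → l ≤ M → ∀ x, ‖x‖ ^ k * ‖iteratedFDeriv ℝ l f x‖ ≤ B) :
    schwartzNorm M f ≤ B := by
  refine Seminorm.finset_sup_apply_le hB fun i hi => ?_
  obtain ⟨h1, h2⟩ := Prod.mk_le_mk.1 (Finset.mem_Iic.1 hi)
  exact SchwartzMap.seminorm_le_bound ℂ _ _ _ hB (h _ _ h1 h2)

theorem one_add_pow_mul_iteratedFDeriv_le (M : ℕ) {k l : ℕ} (hk : k ≤ M) (hl : l ≤ M)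
    (f : 𝓢(V, ℂ)) (x : V) :
    (1 + ‖x‖) ^ k * ‖iteratedFDeriv ℝ l f x‖ ≤ 2 ^ M * schwartzNorm M f :=
  SchwartzMap.one_add_le_sup_seminorm_apply (𝕜 := ℂ) (m := (M, M)) hk hl f x

/-- A finite set of Schwartz seminorms is dominated by one `schwartzNorm`. -/
theorem exists_sup_le_schwartzNorm (s : Finset (ℕ × ℕ)) :
    ∃ M, s.sup (schwartzSeminormFamily ℂ V ℂ) ≤ schwartzNorm M := by
  refine ⟨s.sup (fun i => max i.1 i.2), Finset.sup_mono fun i hi => Finset.mem_Iic.2 ?_⟩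
  have := Finset.le_sup (f := fun i : ℕ × ℕ => max i.1 i.2) hi
  exact Prod.mk_le_mk.2 ⟨le_trans (le_max_left _ _) this, le_trans (le_max_right _ _) this⟩

theorem exists_norm_le_schwartzNorm {E : Type*} [NormedAddCommGroup E] [NormedSpace ℂ E]
    (u : 𝓢(V, ℂ) →L[ℂ] E) : ∃ (M : ℕ) (C : ℝ), 0 ≤ C ∧ ∀ f, ‖u f‖ ≤ C * schwartzNorm M f := by
  obtain ⟨s, C, hC, h⟩ := Seminorm.bound_of_continuous (schwartz_withSeminorms ℂ V ℂ)
    ((normSeminorm ℂ E).comp u.toLinearMap) (by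
      change Continuous fun f => ‖u f‖
      fun_prop)
  obtain ⟨M, hM⟩ := exists_sup_le_schwartzNorm (V := V) s
  refine ⟨M, C, C.2, fun f => (h f).trans ?_⟩
  exact mul_le_mul_of_nonneg_left (hM f) C.2

/-- `f ↦ D^l f(y)` as a continuous linear map on the Schwartz space. -/
noncomputable def iteratedFDerivAtCLM (l : ℕ) (y : V) : 𝓢(V, ℂ) →L[ℂ] (V [×l]→L[ℝ] ℂ) :=
  SchwartzMap.mkCLMtoNormedSpace (fun f => iteratedFDeriv ℝ l f y)
    (fun f g => by
      have := iteratedFDeriv_add_apply (i := l) (x := y) ((f.smooth l).contDiffAt)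
        ((g.smooth l).contDiffAt)
      simpa using this)
    (fun a f => by
      have := iteratedFDeriv_const_smul_apply (i := l) (x := y) (a := a) ((f.smooth l).contDiffAt)
      simpa using this)
    ⟨{(0, l)}, 1, zero_le_one, fun f => by
      simpa using SchwartzMap.norm_iteratedFDeriv_le_seminorm ℂ f l y⟩

theorem iteratedFDerivAtCLM_apply (l : ℕ) (y : V) (f : 𝓢(V, ℂ)) :
    iteratedFDerivAtCLM l y f = iteratedFDeriv ℝ l f y := rfl

/-- The bounded continuous function `y ↦ |y|^k D^l f(y)`, as a continuous linear map in `f`. -/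
noncomputable def weightedDerivCLM (k l : ℕ) :
    𝓢(V, ℂ) →L[ℂ] BoundedContinuousFunction V (V [×l]→L[ℝ] ℂ) :=
  SchwartzMap.mkCLMtoNormedSpace (fun f => BoundedContinuousFunction.ofNormedAddCommGroup
      (fun y => ((‖y‖ : ℂ) ^ k) • iteratedFDerivAtCLM l y f)
      ((by fun_prop : Continuous fun y : V => (‖y‖ : ℂ) ^ k).smul
        ((f.smooth l).continuous_iteratedFDeriv le_rfl))
      (SchwartzMap.seminorm ℂ k l f) (fun y => by
        rw [norm_smul, norm_pow, Complex.norm_real, norm_norm]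
        exact SchwartzMap.le_seminorm ℂ k l f y))
    (fun f g => by ext1 y; simp [smul_add])
    (fun a f => by ext1 y; simp [smul_comm a])
    ⟨{(k, l)}, 1, zero_le_one, fun f => by
      have := BoundedContinuousFunction.norm_ofNormedAddCommGroup_le
        (f := fun y => ((‖y‖ : ℂ) ^ k) • iteratedFDerivAtCLM l y f)
        ((by fun_prop : Continuous fun y : V => (‖y‖ : ℂ) ^ k).smul
          ((f.smooth l).continuous_iteratedFDeriv le_rfl)) (apply_nonneg (SchwartzMap.seminorm ℂ k l) f)
        (fun y => by
          rw [norm_smul, norm_pow, Complex.norm_real, norm_norm]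
          exact SchwartzMap.le_seminorm ℂ k l f y)
      simpa using this⟩

theorem weightedDerivCLM_apply (k l : ℕ) (f : 𝓢(V, ℂ)) (y : V) :
    weightedDerivCLM k l f y = ((‖y‖ : ℂ) ^ k) • iteratedFDeriv ℝ l f y := rfl

theorem norm_weightedDerivCLM (k l : ℕ) (f : 𝓢(V, ℂ)) :
    ‖weightedDerivCLM k l f‖ = SchwartzMap.seminorm ℂ k l f := by
  have key : ∀ x, ‖weightedDerivCLM k l f x‖ = ‖x‖ ^ k * ‖iteratedFDeriv ℝ l f x‖ := fun x => by
    rw [weightedDerivCLM_apply, norm_smul, norm_pow, Complex.norm_real, norm_norm]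
  refine le_antisymm ?_ ?_
  · refine (BoundedContinuousFunction.norm_le (apply_nonneg _ _)).2 fun x => ?_
    rw [key]
    exact SchwartzMap.le_seminorm ℂ k l f x
  · refine SchwartzMap.seminorm_le_bound ℂ _ _ _ 
      ((norm_nonneg _).trans ((weightedDerivCLM k l f).norm_coe_le_norm 0)) fun x => ?_
    rw [← key]
    exact (weightedDerivCLM k l f).norm_coe_le_norm x

/-- The Hahn-Banach theorem extends a functional on the Schwartz space, bounded by the norm
of a Banach space `E`, from the image of the Schwartz space to `E`. -/
theorem exists_factor_of_norm_le {E : Type*} [NormedAddCommGroup E] [NormedSpace ℂ E]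
    (J : 𝓢(V, ℂ) →L[ℂ] E) (u : 𝓢(V, ℂ) →L[ℂ] ℂ) {M : ℕ} {C : ℝ} (hC : 0 ≤ C)
    (h : ∀ f, ‖u f‖ ≤ C * schwartzNorm M f) (hJ : ∀ f, schwartzNorm M f ≤ ‖J f‖) :
    ∃ U : E →L[ℂ] ℂ, ∀ f, u f = U (J f) := by
  -- `J` dominates the sup norm, so it is injective and `u` descends to its range.
  have hinj : Function.Injective J.toLinearMap := by
    refine (LinearMap.ker_eq_bot (f := J.toLinearMap)).1 (LinearMap.ker_eq_bot'.2 ?_)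
    intro f hf
    have h0 : J f = 0 := hf
    have h1 := hJ f
    rw [h0, norm_zero] at h1
    ext x
    have h2 := (SchwartzMap.norm_le_seminorm ℂ f x).trans
      ((seminorm_le_schwartzNorm (Nat.zero_le M) (Nat.zero_le M) f).trans h1)
    simpa using h2
  let e := LinearEquiv.ofInjective J.toLinearMap hinj
  let U₀ : (LinearMap.range J.toLinearMap) →L[ℂ] ℂ :=
    LinearMap.mkContinuous (u.toLinearMap ∘ₗ e.symm.toLinearMap) C (fun w => by
      obtain ⟨f, rfl⟩ := e.surjective w
      have h2 : (u.toLinearMap ∘ₗ e.symm.toLinearMap) (e f) = u f := by simp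
      rw [h2]
      exact (h f).trans (mul_le_mul_of_nonneg_left (hJ f) hC))
  obtain ⟨U, hU, -⟩ := exists_extension_norm_eq _ U₀
  refine ⟨U, fun f => ?_⟩
  have h1 := hU (e f)
  have h2 : U₀ (e f) = u f := by simp [U₀]
  rw [← h2, ← h1]
  rfl

variable {Z : Type*} [TopologicalSpace Z] [SecondCountableTopology Z] [MeasurableSpace Z]
  [OpensMeasurableSpace Z]

/-- A weighted integral of a continuous family of Schwartz functions with integrable seminorms is
a Schwartz function. -/
theorem exists_schwartz_iteratedFDeriv_integral {μ : Measure Z} {F : Z → 𝓢(V, ℂ)}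
    (hF : Continuous F) {c : Z → ℂ} (hc : AEStronglyMeasurable c μ)
    (hint : ∀ M, Integrable (fun z => ‖c z‖ * schwartzNorm M (F z)) μ) :
    ∃ Ψ : 𝓢(V, ℂ), ∀ l y, iteratedFDeriv ℝ l Ψ y = ∫ z, c z • iteratedFDeriv ℝ l (F z) y ∂μ := by
  have hmeas : ∀ l y, AEStronglyMeasurable (fun z => c z • iteratedFDeriv ℝ l (F z) y) μ :=
    fun l y => hc.smul ((iteratedFDerivAtCLM l y).continuous.comp hF).aestronglyMeasurable
  have hbd : ∀ l k M, k ≤ M → l ≤ M → ∀ z y,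
      ‖y‖ ^ k * ‖c z • iteratedFDeriv ℝ l (F z) y‖ ≤ ‖c z‖ * schwartzNorm M (F z) := by
    intro l k M hk hl z y
    rw [norm_smul, mul_left_comm]
    gcongr
    exact (SchwartzMap.le_seminorm ℂ k l (F z) y).trans (seminorm_le_schwartzNorm hk hl _)
  have hbd0 : ∀ l z y, ‖c z • iteratedFDeriv ℝ l (F z) y‖ ≤ ‖c z‖ * schwartzNorm l (F z) := by
    intro l z y
    simpa using hbd l 0 l (Nat.zero_le _) le_rfl z y
  have hInt : ∀ l y, Integrable (fun z => c z • iteratedFDeriv ℝ l (F z) y) μ := fun l y =>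
    (hint l).mono' (hmeas l y) (ae_of_all _ fun z => hbd0 l z y)
  -- The isometry which identifies `D^{l+1}` with the derivative of `D^l`.
  let cu : ∀ l : ℕ, (V [×(l + 1)]→L[ℝ] ℂ) ≃ₗᵢ[ℝ] (V →L[ℝ] (V [×l]→L[ℝ] ℂ)) := fun l =>
    continuousMultilinearCurryLeftEquiv ℝ (fun _ : Fin (l + 1) => V) ℂ
  -- Differentiation under the integral sign; induction on `l` then gives all derivatives.
  have hder : ∀ l y, HasFDerivAt (fun y => ∫ z, c z • iteratedFDeriv ℝ l (F z) y ∂μ)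
      (∫ z, cu l (c z • iteratedFDeriv ℝ (l + 1) (F z) y) ∂μ) y := by
    intro l y
    refine hasFDerivAt_integral_of_dominated_of_fderiv_le (s := Set.univ) Filter.univ_mem
      (bound := fun z => ‖c z‖ * schwartzNorm (l + 1) (F z))
      (F' := fun y z => cu l (c z • iteratedFDeriv ℝ (l + 1) (F z) y))
      (Eventually.of_forall fun y => hmeas l y) (hInt l y)
      ((cu l).continuous.comp_aestronglyMeasurable (hmeas (l + 1) y))
      (ae_of_all _ fun z y _ => ?_) (hint _) (ae_of_all _ fun z y _ => ?_)
    · rw [LinearIsometryEquiv.norm_map]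
      exact hbd0 (l + 1) z y
    · have h2 : ContDiff ℝ 1 (iteratedFDeriv ℝ l (F z)) :=
        ((F z).smooth (l + 1 : ℕ)).iteratedFDeriv_right (m := 1) (by push_cast; rw [add_comm])
      have h3 := ((h2.differentiable one_ne_zero y).hasFDerivAt).const_smul (c z)
      have h4 : cu l (c z • iteratedFDeriv ℝ (l + 1) (F z) y) =
          c z • fderiv ℝ (iteratedFDeriv ℝ l (F z)) y := by
        rw [iteratedFDeriv_succ_eq_comp_left]
        ext v w
        simp [cu]
      rw [h4]
      exact h3
  have hiter : ∀ l y, iteratedFDeriv ℝ l (fun y => ∫ z, c z • F z y ∂μ) y =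
      ∫ z, c z • iteratedFDeriv ℝ l (F z) y ∂μ := by
    intro l
    induction l with
    | zero =>
      intro y
      ext v
      rw [iteratedFDeriv_zero_apply, ContinuousMultilinearMap.integral_apply (hInt 0 y)]
      simp
    | succ l ih =>
      intro y
      have hcu : Integrable (fun z => cu l (c z • iteratedFDeriv ℝ (l + 1) (F z) y)) μ :=
        (hint (l + 1)).mono' ((cu l).continuous.comp_aestronglyMeasurable (hmeas (l + 1) y))
          (ae_of_all _ fun z => by rw [LinearIsometryEquiv.norm_map]; exact hbd0 (l + 1) z y)
      ext v
      rw [iteratedFDeriv_succ_apply_left, funext ih, (hder l y).fderiv,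
        ContinuousMultilinearMap.integral_apply (hInt (l + 1) y),
        ContinuousLinearMap.integral_apply hcu, ContinuousMultilinearMap.integral_apply]
      · refine integral_congr_ae (ae_of_all _ fun z => ?_)
        simp [cu]
      · exact (ContinuousLinearMap.apply ℝ (V [×l]→L[ℝ] ℂ) (v 0)).integrable_comp hcu
  have hsm : ContDiff ℝ ((⊤ : ℕ∞) : WithTop ℕ∞) (fun y => ∫ z, c z • F z y ∂μ) := by
    refine contDiff_of_differentiable_iteratedFDeriv fun l _ => ?_
    rw [funext (hiter l)]
    exact fun y => (hder l y).differentiableAt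
  refine ⟨{ toFun := fun y => ∫ z, c z • F z y ∂μ
            smooth' := hsm
            decay' := fun k l => ⟨∫ z, ‖c z‖ * schwartzNorm (max k l) (F z) ∂μ, fun y => ?_⟩ },
    hiter⟩
  rw [hiter]
  calc ‖y‖ ^ k * ‖∫ z, c z • iteratedFDeriv ℝ l (F z) y ∂μ‖
      ≤ ‖y‖ ^ k * ∫ z, ‖c z • iteratedFDeriv ℝ l (F z) y‖ ∂μ := by
        gcongr; exact norm_integral_le_integral_norm _
    _ = ∫ z, ‖y‖ ^ k * ‖c z • iteratedFDeriv ℝ l (F z) y‖ ∂μ := (integral_const_mul _ _).symm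
    _ ≤ _ := integral_mono ((hInt l y).norm.const_mul _) (hint _)
        fun z => hbd l k _ (le_max_left _ _) (le_max_right _ _) z y

/-- Tempered distributions commute with weighted integrals of continuous families of Schwartz
functions. -/
theorem exists_schwartz_integral {μ : Measure Z} {F : Z → 𝓢(V, ℂ)} (hF : Continuous F)
    {c : Z → ℂ} (hc : AEStronglyMeasurable c μ)
    (hint : ∀ M, Integrable (fun z => ‖c z‖ * schwartzNorm M (F z)) μ) :
    ∃ Ψ : 𝓢(V, ℂ), ∀ u : 𝓢(V, ℂ) →L[ℂ] ℂ,
      Integrable (fun z => c z * u (F z)) μ ∧ u Ψ = ∫ z, c z * u (F z) ∂μ := by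
  obtain ⟨Ψ, hΨ⟩ := exists_schwartz_iteratedFDeriv_integral hF hc hint
  refine ⟨Ψ, fun u => ?_⟩
  obtain ⟨M, C, hC, h⟩ := exists_norm_le_schwartzNorm u
  -- A bound of `u` by finitely many weighted sup norms lets `u` factor through a Banach space, where
  -- continuous functionals commute with Bochner integrals.
  let s : Finset (ℕ × ℕ) := Finset.Iic (M, M)
  let J : 𝓢(V, ℂ) →L[ℂ] ((i : s) → BoundedContinuousFunction V (V [×i.1.2]→L[ℝ] ℂ)) :=
    ContinuousLinearMap.pi fun i => weightedDerivCLM i.1.1 i.1.2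
  have hJn : ∀ f, schwartzNorm M f ≤ ‖J f‖ := fun f => by
    refine Seminorm.finset_sup_apply_le (norm_nonneg _) fun i hi => ?_
    exact (norm_weightedDerivCLM i.1 i.2 f).symm.le.trans (norm_le_pi_norm (J f) ⟨i, hi⟩)
  obtain ⟨U, hU⟩ := exists_factor_of_norm_le
    (E := (i : s) → BoundedContinuousFunction V (V [×i.1.2]→L[ℝ] ℂ)) J u hC h hJn
  have hJi : ∀ i : s, Integrable (fun z => c z • weightedDerivCLM i.1.1 i.1.2 (F z)) μ := by
    intro i
    refine (hint (max i.1.1 i.1.2)).mono'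
      (hc.smul ((weightedDerivCLM _ _).continuous.comp hF).aestronglyMeasurable)
      (ae_of_all _ fun z => ?_)
    refine (norm_smul_le _ _).trans ?_
    gcongr
    exact (norm_weightedDerivCLM _ _ _).le.trans
      (seminorm_le_schwartzNorm (le_max_left _ _) (le_max_right _ _) _)
  have hJ : Integrable (fun z => c z • J (F z)) μ := Integrable.of_eval hJi
  have hJΨ : J Ψ = ∫ z, c z • J (F z) ∂μ := by
    funext i
    refine Eq.trans ?_ (eval_integral (f := fun z i => c z • weightedDerivCLM i.1.1 i.1.2 (F z))
      hJi i).symm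
    ext1 y
    let ev : BoundedContinuousFunction V (V [×i.1.2]→L[ℝ] ℂ) →L[ℝ] (V [×i.1.2]→L[ℝ] ℂ) :=
      BoundedContinuousFunction.evalCLM ℝ y
    change (‖y‖ : ℂ) ^ i.1.1 • iteratedFDeriv ℝ i.1.2 Ψ y =
      ev (∫ z, c z • weightedDerivCLM i.1.1 i.1.2 (F z) ∂μ)
    rw [← ev.integral_comp_comm (hJi i), hΨ, ← integral_smul]
    refine integral_congr_ae (ae_of_all _ fun z => ?_)
    exact smul_comm _ _ _
  have h2 := U.integrable_comp hJ
  have h3 := U.integral_comp_comm hJ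
  have h4 : ∀ z, U (c z • J (F z)) = c z * u (F z) := fun z => by
    rw [map_smul, ← hU, smul_eq_mul]
  simp only [h4] at h2 h3
  exact ⟨h2, by rw [hU, hJΨ, h3]⟩

end SchwartzIntegral

/-! ### The Fourier transform without normalisation -/

section Character

variable {V : Type*} [NormedAddCommGroup V] [InnerProductSpace ℝ V]

/-- The character `e^{-i⟨y, ξ⟩}`. -/
noncomputable def chr (y ξ : V) : ℂ := Complex.exp (-Complex.I * ((inner ℝ y ξ : ℝ) : ℂ))

theorem norm_chr (y ξ : V) : ‖chr y ξ‖ = 1 := by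
  rw [chr, show -Complex.I * ((inner ℝ y ξ : ℝ) : ℂ) = ((-inner ℝ y ξ : ℝ) : ℂ) * Complex.I by
    push_cast; ring]
  exact Complex.norm_exp_ofReal_mul_I _

theorem chr_add_right (y ξ η : V) : chr y (ξ + η) = chr y ξ * chr y η := by
  rw [chr, chr, chr, ← Complex.exp_add, inner_add_right]
  push_cast; ring_nf

theorem chr_add_left (x y ξ : V) : chr (x + y) ξ = chr x ξ * chr y ξ := by
  rw [chr, chr, chr, ← Complex.exp_add, inner_add_left]
  push_cast; ring_nf

@[simp] theorem chr_zero_right (y : V) : chr y 0 = 1 := by simp [chr]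

@[simp] theorem chr_zero_left (y : V) : chr 0 y = 1 := by simp [chr]

theorem chr_smul_left (t : ℝ) (y ξ : V) : chr (t • y) ξ = chr y (t • ξ) := by
  simp [chr, inner_smul_left, inner_smul_right]

theorem continuous_chr : Continuous fun p : V × V => chr p.1 p.2 := by
  unfold chr
  fun_prop

@[fun_prop]
theorem Continuous.chr {X : Type*} [TopologicalSpace X] {f g : X → V} (hf : Continuous f)
    (hg : Continuous g) : Continuous fun x => chr (f x) (g x) :=
  continuous_chr.comp (hf.prodMk hg)

end Character

section Bracket

variable {V : Type*} [NormedAddCommGroup V]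

/-- The decay function `(1 + |x|)^{-M}`. -/
noncomputable def decayFn (M : ℕ) (x : V) : ℝ := ((1 + ‖x‖) ^ M)⁻¹

theorem decayFn_pos (M : ℕ) (x : V) : 0 < decayFn M x := by unfold decayFn; positivity

theorem decayFn_nonneg (M : ℕ) (x : V) : 0 ≤ decayFn M x := (decayFn_pos M x).le

theorem decayFn_le_one (M : ℕ) (x : V) : decayFn M x ≤ 1 :=
  inv_le_one_of_one_le₀ (one_le_pow₀ (by linarith [norm_nonneg x]))

theorem decayFn_anti {M N : ℕ} (h : M ≤ N) (x : V) : decayFn N x ≤ decayFn M x := by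
  unfold decayFn
  gcongr
  linarith [norm_nonneg x]

@[fun_prop]
theorem continuous_decayFn (M : ℕ) : Continuous (decayFn M : V → ℝ) := by
  unfold decayFn
  exact Continuous.inv₀ (by fun_prop) fun x => by positivity

theorem decayFn_neg (M : ℕ) (x : V) : decayFn M (-x) = decayFn M x := by simp [decayFn]

theorem pow_mul_decayFn_add (k M : ℕ) (x : V) : (1 + ‖x‖) ^ k * decayFn (k + M) x = decayFn M x := by
  unfold decayFn
  rw [pow_add]
  field_simp

theorem one_add_norm_add_le (x y : V) : 1 + ‖x + y‖ ≤ (1 + ‖x‖) * (1 + ‖y‖) := by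
  nlinarith [norm_add_le x y, norm_nonneg x, norm_nonneg y, mul_nonneg (norm_nonneg x) (norm_nonneg y)]

theorem le_decayFn_iff {M : ℕ} {x : V} {a B : ℝ} :
    a ≤ B * decayFn M x ↔ (1 + ‖x‖) ^ M * a ≤ B := by
  rw [decayFn, ← div_eq_mul_inv, le_div_iff₀ (by positivity), mul_comm]

theorem decayFn_sub_le (M : ℕ) (x y : V) :
    decayFn M (x - y) ≤ (1 + ‖y‖) ^ M * decayFn M x := by
  rw [le_decayFn_iff, decayFn, ← div_eq_mul_inv, div_le_iff₀ (by positivity), ← mul_pow]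
  gcongr
  have := one_add_norm_add_le y (x - y)
  rwa [add_sub_cancel] at this

variable [NormedSpace ℝ V] [FiniteDimensional ℝ V] [MeasurableSpace V] [BorelSpace V]

theorem integrable_decayFn {M : ℕ} (hM : Module.finrank ℝ V < M) (μ : Measure V)
    [μ.IsAddHaarMeasure] : Integrable (decayFn M) μ := by
  have := integrable_one_add_norm (E := V) (μ := μ) (r := M) (by exact_mod_cast hM)
  refine this.congr (ae_of_all _ fun x => ?_)
  simp only [decayFn]
  rw [Real.rpow_neg (by positivity), Real.rpow_natCast]

end Bracket

section Hat

variable {V : Type*} [NormedAddCommGroup V] [InnerProductSpace ℝ V] [FiniteDimensional ℝ V]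
  [MeasurableSpace V] [BorelSpace V]

/-- The Fourier transform `∫ u(y) e^{-i⟨y, ξ⟩} dy`. -/
noncomputable def hatF (u : V → ℂ) (ξ : V) : ℂ := ∫ y, chr y ξ * u y

theorem hatF_eq_fourier (u : V → ℂ) (ξ : V) :
    hatF u ξ = FourierTransform.fourier u ((2 * Real.pi)⁻¹ • ξ) := by
  rw [Real.fourier_eq', hatF]
  refine integral_congr_ae (ae_of_all _ fun y => ?_)
  simp only [chr, smul_eq_mul]
  congr 2
  rw [inner_smul_right]
  push_cast
  field_simp

theorem integrable_chr_mul {u : V → ℂ} (hu : Integrable u) (ξ : V) :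
    Integrable fun y => chr y ξ * u y := by
  refine hu.bdd_mul (c := 1) ?_ (ae_of_all _ fun y => (norm_chr y ξ).le)
  exact (by fun_prop : Continuous fun y => chr y ξ).aestronglyMeasurable

theorem continuous_hatF {u : V → ℂ} (hu : Integrable u) : Continuous (hatF u) := by
  refine continuous_of_dominated (bound := fun y => ‖u y‖)
    (fun ξ => (integrable_chr_mul hu ξ).aestronglyMeasurable)
    (fun ξ => ae_of_all _ fun y => by simp [norm_chr]) hu.norm
    (ae_of_all _ fun y => by fun_prop)

/-- Fourier inversion. -/
theorem hatF_inversion {u : V → ℂ} (hc : Continuous u) (hu : Integrable u)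
    (hu' : Integrable (hatF u)) (y : V) :
    ∫ ξ, chr y (-ξ) * hatF u ξ = (2 * Real.pi : ℂ) ^ (Module.finrank ℝ V) * u y := by
  have hpi : (2 * Real.pi) ≠ 0 := by positivity
  have h1 : Integrable (FourierTransform.fourier u) := by
    have := hu'.comp_smul (R := 2 * Real.pi) hpi
    refine this.congr (ae_of_all _ fun ξ => ?_)
    simp only [hatF_eq_fourier, smul_smul]
    rw [inv_mul_cancel₀ hpi, one_smul]
  have h2 := congrFun (hc.fourierInv_fourier_eq hu h1) y
  rw [Real.fourierInv_eq'] at h2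
  rw [← h2]
  have h3 := Measure.integral_comp_smul (volume : Measure V)
    (fun ξ => chr y (-ξ) * hatF u ξ) (2 * Real.pi)
  rw [abs_of_pos (by positivity)] at h3
  have h4 : ∀ ξ : V, chr y (-((2 * Real.pi) • ξ)) * hatF u ((2 * Real.pi) • ξ) =
      Complex.exp (((2 * Real.pi * inner ℝ ξ y : ℝ) : ℂ) * Complex.I) • FourierTransform.fourier u ξ := by
    intro ξ
    rw [hatF_eq_fourier, smul_smul, inv_mul_cancel₀ hpi, one_smul, chr, smul_eq_mul]
    congr 2
    rw [inner_neg_right, inner_smul_right, real_inner_comm]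
    push_cast
    ring
  simp only [h4] at h3
  rw [h3, Complex.real_smul, ← mul_assoc]
  push_cast
  rw [mul_inv_cancel₀ (pow_ne_zero _ (by exact_mod_cast hpi)), one_mul]

/-- The Fourier transform of a Schwartz function decays rapidly, uniformly on bounded sets. -/
theorem exists_hatF_decay (M : ℕ) : ∃ (M' : ℕ) (C : ℝ), 0 ≤ C ∧ ∀ (s : 𝓢(V, ℂ)) (ξ : V),
    ‖hatF s ξ‖ ≤ C * schwartzNorm M' s * decayFn M ξ := by
  obtain ⟨M', C, hC, h⟩ := exists_norm_le_schwartzNorm (V := V)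
    ((weightedDerivCLM (V := V) 0 0).comp (SchwartzMap.fourierTransformCLM ℂ))
  obtain ⟨M'', C', hC', h'⟩ := exists_norm_le_schwartzNorm (V := V)
    ((weightedDerivCLM (V := V) M 0).comp (SchwartzMap.fourierTransformCLM ℂ))
  refine ⟨max M' M'', 14 ^ M * (C + C'), by positivity, fun s ξ => ?_⟩
  rw [le_decayFn_iff, hatF_eq_fourier]
  set η := (2 * Real.pi)⁻¹ • ξ with hη
  have hmono : ∀ a b : ℕ, a ≤ b → schwartzNorm a s ≤ schwartzNorm b s := fun a b hab =>
    schwartzNorm_le_of_forall (schwartzNorm_nonneg _ _) fun k l hk hl x =>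
      (SchwartzMap.le_seminorm ℂ k l s x).trans (seminorm_le_schwartzNorm (hk.trans hab) (hl.trans hab) s)
  have e0 : ‖FourierTransform.fourier (s : V → ℂ) η‖ ≤ C * schwartzNorm (max M' M'') s := by
    have := (h s).trans (mul_le_mul_of_nonneg_left (hmono _ _ (le_max_left M' M'')) hC)
    refine le_trans ?_ this
    simp only [ContinuousLinearMap.comp_apply]
    rw [norm_weightedDerivCLM]
    exact SchwartzMap.norm_le_seminorm ℂ (FourierTransform.fourier s) η
  have e1 : ‖η‖ ^ M * ‖FourierTransform.fourier (s : V → ℂ) η‖ ≤ C' * schwartzNorm (max M' M'') s := by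
    have := (h' s).trans (mul_le_mul_of_nonneg_left (hmono _ _ (le_max_right M' M'')) hC')
    refine le_trans ?_ this
    simp only [ContinuousLinearMap.comp_apply]
    rw [norm_weightedDerivCLM]
    exact SchwartzMap.norm_pow_mul_le_seminorm ℂ (FourierTransform.fourier s) M η
  -- The two normalizations differ by the dilation `ξ = 2π η`, and `2π < 7`.
  have hξ : 1 + ‖ξ‖ ≤ 7 * (1 + ‖η‖) := by
    rw [hη, norm_smul, Real.norm_of_nonneg (by positivity)]
    have : ‖ξ‖ = (2 * Real.pi) * ((2 * Real.pi)⁻¹ * ‖ξ‖) := by field_simp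
    nlinarith [Real.pi_lt_d2, norm_nonneg ξ, Real.pi_pos,
      mul_nonneg (by positivity : 0 ≤ (2 * Real.pi)⁻¹) (norm_nonneg ξ)]
  have h2 : (1 + ‖η‖) ^ M ≤ 2 ^ M * (1 + ‖η‖ ^ M) := by
    refine (add_pow_le zero_le_one (norm_nonneg η) M).trans ?_
    rw [one_pow]
    gcongr
    · norm_num
    · omega
  calc (1 + ‖ξ‖) ^ M * ‖FourierTransform.fourier (s : V → ℂ) η‖
      ≤ (7 * (1 + ‖η‖)) ^ M * ‖FourierTransform.fourier (s : V → ℂ) η‖ := by gcongr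
    _ ≤ 7 ^ M * (2 ^ M * (1 + ‖η‖ ^ M)) * ‖FourierTransform.fourier (s : V → ℂ) η‖ := by
        rw [mul_pow]; gcongr
    _ = 14 ^ M * (‖FourierTransform.fourier (s : V → ℂ) η‖ +
          ‖η‖ ^ M * ‖FourierTransform.fourier (s : V → ℂ) η‖) := by
        rw [show (14 : ℝ) = 7 * 2 by norm_num, mul_pow]; ring
    _ ≤ 14 ^ M * (C * schwartzNorm (max M' M'') s + C' * schwartzNorm (max M' M'') s) := by gcongr
    _ = _ := by ring

theorem integrable_hatF (s : 𝓢(V, ℂ)) : Integrable (hatF s) := by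
  obtain ⟨M', C, hC, h⟩ := exists_hatF_decay (V := V) (Module.finrank ℝ V + 1)
  exact ((integrable_decayFn (Nat.lt_succ_self _) volume).const_mul _).mono'
    (continuous_hatF s.integrable).aestronglyMeasurable (ae_of_all _ (h s))

end Hat

section Product

variable {V : Type*} [NormedAddCommGroup V] [NormedSpace ℝ V]

theorem norm_iteratedFDeriv_affine_le (γ : 𝓢(V, ℂ)) (t : ℝ) (w x : V) (l : ℕ) :
    ‖iteratedFDeriv ℝ l (fun y => γ (t • y - w)) x‖ ≤ |t| ^ l * ‖iteratedFDeriv ℝ l γ (t • x - w)‖ := by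
  have h1 : (fun y => γ (t • y - w)) = (fun y => γ (y - w)) ∘ (t • ContinuousLinearMap.id ℝ V) := by
    ext; simp
  have hs : ContDiff ℝ l (fun y => γ (y - w)) := (γ.smooth l).comp (contDiff_id.sub contDiff_const)
  rw [h1, ContinuousLinearMap.iteratedFDeriv_comp_right _ hs _ le_rfl]
  refine (ContinuousMultilinearMap.norm_compContinuousLinearMap_le _ _).trans ?_
  rw [mul_comm]
  gcongr
  · rw [Finset.prod_const, Finset.card_univ, Fintype.card_fin]
    gcongr
    refine (norm_smul_le _ _).trans ?_
    rw [Real.norm_eq_abs]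
    exact mul_le_of_le_one_right (abs_nonneg _) ContinuousLinearMap.norm_id_le
  · rw [iteratedFDeriv_comp_sub]
    simp

/-- The Schwartz function `y ↦ s(y) γ(t y - w)`. -/
noncomputable def prodFam (s γ : 𝓢(V, ℂ)) (t : ℝ) (w : V) : 𝓢(V, ℂ) :=
  SchwartzMap.smulLeftCLM ℂ (fun y => γ (t • y - w)) s

theorem prodFam_apply (s γ : 𝓢(V, ℂ)) (t : ℝ) (w y : V) :
    prodFam s γ t w y = s y * γ (t • y - w) := by
  have h : Function.HasTemperateGrowth (fun y => γ (t • y - w)) :=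
    (γ.hasTemperateGrowth).comp (by fun_prop)
  rw [prodFam, SchwartzMap.smulLeftCLM_apply_apply h, smul_eq_mul, mul_comm]

/-- The Schwartz norms of `y ↦ s(y) γ(t y - w)` decay rapidly in `w`, uniformly in `t ∈ [0, 1]`. -/
theorem exists_schwartzNorm_prodFam_le (γ : 𝓢(V, ℂ)) (M N : ℕ) : ∃ C : ℝ, 0 ≤ C ∧
    ∀ (s : 𝓢(V, ℂ)) (t : ℝ) (_ : t ∈ Set.Icc (0 : ℝ) 1) (w : V),
      schwartzNorm M (prodFam s γ t w) ≤ C * schwartzNorm (M + N) s * decayFn N w := by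
  refine ⟨2 ^ M * (2 ^ (M + N) * schwartzNorm (M + N) γ) * 2 ^ (M + N),
    by have := schwartzNorm_nonneg (M + N) γ; positivity, fun s t ht w => ?_⟩
  have hγ0 := schwartzNorm_nonneg (M + N) γ
  have hs0 := schwartzNorm_nonneg (M + N) s
  refine schwartzNorm_le_of_forall (by have := decayFn_nonneg N w; positivity) fun k l hk hl x => ?_
  rw [le_decayFn_iff]
  have h0 : ((prodFam s γ t w : 𝓢(V, ℂ)) : V → ℂ) = fun y => s y * γ (t • y - w) :=
    funext fun y => prodFam_apply s γ t w y
  have hγs : ContDiff ℝ l (fun y => γ (t • y - w)) :=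
    (γ.smooth l).comp ((contDiff_id.const_smul t).sub contDiff_const)
  rw [h0]
  have h1 := norm_iteratedFDeriv_mul_le (s.smooth l) hγs x le_rfl
  have hterm : ∀ i ∈ Finset.range (l + 1), (1 + ‖w‖) ^ N * (‖x‖ ^ k *
      ((l.choose i : ℝ) * ‖iteratedFDeriv ℝ i s x‖ *
        ‖iteratedFDeriv ℝ (l - i) (fun y => γ (t • y - w)) x‖)) ≤
      (l.choose i : ℝ) * ((2 ^ (M + N) * schwartzNorm (M + N) γ) *
        (2 ^ (M + N) * schwartzNorm (M + N) s)) := by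
    intro i hi
    have hi' : i ≤ l := by simpa [Nat.lt_succ_iff] using hi
    have e1 := one_add_pow_mul_iteratedFDeriv_le (M + N) (k := M + N) (l := i) le_rfl (by omega) s x
    have e2 := one_add_pow_mul_iteratedFDeriv_le (M + N) (k := N) (l := l - i) (by omega) (by omega)
      γ (t • x - w)
    have e3 : ‖iteratedFDeriv ℝ (l - i) (fun y => γ (t • y - w)) x‖ ≤
        ‖iteratedFDeriv ℝ (l - i) γ (t • x - w)‖ := by
      refine (norm_iteratedFDeriv_affine_le γ t w x (l - i)).trans ?_
      refine mul_le_of_le_one_left (norm_nonneg _) (pow_le_one₀ (abs_nonneg _) ?_)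
      rw [abs_of_nonneg ht.1]; exact ht.2
    -- Since `w = t x - (t x - w)`, the decay in `w` is paid for by the decay of `s` and of `γ`.
    have e4 : 1 + ‖w‖ ≤ (1 + ‖x‖) * (1 + ‖t • x - w‖) := by
      have := one_add_norm_add_le (t • x) (-(t • x - w))
      rw [norm_neg, show t • x + -(t • x - w) = w by abel] at this
      refine this.trans ?_
      gcongr
      rw [norm_smul, Real.norm_of_nonneg ht.1]
      exact mul_le_of_le_one_left (norm_nonneg _) ht.2
    have e5 : ‖x‖ ^ k ≤ (1 + ‖x‖) ^ M :=
      (pow_le_pow_left₀ (norm_nonneg _) (by linarith) k).trans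
        (pow_le_pow_right₀ (by linarith [norm_nonneg x]) hk)
    calc (1 + ‖w‖) ^ N * (‖x‖ ^ k * ((l.choose i : ℝ) * ‖iteratedFDeriv ℝ i s x‖ *
          ‖iteratedFDeriv ℝ (l - i) (fun y => γ (t • y - w)) x‖))
        ≤ ((1 + ‖x‖) * (1 + ‖t • x - w‖)) ^ N * ((1 + ‖x‖) ^ M * ((l.choose i : ℝ) *
            ‖iteratedFDeriv ℝ i s x‖ * ‖iteratedFDeriv ℝ (l - i) γ (t • x - w)‖)) := by
          gcongr
      _ = (l.choose i : ℝ) * (((1 + ‖t • x - w‖) ^ N * ‖iteratedFDeriv ℝ (l - i) γ (t • x - w)‖) *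
            ((1 + ‖x‖) ^ (M + N) * ‖iteratedFDeriv ℝ i s x‖)) := by
          rw [mul_pow, pow_add]; ring
      _ ≤ _ := by gcongr
  calc (1 + ‖w‖) ^ N * (‖x‖ ^ k * ‖iteratedFDeriv ℝ l (fun y => s y * γ (t • y - w)) x‖)
      ≤ (1 + ‖w‖) ^ N * (‖x‖ ^ k * ∑ i ∈ Finset.range (l + 1), (l.choose i : ℝ) *
          ‖iteratedFDeriv ℝ i s x‖ * ‖iteratedFDeriv ℝ (l - i) (fun y => γ (t • y - w)) x‖) := by
        gcongr
    _ = ∑ i ∈ Finset.range (l + 1), (1 + ‖w‖) ^ N * (‖x‖ ^ k * ((l.choose i : ℝ) *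
          ‖iteratedFDeriv ℝ i s x‖ *
          ‖iteratedFDeriv ℝ (l - i) (fun y => γ (t • y - w)) x‖)) := by
        rw [Finset.mul_sum, Finset.mul_sum]
    _ ≤ ∑ i ∈ Finset.range (l + 1), (l.choose i : ℝ) * ((2 ^ (M + N) * schwartzNorm (M + N) γ) *
        (2 ^ (M + N) * schwartzNorm (M + N) s)) := Finset.sum_le_sum hterm
    _ = 2 ^ l * ((2 ^ (M + N) * schwartzNorm (M + N) γ) *
        (2 ^ (M + N) * schwartzNorm (M + N) s)) := by
        rw [← Finset.sum_mul]
        congr 1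
        exact_mod_cast Nat.sum_range_choose l
    _ ≤ 2 ^ M * ((2 ^ (M + N) * schwartzNorm (M + N) γ) *
        (2 ^ (M + N) * schwartzNorm (M + N) s)) := by
        gcongr
        norm_num
    _ = _ := by ring

end Product

section ProductHat

variable {V : Type*} [NormedAddCommGroup V] [InnerProductSpace ℝ V] [FiniteDimensional ℝ V]
  [MeasurableSpace V] [BorelSpace V]

/-- The short-time Fourier transform of a Schwartz function decays rapidly in both variables. -/
theorem exists_hatF_prodFam_le (γ : 𝓢(V, ℂ)) (M : ℕ) : ∃ (M' : ℕ) (C : ℝ), 0 ≤ C ∧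
    ∀ (s : 𝓢(V, ℂ)) (t : ℝ) (_ : t ∈ Set.Icc (0 : ℝ) 1) (w ξ : V),
      ‖hatF (prodFam s γ t w) ξ‖ ≤ C * schwartzNorm M' s * (decayFn M w * decayFn M ξ) := by
  obtain ⟨M', C, hC, h⟩ := exists_hatF_decay (V := V) M
  obtain ⟨C', hC', h'⟩ := exists_schwartzNorm_prodFam_le γ M' M
  refine ⟨M' + M, C * C', by positivity, fun s t ht w ξ => (h _ _).trans ?_⟩
  calc C * schwartzNorm M' (prodFam s γ t w) * decayFn M ξ
      ≤ C * (C' * schwartzNorm (M' + M) s * decayFn M w) * decayFn M ξ := by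
        have := decayFn_nonneg M ξ
        gcongr
        exact h' s t ht w
    _ = _ := by ring

end ProductHat

/-! ### Continuous families of Schwartz functions and time-frequency atoms -/

section Families

variable {V : Type*} [NormedAddCommGroup V] [NormedSpace ℝ V]

/-- A family of Schwartz functions with jointly continuous derivatives and locally bounded
seminorms is continuous: the decay at infinity reduces uniform convergence to compact sets. -/
theorem continuous_schwartz_of_jointly [ProperSpace V] {Z : Type*} [TopologicalSpace Z]
    {F : Z → 𝓢(V, ℂ)}
    (hcont : ∀ l : ℕ, Continuous fun p : Z × V => iteratedFDeriv ℝ l (F p.1) p.2)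
    (hloc : ∀ (M : ℕ) (z₀ : Z), ∃ C : ℝ, ∀ᶠ z in 𝓝 z₀, schwartzNorm M (F z) ≤ C) :
    Continuous F := by
  refine continuous_iff_continuousAt.2 fun z₀ => ?_
  refine ((schwartz_withSeminorms ℂ V ℂ).tendsto_nhds _ _).2 fun i ε hε => ?_
  obtain ⟨k, l⟩ := i
  obtain ⟨C, hC⟩ := hloc (max (k + 1) l) z₀
  have hC0 : 0 ≤ C := (schwartzNorm_nonneg _ _).trans hC.self_of_nhds
  -- Outside the ball of radius `R` one more power of `|x|` leaves at most `ε / 4` for each of the two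
  -- functions.
  set R : ℝ := 4 * (C + 1) / ε with hR
  have hRpos : 0 < R := by positivity
  have hsub : ∀ z x, iteratedFDeriv ℝ l ((F z - F z₀ : 𝓢(V, ℂ)) : V → ℂ) x =
      iteratedFDeriv ℝ l (F z) x - iteratedFDeriv ℝ l (F z₀) x := fun z x => by
    have := (iteratedFDerivAtCLM l x).map_sub (F z) (F z₀)
    simpa only [iteratedFDerivAtCLM_apply] using this
  have hcomp : ∀ᶠ z in 𝓝 z₀, ∀ x ∈ Metric.closedBall (0 : V) R,
      ‖x‖ ^ k * ‖iteratedFDeriv ℝ l (F z) x - iteratedFDeriv ℝ l (F z₀) x‖ < ε / 2 := by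
    refine (isCompact_closedBall (0 : V) R).eventually_forall_of_forall_eventually fun x _ => ?_
    have hc : Continuous fun p : Z × V => ‖p.2‖ ^ k *
        ‖iteratedFDeriv ℝ l (F p.1) p.2 - iteratedFDeriv ℝ l (F z₀) p.2‖ := by
      have h1 := hcont l
      have h2 : Continuous fun p : Z × V => iteratedFDeriv ℝ l (F z₀) p.2 :=
        h1.comp (continuous_const.prodMk continuous_snd)
      exact (continuous_snd.norm.pow k).mul (h1.sub h2).norm
    have := hc.continuousAt (x := (z₀, x))
    refine this.eventually (gt_mem_nhds ?_)
    simp only [sub_self, norm_zero, mul_zero]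
    positivity
  filter_upwards [hcomp, hC] with z hz hCz
  refine lt_of_le_of_lt ?_ (half_lt_self hε)
  refine SchwartzMap.seminorm_le_bound ℂ k l _ (by positivity) fun x => ?_
  rw [hsub]
  by_cases hx : x ∈ Metric.closedBall (0 : V) R
  · exact (hz x hx).le
  · rw [mem_closedBall_zero_iff, not_le] at hx
    have hb : ∀ w, schwartzNorm (max (k + 1) l) (F w) ≤ C →
        ‖x‖ ^ k * ‖iteratedFDeriv ℝ l (F w) x‖ ≤ ε / 4 := by
      intro w hw
      have h1 := (SchwartzMap.le_seminorm ℂ (k + 1) l (F w) x).trans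
        ((seminorm_le_schwartzNorm (le_max_left _ _) (le_max_right _ _) _).trans hw)
      have h2 : R * (‖x‖ ^ k * ‖iteratedFDeriv ℝ l (F w) x‖) ≤ C := by
        refine le_trans ?_ h1
        rw [pow_succ' ‖x‖ k, mul_assoc]
        gcongr
      have h3 : ‖x‖ ^ k * ‖iteratedFDeriv ℝ l (F w) x‖ ≤ C / R := by
        rw [le_div_iff₀ hRpos, mul_comm]; exact h2
      refine h3.trans ?_
      rw [hR, div_div_eq_mul_div, div_le_div_iff₀ (by positivity) (by norm_num)]
      nlinarith
    calc ‖x‖ ^ k * ‖iteratedFDeriv ℝ l (F z) x - iteratedFDeriv ℝ l (F z₀) x‖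
        ≤ ‖x‖ ^ k * (‖iteratedFDeriv ℝ l (F z) x‖ + ‖iteratedFDeriv ℝ l (F z₀) x‖) := by
          gcongr; exact norm_sub_le _ _
      _ ≤ ε / 4 + ε / 4 := by
          rw [mul_add]; exact add_le_add (hb z hCz) (hb z₀ hC.self_of_nhds)
      _ = ε / 2 := by ring

/-- Partial derivatives in the second variable of a smooth function are jointly continuous. -/
theorem continuous_iteratedFDeriv_snd {Z : Type*} [NormedAddCommGroup Z] [NormedSpace ℝ Z]
    {f : Z × V → ℂ} (l : ℕ) (hf : ContDiff ℝ l f) :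
    Continuous fun p : Z × V => iteratedFDeriv ℝ l (fun y => f (p.1, y)) p.2 := by
  have h : ∀ p : Z × V, iteratedFDeriv ℝ l (fun y => f (p.1, y)) p.2 =
      (iteratedFDeriv ℝ l f p).compContinuousLinearMap
        (fun _ => ContinuousLinearMap.inr ℝ Z V) := by
    intro p
    have h1 : (fun y => f (p.1, y)) =
        (fun q => f ((p.1, 0) + q)) ∘ (ContinuousLinearMap.inr ℝ Z V) := by
      ext y; simp
    have h2 : ContDiff ℝ l (fun q => f ((p.1, 0) + q)) := hf.comp (contDiff_const.add contDiff_id)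
    rw [h1, ContinuousLinearMap.iteratedFDeriv_comp_right (i := l) _ h2 _ le_rfl,
      iteratedFDeriv_comp_add_left]
    simp
  simp_rw [h]
  exact (ContinuousMultilinearMap.compContinuousLinearMapL 
    (fun _ : Fin l => ContinuousLinearMap.inr ℝ Z V)).continuous.comp
      (hf.continuous_iteratedFDeriv le_rfl)

end Families

section Atoms

variable {ι : Type} [Fintype ι]

/-- A tempered distribution as a continuous linear functional on the Schwartz space. -/
def distCLM {V : Type*} [NormedAddCommGroup V] [NormedSpace ℝ V] (u : 𝓢'(V, ℂ)) :
    𝓢(V, ℂ) →L[ℂ] ℂ := u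

theorem distCLM_apply {V : Type*} [NormedAddCommGroup V] [NormedSpace ℝ V] (u : 𝓢'(V, ℂ))
    (f : 𝓢(V, ℂ)) : distCLM u f = u f := rfl

theorem tfAtom_apply' (χ : 𝓢(ℰ ι, ℂ)) (x ξ y : ℰ ι) :
    tfAtom χ x ξ y = chr y ξ * χ (y - x) := tfAtom_apply χ x ξ y

theorem norm_iteratedFDeriv_chr_le {V : Type*} [NormedAddCommGroup V] [InnerProductSpace ℝ V]
    (ξ y : V) (l : ℕ) : ‖iteratedFDeriv ℝ l (fun y => chr y ξ) y‖ ≤ ‖ξ‖ ^ l := by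
  have h1 : (fun y => chr y ξ) =
      (fun t : ℝ => Complex.exp (-Complex.I * (t : ℂ))) ∘ (innerSL ℝ ξ) := by
    ext y; simp [chr, real_inner_comm]
  have hs : ContDiff ℝ l (fun t : ℝ => Complex.exp (-Complex.I * (t : ℂ))) :=
    Complex.contDiff_exp.comp (contDiff_const.mul Complex.ofRealCLM.contDiff)
  have hd : ∀ t : ℝ, HasDerivAt (fun t : ℝ => Complex.exp (-Complex.I * (t : ℂ)))
      (-Complex.I * Complex.exp (-Complex.I * (t : ℂ))) t := by
    intro t
    have h1 : HasDerivAt (fun t : ℝ => -Complex.I * (t : ℂ)) (-Complex.I * 1) t :=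
      (Complex.ofRealCLM.hasDerivAt (x := t)).const_mul (-Complex.I)
    have h2 := h1.cexp
    rw [mul_one, mul_comm] at h2
    exact h2
  have hit : ∀ k : ℕ, iteratedDeriv k (fun t : ℝ => Complex.exp (-Complex.I * (t : ℂ))) =
      fun t : ℝ => (-Complex.I) ^ k * Complex.exp (-Complex.I * (t : ℂ)) := by
    intro k
    induction k with
    | zero => simp
    | succ k ih =>
      rw [iteratedDeriv_succ, ih]
      funext t
      rw [((hd t).const_mul ((-Complex.I) ^ k)).deriv]
      ring
  rw [h1, ContinuousLinearMap.iteratedFDeriv_comp_right _ hs _ le_rfl]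
  refine (ContinuousMultilinearMap.norm_compContinuousLinearMap_le _ _).trans ?_
  rw [norm_iteratedFDeriv_eq_norm_iteratedDeriv, hit, Finset.prod_const, Finset.card_univ,
    Fintype.card_fin, innerSL_apply_norm]
  refine mul_le_of_le_one_left (by positivity) ?_
  rw [norm_mul, norm_pow, norm_neg, Complex.norm_I, one_pow, one_mul, innerSL_apply_apply]
  have := norm_chr ξ y
  rw [chr] at this
  exact this.le

theorem contDiff_chr {V : Type*} [NormedAddCommGroup V] [InnerProductSpace ℝ V]
    (n : WithTop ℕ∞) : ContDiff ℝ n fun p : V × V => chr p.1 p.2 := by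
  unfold chr
  refine Complex.contDiff_exp.comp (contDiff_const.mul ?_)
  exact Complex.ofRealCLM.contDiff.comp (contDiff_fst.inner ℝ contDiff_snd)

/-- The Schwartz norms of time-frequency atoms grow polynomially in phase space. -/
theorem exists_schwartzNorm_tfAtom_le (χ : 𝓢(ℰ ι, ℂ)) (M : ℕ) :
    ∃ C : ℝ, 0 ≤ C ∧ ∀ x ξ, schwartzNorm M (tfAtom χ x ξ) ≤
      C * ((1 + ‖x‖) ^ M * (1 + ‖ξ‖) ^ M) := by
  have hχ0 := schwartzNorm_nonneg M χ
  refine ⟨2 ^ M * (2 ^ M * schwartzNorm M χ), by positivity, fun x ξ => ?_⟩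
  refine schwartzNorm_le_of_forall (by positivity) fun k l hk hl y => ?_
  have h0 : (tfAtom χ x ξ : ℰ ι → ℂ) = fun y => chr y ξ * χ (y - x) :=
    funext fun y => tfAtom_apply' χ x ξ y
  have hχs : ContDiff ℝ l (fun y => χ (y - x)) :=
    (χ.smooth l).comp (contDiff_id.sub contDiff_const)
  have hcs : ContDiff ℝ l (fun y => chr y ξ) :=
    (contDiff_chr l).comp (contDiff_id.prodMk contDiff_const)
  rw [h0]
  have h1 := norm_iteratedFDeriv_mul_le hcs hχs y le_rfl
  have hterm : ∀ i ∈ Finset.range (l + 1), ‖y‖ ^ k *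
      ((l.choose i : ℝ) * ‖iteratedFDeriv ℝ i (fun y => chr y ξ) y‖ *
        ‖iteratedFDeriv ℝ (l - i) (fun y => χ (y - x)) y‖) ≤
      (l.choose i : ℝ) * ((1 + ‖x‖) ^ M * (1 + ‖ξ‖) ^ M * (2 ^ M * schwartzNorm M χ)) := by
    intro i hi
    have hi' : i ≤ l := by simpa [Nat.lt_succ_iff] using hi
    have e1 : ‖iteratedFDeriv ℝ i (fun y => chr y ξ) y‖ ≤ (1 + ‖ξ‖) ^ M :=
      (norm_iteratedFDeriv_chr_le ξ y i).trans
        ((pow_le_pow_left₀ (norm_nonneg _) (by linarith) i).trans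
          (pow_le_pow_right₀ (by linarith [norm_nonneg ξ]) (hi'.trans hl)))
    have e2 := one_add_pow_mul_iteratedFDeriv_le M (k := M) (l := l - i) le_rfl (by omega) χ (y - x)
    have e4 : ‖y‖ ≤ (1 + ‖x‖) * (1 + ‖y - x‖) := by
      have := one_add_norm_add_le x (y - x)
      rw [add_sub_cancel] at this
      linarith
    have e5 : ‖y‖ ^ k ≤ ((1 + ‖x‖) * (1 + ‖y - x‖)) ^ M :=
      (pow_le_pow_left₀ (norm_nonneg _) e4 k).trans (pow_le_pow_right₀ (by
        nlinarith [norm_nonneg x, norm_nonneg (y - x),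
          mul_nonneg (norm_nonneg x) (norm_nonneg (y - x))]) hk)
    rw [iteratedFDeriv_comp_sub]
    calc ‖y‖ ^ k * ((l.choose i : ℝ) * ‖iteratedFDeriv ℝ i (fun y => chr y ξ) y‖ *
          ‖iteratedFDeriv ℝ (l - i) χ (y - x)‖)
        ≤ ((1 + ‖x‖) * (1 + ‖y - x‖)) ^ M * ((l.choose i : ℝ) * (1 + ‖ξ‖) ^ M *
          ‖iteratedFDeriv ℝ (l - i) χ (y - x)‖) := by gcongr
      _ = (l.choose i : ℝ) * ((1 + ‖x‖) ^ M * (1 + ‖ξ‖) ^ M * ((1 + ‖y - x‖) ^ M *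
          ‖iteratedFDeriv ℝ (l - i) χ (y - x)‖)) := by rw [mul_pow]; ring
      _ ≤ _ := by gcongr
  calc ‖y‖ ^ k * ‖iteratedFDeriv ℝ l (fun y => chr y ξ * χ (y - x)) y‖
      ≤ ‖y‖ ^ k * ∑ i ∈ Finset.range (l + 1), (l.choose i : ℝ) *
          ‖iteratedFDeriv ℝ i (fun y => chr y ξ) y‖ *
            ‖iteratedFDeriv ℝ (l - i) (fun y => χ (y - x)) y‖ := by gcongr
    _ ≤ ∑ i ∈ Finset.range (l + 1), (l.choose i : ℝ) *
          ((1 + ‖x‖) ^ M * (1 + ‖ξ‖) ^ M * (2 ^ M * schwartzNorm M χ)) := by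
        rw [Finset.mul_sum]
        exact Finset.sum_le_sum hterm
    _ = 2 ^ l * ((1 + ‖x‖) ^ M * (1 + ‖ξ‖) ^ M * (2 ^ M * schwartzNorm M χ)) := by
        rw [← Finset.sum_mul]
        congr 1
        exact_mod_cast Nat.sum_range_choose l
    _ ≤ 2 ^ M * ((1 + ‖x‖) ^ M * (1 + ‖ξ‖) ^ M * (2 ^ M * schwartzNorm M χ)) := by
        gcongr
        norm_num
    _ = _ := by ring

theorem continuous_tfAtom (χ : 𝓢(ℰ ι, ℂ)) :
    Continuous fun z : ℰ ι × ℰ ι => tfAtom χ z.1 z.2 := by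
  refine continuous_schwartz_of_jointly (fun l => ?_) (fun M z₀ => ?_)
  · let f : (ℰ ι × ℰ ι) × ℰ ι → ℂ :=
      fun q => chr q.2 q.1.2 * χ (q.2 - q.1.1)
    have hf : ContDiff ℝ l f := by
      refine ContDiff.mul ?_ ?_
      · exact (contDiff_chr l).comp (contDiff_snd.prodMk (contDiff_snd.comp contDiff_fst))
      · exact (χ.smooth l).comp (contDiff_snd.sub (contDiff_fst.comp contDiff_fst))
    have h0 : ∀ z : ℰ ι × ℰ ι,
        (tfAtom χ z.1 z.2 : ℰ ι → ℂ) = fun y => f (z, y) := fun z =>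
      funext fun y => tfAtom_apply' χ z.1 z.2 y
    simp only [h0]
    exact continuous_iteratedFDeriv_snd l hf
  · obtain ⟨C, hC, h⟩ := exists_schwartzNorm_tfAtom_le χ M
    have hc : Continuous fun z : ℰ ι × ℰ ι =>
        C * ((1 + ‖z.1‖) ^ M * (1 + ‖z.2‖) ^ M) := by fun_prop
    refine ⟨C * ((1 + ‖z₀.1‖) ^ M * (1 + ‖z₀.2‖) ^ M) + 1, ?_⟩
    filter_upwards [hc.continuousAt.eventually (gt_mem_nhds (lt_add_one _))] with z hz
    exact (h _ _).trans hz.le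

/-- The short-time Fourier transform of a tempered distribution, without the constant factor. -/
noncomputable def stft₀ (χ : 𝓢(ℰ ι, ℂ)) (u : 𝓢'(ℰ ι, ℂ))
    (z : ℰ ι × ℰ ι) : ℂ := u (tfAtom χ z.1 z.2)

theorem continuous_stft₀ (χ : 𝓢(ℰ ι, ℂ)) (u : 𝓢'(ℰ ι, ℂ)) :
    Continuous (stft₀ χ u) :=
  (distCLM u).continuous.comp (continuous_tfAtom χ)

theorem coe_dist_apply (f g : 𝓢(ℰ ι, ℂ)) :
    (f : 𝓢'(ℰ ι, ℂ)) g = ∫ y, g y * f y := by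
  simp

theorem stft₀_coe (χ ψ : 𝓢(ℰ ι, ℂ)) (x ξ : ℰ ι) :
    stft₀ χ (ψ : 𝓢'(ℰ ι, ℂ)) (x, ξ) = hatF (prodFam ψ χ 1 x) ξ := by
  rw [stft₀, coe_dist_apply, hatF]
  refine integral_congr_ae (ae_of_all _ fun y => ?_)
  simp only [tfAtom_apply', prodFam_apply, one_smul]
  ring

end Atoms

/-! ### The reproducing formula -/

section Reproducing

theorem continuous_schwartzNorm {V : Type*} [NormedAddCommGroup V] [NormedSpace ℝ V] (M : ℕ) :
    Continuous (schwartzNorm (V := V) M) := by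
  have h : ∀ f : 𝓢(V, ℂ), schwartzNorm M f = (((Finset.Iic (M, M)).sup fun i =>
      (⟨schwartzSeminormFamily ℂ V ℂ i f, apply_nonneg _ _⟩ : NNReal) : NNReal) : ℝ) := fun f =>
    Seminorm.finset_sup_apply _ _ _
  simp_rw [funext h]
  refine NNReal.continuous_coe.comp ?_
  apply Continuous.finset_sup_apply
  intro i _
  exact ((schwartz_withSeminorms ℂ V ℂ).continuous_seminorm i).subtype_mk _

variable {ι : Type} [Fintype ι]

theorem stft₀_coe_neg (γ ψ : 𝓢(ℰ ι, ℂ)) (x ξ : ℰ ι) :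
    stft₀ γ (ψ : 𝓢'(ℰ ι, ℂ)) (x, -ξ) = ∫ y, chr y (-ξ) * (ψ y * γ (y - x)) := by
  rw [stft₀_coe, hatF]
  simp only [prodFam_apply, one_smul]

/-- The short-time Fourier transform of a Schwartz function decays rapidly. -/
theorem exists_norm_stft₀_coe_le (γ : 𝓢(ℰ ι, ℂ)) (M : ℕ) :
    ∃ (M' : ℕ) (C : ℝ), 0 ≤ C ∧ ∀ (ψ : 𝓢(ℰ ι, ℂ)) (x ξ : ℰ ι),
      ‖stft₀ γ (ψ : 𝓢'(ℰ ι, ℂ)) (x, ξ)‖ ≤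
        C * schwartzNorm M' ψ * (decayFn M x * decayFn M ξ) := by
  obtain ⟨M', C, hC, h⟩ := exists_hatF_prodFam_le γ M
  exact ⟨M', C, hC, fun ψ x ξ => by
    rw [stft₀_coe]
    exact h ψ 1 ⟨zero_le_one, le_rfl⟩ x ξ⟩

/-- `∫ χ γ`, the constant in the reproducing formula for the windows `χ`, `γ`. -/
noncomputable def windowPairing {V : Type*} [NormedAddCommGroup V] [NormedSpace ℝ V]
    [MeasureSpace V] (χ γ : 𝓢(V, ℂ)) : ℂ := ∫ y, χ y * γ y

theorem integrable_decayFn_prod {M : ℕ} (hM : Module.finrank ℝ (ℰ ι) < M) :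
    Integrable fun z : ℰ ι × ℰ ι => decayFn M z.1 * decayFn M z.2 :=
  (integrable_decayFn hM volume).mul_prod (integrable_decayFn hM volume)

theorem integrable_stft₀_mul_schwartzNorm (χ γ ψ : 𝓢(ℰ ι, ℂ)) (M : ℕ) :
    Integrable fun z : ℰ ι × ℰ ι =>
      ‖stft₀ γ (ψ : 𝓢'(ℰ ι, ℂ)) (z.1, -z.2)‖ *
        schwartzNorm M (tfAtom χ z.1 z.2) := by
  -- the factor `schwartzNorm M (tfAtom χ x ξ)` grows at most with order `M`; decay of order
  -- `M + K` leaves an integrable function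
  set K := Module.finrank ℝ (ℰ ι) + 1
  obtain ⟨M', C, hC, h⟩ := exists_norm_stft₀_coe_le γ (M + K)
  obtain ⟨C', hC', h'⟩ := exists_schwartzNorm_tfAtom_le χ M
  have hψ := schwartzNorm_nonneg M' ψ
  refine ((integrable_decayFn_prod (ι := ι) (M := K) (Nat.lt_succ_self _)).const_mul
    (C * schwartzNorm M' ψ * C')).mono' ?_ (ae_of_all _ fun z => ?_)
  · have h1 : Continuous fun z : ℰ ι × ℰ ι =>
        stft₀ γ (ψ : 𝓢'(ℰ ι, ℂ)) (z.1, -z.2) :=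
      (continuous_stft₀ γ _).comp (continuous_fst.prodMk continuous_snd.neg)
    exact (h1.norm.mul ((continuous_schwartzNorm M).comp (continuous_tfAtom χ))).aestronglyMeasurable
  · rw [norm_mul, norm_norm, Real.norm_of_nonneg (schwartzNorm_nonneg _ _)]
    refine (mul_le_mul (h ψ z.1 (-z.2)) (h' z.1 z.2) (schwartzNorm_nonneg _ _) ?_).trans_eq ?_
    · have := decayFn_nonneg (M + K) z.1
      have := decayFn_nonneg (M + K) (-z.2)
      positivity
    · rw [decayFn_neg, ← pow_mul_decayFn_add M K z.1, ← pow_mul_decayFn_add M K z.2]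
      ring

/-- Integrating a Schwartz function against time-frequency atoms recovers it: Fourier inversion
for each translate of the window, and an integration over the translates. -/
theorem integral_stft₀_mul_tfAtom (χ γ ψ : 𝓢(ℰ ι, ℂ)) (y : ℰ ι) :
    ∫ z : ℰ ι × ℰ ι,
      stft₀ γ (ψ : 𝓢'(ℰ ι, ℂ)) (z.1, -z.2) * tfAtom χ z.1 z.2 y =
      (2 * Real.pi : ℂ) ^ (Module.finrank ℝ (ℰ ι)) * windowPairing χ γ * ψ y := by
  have hint : Integrable fun z : ℰ ι × ℰ ι =>
      stft₀ γ (ψ : 𝓢'(ℰ ι, ℂ)) (z.1, -z.2) * tfAtom χ z.1 z.2 y := by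
    refine (integrable_stft₀_mul_schwartzNorm χ γ ψ 0).mono' ?_ (ae_of_all _ fun z => ?_)
    · have h1 : Continuous fun z : ℰ ι × ℰ ι =>
          stft₀ γ (ψ : 𝓢'(ℰ ι, ℂ)) (z.1, -z.2) :=
        (continuous_stft₀ γ _).comp (continuous_fst.prodMk continuous_snd.neg)
      have h2 : Continuous fun z : ℰ ι × ℰ ι =>
          tfAtom χ z.1 z.2 y := by
        have := χ.continuous
        simp only [tfAtom_apply']
        fun_prop
      exact (h1.mul h2).aestronglyMeasurable
    · rw [norm_mul]
      gcongr
      exact (SchwartzMap.norm_le_seminorm ℂ _ _).trans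
        (seminorm_le_schwartzNorm le_rfl le_rfl _)
  rw [Measure.volume_eq_prod] at hint ⊢
  rw [integral_prod _ hint]
  have hx : ∀ x : ℰ ι,
      ∫ ξ, stft₀ γ (ψ : 𝓢'(ℰ ι, ℂ)) (x, -ξ) * tfAtom χ x ξ y =
      (2 * Real.pi : ℂ) ^ (Module.finrank ℝ (ℰ ι)) * ψ y *
        (χ (y - x) * γ (y - x)) := by
    intro x
    have h1 := hatF_inversion (prodFam ψ γ 1 x).continuous (prodFam ψ γ 1 x).integrable
      (integrable_hatF _) y
    rw [← integral_neg_eq_self] at h1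
    simp only [tfAtom_apply', stft₀_coe]
    calc ∫ ξ, hatF (prodFam ψ γ 1 x) (-ξ) * (chr y ξ * χ (y - x))
        = ∫ ξ, (chr y (-(-ξ)) * hatF (prodFam ψ γ 1 x) (-ξ)) * χ (y - x) := by
          refine integral_congr_ae (ae_of_all _ fun ξ => ?_)
          simp only [neg_neg]
          ring
      _ = _ := by
          rw [integral_mul_const, h1, prodFam_apply, one_smul]
          ring
  simp only [hx]
  rw [integral_const_mul, integral_sub_left_eq_self (fun w => χ w * γ w) volume y, windowPairing]
  ring

/-- The reproducing formula for tempered distributions. -/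
theorem reproducing_formula (χ γ ψ : 𝓢(ℰ ι, ℂ)) (u : 𝓢'(ℰ ι, ℂ)) :
    Integrable (fun z : ℰ ι × ℰ ι =>
      stft₀ γ (ψ : 𝓢'(ℰ ι, ℂ)) (z.1, -z.2) * stft₀ χ u z) ∧
    (2 * Real.pi : ℂ) ^ (Module.finrank ℝ (ℰ ι)) * windowPairing χ γ * u ψ =
      ∫ z : ℰ ι × ℰ ι,
        stft₀ γ (ψ : 𝓢'(ℰ ι, ℂ)) (z.1, -z.2) * stft₀ χ u z := by
  have hc : Continuous fun z : ℰ ι × ℰ ι =>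
      stft₀ γ (ψ : 𝓢'(ℰ ι, ℂ)) (z.1, -z.2) :=
    (continuous_stft₀ γ _).comp (continuous_fst.prodMk continuous_snd.neg)
  obtain ⟨Ψ, hΨ⟩ := exists_schwartz_integral (continuous_tfAtom χ)
    hc.aestronglyMeasurable (μ := volume) (integrable_stft₀_mul_schwartzNorm χ γ ψ)
  -- a Schwartz function is determined by its pairings with point masses, for which the formula is
  -- the inversion formula for Schwartz functions
  have h1 : Ψ = ((2 * Real.pi : ℂ) ^ (Module.finrank ℝ (ℰ ι)) *
      windowPairing χ γ) • ψ := by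
    ext y
    have := (hΨ (distCLM (TemperedDistribution.delta y))).2
    simp only [distCLM_apply, TemperedDistribution.delta_apply] at this
    rw [this, integral_stft₀_mul_tfAtom]
    simp
  refine ⟨(hΨ (distCLM u)).1, ?_⟩
  have h2 := (hΨ (distCLM u)).2
  rw [h1, map_smul, smul_eq_mul] at h2
  exact h2

/-- The kernel of the projection onto the range of the short-time Fourier transform. -/
noncomputable def tfKernel (χ γ : 𝓢(ℰ ι, ℂ))
    (z z' : ℰ ι × ℰ ι) : ℂ :=
  stft₀ γ (tfAtom χ z.1 z.2 : 𝓢'(ℰ ι, ℂ)) (z'.1, -z'.2)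

theorem tfKernel_eq (χ γ : 𝓢(ℰ ι, ℂ))
    (z z' : ℰ ι × ℰ ι) :
    tfKernel χ γ z z' = ∫ y, tfAtom χ z.1 z.2 y * tfAtom γ z'.1 (-z'.2) y := by
  rw [tfKernel, stft₀, coe_dist_apply]
  simp only [mul_comm]

theorem norm_tfKernel_eq (χ γ : 𝓢(ℰ ι, ℂ))
    (z z' : ℰ ι × ℰ ι) :
    ‖tfKernel χ γ z z'‖ =
      ‖stft₀ χ (γ : 𝓢'(ℰ ι, ℂ)) (z.1 - z'.1, z.2 - z'.2)‖ := by
  rw [tfKernel_eq, stft₀, coe_dist_apply, ← integral_add_right_eq_self _ z'.1]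
  have : ∀ y, tfAtom χ z.1 z.2 (y + z'.1) * tfAtom γ z'.1 (-z'.2) (y + z'.1) =
      chr z'.1 (z.2 - z'.2) * (tfAtom χ (z.1 - z'.1) (z.2 - z'.2) y * γ y) := by
    intro y
    simp only [tfAtom_apply', chr_add_left, sub_eq_add_neg, chr_add_right, add_neg_cancel_right]
    rw [show y + z'.1 + -z.1 = y + -(z.1 + -z'.1) by abel]
    ring
  simp only [this]
  rw [integral_const_mul, norm_mul, norm_chr, one_mul]

/-- The kernel decays rapidly off the diagonal. -/
theorem exists_norm_tfKernel_le (χ γ : 𝓢(ℰ ι, ℂ)) (M : ℕ) :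
    ∃ C : ℝ, 0 ≤ C ∧ ∀ z z', ‖tfKernel χ γ z z'‖ ≤
      C * (decayFn M (z.1 - z'.1) * decayFn M (z.2 - z'.2)) := by
  obtain ⟨M', C, hC, h⟩ := exists_norm_stft₀_coe_le χ M
  refine ⟨C * schwartzNorm M' γ, by have := schwartzNorm_nonneg M' γ; positivity, fun z z' => ?_⟩
  rw [norm_tfKernel_eq]
  exact h _ _ _

/-- Synthesis: a cut-off short-time Fourier transform is turned into a Schwartz function. -/
theorem exists_synthesis (χ γ : 𝓢(ℰ ι, ℂ)) (u : 𝓢'(ℰ ι, ℂ))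
    {θ : ℰ ι × ℰ ι → ℂ} (hθ : Measurable θ)
    (hθ1 : ∀ z, ‖θ z‖ ≤ 1) {K : Set (ℰ ι × ℰ ι)}
    (hK : IsCompact K) (hθK : ∀ z ∉ K, θ z = 0) :
    ∃ Ψ : 𝓢(ℰ ι, ℂ), ∀ w : 𝓢(ℰ ι, ℂ) →L[ℂ] ℂ,
      Integrable (fun z => θ z * stft₀ χ u z * w (tfAtom γ z.1 (-z.2))) ∧
      w Ψ = ∫ z, θ z * stft₀ χ u z * w (tfAtom γ z.1 (-z.2)) := by
  have hF : Continuous fun z : ℰ ι × ℰ ι =>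
      tfAtom γ z.1 (-z.2) := by
    have h1 : Continuous fun z : ℰ ι × ℰ ι => (z.1, -z.2) :=
      continuous_fst.prodMk continuous_snd.neg
    have h2 := (continuous_tfAtom γ).comp h1
    simpa only [Function.comp_def] using h2
  have hu := continuous_stft₀ χ u
  have hm : AEStronglyMeasurable (fun z => θ z * stft₀ χ u z) volume :=
    (hθ.aestronglyMeasurable).mul hu.aestronglyMeasurable
  refine exists_schwartz_integral (c := fun z => θ z * stft₀ χ u z) hF hm fun M => ?_
  have hg : Continuous fun z : ℰ ι × ℰ ι =>
      ‖stft₀ χ u z‖ * schwartzNorm M (tfAtom γ z.1 (-z.2)) :=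
    hu.norm.mul ((continuous_schwartzNorm M).comp hF)
  have hgi : Integrable (K.indicator fun z => ‖stft₀ χ u z‖ *
      schwartzNorm M (tfAtom γ z.1 (-z.2))) volume :=
    (hg.continuousOn.integrableOn_compact hK).integrable_indicator hK.measurableSet
  refine Integrable.mono' (g := K.indicator fun z => ‖stft₀ χ u z‖ *
    schwartzNorm M (tfAtom γ z.1 (-z.2))) hgi ?_ (ae_of_all _ fun z => ?_)
  · exact hm.norm.mul
      ((continuous_schwartzNorm M).comp hF).aestronglyMeasurable
  · by_cases hz : z ∈ K
    · rw [Set.indicator_of_mem hz, norm_mul, norm_norm, norm_mul,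
        Real.norm_of_nonneg (schwartzNorm_nonneg _ _)]
      refine mul_le_mul_of_nonneg_right ?_ (schwartzNorm_nonneg _ _)
      exact mul_le_of_le_one_left (norm_nonneg _) (hθ1 z)
    · simp [Set.indicator_of_notMem hz, hθK z hz]

/-- The short-time Fourier transform of a synthesised function, read off by testing the synthesis
with time-frequency atoms. -/
theorem stft₀_synthesis {χ γ : 𝓢(ℰ ι, ℂ)} {u : 𝓢'(ℰ ι, ℂ)}
    {θ : ℰ ι × ℰ ι → ℂ} {Ψ : 𝓢(ℰ ι, ℂ)}
    (hΨ : ∀ w : 𝓢(ℰ ι, ℂ) →L[ℂ] ℂ,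
      Integrable (fun z => θ z * stft₀ χ u z * w (tfAtom γ z.1 (-z.2))) ∧
      w Ψ = ∫ z, θ z * stft₀ χ u z * w (tfAtom γ z.1 (-z.2)))
    (z : ℰ ι × ℰ ι) :
    Integrable (fun z' => θ z' * stft₀ χ u z' * tfKernel χ γ z z') ∧
    stft₀ χ (Ψ : 𝓢'(ℰ ι, ℂ)) z = ∫ z', θ z' * stft₀ χ u z' * tfKernel χ γ z z' := by
  have h := hΨ (distCLM (tfAtom χ z.1 z.2 : 𝓢'(ℰ ι, ℂ)))
  refine ⟨h.1, ?_⟩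
  have h2 := h.2
  rw [distCLM_apply, coe_dist_apply] at h2
  rw [stft₀, coe_dist_apply]
  simp only [mul_comm (tfAtom χ z.1 z.2 _)]
  rw [h2]
  rfl

/-- The reproducing formula for the short-time Fourier transform itself. -/
theorem stft₀_reproducing (χ γ : 𝓢(ℰ ι, ℂ)) (u : 𝓢'(ℰ ι, ℂ))
    (z : ℰ ι × ℰ ι) :
    Integrable (fun z' => stft₀ χ u z' * tfKernel χ γ z z') ∧
    (2 * Real.pi : ℂ) ^ (Module.finrank ℝ (ℰ ι)) * windowPairing χ γ * stft₀ χ u z =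
      ∫ z', stft₀ χ u z' * tfKernel χ γ z z' := by
  have h := reproducing_formula χ γ (tfAtom χ z.1 z.2) u
  simp only [mul_comm (stft₀ χ u _)]
  exact h

end Reproducing

/-! ### Weights -/

section Weights

variable {V : Type*} [NormedAddCommGroup V]

/-- A continuous weight which is polynomially moderate with constant `1`. -/
structure IsContWeight (ω : V → ℝ) (k : ℕ) : Prop where
  pos : ∀ x, 0 < ω x
  cont : Continuous ω
  moderate : ∀ x y, ω (x + y) ≤ ω x * (1 + ‖y‖) ^ k

/-- Every polynomially moderate weight is equivalent to a continuous one, namely to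
`x ↦ sup_y ω(x + y) (1 + |y|)^{-k}`. -/
theorem exists_isContWeight {ω : V → ℝ} (hpos : ∀ x, 0 < ω x)
    (hmod : ∃ (C : ℝ) (k : ℕ), ∀ x y, ω (x + y) ≤ C * ω x * (1 + ‖y‖) ^ k) :
    ∃ (ω' : V → ℝ) (k : ℕ) (C : ℝ), IsContWeight ω' k ∧ 0 < C ∧ (∀ x, ω x ≤ ω' x) ∧
      ∀ x, ω' x ≤ C * ω x := by
  obtain ⟨C, k, h⟩ := hmod
  -- `ω(0) ≤ C ω(0)` with `ω(0) > 0`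
  have hC : 0 < C := by
    have := h 0 0
    simp only [add_zero, norm_zero, one_pow, mul_one] at this
    nlinarith [hpos 0]
  let f : V → V → ℝ := fun x y => ω (x + y) * decayFn k y
  have hf : ∀ x y, f x y ≤ C * ω x := fun x y => by
    have := h x y
    calc ω (x + y) * decayFn k y ≤ C * ω x * (1 + ‖y‖) ^ k * decayFn k y :=
          mul_le_mul_of_nonneg_right this (decayFn_nonneg _ _)
      _ = C * ω x := by unfold decayFn; field_simp
  have hbdd : ∀ x, BddAbove (Set.range (f x)) := fun x => ⟨C * ω x, by rintro _ ⟨y, rfl⟩; exact hf x y⟩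
  let ω' : V → ℝ := fun x => ⨆ y, f x y
  have h1 : ∀ x, ω x ≤ ω' x := fun x => by
    refine le_trans (le_of_eq ?_) (le_ciSup (hbdd x) 0)
    simp [f, decayFn]
  have h2 : ∀ x, ω' x ≤ C * ω x := fun x => ciSup_le (hf x)
  have h3 : ∀ x, 0 < ω' x := fun x => (hpos x).trans_le (h1 x)
  have h4 : ∀ x y, ω' (x + y) ≤ ω' x * (1 + ‖y‖) ^ k := fun x y => by
    refine ciSup_le fun z => ?_
    have e1 := le_ciSup (hbdd x) (y + z)
    have e2 : decayFn k z ≤ (1 + ‖y‖) ^ k * decayFn k (y + z) := by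
      have := decayFn_sub_le k (y + z) y
      rwa [add_sub_cancel_left] at this
    calc ω (x + y + z) * decayFn k z
        ≤ ω (x + y + z) * ((1 + ‖y‖) ^ k * decayFn k (y + z)) :=
          mul_le_mul_of_nonneg_left e2 (hpos _).le
      _ = f x (y + z) * (1 + ‖y‖) ^ k := by simp only [f, add_assoc]; ring
      _ ≤ ω' x * (1 + ‖y‖) ^ k := by gcongr
  refine ⟨ω', k, C, ⟨h3, ?_, h4⟩, hC, h1, h2⟩
  refine continuous_iff_continuousAt.2 fun x => ?_
  have hn : Tendsto (fun y => (1 + ‖y - x‖) ^ k) (𝓝 x) (𝓝 1) := by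
    have : Continuous fun y => (1 + ‖y - x‖) ^ k := by fun_prop
    simpa using this.tendsto x
  refine tendsto_of_tendsto_of_tendsto_of_le_of_le (g := fun y => ω' x * ((1 + ‖y - x‖) ^ k)⁻¹)
    (h := fun y => ω' x * (1 + ‖y - x‖) ^ k) ?_ ?_ (fun y => ?_) (fun y => ?_)
  · simpa using (hn.inv₀ one_ne_zero).const_mul (ω' x)
  · simpa using hn.const_mul (ω' x)
  · simp only []
    rw [← div_eq_mul_inv, div_le_iff₀ (by positivity)]
    have := h4 y (x - y)
    rwa [add_sub_cancel, norm_sub_rev] at this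
  · have := h4 x (y - x)
    rwa [add_sub_cancel] at this

namespace IsContWeight

theorem le_sub {ω : V → ℝ} {k : ℕ} (h : IsContWeight ω k) (x y : V) :
    ω x ≤ ω y * (1 + ‖x - y‖) ^ k := by
  have := h.moderate y (x - y)
  rwa [add_sub_cancel] at this

theorem le_zero {ω : V → ℝ} {k : ℕ} (h : IsContWeight ω k) (x : V) :
    ω x ≤ ω 0 * (1 + ‖x‖) ^ k := by simpa using h.le_sub x 0

end IsContWeight

theorem one_add_norm_prod_le {W : Type*} [NormedAddCommGroup W] (z : V × W) :
    1 + ‖z‖ ≤ (1 + ‖z.1‖) * (1 + ‖z.2‖) := by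
  rw [Prod.norm_def]
  have h1 := norm_nonneg z.1
  have h2 := norm_nonneg z.2
  have := mul_nonneg h1 h2
  rcases max_cases ‖z.1‖ ‖z.2‖ with ⟨h, -⟩ | ⟨h, -⟩ <;> rw [h] <;> nlinarith

end Weights

/-! ### Modulation space norms -/

section ModNorm

variable {ι : Type} [Fintype ι]

/-- The factor `(2π)^{-N/2}` of the short-time Fourier transform. -/
noncomputable def stftConst (ι : Type) [Fintype ι] : ℝ :=
  (2 * Real.pi) ^ (-(Fintype.card ι : ℝ) / 2)

theorem stftConst_pos : 0 < stftConst ι := by unfold stftConst; positivity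

theorem stft_eq (χ : 𝓢(ℰ ι, ℂ)) (u : 𝓢'(ℰ ι, ℂ))
    (x ξ : ℰ ι) : stft χ u x ξ = (stftConst ι : ℂ) * stft₀ χ u (x, ξ) := rfl

theorem modSlice_le_of_le {ω ω' : ℰ ι × ℰ ι → ℝ} {C : ℝ}
    (hω : ∀ z, 0 ≤ ω z) (hC : 0 ≤ C) (h : ∀ z, ω z ≤ C * ω' z)
    (χ : 𝓢(ℰ ι, ℂ)) (p : ℝ≥0∞) (u : 𝓢'(ℰ ι, ℂ))
    (ξ : ℰ ι) : modSlice χ ω p u ξ ≤ ENNReal.ofReal C * modSlice χ ω' p u ξ := by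
  unfold modSlice
  refine eLpNorm_le_mul_eLpNorm_of_ae_le_mul (ae_of_all _ fun x => ?_) p
  rw [norm_mul, norm_mul, Complex.norm_real, Complex.norm_real, Real.norm_of_nonneg (hω _)]
  calc ‖stft χ u x ξ‖ * ω (x, ξ) ≤ ‖stft χ u x ξ‖ * (C * ω' (x, ξ)) := by gcongr; exact h _
    _ ≤ C * (‖stft χ u x ξ‖ * ‖ω' (x, ξ)‖) := by
      rw [mul_left_comm]
      gcongr
      exact le_abs_self _

theorem modNorm_le_of_le {ω ω' : ℰ ι × ℰ ι → ℝ} {C : ℝ}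
    (hω : ∀ z, 0 ≤ ω z) (hC : 0 ≤ C) (h : ∀ z, ω z ≤ C * ω' z)
    (χ : 𝓢(ℰ ι, ℂ)) (p q : ℝ≥0∞) (u : 𝓢'(ℰ ι, ℂ)) :
    modNorm χ ω p q u ≤ ENNReal.ofReal C * modNorm χ ω' p q u := by
  unfold modNorm
  exact eLpNorm_le_mul_eLpNorm_of_ae_le_mul' (c := C.toNNReal)
    (ae_of_all _ fun ξ => modSlice_le_of_le hω hC h χ p u ξ) q

theorem modNorm_top_one (χ : 𝓢(ℰ ι, ℂ))
    (ω : ℰ ι × ℰ ι → ℝ) (u : 𝓢'(ℰ ι, ℂ)) :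
    modNorm χ ω ∞ 1 u = ∫⁻ ξ, modSlice χ ω ∞ u ξ := by
  simp [modNorm, eLpNorm_one_eq_lintegral_enorm]

/-- The supremum of a continuous function is an essential supremum: pointwise bound of the
short-time Fourier transform by the slice norm. -/
theorem enorm_stft₀_mul_le_modSlice {ω ω' : ℰ ι × ℰ ι → ℝ} {C : ℝ}
    (hc : Continuous ω') (h : ∀ z, ω' z ≤ C * ω z) (hC : 0 ≤ C)
    (hω : ∀ z, 0 ≤ ω z)
    (χ : 𝓢(ℰ ι, ℂ)) (u : 𝓢'(ℰ ι, ℂ))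
    (z : ℰ ι × ℰ ι) :
    ‖stft₀ χ u z‖ₑ * ENNReal.ofReal (ω' z) ≤
      ENNReal.ofReal (C * (stftConst ι)⁻¹) * modSlice χ ω ∞ u z.2 := by
  obtain ⟨x, ξ⟩ := z
  have hcst := stftConst_pos (ι := ι)
  have hae : ∀ᵐ x, ‖stft₀ χ u (x, ξ)‖ₑ * ENNReal.ofReal (ω' (x, ξ)) ≤
      ENNReal.ofReal (C * (stftConst ι)⁻¹) * modSlice χ ω ∞ u ξ := by
    unfold modSlice
    rw [eLpNorm_exponent_top]
    filter_upwards [ae_le_eLpNormEssSup (f := fun x => stft χ u x ξ * (ω (x, ξ) : ℂ))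
      (μ := volume)] with x hx
    refine le_trans ?_ (mul_le_mul_right hx _)
    rw [stft_eq, ← ofReal_norm, ← ofReal_norm, ← ENNReal.ofReal_mul (norm_nonneg _),
      ← ENNReal.ofReal_mul (by positivity)]
    refine ENNReal.ofReal_le_ofReal ?_
    rw [norm_mul, norm_mul, Complex.norm_real, Complex.norm_real, Real.norm_of_nonneg (hω _),
      Real.norm_of_nonneg hcst.le]
    calc ‖stft₀ χ u (x, ξ)‖ * ω' (x, ξ) ≤ ‖stft₀ χ u (x, ξ)‖ * (C * ω (x, ξ)) := by
          gcongr; exact h _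
      _ = _ := by field_simp
  -- a continuous function exceeds its essential supremum on an open set of measure zero, hence
  -- nowhere
  by_contra hlt
  rw [not_le] at hlt
  have hcont : Continuous fun x => ‖stft₀ χ u (x, ξ)‖ₑ * ENNReal.ofReal (ω' (x, ξ)) := by
    have h1 : Continuous fun x => ‖stft₀ χ u (x, ξ)‖ * ω' (x, ξ) :=
      ((continuous_stft₀ χ u).comp (continuous_id.prodMk continuous_const)).norm.mul
        (hc.comp (continuous_id.prodMk continuous_const))
    refine (ENNReal.continuous_ofReal.comp h1).congr fun x => ?_
    simp only [Function.comp_apply]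
    rw [ENNReal.ofReal_mul (norm_nonneg _), ofReal_norm]
  have hopen := hcont.isOpen_preimage _ (isOpen_Ioi
    (a := ENNReal.ofReal (C * (stftConst ι)⁻¹) * modSlice χ ω ∞ u ξ))
  have hpos := hopen.measure_pos volume ⟨x, hlt⟩
  refine hpos.ne' (measure_mono_null (fun y hy => ?_) (ae_iff.1 hae))
  exact not_le.2 hy

theorem measurable_essSup_snd {α β : Type*} [MeasurableSpace α] [MeasurableSpace β]
    {μ : Measure α} [SFinite μ] {f : α × β → ℝ≥0∞} (hf : Measurable f) :
    Measurable fun b => essSup (fun a => f (a, b)) μ := by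
  refine measurable_of_Ioi fun c => ?_
  have h : (fun b => essSup (fun a => f (a, b)) μ) ⁻¹' Set.Ioi c =
      {b | 0 < μ ((fun a => (a, b)) ⁻¹' (f ⁻¹' Set.Ioi c))} := by
    ext b
    simp only [Set.mem_preimage, Set.mem_Ioi, Set.mem_ofPred_eq]
    rw [← not_le, pos_iff_ne_zero, ← not_iff_not, not_not, not_not]
    constructor
    · intro hb
      have := ENNReal.ae_le_essSup (μ := μ) (fun a => f (a, b))
      refine measure_mono_null (fun a ha => ?_) (ae_iff.1 this)
      exact not_le.2 (hb.trans_lt ha)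
    · intro hb
      refine essSup_le_of_ae_le _ ?_
      refine ae_iff.2 (measure_mono_null (fun a ha => ?_) hb)
      exact not_le.1 ha
  rw [h]
  exact measurableSet_lt measurable_const
    (measurable_measure_prodMk_right (hf measurableSet_Ioi))

theorem aemeasurable_modSlice_top {ω : ℰ ι × ℰ ι → ℝ}
    (hω : AEMeasurable ω volume) (χ : 𝓢(ℰ ι, ℂ)) (u : 𝓢'(ℰ ι, ℂ)) :
    AEMeasurable (modSlice χ ω ∞ u) volume := by
  -- the weight is only almost everywhere measurable: a measurable representative changes the slice
  -- for almost no `ξ`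
  let f : ℰ ι × ℰ ι → ℝ≥0∞ := fun z =>
    ‖stft χ u z.1 z.2 * ((AEMeasurable.mk ω hω) z : ℂ)‖ₑ
  have hf : Measurable f := by
    have h1 : Continuous fun z : ℰ ι × ℰ ι => stft χ u z.1 z.2 :=
      continuous_const.mul (continuous_stft₀ χ u)
    have h2 := hω.measurable_mk
    exact (h1.measurable.mul (Complex.measurable_ofReal.comp h2)).enorm
  refine ⟨_, measurable_essSup_snd (μ := volume) hf, ?_⟩
  have h3 : ∀ᵐ z ∂((volume : Measure (ℰ ι)).prod
      (volume : Measure (ℰ ι))), ω z = AEMeasurable.mk ω hω z := hω.ae_eq_mk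
  have h4 : ∀ᵐ ξ : ℰ ι, ∀ᵐ x : ℰ ι, ω (x, ξ) = AEMeasurable.mk ω hω (x, ξ) := by
    have h5 : ∀ᵐ z ∂((volume : Measure (ℰ ι)).prod
        (volume : Measure (ℰ ι))), ω z.swap = AEMeasurable.mk ω hω z.swap := by
      have := Measure.measurePreserving_swap (μ := (volume : Measure (ℰ ι)))
        (ν := (volume : Measure (ℰ ι)))
      exact this.quasiMeasurePreserving.ae h3
    exact Measure.ae_ae_of_ae_prod h5
  filter_upwards [h4] with ξ hξ
  rw [modSlice, eLpNorm_exponent_top, eLpNormEssSup]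
  refine essSup_congr_ae ?_
  filter_upwards [hξ] with x hx
  simp only [f, hx]

/-- For a continuous weight and a finite exponent, the modulation space norm is an `L^p` norm on
phase space. -/
theorem modNorm_eq_eLpNorm {ω : ℰ ι × ℰ ι → ℝ}
    (hω : Continuous ω) {p : ℝ≥0∞} (hp0 : p ≠ 0) (hp : p ≠ ∞) (χ : 𝓢(ℰ ι, ℂ))
    (u : 𝓢'(ℰ ι, ℂ)) :
    modNorm χ ω p p u =
      ENNReal.ofReal (stftConst ι) * eLpNorm (fun z => stft₀ χ u z * (ω z : ℂ)) p volume := by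
  have hpr : 0 < p.toReal := ENNReal.toReal_pos hp0 hp
  have hc : Continuous fun z : ℰ ι × ℰ ι =>
      stft χ u z.1 z.2 * (ω z : ℂ) :=
    (continuous_const.mul (continuous_stft₀ χ u)).mul (Complex.continuous_ofReal.comp hω)
  have h1 : ENNReal.ofReal (stftConst ι) * eLpNorm (fun z => stft₀ χ u z * (ω z : ℂ)) p volume =
      eLpNorm (fun z : ℰ ι × ℰ ι =>
        stft χ u z.1 z.2 * (ω z : ℂ)) p volume := by
    have := eLpNorm_const_smul (stftConst ι : ℂ) (fun z => stft₀ χ u z * (ω z : ℂ)) p volume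
    rw [← ofReal_norm, Complex.norm_real, Real.norm_of_nonneg stftConst_pos.le] at this
    rw [← this]
    congr 1
    ext z
    simp [stft_eq, mul_assoc]
  rw [h1, modNorm, eLpNorm_eq_lintegral_rpow_enorm_toReal hp0 hp,
    eLpNorm_eq_lintegral_rpow_enorm_toReal hp0 hp, Measure.volume_eq_prod, lintegral_prod_symm']
  · congr 1
    refine lintegral_congr fun ξ => ?_
    rw [enorm_eq_self, modSlice, eLpNorm_eq_lintegral_rpow_enorm_toReal hp0 hp, ← ENNReal.rpow_mul,
      one_div, inv_mul_cancel₀ hpr.ne', ENNReal.rpow_one]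
  · exact hc.measurable.enorm.pow_const _

end ModNorm

/-! ### Globally invertible maps -/

section Hadamard

variable {V : Type*} [NormedAddCommGroup V] [NormedSpace ℝ V]

/-- A Lipschitz map which is uniformly locally expanding and which has the uniform local lifting
property is injective: if `F a = F b`, the image of the segment from `a` to `b` is a loop which is
contracted to its base point in small steps, and the (discretised) lift follows the contraction
with its end points fixed. -/
theorem injective_of_locally_expanding {F : V → V} {δ r K Λ : ℝ} (hδ : 0 < δ)
    (hr : 0 < r) (hK : 0 < K) (hΛ : 0 ≤ Λ) (hLip : ∀ a b, ‖F a - F b‖ ≤ Λ * ‖a - b‖)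
    (hexp : ∀ a b, ‖a - b‖ < δ → ‖a - b‖ ≤ K * ‖F a - F b‖)
    (hlift : ∀ x q, ‖q - F x‖ ≤ r → ∃ x', F x' = q ∧ ‖x' - x‖ ≤ K * ‖q - F x‖) :
    Function.Injective F := by
  intro a b hab
  -- `A` bounds the distance from the loop to its base point
  obtain ⟨A, hA⟩ : ∃ A, A = Λ * ‖b - a‖ := ⟨_, rfl⟩
  have hA0 : 0 ≤ A := by rw [hA]; positivity
  -- the segment is divided into `M` steps: the steps of the segment and those of every lift of the
  -- contracted loop are shorter than `δ / 2`
  obtain ⟨M, hM⟩ := exists_nat_gt (max (‖b - a‖ / (δ / 2)) (K * A / (δ / 2)))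
  have hM0 : (0 : ℝ) < M := lt_of_le_of_lt (le_max_of_le_left (by positivity)) hM
  have hMb : ‖b - a‖ / M < δ / 2 := by
    have := (le_max_left _ _).trans_lt hM
    rw [div_lt_iff₀ (by positivity)] at this
    rw [div_lt_iff₀ hM0]; linarith
  have hMδ : K * (A / M) < δ / 2 := by
    have := (le_max_right _ _).trans_lt hM
    rw [div_lt_iff₀ (by positivity)] at this
    rw [← mul_div_assoc, div_lt_iff₀ hM0]; linarith
  -- the contraction is divided into `N` steps: a lift moves by so little in one of them that the
  -- steps of the new lift are known to be shorter than `δ`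
  obtain ⟨N, hN⟩ := exists_nat_gt (max (A / r) (2 * K * A / (δ / 2)))
  have hN0 : (0 : ℝ) < N := lt_of_le_of_lt (le_max_of_le_left (by positivity)) hN
  have hNr : A / N ≤ r := by
    have := (le_max_left _ _).trans_lt hN
    rw [div_lt_iff₀ hr] at this
    rw [div_le_iff₀ hN0]; linarith
  have hNδ : 2 * (K * (A / N)) < δ / 2 := by
    have := (le_max_right _ _).trans_lt hN
    rw [div_lt_iff₀ (by positivity)] at this
    rw [← mul_div_assoc, ← mul_div_assoc, div_lt_iff₀ hN0]; linarith
  let g : ℕ → V := fun i => a + ((i : ℝ) / M) • (b - a)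
  have hg0 : g 0 = a := by simp [g]
  have hgM : g M = b := by simp [g, hM0.ne']
  have hgd : ∀ i, ‖g (i + 1) - g i‖ = ‖b - a‖ / M := fun i => by
    have : g (i + 1) - g i = (1 / M : ℝ) • (b - a) := by
      simp only [g]; push_cast; module
    rw [this, norm_smul, Real.norm_of_nonneg (by positivity)]; ring
  have hgs : ∀ i, ‖F (g (i + 1)) - F (g i)‖ ≤ A / M := fun i => by
    refine (hLip _ _).trans (le_of_eq ?_)
    rw [hgd, hA]; ring
  have hgq : ∀ i ≤ M, ‖F (g i) - F a‖ ≤ A := fun i hi => by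
    refine (hLip _ _).trans ?_
    have hi' : (i : ℝ) / M ≤ 1 := by rw [div_le_one hM0]; exact_mod_cast hi
    have : g i - a = ((i : ℝ) / M) • (b - a) := by simp [g]
    rw [this, norm_smul, Real.norm_of_nonneg (by positivity), hA]
    gcongr
    exact mul_le_of_le_one_left (norm_nonneg _) hi'
  -- the lift of the loop contracted by the factor `1 - k / N`
  have key : ∀ k ≤ N, ∃ x : ℕ → V, x 0 = a ∧ x M = b ∧
      (∀ i ≤ M, F (x i) = F a + (1 - (k : ℝ) / N) • (F (g i) - F a)) ∧
      ∀ i < M, ‖x (i + 1) - x i‖ < δ / 2 := by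
    intro k
    induction k with
    | zero => exact fun _ => ⟨g, hg0, hgM, fun i _ => by simp, fun i _ => (hgd i).trans_lt hMb⟩
    | succ k ih =>
      intro hk
      obtain ⟨x, hx0, hxM, hxF, hxs⟩ := ih (by omega)
      have hq : ∀ i ≤ M, ‖F a + (1 - ((k + 1 : ℕ) : ℝ) / N) • (F (g i) - F a) - F (x i)‖
          ≤ A / N := fun i hi => by
        have : F a + (1 - ((k + 1 : ℕ) : ℝ) / N) • (F (g i) - F a) - F (x i) =
            (-(1 / N) : ℝ) • (F (g i) - F a) := by
          rw [hxF i hi]; push_cast; module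
        rw [this, norm_smul, norm_neg, Real.norm_of_nonneg (by positivity), one_div,
          inv_mul_eq_div]
        gcongr
        exact hgq i hi
      have hy : ∀ i, ∃ y, i ≤ M → F y = F a + (1 - ((k + 1 : ℕ) : ℝ) / N) • (F (g i) - F a) ∧
          ‖y - x i‖ ≤ K * (A / N) := fun i => by
        by_cases hi : i ≤ M
        · obtain ⟨y, h1, h2⟩ := hlift (x i) _ ((hq i hi).trans hNr)
          exact ⟨y, fun _ => ⟨h1, h2.trans (by gcongr; exact hq i hi)⟩⟩
        · exact ⟨0, fun h => absurd h hi⟩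
      choose y hy using hy
      have hKN : 0 ≤ K * (A / N) := by positivity
      -- the lifts of the base point stay fixed, as the map is injective on small balls
      have hend : ∀ i ≤ M, F (g i) = F a → F (x i) = F a → y i = x i := fun i hi h1 h2 => by
        obtain ⟨e1, e2⟩ := hy i hi
        rw [h1, sub_self, smul_zero, add_zero] at e1
        have := hexp (y i) (x i) (by linarith)
        rw [e1, h2, sub_self, norm_zero, mul_zero] at this
        exact sub_eq_zero.1 (norm_le_zero_iff.1 this)
      refine ⟨y, ?_, ?_, fun i hi => (hy i hi).1, fun i hi => ?_⟩
      · rw [hend 0 (Nat.zero_le _) (by rw [hg0]) (by rw [hx0]), hx0]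
      · rw [hend M le_rfl (by rw [hgM, hab]) (by rw [hxM, hab]), hxM]
      -- a step of the new lift is shorter than `δ` by the triangle inequality, and then shorter than
      -- `δ / 2` by the expansion property, so that the induction does not lose anything
      · have e1 := hy i hi.le
        have e2 := hy (i + 1) hi
        have e3 := hxs i hi
        have hlt : ‖y (i + 1) - y i‖ < δ := by
          have : y (i + 1) - y i = (y (i + 1) - x (i + 1)) + (x (i + 1) - x i) - (y i - x i) := by
            abel
          rw [this]
          have h1 := norm_sub_le ((y (i + 1) - x (i + 1)) + (x (i + 1) - x i)) (y i - x i)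
          have h2 := norm_add_le (y (i + 1) - x (i + 1)) (x (i + 1) - x i)
          linarith [e1.2, e2.2]
        refine (hexp _ _ hlt).trans_lt (lt_of_le_of_lt ?_ hMδ)
        gcongr
        have h1 : F (y (i + 1)) - F (y i) =
            (1 - ((k + 1 : ℕ) : ℝ) / N) • (F (g (i + 1)) - F (g i)) := by
          rw [e1.1, e2.1]; module
        have hk' : ((k + 1 : ℕ) : ℝ) / N ≤ 1 := by rw [div_le_one hN0]; exact_mod_cast hk
        have hk'' : 0 ≤ ((k + 1 : ℕ) : ℝ) / N := by positivity
        rw [h1, norm_smul, Real.norm_of_nonneg (by linarith)]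
        exact (mul_le_of_le_one_left (norm_nonneg _) (by linarith)).trans (hgs i)
  -- the last lift lies in one fibre and has small steps: it is constant
  obtain ⟨x, hx0, hxM, hxF, hxs⟩ := key N le_rfl
  have hFx : ∀ i ≤ M, F (x i) = F a := fun i hi => by
    rw [hxF i hi, div_self hN0.ne', sub_self, zero_smul, add_zero]
  have : ∀ i ≤ M, x i = a := fun i => by
    induction i with
    | zero => exact fun _ => hx0
    | succ i ih =>
      intro hi
      have h1 := hexp (x (i + 1)) (x i) (by linarith [hxs i hi])
      rw [hFx _ hi, hFx i (by omega), sub_self, norm_zero, mul_zero] at h1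
      rw [← ih (by omega)]
      exact sub_eq_zero.1 (norm_le_zero_iff.1 h1)
  rw [← this M le_rfl, hxM]

variable [FiniteDimensional ℝ V]

/-- Linear maps with bounded norm and with determinant bounded away from zero are uniformly
bounded from below. -/
theorem exists_antilipschitz_of_det_ge {M d : ℝ} (hd : 0 < d) :
    ∃ c : ℝ, 0 < c ∧ ∀ L : V →L[ℝ] V, ‖L‖ ≤ M → d ≤ |L.det| → ∀ v, c * ‖v‖ ≤ ‖L v‖ := by
  -- `(L, v) ↦ ‖L v‖` attains a positive minimum on a compact set
  let S : Set (V →L[ℝ] V) := Metric.closedBall 0 M ∩ {L | d ≤ |L.det|}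
  have hdet : Continuous fun L : V →L[ℝ] V => L.det := ContinuousLinearMap.continuous_det
  have hS : IsCompact S :=
    (isCompact_closedBall 0 M).inter_right (isClosed_le continuous_const hdet.abs)
  have hK := hS.prod (isCompact_sphere (0 : V) 1)
  have hcont : ContinuousOn (fun q : (V →L[ℝ] V) × V => ‖q.1 q.2‖) (S ×ˢ Metric.sphere (0 : V) 1) :=
    (continuous_fst.clm_apply continuous_snd).norm.continuousOn
  -- the set is empty if `V = 0` or if no map satisfies the bounds
  rcases (S ×ˢ Metric.sphere (0 : V) 1).eq_empty_or_nonempty with he | hne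
  · refine ⟨1, one_pos, fun L hL hLd v => ?_⟩
    by_cases hv : v = 0
    · simp [hv]
    · have : (L, ‖v‖⁻¹ • v) ∈ S ×ˢ Metric.sphere (0 : V) 1 := by
        refine ⟨⟨by simpa using hL, hLd⟩, ?_⟩
        simp [norm_smul, hv]
      rw [he] at this
      exact absurd this (Set.notMem_empty _)
  · obtain ⟨q, hq, hmin⟩ := hK.exists_isMinOn hne hcont
    have hqpos : 0 < ‖q.1 q.2‖ := by
      rw [norm_pos_iff]
      intro h0
      have hne0 : q.2 ≠ 0 := by
        intro h
        have := hq.2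
        rw [h] at this
        simp at this
      have hz : q.1.det = 0 := by
        by_contra hne
        have hinj : Function.Injective (q.1 : V →ₗ[ℝ] V) := by
          have hu := (LinearMap.equivOfDetNeZero (q.1 : V →ₗ[ℝ] V) hne).injective
          exact hu
        exact hne0 (hinj (by simpa using h0))
      have := hq.1.2
      simp only [Set.mem_ofPred_eq, hz, abs_zero] at this
      linarith
    refine ⟨‖q.1 q.2‖, hqpos, fun L hL hLd v => ?_⟩
    by_cases hv : v = 0
    · simp [hv]
    · have hmem : (L, ‖v‖⁻¹ • v) ∈ S ×ˢ Metric.sphere (0 : V) 1 := by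
        refine ⟨⟨by simpa using hL, hLd⟩, ?_⟩
        simp [norm_smul, hv]
      have := isMinOn_iff.1 hmin _ hmem
      simp only [map_smul, norm_smul, norm_inv, norm_norm] at this
      have hv' : 0 < ‖v‖ := norm_pos_iff.2 hv
      rwa [inv_mul_eq_div, le_div_iff₀ hv'] at this

/-- A global inverse function theorem of Hadamard's type. -/
theorem injective_of_det_ge {F : V → V} {F' : V → V →L[ℝ] V} {M d : ℝ}
    (hF : ∀ x, HasFDerivAt F (F' x) x) (hM : ∀ x, ‖F' x‖ ≤ M) (hd : 0 < d)
    (hdet : ∀ x, d ≤ |(F' x).det|) (huc : UniformContinuous F') : Function.Injective F := by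
  obtain ⟨c, hc, hcL⟩ := exists_antilipschitz_of_det_ge (V := V) (M := M) hd
  obtain ⟨δ, hδ, hδF⟩ := Metric.uniformContinuous_iff.1 huc (c / 2) (by positivity)
  -- by uniform continuity of the derivative, `F` is close to its differential on balls of a fixed
  -- radius; this gives the local expansion and, by the quantitative inverse function theorem, the
  -- local lifting
  have happ : ∀ x, ApproximatesLinearOn F (F' x) (Metric.ball x δ) (c / 2).toNNReal := fun x => by
    intro a ha b hb
    rw [Real.coe_toNNReal _ (by positivity)]
    refine (convex_ball x δ).norm_image_sub_le_of_norm_hasFDerivWithin_le' (f' := F') (𝕜 := ℝ)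
      (fun y _ => (hF y).hasFDerivWithinAt) (fun y hy => ?_) hb ha
    rw [← dist_eq_norm]
    exact (hδF (Metric.mem_ball.1 hy)).le
  have hexp : ∀ x a, ‖a - x‖ < δ → c / 2 * ‖a - x‖ ≤ ‖F a - F x‖ := fun x a ha => by
    have h1 := happ x a (by rwa [Metric.mem_ball, dist_eq_norm]) x (Metric.mem_ball_self hδ)
    rw [Real.coe_toNNReal _ (by positivity)] at h1
    have h2 := hcL (F' x) (hM x) (hdet x) (a - x)
    have h3 := norm_sub_norm_le (F' x (a - x)) (F a - F x)
    rw [norm_sub_rev (F' x (a - x))] at h3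
    linarith
  have hM0 : 0 ≤ M := (norm_nonneg _).trans (hM 0)
  refine injective_of_locally_expanding (δ := δ) (r := c / 2 * (δ / 2)) (K := 2 / c) (Λ := M) hδ
    (by positivity) (by positivity) hM0 (fun a b => ?_) (fun a b hab => ?_) (fun x q hq => ?_)
  · exact (convex_univ).norm_image_sub_le_of_norm_hasFDerivWithin_le (𝕜 := ℝ) (f' := F')
      (fun y _ => (hF y).hasFDerivWithinAt) (fun y _ => hM y) (Set.mem_univ b) (Set.mem_univ a)
  · have := hexp b a hab
    rw [div_mul_eq_mul_div, le_div_iff₀ hc]; linarith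
  · have hdet0 : (F' x).det ≠ 0 := fun h => by
      have := hdet x
      rw [h, abs_zero] at this
      linarith
    let e := (F' x).toContinuousLinearEquivOfDetNeZero hdet0
    have he : ∀ v, (e : V →L[ℝ] V) v = F' x v := fun v => rfl
    let s : (F' x).NonlinearRightInverse :=
      { toFun := e.symm
        nnnorm := (1 / c).toNNReal
        bound' := fun y => by
          rw [Real.coe_toNNReal _ (by positivity), one_div, inv_mul_eq_div, le_div_iff₀ hc]
          have := hcL (F' x) (hM x) (hdet x) (e.symm y)
          rw [← he] at this
          simp only [ContinuousLinearEquiv.coe_coe, ContinuousLinearEquiv.apply_symm_apply] at this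
          linarith
        right_inv' := fun y => by
          rw [← he]; simp }
    have hε : 2 / c * ‖q - F x‖ ≤ δ / 2 := by
      rw [div_mul_eq_mul_div, div_le_iff₀ hc]; linarith
    have hsurj := (happ x).surjOn_closedBall_of_nonlinearRightInverse s
      (ε := 2 / c * ‖q - F x‖) (b := x) (by positivity)
      (fun y hy => by
        rw [Metric.mem_closedBall] at hy
        rw [Metric.mem_ball]
        linarith)
    have hs : ((s.nnnorm : ℝ)⁻¹ - ((c / 2).toNNReal : ℝ)) = c / 2 := by
      rw [show s.nnnorm = (1 / c).toNNReal from rfl, Real.coe_toNNReal _ (by positivity),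
        Real.coe_toNNReal _ (by positivity), one_div, inv_inv]; ring
    rw [hs] at hsurj
    obtain ⟨x', hx', hFx'⟩ := hsurj (show q ∈ _ by
      rw [Metric.mem_closedBall, dist_eq_norm]
      apply le_of_eq; field_simp)
    exact ⟨x', hFx', by rwa [Metric.mem_closedBall, dist_eq_norm] at hx'⟩

/-- Change of variables inequality for maps whose Jacobian is bounded from below. -/
theorem lintegral_comp_le_of_det_ge [MeasurableSpace V] [BorelSpace V] {μ : Measure V}
    [μ.IsAddHaarMeasure] {F : V → V} {F' : V → V →L[ℝ] V} {M d : ℝ}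
    (hF : ∀ x, HasFDerivAt F (F' x) x) (hM : ∀ x, ‖F' x‖ ≤ M) (hd : 0 < d)
    (hdet : ∀ x, d ≤ |(F' x).det|) (huc : UniformContinuous F') (G : V → ℝ≥0∞) :
    ∫⁻ x, G (F x) ∂μ ≤ ENNReal.ofReal d⁻¹ * ∫⁻ x, G x ∂μ := by
  have hinj := injective_of_det_ge hF hM hd hdet huc
  have h1 := lintegral_image_eq_lintegral_abs_det_fderiv_mul μ MeasurableSet.univ
    (fun x _ => (hF x).hasFDerivWithinAt) hinj.injOn G
  rw [Measure.restrict_univ] at h1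
  have h2 : ENNReal.ofReal d * ∫⁻ x, G (F x) ∂μ ≤ ∫⁻ x, G x ∂μ := by
    rw [← lintegral_const_mul' _ _ ENNReal.ofReal_ne_top]
    calc ∫⁻ x, ENNReal.ofReal d * G (F x) ∂μ ≤ ∫⁻ x, ENNReal.ofReal |(F' x).det| * G (F x) ∂μ :=
          lintegral_mono fun x => by gcongr; exact hdet x
      _ = ∫⁻ x in F '' Set.univ, G x ∂μ := h1.symm
      _ ≤ ∫⁻ x, G x ∂μ := setLIntegral_le_lintegral _ _
  rw [ENNReal.ofReal_inv_of_pos hd, ← ENNReal.div_eq_inv_mul]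
  refine (ENNReal.le_div_iff_mul_le (Or.inl (by simpa using hd)) (Or.inl ENNReal.ofReal_ne_top)).2 ?_
  rwa [mul_comm]

end Hadamard

/-! ### Functions given by elements of `M^{∞,1}` -/

section SliceSup

variable {E : Type*}

/-- The supremum `sup_x |V(x, ξ)| w(x, ξ)`. -/
noncomputable def sliceSup (V : E × E → ℂ) (w : E × E → ℝ) (ξ : E) : ℝ≥0∞ :=
  ⨆ x, ‖V (x, ξ)‖ₑ * ENNReal.ofReal (w (x, ξ))

theorem le_sliceSup (V : E × E → ℂ) (w : E × E → ℝ) (z : E × E) :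
    ‖V z‖ₑ * ENNReal.ofReal (w z) ≤ sliceSup V w z.2 :=
  le_iSup (fun x => ‖V (x, z.2)‖ₑ * ENNReal.ofReal (w (x, z.2))) z.1

theorem continuous_enorm_mul_ofReal {X : Type*} [TopologicalSpace X] {V : X → ℂ} {w : X → ℝ}
    (hV : Continuous V) (hw : Continuous w) :
    Continuous fun z => ‖V z‖ₑ * ENNReal.ofReal (w z) := by
  refine (ENNReal.continuous_ofReal.comp (hV.norm.mul hw)).congr fun x => ?_
  change ENNReal.ofReal (‖V x‖ * w x) = _
  rw [ENNReal.ofReal_mul (norm_nonneg _), ofReal_norm]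

theorem measurable_sliceSup [TopologicalSpace E] [MeasurableSpace E] [BorelSpace E] {V : E × E → ℂ} {w : E × E → ℝ}
    (hV : Continuous V) (hw : Continuous w) : Measurable (sliceSup V w) :=
  (lowerSemicontinuous_iSup fun x =>
    ((continuous_enorm_mul_ofReal hV hw).comp
      (Continuous.prodMk_right x)).lowerSemicontinuous).measurable

theorem integrable_mul_of_slice {α β : Type*} [MeasurableSpace α] [MeasurableSpace β]
    {μ : Measure α} {ν : Measure β} [SFinite μ] [SFinite ν] {V g : α × β → ℂ} {H : β → ℝ≥0∞}
    {G : α → ℝ} (hVm : AEStronglyMeasurable V (μ.prod ν))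
    (hgm : AEStronglyMeasurable g (μ.prod ν)) (hHm : AEMeasurable H ν) (hH : ∫⁻ ξ, H ξ ∂ν ≠ ∞)
    (hVH : ∀ z, ‖V z‖ₑ ≤ H z.2) (hG : Integrable G μ) (hgG : ∀ z, ‖g z‖ ≤ G z.1) :
    Integrable (fun z => V z * g z) (μ.prod ν) := by
  refine ⟨hVm.mul hgm, ?_⟩
  rw [hasFiniteIntegral_iff_enorm]
  calc ∫⁻ z, ‖V z * g z‖ₑ ∂(μ.prod ν) ≤ ∫⁻ z, ‖G z.1‖ₑ * H z.2 ∂(μ.prod ν) := by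
        refine lintegral_mono fun z => ?_
        rw [enorm_mul, mul_comm]
        gcongr
        · rw [← ofReal_norm, ← ofReal_norm]
          exact ENNReal.ofReal_le_ofReal ((hgG z).trans (le_abs_self _))
        · exact hVH z
    _ = (∫⁻ x, ‖G x‖ₑ ∂μ) * ∫⁻ ξ, H ξ ∂ν :=
        lintegral_prod_mul hG.aestronglyMeasurable.enorm hHm
    _ < ∞ := ENNReal.mul_lt_top hG.2 hH.lt_top

end SliceSup

section Windows

variable {V : Type*} [NormedAddCommGroup V] [NormedSpace ℝ V]

theorem SchwartzMap.exists_norm_le_decayFn (γ : 𝓢(V, ℂ)) (M : ℕ) :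
    ∃ C : ℝ, 0 ≤ C ∧ ∀ x, ‖γ x‖ ≤ C * decayFn M x := by
  refine ⟨2 ^ M * schwartzNorm M γ, mul_nonneg (by positivity) (schwartzNorm_nonneg _ _),
    fun x => ?_⟩
  rw [le_decayFn_iff]
  simpa using one_add_pow_mul_iteratedFDeriv_le M le_rfl (Nat.zero_le _) γ x

/-- Two continuous functions with the same integrals against all compactly supported test functions
agree. -/
theorem eq_of_forall_integral_schwartz_eq [FiniteDimensional ℝ V] [MeasurableSpace V]
    [BorelSpace V] {μ : Measure V} [μ.IsAddHaarMeasure]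
    {f g : V → ℂ} (hf : Continuous f) (hg : Continuous g)
    (h : ∀ ψ : 𝓢(V, ℂ), HasCompactSupport ψ → ∫ y, f y * ψ y ∂μ = ∫ y, g y * ψ y ∂μ) : f = g := by
  have h0 : ∀ᵐ x ∂μ, f x - g x = 0 := by
    refine ae_eq_zero_of_integral_contDiff_smul_eq_zero
      (hf.sub hg).locallyIntegrable fun k hk hkc => ?_
    have hkc' : HasCompactSupport fun x => (k x : ℂ) := hkc.comp_left Complex.ofReal_zero
    have hk' : ContDiff ℝ _ fun x => (k x : ℂ) := Complex.ofRealCLM.contDiff.comp hk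
    have e := h (hkc'.toSchwartzMap hk') hkc'
    have e1 : ∀ {F : V → ℂ}, Continuous F → Integrable (fun y => F y * (k y : ℂ)) μ := fun hF =>
      (hF.mul hk'.continuous).integrable_of_hasCompactSupport hkc'.mul_left
    calc ∫ x, k x • (f x - g x) ∂μ = ∫ x, (f x * (k x : ℂ) - g x * (k x : ℂ)) ∂μ := by
          refine integral_congr_ae (ae_of_all _ fun x => ?_)
          simp only [Complex.real_smul]; ring
      _ = 0 := by
          rw [integral_sub (e1 hf) (e1 hg)]
          exact sub_eq_zero.2 e
  have h1 : f =ᵐ[μ] g := h0.mono fun x hx => sub_eq_zero.1 hx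
  exact (hf.ae_eq_iff_eq μ hg).1 h1

theorem exists_windowPairing_ne_zero [FiniteDimensional ℝ V] [MeasureSpace V]
    [BorelSpace V] [(volume : Measure V).IsAddHaarMeasure] {χ : 𝓢(V, ℂ)} (hχ : χ ≠ 0) :
    ∃ γ : 𝓢(V, ℂ), HasCompactSupport γ ∧ windowPairing χ γ ≠ 0 := by
  by_contra! hcon
  refine hχ (DFunLike.coe_injective ?_)
  refine eq_of_forall_integral_schwartz_eq (μ := volume) χ.continuous continuous_const
    fun ψ hψ => ?_
  exact (hcon ψ hψ).trans (by simp)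

end Windows

section Representation

variable {ι : Type} [Fintype ι]

theorem lintegral_sliceSup_le {ω ω' : ℰ ι × ℰ ι → ℝ} {C : ℝ}
    (hc : Continuous ω') (h : ∀ z, ω' z ≤ C * ω z) (hC : 0 ≤ C) (hω : ∀ z, 0 ≤ ω z)
    (χ : 𝓢(ℰ ι, ℂ)) (u : 𝓢'(ℰ ι, ℂ)) :
    ∫⁻ ξ, sliceSup (stft₀ χ u) ω' ξ ≤
      ENNReal.ofReal (C * (stftConst ι)⁻¹) * modNorm χ ω ∞ 1 u := by
  rw [modNorm_top_one, ← lintegral_const_mul' _ _ ENNReal.ofReal_ne_top]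
  exact lintegral_mono fun ξ => iSup_le fun x =>
    enorm_stft₀_mul_le_modSlice hc h hC hω χ u (x, ξ)

/-- The function obtained by synthesis from `V` with the window `γ`. -/
noncomputable def synth (γ : 𝓢(ℰ ι, ℂ))
    (V : ℰ ι × ℰ ι → ℂ) (y : ℰ ι) : ℂ :=
  ∫ z, V z * (γ (y - z.1) * chr y (-z.2))

variable {V : ℰ ι × ℰ ι → ℂ} {H : ℰ ι → ℝ≥0∞}

theorem integrable_synth (γ : 𝓢(ℰ ι, ℂ)) (hV : Continuous V) (hHm : Measurable H)
    (hH : ∫⁻ ξ, H ξ ≠ ∞) (hVH : ∀ z, ‖V z‖ₑ ≤ H z.2) (y : ℰ ι) :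
    Integrable fun z => V z * (γ (y - z.1) * chr y (-z.2)) := by
  rw [Measure.volume_eq_prod]
  refine integrable_mul_of_slice (G := fun x => ‖γ (y - x)‖) hV.aestronglyMeasurable
    ?_ hHm.aemeasurable hH hVH ?_ fun z => ?_
  · exact (by fun_prop : Continuous fun z : ℰ ι × ℰ ι =>
      γ (y - z.1) * chr y (-z.2)).aestronglyMeasurable
  · exact ((γ.integrable).comp_sub_left y).norm
  · rw [norm_mul, norm_chr, mul_one]

theorem exists_norm_synth_le (γ : 𝓢(ℰ ι, ℂ))
    (hHm : Measurable H) (hH : ∫⁻ ξ, H ξ ≠ ∞) (hVH : ∀ z, ‖V z‖ₑ ≤ H z.2) :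
    ∃ C, ∀ y, ‖synth γ V y‖ ≤ C := by
  refine ⟨((∫⁻ x, ‖γ x‖ₑ) * ∫⁻ ξ, H ξ).toReal, fun y => ?_⟩
  rw [← toReal_enorm]
  refine ENNReal.toReal_mono (ENNReal.mul_ne_top γ.integrable.2.ne hH) ?_
  refine (enorm_integral_le_lintegral_enorm _).trans ?_
  rw [← lintegral_sub_left_eq_self (fun x => ‖γ x‖ₑ) y, ← lintegral_prod_mul (by
    exact (by fun_prop : Continuous fun x => ‖γ (y - x)‖ₑ).aemeasurable) hHm.aemeasurable,
    ← Measure.volume_eq_prod]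
  refine lintegral_mono fun z => ?_
  rw [enorm_mul, mul_comm, enorm_mul, ← ofReal_norm (chr _ _), norm_chr, ENNReal.ofReal_one, mul_one]
  gcongr
  exact hVH z

theorem uniformContinuous_synth (γ : 𝓢(ℰ ι, ℂ)) (hV : Continuous V)
    (hHm : Measurable H) (hH : ∫⁻ ξ, H ξ ≠ ∞) (hVH : ∀ z, ‖V z‖ₑ ≤ H z.2) :
    UniformContinuous (synth γ V) := by
  -- the increment by `h` is dominated uniformly in `y` by the integral of `D h`, which tends to zero
  let D : ℰ ι → ℰ ι × ℰ ι → ℝ≥0∞ := fun h z =>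
    ‖γ (z.1 + h) * chr h (-z.2) - γ z.1‖ₑ * H z.2
  have hD : ∀ h, Measurable (D h) := fun h =>
    (by fun_prop : Continuous fun z : ℰ ι × ℰ ι =>
      ‖γ (z.1 + h) * chr h (-z.2) - γ z.1‖ₑ).measurable.mul (hHm.comp measurable_snd)
  have hle : ∀ y h, ‖synth γ V (y + h) - synth γ V y‖ₑ ≤ ∫⁻ z, D h z := by
    intro y h
    have e : synth γ V (y + h) - synth γ V y =
        ∫ z : ℰ ι × ℰ ι,
          V z * chr y (-z.2) * (γ (y - z.1 + h) * chr h (-z.2) - γ (y - z.1)) := by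
      rw [synth, synth, ← integral_sub (integrable_synth γ hV hHm hH hVH _)
        (integrable_synth γ hV hHm hH hVH _)]
      refine integral_congr_ae (ae_of_all _ fun z => ?_)
      simp only [chr_add_left, show y + h - z.1 = y - z.1 + h by abel]
      ring
    rw [e]
    refine (enorm_integral_le_lintegral_enorm _).trans ?_
    calc _ ≤ ∫⁻ z : ℰ ι × ℰ ι, D h (y - z.1, z.2) := by
          refine lintegral_mono fun z => ?_
          rw [enorm_mul, enorm_mul, ← ofReal_norm (chr _ _), norm_chr, ENNReal.ofReal_one, mul_one,
            mul_comm ‖V z‖ₑ]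
          exact mul_le_mul_right (hVH z) _
      _ = ∫⁻ z, D h z := by
          rw [Measure.volume_eq_prod, lintegral_prod_symm' _ (hD h), lintegral_prod_symm']
          · exact lintegral_congr fun ξ => lintegral_sub_left_eq_self (fun x => D h (x, ξ)) y
          · exact (hD h).comp (by fun_prop)
  obtain ⟨C, hC, hγ⟩ := γ.exists_norm_le_decayFn (Module.finrank ℝ (ℰ ι) + 1)
  set M := Module.finrank ℝ (ℰ ι) + 1 with hM
  have hlim : Tendsto (fun h => ∫⁻ z, D h z) (𝓝 0) (𝓝 0) := by
    have := tendsto_lintegral_filter_of_dominated_convergence (μ := volume) (l := 𝓝 0)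
      (F := D) (f := fun _ => 0)
      (fun z : ℰ ι × ℰ ι =>
        ENNReal.ofReal (C * (2 ^ M + 1) * decayFn M z.1) * H z.2)
      (Eventually.of_forall hD) ?_ ?_ ?_
    · simpa using this
    · filter_upwards [Metric.ball_mem_nhds (0 : ℰ ι) one_pos] with h hh
      refine ae_of_all _ fun z => ?_
      simp only [D]
      gcongr
      rw [← ofReal_norm]
      refine ENNReal.ofReal_le_ofReal ?_
      have h1 := norm_sub_le (γ (z.1 + h) * chr h (-z.2)) (γ z.1)
      rw [norm_mul, norm_chr, mul_one] at h1
      have h2 := decayFn_sub_le M z.1 (-h)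
      rw [sub_neg_eq_add, norm_neg] at h2
      -- translations by less than `1` change the decay of `γ` by a bounded factor
      have h3 : (1 + ‖h‖) ^ M ≤ 2 ^ M := by
        have : ‖h‖ < 1 := by simpa using hh
        gcongr; linarith
      have h4 := mul_le_mul_of_nonneg_right h3 (decayFn_nonneg M z.1)
      have h5 := mul_le_mul_of_nonneg_left (h2.trans h4) hC
      linarith [hγ (z.1 + h), hγ z.1]
    · rw [Measure.volume_eq_prod, lintegral_prod_mul
        (f := fun x => ENNReal.ofReal (C * (2 ^ M + 1) * decayFn M x)) _ hHm.aemeasurable]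
      · refine ENNReal.mul_ne_top (Integrable.lintegral_lt_top ?_).ne hH
        exact (integrable_decayFn (Nat.lt_succ_self _) volume).const_mul _
      · exact (ENNReal.continuous_ofReal.comp
          ((continuous_decayFn M).const_mul _)).aemeasurable
    · have hfin : ∀ᵐ ξ, H ξ < ∞ := ae_lt_top hHm hH
      have hfin' : ∀ᵐ z : ℰ ι × ℰ ι, H z.2 < ∞ :=
        Measure.quasiMeasurePreserving_snd.ae hfin
      filter_upwards [hfin'] with z hz
      have hc : Continuous fun h => ‖γ (z.1 + h) * chr h (-z.2) - γ z.1‖ₑ := by fun_prop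
      have := ENNReal.Tendsto.mul_const (b := H z.2) (hc.tendsto 0) (Or.inr hz.ne)
      simpa using this
  rw [Metric.uniformContinuous_iff]
  intro ε hε
  have hev := hlim.eventually (gt_mem_nhds (ENNReal.ofReal_pos.2 hε))
  obtain ⟨δ, hδ, hball⟩ := Metric.eventually_nhds_iff.1 hev
  refine ⟨δ, hδ, fun {a b} hab => ?_⟩
  have h1 := hle b (a - b)
  rw [add_sub_cancel] at h1
  have h2 := h1.trans_lt (hball (y := a - b) (by rwa [dist_zero_right, ← dist_eq_norm]))
  rw [← ofReal_norm, ENNReal.ofReal_lt_ofReal_iff hε] at h2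
  rwa [dist_eq_norm]

/-- The reproducing formula for a continuous function whose short-time Fourier transform is
integrable in the dual variable, uniformly in the space variable. -/
theorem synth_stft₀_eq {χ γ : 𝓢(ℰ ι, ℂ)} {u : 𝓢'(ℰ ι, ℂ)}
    {b : ℰ ι → ℂ} (hb : Continuous b) (hu : IsGivenBy u b) (hHm : Measurable H)
    (hH : ∫⁻ ξ, H ξ ≠ ∞) (hVH : ∀ z, ‖stft₀ χ u z‖ₑ ≤ H z.2) (y : ℰ ι) :
    (2 * Real.pi : ℂ) ^ (Module.finrank ℝ (ℰ ι)) * windowPairing χ γ * b y =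
      synth γ (stft₀ χ u) y := by
  have hV := continuous_stft₀ χ u
  refine congrFun (eq_of_forall_integral_schwartz_eq (μ := volume)
    (f := fun y => (2 * Real.pi : ℂ) ^ (Module.finrank ℝ (ℰ ι)) *
      windowPairing χ γ * b y) (hb.const_mul _)
    (uniformContinuous_synth γ hV hHm hH hVH).continuous fun ψ hψ => ?_) y
  -- both sides are continuous: they are compared after integration against a test function, where
  -- the left hand side is given by the reproducing formula for distributions
  have h1 := (reproducing_formula χ γ ψ u).2
  rw [hu ψ hψ] at h1
  simp only [mul_assoc] at h1 ⊢
  rw [integral_const_mul, integral_const_mul, h1]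
  have hint : Integrable (Function.uncurry fun
      (z : ℰ ι × ℰ ι) (y : ℰ ι) =>
      stft₀ χ u z * (γ (y - z.1) * chr y (-z.2) * ψ y)) (volume.prod volume) := by
    have hgc : Continuous fun q : (ℰ ι × ℰ ι) × ℰ ι =>
        γ (q.2 - q.1.1) * chr q.2 (-q.1.2) * ψ q.2 := by fun_prop
    refine ⟨((hV.comp continuous_fst).mul hgc).aestronglyMeasurable, ?_⟩
    have hm : Measurable fun q : (ℰ ι × ℰ ι) × ℰ ι =>
        ‖stft₀ χ u q.1 * (γ (q.2 - q.1.1) * chr q.2 (-q.1.2) * ψ q.2)‖ₑ :=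
      ((hV.comp continuous_fst).mul hgc).enorm.measurable
    rw [hasFiniteIntegral_iff_enorm]
    refine (lintegral_prod_symm' _ hm).trans_lt ?_
    have hle : ∀ y, ∫⁻ z : ℰ ι × ℰ ι,
        ‖stft₀ χ u z * (γ (y - z.1) * chr y (-z.2) * ψ y)‖ₑ ≤
        ((∫⁻ x, ‖γ x‖ₑ) * ∫⁻ ξ, H ξ) * ‖ψ y‖ₑ := by
      intro y
      rw [← lintegral_sub_left_eq_self (fun x => ‖γ x‖ₑ) y, ← lintegral_prod_mul (by
        exact (by fun_prop : Continuous fun x => ‖γ (y - x)‖ₑ).aemeasurable) hHm.aemeasurable,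
        ← Measure.volume_eq_prod, ← lintegral_mul_const' _ _ enorm_ne_top]
      refine lintegral_mono fun z => ?_
      rw [enorm_mul, enorm_mul, enorm_mul, ← ofReal_norm (chr _ _), norm_chr, ENNReal.ofReal_one,
        mul_one, ← mul_assoc, mul_comm ‖stft₀ χ u z‖ₑ]
      gcongr
      exact hVH z
    refine (lintegral_mono hle).trans_lt ?_
    rw [lintegral_const_mul' _ _ (ENNReal.mul_ne_top γ.integrable.2.ne hH)]
    exact ENNReal.mul_lt_top (ENNReal.mul_lt_top γ.integrable.2 hH.lt_top) ψ.integrable.2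
  calc _ = ∫ z : ℰ ι × ℰ ι, ∫ y : ℰ ι,
        stft₀ χ u z * (γ (y - z.1) * chr y (-z.2) * ψ y) := by
        refine integral_congr_ae (ae_of_all _ fun z => ?_)
        simp only []
        rw [stft₀_coe_neg, mul_comm, ← integral_const_mul]
        refine integral_congr_ae (ae_of_all _ fun y => ?_)
        simp only []
        ring
    _ = _ := by
        rw [integral_integral_swap hint]
        refine integral_congr_ae (ae_of_all _ fun y => ?_)
        simp only [synth]
        rw [← integral_mul_const]
        refine integral_congr_ae (ae_of_all _ fun z => ?_)
        simp only []
        ring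

end Representation

/-! ### The Fourier transform of a localised oscillating factor -/

section Superposition

variable {V : Type*} [NormedAddCommGroup V] [InnerProductSpace ℝ V] [FiniteDimensional ℝ V]
  [MeasurableSpace V] [BorelSpace V]

/-- Multiplication by a superposition of characters acts on the Fourier side as a superposition of
translations. -/
theorem hatF_mul_of_superposition {Q : Type*} [MeasurableSpace Q] {μ : Measure Q} [SFinite μ]
    {W : Q → ℂ} (hW : Integrable W μ) {p : Q → V} (hp : Measurable p) {m : V → ℂ}
    (hm : ∀ y, m y = ∫ q, W q * chr y (-(p q)) ∂μ) {u : V → ℂ} (hu : Integrable u) (ξ : V) :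
    hatF (fun y => u y * m y) ξ = ∫ q, W q * hatF u (ξ - p q) ∂μ := by
  have hchr : Measurable fun r : V × Q => chr r.1 (ξ - p r.2) :=
    continuous_chr.measurable.comp (measurable_fst.prodMk
      (measurable_const.sub (hp.comp measurable_snd)))
  have hint : Integrable (Function.uncurry fun (y : V) (q : Q) =>
      chr y (ξ - p q) * (u y * W q)) (volume.prod μ) :=
    (hu.mul_prod hW).bdd_mul (c := 1) hchr.aestronglyMeasurable
      (ae_of_all _ fun r => (norm_chr _ _).le)
  calc hatF (fun y => u y * m y) ξ = ∫ y, ∫ q, chr y (ξ - p q) * (u y * W q) ∂μ := by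
        refine integral_congr_ae (ae_of_all _ fun y => ?_)
        simp only []
        rw [hm, ← integral_const_mul, ← integral_const_mul]
        refine integral_congr_ae (ae_of_all _ fun q => ?_)
        simp only [sub_eq_add_neg, chr_add_right]
        ring
    _ = ∫ q, (∫ y, chr y (ξ - p q) * (u y * W q)) ∂μ := integral_integral_swap hint
    _ = _ := by
        refine integral_congr_ae (ae_of_all _ fun q => ?_)
        simp only [hatF]
        rw [← integral_const_mul]
        refine integral_congr_ae (ae_of_all _ fun y => ?_)
        simp only []
        ring

theorem continuous_hatF_prodFam (s γ : 𝓢(V, ℂ)) :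
    Continuous fun q : ℝ × V × V => hatF (prodFam s γ q.1 q.2.1) q.2.2 := by
  obtain ⟨C, hC, hγ⟩ := γ.exists_norm_le_decayFn 0
  refine continuous_of_dominated (bound := fun y => C * ‖s y‖) (fun q => ?_)
    (fun q => ae_of_all _ fun y => ?_) (s.integrable.norm.const_mul C) (ae_of_all _ fun y => ?_)
  · exact (by fun_prop : Continuous fun y =>
      chr y q.2.2 * prodFam s γ q.1 q.2.1 y).aestronglyMeasurable
  · rw [norm_mul, norm_chr, one_mul, prodFam_apply, norm_mul, mul_comm]
    gcongr
    simpa [decayFn] using hγ (q.1 • y - q.2.1)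
  · simp only [prodFam_apply]
    fun_prop

end Superposition

section PhaseOperator

variable {ι : Type} [Fintype ι]

/-- The operator `k ↦ ∫_0^1 ∬ h(η) (1 + |Θ|)^{-M} k(ξ - tη - Θ) dη dΘ dt`. -/
noncomputable def phaseOp (h : ℰ ι → ℝ≥0∞) (M : ℕ)
    (k : ℰ ι → ℝ≥0∞) (ξ : ℰ ι) : ℝ≥0∞ :=
  ∫⁻ q : ℝ × ℰ ι × ℰ ι,
    h q.2.1 * ENNReal.ofReal (decayFn M q.2.2) * k (ξ - (q.1 • q.2.1 + q.2.2))
    ∂((volume.restrict (Set.Icc (0 : ℝ) 1)).prod (volume.prod volume))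

theorem measurable_ofReal_decayFn {V : Type*} [NormedAddCommGroup V] [MeasurableSpace V]
    [BorelSpace V] (M : ℕ) : Measurable fun x : V => ENNReal.ofReal (decayFn M x) :=
  (ENNReal.continuous_ofReal.comp (continuous_decayFn M)).measurable

theorem measurable_phaseOp_integrand {h k : ℰ ι → ℝ≥0∞} (hh : Measurable h)
    (M : ℕ) (hk : Measurable k) : Measurable fun r : ℰ ι ×
      ℝ × ℰ ι × ℰ ι =>
      h r.2.2.1 * ENNReal.ofReal (decayFn M r.2.2.2) * k (r.1 - (r.2.1 • r.2.2.1 + r.2.2.2)) := by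
  have h1 := measurable_ofReal_decayFn (V := ℰ ι) M
  have h2 : Measurable fun r : ℰ ι × ℝ × ℰ ι × ℰ ι =>
    r.1 - (r.2.1 • r.2.2.1 + r.2.2.2) := by fun_prop
  exact ((hh.comp (by fun_prop)).mul (h1.comp (by fun_prop))).mul (hk.comp h2)

theorem measurable_phaseOp {h k : ℰ ι → ℝ≥0∞} (hh : Measurable h) (M : ℕ)
    (hk : Measurable k) : Measurable (phaseOp h M k) :=
  (measurable_phaseOp_integrand hh M hk).lintegral_prod_right'

/-- Young's inequality for `phaseOp`, in weighted spaces with submultiplicative weights. -/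
theorem lintegral_phaseOp_mul_le {h k w : ℰ ι → ℝ≥0∞} (hh : Measurable h) (M : ℕ)
    (hk : Measurable k) (hw : Measurable w) {A : ℝ≥0∞}
    (hsub : ∀ x y, w (x + y) ≤ A * w x * w y)
    (hscale : ∀ t ∈ Set.Icc (0 : ℝ) 1, ∀ x, w (t • x) ≤ A * w x) :
    ∫⁻ ξ, phaseOp h M k ξ * w ξ ≤
      A ^ 3 * (∫⁻ η, h η * w η) * (∫⁻ Θ, ENNReal.ofReal (decayFn M Θ) * w Θ) *
        ∫⁻ ξ, k ξ * w ξ := by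
  have hm := measurable_phaseOp_integrand hh M hk
  have hd := measurable_ofReal_decayFn (V := ℰ ι) M
  have e1 : ∫⁻ ξ, phaseOp h M k ξ * w ξ =
      ∫⁻ q : ℝ × ℰ ι × ℰ ι, (∫⁻ ξ, h q.2.1 *
        ENNReal.ofReal (decayFn M q.2.2) * k (ξ - (q.1 • q.2.1 + q.2.2)) * w ξ)
        ∂((volume.restrict (Set.Icc (0 : ℝ) 1)).prod (volume.prod volume)) := by
    rw [← lintegral_lintegral_swap (hm.mul (hw.comp measurable_fst)).aemeasurable]
    refine lintegral_congr fun ξ => ?_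
    exact (lintegral_mul_const _ (hm.comp (measurable_prodMk_left (x := ξ)))).symm
  have e2 : ∀ᵐ q ∂((volume.restrict (Set.Icc (0 : ℝ) 1)).prod
      ((volume : Measure (ℰ ι)).prod (volume : Measure (ℰ ι)))),
      q.1 ∈ Set.Icc (0 : ℝ) 1 :=
    Measure.quasiMeasurePreserving_fst.ae (ae_restrict_mem measurableSet_Icc)
  have e3 : ∀ q : ℝ × ℰ ι × ℰ ι, q.1 ∈ Set.Icc (0 : ℝ) 1 →
      ∫⁻ ξ, h q.2.1 * ENNReal.ofReal (decayFn M q.2.2) *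
        k (ξ - (q.1 • q.2.1 + q.2.2)) * w ξ ≤
      (h q.2.1 * w q.2.1) * (ENNReal.ofReal (decayFn M q.2.2) * w q.2.2) *
        (A ^ 3 * ∫⁻ ξ, k ξ * w ξ) := by
    intro q hq
    have hkw : Measurable fun ξ => k (ξ - (q.1 • q.2.1 + q.2.2)) * w (ξ - (q.1 • q.2.1 + q.2.2)) :=
      (hk.mul hw).comp (measurable_sub_const _)
    rw [← lintegral_sub_right_eq_self (fun ξ => k ξ * w ξ) (q.1 • q.2.1 + q.2.2),
      ← mul_assoc, ← lintegral_const_mul _ hkw]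
    refine lintegral_mono fun ξ => ?_
    -- submultiplicativity is used twice, and the scaling condition for the factor `tη`
    have h1 : w ξ ≤ A * w (ξ - (q.1 • q.2.1 + q.2.2)) * (A * (A * w q.2.1) * w q.2.2) := by
      calc w ξ = w ((ξ - (q.1 • q.2.1 + q.2.2)) + (q.1 • q.2.1 + q.2.2)) := by
            rw [sub_add_cancel]
        _ ≤ _ := hsub _ _
        _ ≤ _ := by
          gcongr
          refine (hsub _ _).trans ?_
          gcongr
          exact hscale _ hq _
    calc _ ≤ h q.2.1 * ENNReal.ofReal (decayFn M q.2.2) * k (ξ - (q.1 • q.2.1 + q.2.2)) *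
        (A * w (ξ - (q.1 • q.2.1 + q.2.2)) * (A * (A * w q.2.1) * w q.2.2)) := by gcongr
      _ = _ := by ring
  rw [e1]
  refine (lintegral_mono_ae (e2.mono e3)).trans ?_
  have hm1 : Measurable fun x : ℰ ι × ℰ ι =>
      (h x.1 * w x.1) * (ENNReal.ofReal (decayFn M x.2) * w x.2) :=
    ((hh.mul hw).comp measurable_fst).mul ((hd.mul hw).comp measurable_snd)
  have hm2 : Measurable fun q : ℝ × ℰ ι × ℰ ι =>
      (h q.2.1 * w q.2.1) * (ENNReal.ofReal (decayFn M q.2.2) * w q.2.2) :=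
    hm1.comp measurable_snd
  rw [lintegral_mul_const _ hm2]
  have e4 := lintegral_prod_mul (μ := volume.restrict (Set.Icc (0 : ℝ) 1))
    (ν := (volume : Measure (ℰ ι)).prod (volume : Measure (ℰ ι)))
    (f := fun _ => 1) (g := fun x => (h x.1 * w x.1) * (ENNReal.ofReal (decayFn M x.2) * w x.2))
    aemeasurable_const hm1.aemeasurable
  simp only [one_mul] at e4
  rw [e4, lintegral_prod_mul (f := fun x => h x * w x)
    (g := fun x => ENNReal.ofReal (decayFn M x) * w x) (hh.mul hw).aemeasurable
    (hd.mul hw).aemeasurable]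
  simp only [lintegral_const, Measure.restrict_apply_univ, Real.volume_Icc, sub_zero,
    ENNReal.ofReal_one, mul_one, one_mul]
  exact le_of_eq (by ring)

/-- The coefficients in the expansion of `s(Y) ∫_0^1 (1 - t) b(X + tY) dt` into characters
`e^{i⟨Y, tη + Θ⟩}`, where `b` is synthesised from `V` with window `γ`. The integration variable is
`(t, (x, η), Θ)`. -/
noncomputable def phaseCoeff (γ s : 𝓢(ℰ ι, ℂ))
    (V : ℰ ι × ℰ ι → ℂ) (X : ℰ ι)
    (q : ℝ × (ℰ ι × ℰ ι) × ℰ ι) : ℂ :=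
  ((1 - q.1 : ℝ) : ℂ) * (V q.2.1 * (chr X (-q.2.1.2) *
    (((2 * Real.pi : ℂ) ^ Module.finrank ℝ (ℰ ι))⁻¹ *
      hatF (prodFam s γ q.1 (q.2.1.1 - X)) q.2.2)))

/-- The measure `dt dx dη dΘ` on `[0,1] × (ℝ^N × ℝ^N) × ℝ^N`. -/
noncomputable def phaseMeasure (ι : Type) [Fintype ι] :
    Measure (ℝ × (ℰ ι × ℰ ι) × ℰ ι) :=
  (volume.restrict (Set.Icc (0 : ℝ) 1)).prod (volume.prod volume)

instance : SFinite (phaseMeasure ι) := by unfold phaseMeasure; infer_instance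

theorem ae_phaseMeasure_mem_Icc : ∀ᵐ q ∂(phaseMeasure ι), q.1 ∈ Set.Icc (0 : ℝ) 1 :=
  Measure.quasiMeasurePreserving_fst.ae (ae_restrict_mem measurableSet_Icc)

theorem continuous_phaseCoeff (γ s : 𝓢(ℰ ι, ℂ))
    {V : ℰ ι × ℰ ι → ℂ} (hV : Continuous V)
    (X : ℰ ι) : Continuous (phaseCoeff γ s V X) := by
  have h1 : Continuous fun q : ℝ × (ℰ ι × ℰ ι) ×
      ℰ ι => hatF (prodFam s γ q.1 (q.2.1.1 - X)) q.2.2 :=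
    Continuous.comp (g := fun q : ℝ × ℰ ι × ℰ ι =>
      hatF (prodFam s γ q.1 q.2.1) q.2.2) (continuous_hatF_prodFam s γ)
      (f := fun q : ℝ × (ℰ ι × ℰ ι) × ℰ ι =>
      (q.1, q.2.1.1 - X, q.2.2)) (by fun_prop)
  have h2 : Continuous fun q : ℝ × (ℰ ι × ℰ ι) ×
      ℰ ι => V q.2.1 := hV.comp (continuous_fst.comp continuous_snd)
  have h3 : Continuous fun q : ℝ × (ℰ ι × ℰ ι) ×
      ℰ ι => ((1 - q.1 : ℝ) : ℂ) := by fun_prop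
  have h4 : Continuous fun q : ℝ × (ℰ ι × ℰ ι) ×
      ℰ ι => chr X (-q.2.1.2) := by fun_prop
  exact h3.mul (h2.mul (h4.mul (h1.const_mul _)))

theorem two_pi_pow_ne_zero (N : ℕ) : (2 * Real.pi : ℂ) ^ N ≠ 0 :=
  pow_ne_zero _ (mul_ne_zero two_ne_zero (by exact_mod_cast Real.pi_ne_zero))

theorem norm_two_pi_pow (N : ℕ) : ‖(2 * Real.pi : ℂ) ^ N‖ = (2 * Real.pi) ^ N := by
  rw [norm_pow, norm_mul, Complex.norm_ofNat, Complex.norm_real,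
    Real.norm_of_nonneg Real.pi_pos.le]

theorem exists_enorm_phaseCoeff_le (γ s : 𝓢(ℰ ι, ℂ)) (M : ℕ) :
    ∃ C : ℝ≥0∞, C ≠ ∞ ∧ ∀ (V : ℰ ι × ℰ ι → ℂ)
      (H : ℰ ι → ℝ≥0∞) (X : ℰ ι), (∀ z, ‖V z‖ₑ ≤ H z.2) →
      ∀ q, q.1 ∈ Set.Icc (0 : ℝ) 1 → ‖phaseCoeff γ s V X q‖ₑ ≤
        C * (ENNReal.ofReal (decayFn M (q.2.1.1 - X)) *
          (H q.2.1.2 * ENNReal.ofReal (decayFn M q.2.2))) := by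
  obtain ⟨M', C₁, hC₁, hfam⟩ := exists_hatF_prodFam_le γ M
  set N := Module.finrank ℝ (ℰ ι)
  set K : ℝ := ((2 * Real.pi) ^ N)⁻¹ * (C₁ * schwartzNorm M' s) with hK
  have hK0 : 0 ≤ K := mul_nonneg (by positivity) (mul_nonneg hC₁ (schwartzNorm_nonneg _ _))
  refine ⟨ENNReal.ofReal K, ENNReal.ofReal_ne_top, fun V H X hVH q hq => ?_⟩
  have h1 : ‖((1 - q.1 : ℝ) : ℂ)‖ₑ ≤ 1 := by
    rw [← ofReal_norm, Complex.norm_real, Real.norm_of_nonneg (by linarith [hq.2])]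
    exact ENNReal.ofReal_le_one.2 (by linarith [hq.1])
  have h2 : ‖((2 * Real.pi : ℂ) ^ N)⁻¹ * hatF (prodFam s γ q.1 (q.2.1.1 - X)) q.2.2‖ₑ ≤
      ENNReal.ofReal K * (ENNReal.ofReal (decayFn M (q.2.1.1 - X)) *
        ENNReal.ofReal (decayFn M q.2.2)) := by
    rw [← ofReal_norm, ← ENNReal.ofReal_mul (decayFn_nonneg _ _), ← ENNReal.ofReal_mul hK0]
    refine ENNReal.ofReal_le_ofReal ?_
    rw [norm_mul, norm_inv, norm_two_pi_pow, hK, mul_assoc]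
    gcongr
    exact hfam s q.1 hq (q.2.1.1 - X) q.2.2
  rw [phaseCoeff, enorm_mul, enorm_mul, enorm_mul, ← ofReal_norm (chr _ _), norm_chr,
    ENNReal.ofReal_one, one_mul]
  calc _ ≤ 1 * (H q.2.1.2 * (ENNReal.ofReal K * (ENNReal.ofReal (decayFn M (q.2.1.1 - X)) *
        ENNReal.ofReal (decayFn M q.2.2)))) := mul_le_mul' h1 (mul_le_mul' (hVH _) h2)
    _ = _ := by ring

/-- The integration over the position `x` separates from that over the remaining variables. -/
theorem lintegral_phaseMeasure {g : ℰ ι → ℝ≥0∞} (hg : Measurable g)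
    (X : ℰ ι) {Φ : ℝ × ℰ ι × ℰ ι → ℝ≥0∞}
    (hΦ : Measurable Φ) :
    ∫⁻ q, g (q.2.1.1 - X) * Φ (q.1, q.2.1.2, q.2.2) ∂(phaseMeasure ι) =
      (∫⁻ x, g x) *
        ∫⁻ q, Φ q ∂((volume.restrict (Set.Icc (0 : ℝ) 1)).prod (volume.prod volume)) := by
  have hd : Measurable fun x : ℰ ι => g (x - X) := hg.comp (measurable_sub_const X)
  have hm1 : Measurable fun q : ℝ × (ℰ ι × ℰ ι) ×
      ℰ ι => g (q.2.1.1 - X) * Φ (q.1, q.2.1.2, q.2.2) :=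
    (hd.comp (by fun_prop)).mul (hΦ.comp (by fun_prop))
  rw [phaseMeasure, lintegral_prod _ hm1.aemeasurable, lintegral_prod _ hΦ.aemeasurable,
    ← lintegral_const_mul _ hΦ.lintegral_prod_right']
  refine lintegral_congr fun t => ?_
  have hΦt : Measurable fun r : ℰ ι × ℰ ι => Φ (t, r) :=
    hΦ.comp (by fun_prop)
  have hmt : Measurable fun r : (ℰ ι × ℰ ι) ×
      ℰ ι => g (r.1.1 - X) * Φ (t, r.1.2, r.2) :=
    (hd.comp (by fun_prop)).mul (hΦ.comp (by fun_prop))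
  rw [lintegral_prod _ hmt.aemeasurable, lintegral_prod _ hΦt.aemeasurable,
    ← lintegral_sub_right_eq_self g X,
    ← lintegral_prod_mul hd.aemeasurable hΦt.lintegral_prod_right'.aemeasurable,
    ← Measure.volume_eq_prod]
  refine lintegral_congr fun z => ?_
  have hΦz : Measurable fun y => Φ (t, z.2, y) := hΦt.comp (measurable_prodMk_left (x := z.2))
  exact lintegral_const_mul (μ := volume) (g (z.1 - X)) hΦz

theorem integrable_phaseCoeff (γ s : 𝓢(ℰ ι, ℂ))
    {V : ℰ ι × ℰ ι → ℂ} {H : ℰ ι → ℝ≥0∞}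
    (X : ℰ ι) (hV : Continuous V) (hHm : Measurable H) (hH : ∫⁻ ξ, H ξ ≠ ∞)
    (hVH : ∀ z, ‖V z‖ₑ ≤ H z.2) : Integrable (phaseCoeff γ s V X) (phaseMeasure ι) := by
  obtain ⟨C, hC, hle⟩ := exists_enorm_phaseCoeff_le γ s
    (Module.finrank ℝ (ℰ ι) + 1)
  set M := Module.finrank ℝ (ℰ ι) + 1
  have hdint : ∫⁻ x : ℰ ι, ENNReal.ofReal (decayFn M x) ≠ ∞ :=
    (integrable_decayFn (Nat.lt_succ_self _) volume).lintegral_lt_top.ne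
  refine ⟨(continuous_phaseCoeff γ s hV X).aestronglyMeasurable, ?_⟩
  rw [hasFiniteIntegral_iff_enorm]
  refine (lintegral_mono_ae (ae_phaseMeasure_mem_Icc.mono (hle V H X hVH))).trans_lt ?_
  have hm2 : Measurable fun q : ℝ × ℰ ι × ℰ ι =>
      H q.2.1 * ENNReal.ofReal (decayFn M q.2.2) :=
    (hHm.comp (by fun_prop)).mul ((measurable_ofReal_decayFn M).comp (by fun_prop))
  rw [lintegral_const_mul' _ _ hC, lintegral_phaseMeasure (measurable_ofReal_decayFn M) X hm2]
  refine ENNReal.mul_lt_top hC.lt_top (ENNReal.mul_lt_top hdint.lt_top ?_)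
  have e4 := lintegral_prod_mul (μ := volume.restrict (Set.Icc (0 : ℝ) 1))
    (ν := (volume : Measure (ℰ ι)).prod (volume : Measure (ℰ ι)))
    (f := fun _ => 1) (g := fun x => H x.1 * ENNReal.ofReal (decayFn M x.2))
    aemeasurable_const ((hHm.comp measurable_fst).mul
      ((measurable_ofReal_decayFn M).comp measurable_snd)).aemeasurable
  simp only [one_mul] at e4
  rw [e4, lintegral_prod_mul hHm.aemeasurable (measurable_ofReal_decayFn M).aemeasurable]
  refine ENNReal.mul_lt_top ?_ (ENNReal.mul_lt_top hH.lt_top hdint.lt_top)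
  simp

/-- The expansion into characters with the coefficients `phaseCoeff`: for fixed `t`, `x` and `η` it
is Fourier inversion for the localised window `Y ↦ s(Y) γ(tY + X - x)`. -/
theorem mul_integral_synth_eq (γ s : 𝓢(ℰ ι, ℂ))
    {V : ℰ ι × ℰ ι → ℂ} {H : ℰ ι → ℝ≥0∞}
    (X : ℰ ι) (hV : Continuous V) (hHm : Measurable H) (hH : ∫⁻ ξ, H ξ ≠ ∞)
    (hVH : ∀ z, ‖V z‖ₑ ≤ H z.2) (Y : ℰ ι) :
    (s Y * ∫ t in Set.Icc (0 : ℝ) 1, ((1 - t : ℝ) : ℂ) * synth γ V (X + t • Y)) =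
      ∫ q, phaseCoeff γ s V X q * chr Y (-(q.1 • q.2.1.2 + q.2.2)) ∂(phaseMeasure ι) := by
  have hint : Integrable (fun q => phaseCoeff γ s V X q * chr Y (-(q.1 • q.2.1.2 + q.2.2)))
      (phaseMeasure ι) := by
    refine (integrable_phaseCoeff γ s X hV hHm hH hVH).mul_bdd (c := 1) ?_
      (ae_of_all _ fun q => (norm_chr _ _).le)
    exact (by fun_prop : Continuous fun q : ℝ × (ℰ ι × ℰ ι) ×
      ℰ ι => chr Y (-(q.1 • q.2.1.2 + q.2.2))).aestronglyMeasurable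
  unfold phaseMeasure at hint ⊢
  rw [integral_prod _ hint, ← integral_const_mul]
  refine integral_congr_ae ?_
  filter_upwards [hint.prod_right_ae] with t ht
  rw [integral_prod _ ht, synth, ← integral_const_mul, ← integral_const_mul]
  refine integral_congr_ae (ae_of_all _ fun z => ?_)
  have hinv := hatF_inversion (prodFam s γ t (z.1 - X)).continuous
    (prodFam s γ t (z.1 - X)).integrable (integrable_hatF _) Y
  simp only [phaseCoeff]
  have e : ∀ Θ, ((1 - t : ℝ) : ℂ) * (V z * (chr X (-z.2) *
      (((2 * Real.pi : ℂ) ^ Module.finrank ℝ (ℰ ι))⁻¹ *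
        hatF (prodFam s γ t (z.1 - X)) Θ))) * chr Y (-(t • z.2 + Θ)) =
      (((1 - t : ℝ) : ℂ) * (V z * (chr X (-z.2) * chr Y (-(t • z.2)))) *
          ((2 * Real.pi : ℂ) ^ Module.finrank ℝ (ℰ ι))⁻¹) *
        (chr Y (-Θ) * hatF (prodFam s γ t (z.1 - X)) Θ) := fun Θ => by
    rw [neg_add, chr_add_right]; ring
  simp only [e]
  rw [integral_const_mul, hinv, prodFam_apply, chr_add_left, chr_smul_left, smul_neg,
    show t • Y - (z.1 - X) = X + t • Y - z.1 by abel]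
  have := two_pi_pow_ne_zero (Module.finrank ℝ (ℰ ι))
  field_simp

/-- Multiplication by `s(Y) ∫_0^1 (1 - t) b(X + tY) dt`, where `b` is synthesised from a function
`V` dominated by `H` in the dual variable, is controlled by `phaseOp H` on the Fourier side,
uniformly in `X`. -/
theorem exists_enorm_hatF_mul_le (γ s : 𝓢(ℰ ι, ℂ)) {M : ℕ}
    (hM : Module.finrank ℝ (ℰ ι) < M) : ∃ C : ℝ≥0∞, C ≠ ∞ ∧
    ∀ (V : ℰ ι × ℰ ι → ℂ) (H : ℰ ι → ℝ≥0∞)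
      (X : ℰ ι) (u : ℰ ι → ℂ) (k : ℰ ι → ℝ≥0∞),
      Continuous V → Measurable H → ∫⁻ ξ, H ξ ≠ ∞ → (∀ z, ‖V z‖ₑ ≤ H z.2) → Integrable u →
      Measurable k → (∀ ξ, ‖hatF u ξ‖ₑ ≤ k ξ) → ∀ ξ,
      ‖hatF (fun Y => u Y * (s Y * ∫ t in Set.Icc (0 : ℝ) 1,
        ((1 - t : ℝ) : ℂ) * synth γ V (X + t • Y))) ξ‖ₑ ≤ C * phaseOp H M k ξ := by
  obtain ⟨K, hK, hle⟩ := exists_enorm_phaseCoeff_le γ s M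
  have hdint : ∫⁻ x : ℰ ι, ENNReal.ofReal (decayFn M x) ≠ ∞ :=
    (integrable_decayFn hM volume).lintegral_lt_top.ne
  refine ⟨K * ∫⁻ x : ℰ ι, ENNReal.ofReal (decayFn M x),
    ENNReal.mul_ne_top hK hdint, ?_⟩
  intro V H X u k hV hHm hH hVH hu hk huk ξ
  rw [hatF_mul_of_superposition (integrable_phaseCoeff γ s X hV hHm hH hVH)
    (p := fun q => q.1 • q.2.1.2 + q.2.2) (by fun_prop)
    (mul_integral_synth_eq γ s X hV hHm hH hVH) hu]
  refine (enorm_integral_le_lintegral_enorm _).trans ?_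
  calc _ ≤ ∫⁻ q, K * (ENNReal.ofReal (decayFn M (q.2.1.1 - X)) *
        (H q.2.1.2 * ENNReal.ofReal (decayFn M q.2.2) * k (ξ - (q.1 • q.2.1.2 + q.2.2))))
        ∂(phaseMeasure ι) := by
        refine lintegral_mono_ae (ae_phaseMeasure_mem_Icc.mono fun q hq => ?_)
        rw [enorm_mul]
        exact (mul_le_mul' (hle V H X hVH q hq) (huk _)).trans_eq (by ring)
    _ = _ := by
        have hm3 : Measurable fun q : ℝ × ℰ ι × ℰ ι =>
            H q.2.1 * ENNReal.ofReal (decayFn M q.2.2) * k (ξ - (q.1 • q.2.1 + q.2.2)) :=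
          (measurable_phaseOp_integrand hHm M hk).comp
            (by fun_prop : Measurable fun q => (ξ, q))
        rw [lintegral_const_mul' _ _ hK, mul_assoc, phaseOp,
          ← lintegral_phaseMeasure (measurable_ofReal_decayFn M) X hm3]

end PhaseOperator

/-! ### Second order Taylor expansion in coordinates -/

section Taylor

variable {ι : Type} [Fintype ι] [DecidableEq ι]

theorem fderiv_apply_eq_sum (φ : ℰ ι → ℝ) (X Y : ℰ ι) :
    fderiv ℝ φ X Y = ∑ i, Y i * pderivAt i φ X := by
  have h := (EuclideanSpace.basisFun ι ℝ).sum_repr Y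
  conv_lhs => rw [← h]
  simp [map_sum, pderivAt]

theorem inner_gradVec (φ : ℰ ι → ℝ) (X Y : ℰ ι) :
    inner ℝ Y (gradVec φ X) = fderiv ℝ φ X Y := by
  rw [fderiv_apply_eq_sum, PiLp.inner_apply]
  refine Finset.sum_congr rfl fun i _ => ?_
  simp [gradVec, mul_comm]

theorem contDiff_pderivAt {φ : ℰ ι → ℝ} (hφ : ContDiff ℝ 2 φ) (i : ι) :
    ContDiff ℝ 1 (pderivAt i φ) :=
  (hφ.fderiv_right (m := 1) (by norm_num)).clm_apply contDiff_const

theorem continuous_pderiv2 {φ : ℰ ι → ℝ} (hφ : ContDiff ℝ 2 φ) (i j : ι) :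
    Continuous (pderiv2 i j φ) :=
  ((contDiff_pderivAt hφ j).continuous_fderiv one_ne_zero).clm_apply continuous_const

theorem pderiv2_comm {φ : ℰ ι → ℝ} (hφ : ContDiff ℝ 2 φ) (i j : ι)
    (X : ℰ ι) : pderiv2 i j φ X = pderiv2 j i φ X := by
  have hd : DifferentiableAt ℝ (fderiv ℝ φ) X :=
    ((hφ.fderiv_right (m := 1) (by norm_num)).differentiable one_ne_zero) X
  have key : ∀ i j, pderiv2 i j φ X = fderiv ℝ (fderiv ℝ φ) X (EuclideanSpace.single i 1)
      (EuclideanSpace.single j 1) := fun i j => by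
    have h1 : pderivAt j φ = fun X => fderiv ℝ φ X (EuclideanSpace.single j 1) := rfl
    rw [pderiv2, pderivAt, h1, fderiv_clm_apply hd (by fun_prop)]
    simp
  rw [key, key]
  exact (hφ.contDiffAt.isSymmSndFDerivAt (by simp)) _ _

/-- The second order Taylor remainder of `φ` at `X`. -/
noncomputable def taylorRem (φ : ℰ ι → ℝ) (X Y : ℰ ι) : ℝ :=
  φ (X + Y) - φ X - fderiv ℝ φ X Y

omit [DecidableEq ι] in
theorem continuous_taylorRem {φ : ℰ ι → ℝ} (hφ : ContDiff ℝ 2 φ)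
    (X : ℰ ι) : Continuous (taylorRem φ X) := by
  have := hφ.continuous
  unfold taylorRem
  fun_prop

/-- Taylor's formula with integral remainder of second order. -/
theorem taylorRem_eq_integral {φ : ℰ ι → ℝ} (hφ : ContDiff ℝ 2 φ)
    (X Y : ℰ ι) : taylorRem φ X Y =
      ∫ t in Set.Icc (0 : ℝ) 1, (1 - t) * ∑ j, Y j * ∑ i, Y i * pderiv2 i j φ (X + t • Y) := by
  have hline : ∀ t : ℝ, HasDerivAt (fun t : ℝ => X + t • Y) Y t := fun t => by
    simpa using ((hasDerivAt_id t).smul_const Y).const_add X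
  have h1 : ∀ t : ℝ, HasDerivAt (fun t : ℝ => φ (X + t • Y)) (fderiv ℝ φ (X + t • Y) Y) t :=
    fun t => ((hφ.differentiable two_ne_zero) _).hasFDerivAt.comp_hasDerivAt t (hline t)
  have h2 : ∀ (j : ι) (t : ℝ), HasDerivAt (fun t : ℝ => pderivAt j φ (X + t • Y))
      (∑ i, Y i * pderiv2 i j φ (X + t • Y)) t := fun j t => by
    have := (((contDiff_pderivAt hφ j).differentiable one_ne_zero) _).hasFDerivAt.comp_hasDerivAt
      t (hline t)
    rwa [fderiv_apply_eq_sum] at this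
  have h3 : ∀ t : ℝ, HasDerivAt (fun t : ℝ => fderiv ℝ φ (X + t • Y) Y)
      (∑ j, Y j * ∑ i, Y i * pderiv2 i j φ (X + t • Y)) t := fun t => by
    simp only [fun t => fderiv_apply_eq_sum φ (X + t • Y) Y]
    exact HasDerivAt.fun_sum fun j _ => (h2 j t).const_mul (Y j)
  -- an antiderivative of the integrand
  have h4 : ∀ t : ℝ, HasDerivAt
      (fun t : ℝ => φ (X + t • Y) + (1 - t) * fderiv ℝ φ (X + t • Y) Y)
      ((1 - t) * ∑ j, Y j * ∑ i, Y i * pderiv2 i j φ (X + t • Y)) t := fun t => by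
    have h5 : HasDerivAt (fun t : ℝ => 1 - t) (-1) t := by
      simpa using (hasDerivAt_id t).const_sub 1
    refine ((h1 t).add (h5.mul (h3 t))).congr_deriv ?_
    ring
  have hcont : Continuous fun t : ℝ => (1 - t) * ∑ j, Y j * ∑ i, Y i * pderiv2 i j φ (X + t • Y) := by
    have := fun i j => continuous_pderiv2 hφ i j
    fun_prop
  have h6 := intervalIntegral.integral_eq_sub_of_hasDerivAt (a := 0) (b := 1)
    (fun t _ => h4 t) (hcont.intervalIntegrable 0 1)
  rw [intervalIntegral.integral_of_le zero_le_one] at h6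
  rw [integral_Icc_eq_integral_Ioc, h6, taylorRem]
  simp
  ring

end Taylor

section ExpSeries

variable {V : Type*} [NormedAddCommGroup V] [InnerProductSpace ℝ V] [FiniteDimensional ℝ V]
  [MeasurableSpace V] [BorelSpace V]

/-- Bound of the Fourier transform of `χ e^{iψ}` by expansion of the exponential. -/
theorem enorm_hatF_mul_exp_le {χ : V → ℂ} (hχ : Continuous χ) (hχc : HasCompactSupport χ)
    {ψ : V → ℝ} (hψ : Continuous ψ) {k : ℕ → V → ℝ≥0∞}
    (hk : ∀ j ξ, ‖hatF (fun Y => χ Y * (ψ Y : ℂ) ^ j) ξ‖ₑ ≤ k j ξ) (ξ : V) :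
    ‖hatF (fun Y => χ Y * Complex.exp (Complex.I * (ψ Y : ℂ))) ξ‖ₑ ≤
      ∑' j, ((j.factorial : ℝ≥0∞))⁻¹ * k j ξ := by
  obtain ⟨R, hR⟩ : ∃ R : ℝ, ∀ Y ∈ tsupport χ, ‖ψ Y‖ ≤ R :=
    hχc.exists_bound_of_continuousOn hψ.continuousOn
  have hR' : ∀ (j : ℕ) Y, ‖χ Y * (ψ Y : ℂ) ^ j‖ ≤ ‖χ Y‖ * |R| ^ j := fun j Y => by
    by_cases hY : Y ∈ tsupport χ
    · rw [norm_mul, norm_pow, Complex.norm_real]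
      gcongr
      exact (hR Y hY).trans (le_abs_self R)
    · simp [image_eq_zero_of_notMem_tsupport hY]
  have hint : ∀ j : ℕ, Integrable fun Y => χ Y * (ψ Y : ℂ) ^ j := fun j =>
    (by fun_prop : Continuous fun Y => χ Y * (ψ Y : ℂ) ^ j).integrable_of_hasCompactSupport
      hχc.mul_right
  have hχint : Integrable χ := hχ.integrable_of_hasCompactSupport hχc
  have hsum := hasSum_integral_of_summable_integral_norm (μ := volume)
    (F := fun (j : ℕ) Y => chr Y ξ * (χ Y * (ψ Y : ℂ) ^ j) * (Complex.I ^ j / (j.factorial : ℂ)))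
    (fun j => (integrable_chr_mul (hint j) ξ).mul_const _) ?_
  · have e1 : ∀ Y, ∑' j : ℕ, chr Y ξ * (χ Y * (ψ Y : ℂ) ^ j) * (Complex.I ^ j / (j.factorial : ℂ)) =
        chr Y ξ * (χ Y * Complex.exp (Complex.I * (ψ Y : ℂ))) := fun Y => by
      have := (NormedSpace.expSeries_div_hasSum_exp (Complex.I * (ψ Y : ℂ))).mul_left
        (chr Y ξ * χ Y)
      rw [← Complex.exp_eq_exp_ℂ] at this
      rw [← mul_assoc, ← this.tsum_eq]
      refine tsum_congr fun j => ?_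
      rw [mul_pow]; ring
    have e2 : ∑' j : ℕ, (∫ Y, chr Y ξ * (χ Y * (ψ Y : ℂ) ^ j) * (Complex.I ^ j / (j.factorial : ℂ))) =
        hatF (fun Y => χ Y * Complex.exp (Complex.I * (ψ Y : ℂ))) ξ := by
      rw [hsum.tsum_eq]
      simp only [e1, hatF]
    rw [← e2]
    refine enorm_tsum_le_tsum_enorm.trans (ENNReal.tsum_le_tsum fun j => ?_)
    rw [integral_mul_const, enorm_mul, mul_comm]
    refine mul_le_mul' (le_of_eq ?_) (hk j ξ)
    rw [← ofReal_norm, norm_div, norm_pow, Complex.norm_I, one_pow, one_div,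
      Complex.norm_natCast, ENNReal.ofReal_inv_of_pos (by positivity), ENNReal.ofReal_natCast]
  · have hs : Summable fun j : ℕ => (∫ Y, ‖χ Y‖) * (|R| ^ j / (j.factorial : ℝ)) :=
      (Real.summable_pow_div_factorial |R|).mul_left _
    refine Summable.of_nonneg_of_le (fun j => by positivity) (fun j => ?_) hs
    rw [← integral_mul_const]
    refine integral_mono ((integrable_chr_mul (hint j) ξ).mul_const _).norm
      (hχint.norm.mul_const _) fun Y => ?_
    simp only []
    rw [norm_mul, norm_mul, norm_chr, one_mul, norm_div, norm_pow Complex.I, Complex.norm_I,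
      one_pow, Complex.norm_natCast, ← mul_div_assoc, mul_one, ← mul_div_assoc]
    gcongr
    exact hR' j Y

end ExpSeries

/-! ### Bounds for phase functions with second derivatives in `M^{∞,1}` -/

section PhaseBound

variable {ι : Type} [Fintype ι]

theorem IsContWeight.lintegral_decayFn_mul_ne_top {w : ℰ ι → ℝ} {k M : ℕ}
    (hw : IsContWeight w k) (hM : Module.finrank ℝ (ℰ ι) < M) :
    ∫⁻ ξ, ENNReal.ofReal (decayFn (k + M) ξ) * ENNReal.ofReal (w ξ) ≠ ∞ := by
  have h1 := ((integrable_decayFn hM volume).const_mul (w 0)).lintegral_lt_top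
  refine (lt_of_le_of_lt (lintegral_mono fun ξ => ?_) h1).ne
  rw [← ENNReal.ofReal_mul (decayFn_nonneg _ _)]
  refine ENNReal.ofReal_le_ofReal ?_
  calc decayFn (k + M) ξ * w ξ ≤ decayFn (k + M) ξ * (w 0 * (1 + ‖ξ‖) ^ k) :=
        mul_le_mul_of_nonneg_left (hw.le_zero ξ) (decayFn_nonneg _ _)
    _ = w 0 * ((1 + ‖ξ‖) ^ k * decayFn (k + M) ξ) := by ring
    _ = w 0 * decayFn M ξ := by rw [pow_mul_decayFn_add]

omit [Fintype ι] in
theorem sliceSup_one_mul (V : ℰ ι × ℰ ι → ℂ)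
    (w : ℰ ι → ℝ) (ξ : ℰ ι) :
    sliceSup V (fun _ => 1) ξ * ENNReal.ofReal (w ξ) = sliceSup V (fun z => w z.2) ξ := by
  simp [sliceSup, ENNReal.iSup_mul]

variable [DecidableEq ι]

/-- The second derivatives of `φ` are given by distributions in `M^{∞,1}` whose norms nearly
attain the infima in the definition of `hessNorm`. -/
theorem exists_isGivenBy_of_hessNorm_lt_top {χ : 𝓢(ℰ ι, ℂ)}
    {v : ℰ ι × ℰ ι → ℝ} {φ : ℰ ι → ℝ}
    (h : hessNorm χ v φ < ∞) : ∃ u : ι → ι → 𝓢'(ℰ ι, ℂ),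
      (∀ i j, IsGivenBy (u i j) fun X => (pderiv2 i j φ X : ℂ)) ∧
      ∑ i, ∑ j, modNorm χ v ∞ 1 (u i j) ≤ hessNorm χ v φ + (Fintype.card ι : ℝ≥0∞) ^ 2 := by
  -- the infimum need not be attained, which costs `1` for each derivative
  have h1 : ∀ i j, ∃ u : 𝓢'(ℰ ι, ℂ), IsGivenBy u (fun X => (pderiv2 i j φ X : ℂ)) ∧
      modNorm χ v ∞ 1 u ≤ modNormFun χ v ∞ 1 (fun X => (pderiv2 i j φ X : ℂ)) + 1 := by
    intro i j
    have hfin : modNormFun χ v ∞ 1 (fun X => (pderiv2 i j φ X : ℂ)) < ∞ := by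
      refine lt_of_le_of_lt ?_ h
      refine le_trans ?_ (Finset.single_le_sum (f := fun i => ∑ j, modNormFun χ v ∞ 1
        (fun X => (pderiv2 i j φ X : ℂ))) (fun _ _ => zero_le) (Finset.mem_univ i))
      exact Finset.single_le_sum (f := fun j => modNormFun χ v ∞ 1
        (fun X => (pderiv2 i j φ X : ℂ))) (fun _ _ => zero_le) (Finset.mem_univ j)
    have hlt : modNormFun χ v ∞ 1 (fun X => (pderiv2 i j φ X : ℂ)) <
        modNormFun χ v ∞ 1 (fun X => (pderiv2 i j φ X : ℂ)) + 1 :=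
      ENNReal.lt_add_right hfin.ne one_ne_zero
    conv_lhs at hlt => unfold modNormFun
    simp only [iInf_lt_iff] at hlt
    obtain ⟨u, hu, hlt⟩ := hlt
    exact ⟨u, hu, hlt.le⟩
  choose u hu hle using h1
  refine ⟨u, hu, ?_⟩
  calc _ ≤ ∑ i, ∑ j, (modNormFun χ v ∞ 1 (fun X => (pderiv2 i j φ X : ℂ)) + 1) :=
        Finset.sum_le_sum fun i _ => Finset.sum_le_sum fun j _ => hle i j
    _ = _ := by
        simp only [Finset.sum_add_distrib, hessNorm]
        simp [sq]

/-- The conditions on a submultiplicative weight on the dual space. -/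
structure IsSubWeight (w : ℰ ι → ℝ) (k : ℕ) (A : ℝ) : Prop extends
    IsContWeight w k where
  sub : ∀ x y, w (x + y) ≤ A * w x * w y
  scale : ∀ t ∈ Set.Icc (0 : ℝ) 1, ∀ x, w (t • x) ≤ A * w x

namespace IsSubWeight

omit [DecidableEq ι] in
theorem A_pos {w : ℰ ι → ℝ} {k : ℕ} {A : ℝ} (hw : IsSubWeight w k A) : 0 < A := by
  have h0 := hw.pos 0
  have := hw.scale 1 (by simp) 0
  rw [smul_zero] at this
  by_contra hA
  have := mul_nonpos_of_nonpos_of_nonneg (not_lt.1 hA) h0.le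
  linarith

omit [DecidableEq ι] in
/-- The scaling condition with `t = 0` shows that the weight is bounded from below. -/
theorem one_le_mul {w : ℰ ι → ℝ} {k : ℕ} {A : ℝ} (hw : IsSubWeight w k A)
    (ξ : ℰ ι) : 1 ≤ ENNReal.ofReal (A / w 0) * ENNReal.ofReal (w ξ) := by
  have h0 := hw.pos 0
  have := hw.scale 0 (by simp) ξ
  rw [zero_smul] at this
  rw [← ENNReal.ofReal_mul (div_nonneg hw.A_pos.le h0.le), ← ENNReal.ofReal_one]
  refine ENNReal.ofReal_le_ofReal ?_
  rw [div_mul_eq_mul_div, one_le_div h0]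
  exact this

end IsSubWeight

/-- The suprema of the short-time Fourier transforms of the second derivatives. -/
theorem exists_slice_of_hessNorm_lt_top {χ : 𝓢(ℰ ι, ℂ)}
    {v : ℰ ι × ℰ ι → ℝ} (hv : ∀ z, 0 ≤ v z)
    {w : ℰ ι → ℝ} {k : ℕ} {A B : ℝ} (hw : IsSubWeight w k A) (hB : 0 ≤ B)
    (hvw : ∀ z, w z.2 ≤ B * v z)
    {φ : ℰ ι → ℝ} (h : hessNorm χ v φ < ∞) :
    ∃ (u : ι → ι → 𝓢'(ℰ ι, ℂ)) (H : ℰ ι → ℝ≥0∞),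
      (∀ i j, IsGivenBy (u i j) fun X => (pderiv2 i j φ X : ℂ)) ∧ Measurable H ∧
      (∀ i j z, ‖stft₀ χ (u i j) z‖ₑ ≤ H z.2) ∧ ∫⁻ ξ, H ξ ≠ ∞ ∧
      ∫⁻ ξ, H ξ * ENNReal.ofReal (w ξ) ≤ ENNReal.ofReal (B * (stftConst ι)⁻¹) *
        (hessNorm χ v φ + (Fintype.card ι : ℝ≥0∞) ^ 2) := by
  obtain ⟨u, hu, hle⟩ := exists_isGivenBy_of_hessNorm_lt_top h
  have hmeas : ∀ i j, Measurable (sliceSup (stft₀ χ (u i j)) fun _ => 1) := fun i j =>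
    measurable_sliceSup (continuous_stft₀ χ _) continuous_const
  have hwm : Measurable fun ξ => ENNReal.ofReal (w ξ) :=
    (ENNReal.continuous_ofReal.comp hw.cont).measurable
  have hHm : Measurable fun ξ => ∑ i, ∑ j, sliceSup (stft₀ χ (u i j)) (fun _ => 1) ξ :=
    Finset.measurable_sum _ fun i _ => Finset.measurable_sum _ fun j _ => hmeas i j
  have hbd : ∫⁻ ξ, (∑ i, ∑ j, sliceSup (stft₀ χ (u i j)) (fun _ => 1) ξ) * ENNReal.ofReal (w ξ) ≤
      ENNReal.ofReal (B * (stftConst ι)⁻¹) *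
        (hessNorm χ v φ + (Fintype.card ι : ℝ≥0∞) ^ 2) := by
    refine le_trans ?_ (mul_le_mul_right hle _)
    simp only [Finset.sum_mul, sliceSup_one_mul, Finset.mul_sum]
    have hm2 : ∀ i j, Measurable (sliceSup (stft₀ χ (u i j)) fun z => w z.2) := fun i j =>
      measurable_sliceSup (continuous_stft₀ χ _) (hw.cont.comp continuous_snd)
    rw [lintegral_finsetSum _ fun i _ => Finset.measurable_sum _ fun j _ => hm2 i j]
    refine Finset.sum_le_sum fun i _ => ?_
    rw [lintegral_finsetSum _ fun j _ => hm2 i j]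
    refine Finset.sum_le_sum fun j _ => ?_
    exact lintegral_sliceSup_le (hw.cont.comp continuous_snd) hvw hB hv χ (u i j)
  refine ⟨u, _, hu, hHm, fun i j z => ?_, ?_, hbd⟩
  · have h1 := le_sliceSup (stft₀ χ (u i j)) (fun _ => 1) z
    rw [ENNReal.ofReal_one, mul_one] at h1
    refine h1.trans (le_trans ?_ (Finset.single_le_sum (f := fun i => ∑ j,
      sliceSup (stft₀ χ (u i j)) (fun _ => 1) z.2) (fun _ _ => zero_le) (Finset.mem_univ i)))
    exact Finset.single_le_sum (f := fun j => sliceSup (stft₀ χ (u i j)) (fun _ => 1) z.2)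
      (fun _ _ => zero_le) (Finset.mem_univ j)
  · have h2 : ∫⁻ ξ, (∑ i, ∑ j, sliceSup (stft₀ χ (u i j)) (fun _ => 1) ξ) ≤
        ENNReal.ofReal (A / w 0) * ∫⁻ ξ, (∑ i, ∑ j, sliceSup (stft₀ χ (u i j)) (fun _ => 1) ξ) *
          ENNReal.ofReal (w ξ) := by
      have hHwm : Measurable fun ξ => (∑ i, ∑ j, sliceSup (stft₀ χ (u i j)) (fun _ => 1) ξ) *
        ENNReal.ofReal (w ξ) := hHm.mul hwm
      rw [← lintegral_const_mul _ hHwm]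
      refine lintegral_mono fun ξ => ?_
      calc _ = (∑ i, ∑ j, sliceSup (stft₀ χ (u i j)) (fun _ => 1) ξ) * 1 := (mul_one _).symm
        _ ≤ _ := mul_le_mul_right (hw.one_le_mul ξ) _
        _ = _ := by ring
    refine (h2.trans (mul_le_mul_right hbd _)).trans_lt ?_ |>.ne
    refine ENNReal.mul_lt_top ENNReal.ofReal_lt_top (ENNReal.mul_lt_top ENNReal.ofReal_lt_top ?_)
    exact ENNReal.add_lt_top.2 ⟨h, by simp⟩

/-- Functions in `M^{∞,1}` are bounded and uniformly continuous. -/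
theorem pderiv2_bounded_uniformContinuous {χ : 𝓢(ℰ ι, ℂ)} (hχ : χ ≠ 0)
    {v : ℰ ι × ℰ ι → ℝ} (hv : ∀ z, 0 ≤ v z)
    {w : ℰ ι → ℝ} {k : ℕ} {A B : ℝ} (hw : IsSubWeight w k A) (hB : 0 ≤ B)
    (hvw : ∀ z, w z.2 ≤ B * v z) {φ : ℰ ι → ℝ} (hφ : ContDiff ℝ 2 φ)
    (h : hessNorm χ v φ < ∞) (i j : ι) :
    (∃ C, ∀ X, ‖pderiv2 i j φ X‖ ≤ C) ∧ UniformContinuous (pderiv2 i j φ) := by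
  obtain ⟨γ, -, hγ⟩ := exists_windowPairing_ne_zero hχ
  obtain ⟨u, H, hu, hHm, hVH, hH, -⟩ := exists_slice_of_hessNorm_lt_top hv hw hB hvw h
  set c : ℂ := (2 * Real.pi : ℂ) ^ (Module.finrank ℝ (ℰ ι)) * windowPairing χ γ
  have hc : c ≠ 0 := mul_ne_zero (two_pi_pow_ne_zero _) hγ
  have hrep : ∀ X, (pderiv2 i j φ X : ℂ) = c⁻¹ * synth γ (stft₀ χ (u i j)) X := fun X => by
    rw [eq_inv_mul_iff_mul_eq₀ hc]
    exact synth_stft₀_eq (Complex.continuous_ofReal.comp (continuous_pderiv2 hφ i j)) (hu i j)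
      hHm hH (hVH i j) X
  constructor
  · obtain ⟨C, hC⟩ := exists_norm_synth_le γ hHm hH (hVH i j)
    refine ⟨‖c⁻¹‖ * C, fun X => ?_⟩
    rw [← Complex.norm_real, hrep, norm_mul]
    gcongr
    exact hC X
  · have h1 := (uniformContinuous_synth γ (continuous_stft₀ χ (u i j)) hHm hH (hVH i j)).const_mul'
      c⁻¹
    have h2 : pderiv2 i j φ = fun X => (c⁻¹ * synth γ (stft₀ χ (u i j)) X).re := by
      funext X
      rw [← hrep, Complex.ofReal_re]
    rw [h2]
    exact Complex.reCLM.uniformContinuous.comp h1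

/-- The fundamental estimate for the oscillating factor: the Fourier transform of
`e^{iφ} χ₂(· - X)` is concentrated near the frequency `φ'(X)`, uniformly in `X`, with a
concentration depending exponentially on the norm of the second derivatives of `φ`. -/
theorem exists_phase_bound {χ : 𝓢(ℰ ι, ℂ)} (hχ : χ ≠ 0)
    {v : ℰ ι × ℰ ι → ℝ} (hv : ∀ z, 0 ≤ v z)
    {w : ℰ ι → ℝ} {k : ℕ} {A B : ℝ} (hw : IsSubWeight w k A) (hB : 0 ≤ B)
    (hvw : ∀ z, w z.2 ≤ B * v z) (χ₂ : 𝓢(ℰ ι, ℂ)) (hχ₂ : HasCompactSupport χ₂) :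
    ∃ C : ℝ, 0 < C ∧ ∀ φ : ℰ ι → ℝ, ContDiff ℝ 2 φ → hessNorm χ v φ < ∞ →
      ∃ h : ℰ ι → ℝ≥0∞, Measurable h ∧
        ∫⁻ ξ, h ξ * ENNReal.ofReal (w ξ) ≤
          ENNReal.ofReal (C * Real.exp (C * (hessNorm χ v φ).toReal)) ∧
        ∀ X Θ, ‖hatF (fun Y => Complex.exp (Complex.I * (φ Y : ℂ)) * χ₂ (Y - X)) Θ‖ₑ ≤
          h (Θ - gradVec φ X) := by
  obtain ⟨γ, -, hγ⟩ := exists_windowPairing_ne_zero hχ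
  set c : ℂ := (2 * Real.pi : ℂ) ^ (Module.finrank ℝ (ℰ ι)) * windowPairing χ γ
    with hcdef
  have hc : c ≠ 0 := mul_ne_zero (two_pi_pow_ne_zero _) hγ
  -- a cut-off function equal to one on the support of `χ₂`
  obtain ⟨R, hR, hsupp⟩ : ∃ R : ℝ, 0 < R ∧ tsupport χ₂ ⊆ Metric.closedBall 0 R := by
    obtain ⟨R, hR⟩ := hχ₂.isBounded.subset_closedBall 0
    exact ⟨max R 1, by positivity, hR.trans (Metric.closedBall_subset_closedBall (le_max_left _ _))⟩
  let χ₃ : ContDiffBump (0 : ℰ ι) := ⟨R, R + 1, hR, by linarith⟩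
  have hs₀ : ∀ i j : ι, ∃ s : 𝓢(ℰ ι, ℂ), ∀ Y, s Y = (χ₃ Y * (Y j * Y i) : ℝ) := by
    intro i j
    have hcs : HasCompactSupport fun Y : ℰ ι => ((χ₃ Y * (Y j * Y i) : ℝ) : ℂ) :=
      (χ₃.hasCompactSupport.mul_right (f' := fun Y : ℰ ι => Y j * Y i)).comp_left
        Complex.ofReal_zero
    have hsm : ContDiff ℝ ((⊤ : ℕ∞) : WithTop ℕ∞)
        fun Y : ℰ ι => ((χ₃ Y * (Y j * Y i) : ℝ) : ℂ) :=
      Complex.ofRealCLM.contDiff.comp (χ₃.contDiff.mul (by fun_prop))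
    exact ⟨hcs.toSchwartzMap hsm, fun Y => rfl⟩
  choose s hs using hs₀
  -- decay of this order compensates the growth of the weight and is integrable
  obtain ⟨M, hM⟩ : ∃ M, M = k + (Module.finrank ℝ (ℰ ι) + 1) := ⟨_, rfl⟩
  have hMN : Module.finrank ℝ (ℰ ι) < M := by omega
  have hstep := fun i j => exists_enorm_hatF_mul_le γ (s i j) hMN
  choose K hK hstep using hstep
  obtain ⟨K₁, hK₁⟩ : ∃ K₁ : ℝ≥0∞, K₁ = ‖c⁻¹‖ₑ * ∑ j, ∑ i, K i j := ⟨_, rfl⟩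
  have hK₁t : K₁ ≠ ∞ := by
    rw [hK₁]
    exact ENNReal.mul_ne_top enorm_ne_top (ENNReal.sum_ne_top.2 fun j _ =>
      ENNReal.sum_ne_top.2 fun i _ => hK i j)
  have hDt : ∫⁻ Θ : ℰ ι, ENNReal.ofReal (decayFn M Θ) * ENNReal.ofReal (w Θ) ≠ ∞ := by
    rw [hM]; exact hw.lintegral_decayFn_mul_ne_top (Nat.lt_succ_self _)
  obtain ⟨D, hD⟩ : ∃ D : ℝ≥0∞, D = ∫⁻ Θ : ℰ ι,
    ENNReal.ofReal (decayFn M Θ) * ENNReal.ofReal (w Θ) := ⟨_, rfl⟩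
  have hwm : Measurable fun ξ => ENNReal.ofReal (w ξ) :=
    (ENNReal.continuous_ofReal.comp hw.cont).measurable
  -- the Fourier transform of `χ₂`
  obtain ⟨k₀, hk₀⟩ : ∃ k₀ : ℰ ι → ℝ≥0∞, k₀ = fun ξ => ‖hatF χ₂ ξ‖ₑ := ⟨_, rfl⟩
  have hk₀m : Measurable k₀ := by
    rw [hk₀]; exact (continuous_hatF χ₂.integrable).enorm.measurable
  have hk₀t : ∫⁻ ξ, k₀ ξ * ENNReal.ofReal (w ξ) ≠ ∞ := by
    obtain ⟨M', C', hC', hdec⟩ := exists_hatF_decay (V := ℰ ι) M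
    have hle : ∀ ξ, k₀ ξ * ENNReal.ofReal (w ξ) ≤ ENNReal.ofReal (C' * schwartzNorm M' χ₂) *
        (ENNReal.ofReal (decayFn M ξ) * ENNReal.ofReal (w ξ)) := fun ξ => by
      rw [← mul_assoc, ← ENNReal.ofReal_mul (mul_nonneg hC' (schwartzNorm_nonneg _ _)), hk₀]
      refine mul_le_mul_left ?_ _
      simp only []
      rw [← ofReal_norm]
      exact ENNReal.ofReal_le_ofReal (hdec χ₂ ξ)
    refine ((lintegral_mono hle).trans_lt ?_).ne
    rw [lintegral_const_mul' _ _ ENNReal.ofReal_ne_top]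
    exact ENNReal.mul_lt_top ENNReal.ofReal_lt_top hDt.lt_top
  -- the constants of the exponential bound
  obtain ⟨a₀, ha₀⟩ : ∃ a₀ : ℝ, a₀ = (∫⁻ ξ, k₀ ξ * ENNReal.ofReal (w ξ)).toReal := ⟨_, rfl⟩
  obtain ⟨b, hb⟩ : ∃ b : ℝ, b = (K₁ * (ENNReal.ofReal A ^ 3 *
    ENNReal.ofReal (B * (stftConst ι)⁻¹) * D)).toReal := ⟨_, rfl⟩
  have ha₀0 : 0 ≤ a₀ := by rw [ha₀]; exact ENNReal.toReal_nonneg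
  have hb0 : 0 ≤ b := by rw [hb]; exact ENNReal.toReal_nonneg
  have hbt : K₁ * (ENNReal.ofReal A ^ 3 * ENNReal.ofReal (B * (stftConst ι)⁻¹) * D) =
      ENNReal.ofReal b := by
    rw [hb, ENNReal.ofReal_toReal]
    refine ENNReal.mul_ne_top hK₁t (ENNReal.mul_ne_top (ENNReal.mul_ne_top
      (ENNReal.pow_ne_top ENNReal.ofReal_ne_top) ENNReal.ofReal_ne_top) ?_)
    rw [hD]; exact hDt
  refine ⟨(a₀ + 1) * Real.exp (b * (Fintype.card ι : ℝ) ^ 2) + b, by positivity,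
    fun φ hφ hhess => ?_⟩
  obtain ⟨u, H, hu, hHm, hVH, hH, hHw⟩ := exists_slice_of_hessNorm_lt_top hv hw hB hvw hhess
  -- `kk j` dominates the Fourier transform of `χ₂ R_X ^ j`, where `R_X` is the Taylor remainder at
  -- `X`: each power of `R_X` costs one application of `phaseOp H`, uniformly in `X`
  let kk : ℕ → ℰ ι → ℝ≥0∞ := fun j => (fun f ξ => K₁ * phaseOp H M f ξ)^[j] k₀
  have hkk0 : kk 0 = k₀ := rfl
  have hkks : ∀ j, kk (j + 1) = fun ξ => K₁ * phaseOp H M (kk j) ξ := fun j =>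
    Function.iterate_succ_apply' _ _ _
  have hkkm : ∀ j, Measurable (kk j) := fun j => by
    induction j with
    | zero => rw [hkk0]; exact hk₀m
    | succ j ih => rw [hkks]; exact (measurable_phaseOp hHm M ih).const_mul _
  have hcont2 := fun i j => continuous_pderiv2 hφ i j
  -- the pointwise bounds
  have hpow : ∀ X (j : ℕ) ξ, ‖hatF (fun Y => χ₂ Y * (taylorRem φ X Y : ℂ) ^ j) ξ‖ₑ ≤ kk j ξ := by
    intro X j
    induction j with
    | zero => intro ξ; simp [hkk0, hk₀]
    | succ n ih =>
      intro ξ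
      let m : ι → ι → ℰ ι → ℂ := fun j i Y => s i j Y *
        ∫ t in Set.Icc (0 : ℝ) 1, ((1 - t : ℝ) : ℂ) * synth γ (stft₀ χ (u i j)) (X + t • Y)
      have hm : ∀ j i, Continuous (m j i) := fun j i => by
        refine (s i j).continuous.mul ?_
        have hsy := (uniformContinuous_synth γ (continuous_stft₀ χ (u i j)) hHm hH
          (hVH i j)).continuous
        have hsy' : Continuous fun q : ℰ ι × ℝ =>
            ((1 - q.2 : ℝ) : ℂ) * synth γ (stft₀ χ (u i j)) (X + q.2 • q.1) := by fun_prop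
        exact continuous_parametric_integral_of_continuous (f := fun Y t =>
          ((1 - t : ℝ) : ℂ) * synth γ (stft₀ χ (u i j)) (X + t • Y)) hsy' isCompact_Icc
      have htr := continuous_taylorRem hφ X
      have hu₀ : Continuous fun Y => χ₂ Y * (taylorRem φ X Y : ℂ) ^ n := by fun_prop
      have hu₀c : HasCompactSupport fun Y => χ₂ Y * (taylorRem φ X Y : ℂ) ^ n := hχ₂.mul_right
      -- the second derivatives are synthesised from their short-time Fourier transforms
      have hrep : ∀ (i j : ι) (X : ℰ ι),
          (pderiv2 i j φ X : ℂ) = c⁻¹ * synth γ (stft₀ χ (u i j)) X := fun i j X => by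
        rw [eq_inv_mul_iff_mul_eq₀ hc]
        exact synth_stft₀_eq (Complex.continuous_ofReal.comp (hcont2 i j)) (hu i j)
          hHm hH (hVH i j) X
      -- on the support of `χ₂` one factor `R_X` is expanded by Taylor's formula
      have hexp : ∀ Y, χ₂ Y * (taylorRem φ X Y : ℂ) ^ (n + 1) =
          c⁻¹ * ∑ j, ∑ i, (χ₂ Y * (taylorRem φ X Y : ℂ) ^ n) * m j i Y := by
        intro Y
        by_cases hY : Y ∈ tsupport χ₂
        swap
        · simp [image_eq_zero_of_notMem_tsupport hY]
        have h1 : χ₃ Y = 1 := χ₃.one_of_mem_closedBall (hsupp hY)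
        have h2 : ∀ j i, m j i Y = c * ((Y j * Y i : ℝ) : ℂ) *
            ∫ t in Set.Icc (0 : ℝ) 1, ((1 - t : ℝ) : ℂ) * (pderiv2 i j φ (X + t • Y) : ℂ) := by
          intro j i
          have e : ∫ t in Set.Icc (0 : ℝ) 1,
              ((1 - t : ℝ) : ℂ) * synth γ (stft₀ χ (u i j)) (X + t • Y) =
              c * ∫ t in Set.Icc (0 : ℝ) 1,
                ((1 - t : ℝ) : ℂ) * (pderiv2 i j φ (X + t • Y) : ℂ) := by
            rw [← integral_const_mul]
            refine integral_congr_ae (ae_of_all _ fun t => ?_)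
            simp only [hrep]
            field_simp
          simp only [m, hs, h1, one_mul]
          rw [e]
          ring
        have h3 : (taylorRem φ X Y : ℂ) = c⁻¹ * ∑ j, ∑ i, m j i Y := by
          have hi : ∀ i j, Integrable (fun t : ℝ => (1 - t) * (Y j * (Y i * pderiv2 i j φ (X + t • Y))))
              (volume.restrict (Set.Icc (0 : ℝ) 1)) := fun i j => by
            have : Continuous fun t : ℝ => (1 - t) * (Y j * (Y i * pderiv2 i j φ (X + t • Y))) := by
              have := hcont2 i j
              fun_prop
            exact this.continuousOn.integrableOn_compact isCompact_Icc
          rw [taylorRem_eq_integral hφ X Y]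
          simp only [Finset.mul_sum]
          rw [integral_finsetSum _ fun j _ => integrable_finsetSum _ fun i _ => hi i j]
          push_cast
          refine Finset.sum_congr rfl fun j _ => ?_
          rw [integral_finsetSum _ fun i _ => hi i j]
          push_cast
          refine Finset.sum_congr rfl fun i _ => ?_
          rw [h2, ← mul_assoc, ← mul_assoc, inv_mul_cancel₀ hc, one_mul, ← integral_const_mul,
            ← integral_complex_ofReal]
          refine integral_congr_ae (ae_of_all _ fun t => ?_)
          simp only []
          push_cast
          ring
        calc _ = (χ₂ Y * (taylorRem φ X Y : ℂ) ^ n) * (c⁻¹ * ∑ j, ∑ i, m j i Y) := by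
              rw [← h3]; ring
          _ = _ := by
              simp only [Finset.mul_sum]
              refine Finset.sum_congr rfl fun j _ => Finset.sum_congr rfl fun i _ => by ring
      have hint : ∀ j i, Integrable fun Y => (χ₂ Y * (taylorRem φ X Y : ℂ) ^ n) * m j i Y :=
        fun j i => (hu₀.mul (hm j i)).integrable_of_hasCompactSupport hu₀c.mul_right
      have hsplit : hatF (fun Y => χ₂ Y * (taylorRem φ X Y : ℂ) ^ (n + 1)) ξ =
          c⁻¹ * ∑ j, ∑ i, hatF (fun Y => (χ₂ Y * (taylorRem φ X Y : ℂ) ^ n) * m j i Y) ξ := by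
        simp only [hatF]
        calc _ = ∫ Y, c⁻¹ * ∑ j, ∑ i, chr Y ξ * ((χ₂ Y * (taylorRem φ X Y : ℂ) ^ n) * m j i Y) := by
              refine integral_congr_ae (ae_of_all _ fun Y => ?_)
              simp only [hexp, Finset.mul_sum]
              refine Finset.sum_congr rfl fun j _ => Finset.sum_congr rfl fun i _ => by ring
          _ = _ := by
              rw [integral_const_mul, integral_finsetSum _ fun j _ =>
                integrable_finsetSum _ fun i _ => integrable_chr_mul (hint j i) ξ]
              congr 1
              refine Finset.sum_congr rfl fun j _ => ?_
              rw [integral_finsetSum _ fun i _ => integrable_chr_mul (hint j i) ξ]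
      rw [hsplit, enorm_mul, hkks]
      simp only []
      rw [hK₁, mul_assoc]
      refine mul_le_mul_right ?_ _
      refine (enorm_sum_le _ _).trans ?_
      rw [Finset.sum_mul]
      refine Finset.sum_le_sum fun j _ => (enorm_sum_le _ _).trans ?_
      rw [Finset.sum_mul]
      refine Finset.sum_le_sum fun i _ => ?_
      exact hstep i j (stft₀ χ (u i j)) H X _ (kk n) (continuous_stft₀ χ _) hHm hH (hVH i j)
        (hu₀.integrable_of_hasCompactSupport hu₀c) (hkkm n) ih ξ
  refine ⟨fun ξ => ∑' j, ((j.factorial : ℝ≥0∞))⁻¹ * kk j ξ,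
    Measurable.tsum fun j => (hkkm j).const_mul _, ?_, fun X Θ => ?_⟩
  · -- summation of the weighted norms
    obtain ⟨r, hr⟩ : ∃ r : ℝ, r = b * ((hessNorm χ v φ).toReal + (Fintype.card ι : ℝ) ^ 2) :=
      ⟨_, rfl⟩
    have hr0 : 0 ≤ r := by rw [hr]; positivity
    have hrt : ENNReal.ofReal b * (hessNorm χ v φ + (Fintype.card ι : ℝ≥0∞) ^ 2) =
        ENNReal.ofReal r := by
      rw [hr, ENNReal.ofReal_mul hb0, ENNReal.ofReal_add ENNReal.toReal_nonneg (by positivity),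
        ENNReal.ofReal_toReal hhess.ne, ENNReal.ofReal_pow (by positivity), ENNReal.ofReal_natCast]
    have hnorm : ∀ j, ∫⁻ ξ, kk j ξ * ENNReal.ofReal (w ξ) ≤ ENNReal.ofReal r ^ j *
        ENNReal.ofReal a₀ := by
      intro j
      induction j with
      | zero => rw [hkk0, pow_zero, one_mul, ha₀, ENNReal.ofReal_toReal hk₀t]
      | succ j ih =>
        have h1 := lintegral_phaseOp_mul_le hHm M (hkkm j) hwm (A := ENNReal.ofReal A)
          (fun x y => by
            rw [← ENNReal.ofReal_mul hw.A_pos.le, ← ENNReal.ofReal_mul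
              (mul_nonneg hw.A_pos.le (hw.pos x).le)]
            exact ENNReal.ofReal_le_ofReal (hw.sub x y))
          (fun t ht x => by
            rw [← ENNReal.ofReal_mul hw.A_pos.le]
            exact ENNReal.ofReal_le_ofReal (hw.scale t ht x))
        have hm1 : Measurable fun ξ => phaseOp H M (kk j) ξ * ENNReal.ofReal (w ξ) :=
          (measurable_phaseOp hHm M (hkkm j)).mul hwm
        simp only [hkks, mul_assoc]
        rw [lintegral_const_mul _ hm1]
        calc _ ≤ K₁ * (ENNReal.ofReal A ^ 3 * (ENNReal.ofReal (B * (stftConst ι)⁻¹) *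
                (hessNorm χ v φ + (Fintype.card ι : ℝ≥0∞) ^ 2)) * D *
                (ENNReal.ofReal r ^ j * ENNReal.ofReal a₀)) := by
              refine mul_le_mul_right (h1.trans ?_) _
              rw [← hD]
              gcongr
          _ = (K₁ * (ENNReal.ofReal A ^ 3 * ENNReal.ofReal (B * (stftConst ι)⁻¹) * D)) *
                (hessNorm χ v φ + (Fintype.card ι : ℝ≥0∞) ^ 2) *
                (ENNReal.ofReal r ^ j * ENNReal.ofReal a₀) := by ring
          _ = _ := by rw [hbt, hrt]; ring
    calc ∫⁻ ξ, (∑' j, ((j.factorial : ℝ≥0∞))⁻¹ * kk j ξ) * ENNReal.ofReal (w ξ)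
        = ∑' j, ((j.factorial : ℝ≥0∞))⁻¹ * ∫⁻ ξ, kk j ξ * ENNReal.ofReal (w ξ) := by
          have hm1 : ∀ j, Measurable fun ξ => kk j ξ * ENNReal.ofReal (w ξ) :=
            fun j => (hkkm j).mul hwm
          simp only [← ENNReal.tsum_mul_right, mul_assoc]
          rw [lintegral_tsum fun j => ((hm1 j).const_mul _).aemeasurable]
          exact tsum_congr fun j => lintegral_const_mul _ (hm1 j)
      _ ≤ ∑' j : ℕ, ENNReal.ofReal (r ^ j / (j.factorial : ℝ) * a₀) := by
          refine ENNReal.tsum_le_tsum fun j => ?_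
          refine (mul_le_mul_right (hnorm j) _).trans (le_of_eq ?_)
          rw [ENNReal.ofReal_mul (by positivity), div_eq_inv_mul,
            ENNReal.ofReal_mul (by positivity), ENNReal.ofReal_inv_of_pos (by positivity),
            ENNReal.ofReal_natCast, ENNReal.ofReal_pow hr0, mul_assoc]
      _ = ENNReal.ofReal (Real.exp r * a₀) := by
          have hsum := (NormedSpace.expSeries_div_hasSum_exp r).mul_right a₀
          rw [← Real.exp_eq_exp_ℝ] at hsum
          rw [← hsum.tsum_eq, ENNReal.ofReal_tsum_of_nonneg (fun j => by positivity) hsum.summable]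
      _ ≤ _ := by
          refine ENNReal.ofReal_le_ofReal ?_
          have h1 : Real.exp r = Real.exp (b * (Fintype.card ι : ℝ) ^ 2) *
              Real.exp (b * (hessNorm χ v φ).toReal) := by
            rw [hr, ← Real.exp_add]; ring_nf
          have h2 : b ≤ (a₀ + 1) * Real.exp (b * (Fintype.card ι : ℝ) ^ 2) + b := by
            have : 0 ≤ (a₀ + 1) * Real.exp (b * (Fintype.card ι : ℝ) ^ 2) := by positivity
            linarith
          have h3 : Real.exp (b * (hessNorm χ v φ).toReal) ≤
              Real.exp (((a₀ + 1) * Real.exp (b * (Fintype.card ι : ℝ) ^ 2) + b) *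
                (hessNorm χ v φ).toReal) :=
            Real.exp_le_exp.2 (mul_le_mul_of_nonneg_right h2 ENNReal.toReal_nonneg)
          have h4 : a₀ * Real.exp (b * (Fintype.card ι : ℝ) ^ 2) ≤
              (a₀ + 1) * Real.exp (b * (Fintype.card ι : ℝ) ^ 2) + b := by
            nlinarith [Real.exp_pos (b * (Fintype.card ι : ℝ) ^ 2)]
          rw [h1]
          calc _ = (a₀ * Real.exp (b * (Fintype.card ι : ℝ) ^ 2)) *
                Real.exp (b * (hessNorm χ v φ).toReal) := by ring
            _ ≤ _ := mul_le_mul h4 h3 (Real.exp_pos _).le (by positivity)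
  · -- translation to the point `X` and subtraction of the affine part of the phase
    have h1 : hatF (fun Y => Complex.exp (Complex.I * (φ Y : ℂ)) * χ₂ (Y - X)) Θ =
        chr X Θ * Complex.exp (Complex.I * (φ X : ℂ)) *
          hatF (fun Y => χ₂ Y * Complex.exp (Complex.I * (taylorRem φ X Y : ℂ)))
            (Θ - gradVec φ X) := by
      simp only [hatF]
      rw [← integral_add_right_eq_self _ X, ← integral_const_mul]
      refine integral_congr_ae (ae_of_all _ fun Y => ?_)
      simp only [add_sub_cancel_right]
      have h2 : (φ (Y + X) : ℂ) = φ X + fderiv ℝ φ X Y + taylorRem φ X Y := by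
        rw [taylorRem, add_comm X Y]; push_cast; ring
      have h3 : chr Y (-gradVec φ X) = Complex.exp (Complex.I * (fderiv ℝ φ X Y : ℂ)) := by
        rw [chr, inner_neg_right, inner_gradVec]; push_cast; ring_nf
      rw [h2, sub_eq_add_neg, chr_add_right, h3, chr_add_left, mul_add, mul_add, Complex.exp_add,
        Complex.exp_add]
      ring
    rw [h1, enorm_mul, enorm_mul, ← ofReal_norm (chr _ _), norm_chr, ENNReal.ofReal_one, one_mul,
      ← ofReal_norm, mul_comm Complex.I, Complex.norm_exp_ofReal_mul_I, ENNReal.ofReal_one, one_mul]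
    exact enorm_hatF_mul_exp_le χ₂.continuous hχ₂ (continuous_taylorRem hφ X) (hpow X) _

end PhaseBound

/-! ### Schur's test -/

section Schur

variable {α β : Type*} [MeasurableSpace α] [MeasurableSpace β] {μ : Measure α} {ν : Measure β}

/-- Jensen's inequality for the measure with density `K`. -/
theorem rpow_lintegral_mul_le {K f : β → ℝ≥0∞} (hK : Measurable K) (hf : Measurable f) {p : ℝ}
    (hp : 1 ≤ p) : (∫⁻ b, K b * f b ∂ν) ^ p ≤
      (∫⁻ b, K b ∂ν) ^ (p - 1) * ∫⁻ b, K b * f b ^ p ∂ν := by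
  have hp0 : 0 < p := by linarith
  have h := eLpNorm_le_eLpNorm_mul_rpow_measure_univ (μ := ν.withDensity K) (p := 1)
    (q := ENNReal.ofReal p) (f := f) (by simpa using hp) hf.aestronglyMeasurable
  rw [eLpNorm_one_eq_lintegral_enorm, eLpNorm_eq_lintegral_rpow_enorm_toReal
    (by simpa using hp0) ENNReal.ofReal_ne_top, ENNReal.toReal_ofReal hp0.le, ENNReal.toReal_one,
    withDensity_apply _ MeasurableSet.univ, Measure.restrict_univ] at h
  simp only [enorm_eq_self] at h
  rw [lintegral_withDensity_eq_lintegral_mul _ hK hf,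
    lintegral_withDensity_eq_lintegral_mul _ hK (hf.pow_const p)] at h
  calc _ ≤ _ := ENNReal.rpow_le_rpow h hp0.le
    _ = _ := by
      rw [ENNReal.mul_rpow_of_nonneg _ _ hp0.le, ← ENNReal.rpow_mul, ← ENNReal.rpow_mul, one_div,
        inv_mul_cancel₀ hp0.ne', ENNReal.rpow_one, mul_comm]
      congr 2
      field_simp

/-- Schur's test for a nonnegative kernel. -/
theorem lintegral_schur [SFinite μ] [SFinite ν] {K : α → β → ℝ≥0∞}
    (hK : Measurable (Function.uncurry K)) {f : β → ℝ≥0∞} (hf : Measurable f) {p : ℝ} (hp : 1 ≤ p)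
    {A₁ A₂ : ℝ≥0∞} (h₁ : ∀ a, ∫⁻ b, K a b ∂ν ≤ A₁) (h₂ : ∀ b, ∫⁻ a, K a b ∂μ ≤ A₂) :
    ∫⁻ a, (∫⁻ b, K a b * f b ∂ν) ^ p ∂μ ≤ A₁ ^ (p - 1) * A₂ * ∫⁻ b, f b ^ p ∂ν := by
  have hm : Measurable (Function.uncurry fun a b => K a b * f b ^ p) :=
    hK.mul ((hf.pow_const p).comp measurable_snd)
  calc ∫⁻ a, (∫⁻ b, K a b * f b ∂ν) ^ p ∂μ ≤
        ∫⁻ a, A₁ ^ (p - 1) * ∫⁻ b, K a b * f b ^ p ∂ν ∂μ := by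
        refine lintegral_mono fun a => ?_
        refine (rpow_lintegral_mul_le (hK.comp measurable_prodMk_left) hf hp).trans ?_
        exact mul_le_mul_left (ENNReal.rpow_le_rpow (h₁ a) (by linarith)) _
    _ = A₁ ^ (p - 1) * ∫⁻ b, ∫⁻ a, K a b * f b ^ p ∂μ ∂ν := by
        rw [lintegral_const_mul _ hm.lintegral_prod_right, lintegral_lintegral_swap hm.aemeasurable]
    _ ≤ A₁ ^ (p - 1) * ∫⁻ b, A₂ * f b ^ p ∂ν := by
        gcongr with b
        have hKb : Measurable fun a => K a b := hK.comp measurable_prodMk_right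
        rw [lintegral_mul_const _ hKb]
        exact mul_le_mul_left (h₂ b) _
    _ = _ := by rw [lintegral_const_mul _ (hf.pow_const p), mul_assoc]

end Schur

/-! ### Modulation spaces as normed spaces -/

section ModSpaces

variable {ι : Type} [Fintype ι]

theorem stft₀_add_smul (χ : 𝓢(ℰ ι, ℂ)) (u w : 𝓢'(ℰ ι, ℂ)) (c : ℂ)
    (z : ℰ ι × ℰ ι) :
    stft₀ χ (u + c • w) z = stft₀ χ u z + c * stft₀ χ w z := rfl

theorem stft₀_sub (χ : 𝓢(ℰ ι, ℂ)) (u w : 𝓢'(ℰ ι, ℂ))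
    (z : ℰ ι × ℰ ι) :
    stft₀ χ (u - w) z = stft₀ χ u z - stft₀ χ w z := rfl

/-- The weighted short-time Fourier transform. -/
noncomputable def wstft (χ : 𝓢(ℰ ι, ℂ))
    (ω : ℰ ι × ℰ ι → ℝ) (u : 𝓢'(ℰ ι, ℂ))
    (z : ℰ ι × ℰ ι) : ℂ := stft₀ χ u z * (ω z : ℂ)

variable {χ : 𝓢(ℰ ι, ℂ)} {ω ω' : ℰ ι × ℰ ι → ℝ}
  {k : ℕ} {C : ℝ} {p : ℝ≥0∞}

theorem enorm_wstft (hω : ∀ z, 0 ≤ ω z) (u : 𝓢'(ℰ ι, ℂ))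
    (z : ℰ ι × ℰ ι) :
    ‖wstft χ ω u z‖ₑ = ‖stft₀ χ u z‖ₑ * ENNReal.ofReal (ω z) := by
  rw [wstft, enorm_mul, ← ofReal_norm (ω z : ℂ), Complex.norm_real, Real.norm_of_nonneg (hω z)]

theorem continuous_wstft (hω : Continuous ω) (u : 𝓢'(ℰ ι, ℂ)) :
    Continuous (wstft χ ω u) :=
  (continuous_stft₀ χ u).mul (Complex.continuous_ofReal.comp hω)

theorem wstft_add_smul (u w : 𝓢'(ℰ ι, ℂ)) (c : ℂ) :
    wstft χ ω (u + c • w) = wstft χ ω u + c • wstft χ ω w := by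
  ext z
  simp only [wstft, stft₀_add_smul, Pi.add_apply, Pi.smul_apply, smul_eq_mul]
  ring

theorem wstft_sub (u w : 𝓢'(ℰ ι, ℂ)) :
    wstft χ ω (u - w) = wstft χ ω u - wstft χ ω w := by
  ext z
  simp only [wstft, stft₀_sub, Pi.sub_apply]
  ring

theorem modNorm_le_eLpNorm_wstft (hω : ∀ z, 0 ≤ ω z) (hω' : IsContWeight ω' k)
    (h : ∀ z, ω z ≤ ω' z) (hp0 : p ≠ 0) (hp : p ≠ ∞) (u : 𝓢'(ℰ ι, ℂ)) :
    modNorm χ ω p p u ≤ ENNReal.ofReal (stftConst ι) * eLpNorm (wstft χ ω' u) p volume := by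
  refine (modNorm_le_of_le (C := 1) hω zero_le_one (by simpa using h) χ p p u).trans ?_
  rw [ENNReal.ofReal_one, one_mul, modNorm_eq_eLpNorm hω'.cont hp0 hp]
  rfl

theorem eLpNorm_wstft_le_modNorm (hω' : IsContWeight ω' k) (hC : 0 ≤ C)
    (h : ∀ z, ω' z ≤ C * ω z) (hp0 : p ≠ 0) (hp : p ≠ ∞) (u : 𝓢'(ℰ ι, ℂ)) :
    eLpNorm (wstft χ ω' u) p volume ≤ ENNReal.ofReal (C * (stftConst ι)⁻¹) * modNorm χ ω p p u := by
  have h1 := modNorm_le_of_le (fun z => (hω'.pos z).le) hC h χ p p u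
  rw [modNorm_eq_eLpNorm hω'.cont hp0 hp] at h1
  have hs := stftConst_pos (ι := ι)
  calc eLpNorm (wstft χ ω' u) p volume = ENNReal.ofReal (stftConst ι)⁻¹ *
        (ENNReal.ofReal (stftConst ι) * eLpNorm (wstft χ ω' u) p volume) := by
        rw [← mul_assoc, ← ENNReal.ofReal_mul (by positivity), inv_mul_cancel₀ hs.ne',
          ENNReal.ofReal_one, one_mul]
    _ ≤ ENNReal.ofReal (stftConst ι)⁻¹ * (ENNReal.ofReal C * modNorm χ ω p p u) :=
        mul_le_mul_right h1 _
    _ = _ := by rw [← mul_assoc, ← ENNReal.ofReal_mul (by positivity), mul_comm C]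

theorem mem_modSpace_iff (hω : ∀ z, 0 ≤ ω z) (hω' : IsContWeight ω' k) (hC : 0 ≤ C)
    (h₁ : ∀ z, ω z ≤ ω' z) (h₂ : ∀ z, ω' z ≤ C * ω z) (hp0 : p ≠ 0) (hp : p ≠ ∞)
    {u : 𝓢'(ℰ ι, ℂ)} :
    u ∈ modSpace χ ω p p ↔ eLpNorm (wstft χ ω' u) p volume < ∞ :=
  ⟨fun h => (eLpNorm_wstft_le_modNorm hω' hC h₂ hp0 hp u).trans_lt
    (ENNReal.mul_lt_top ENNReal.ofReal_lt_top h),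
  fun h => (modNorm_le_eLpNorm_wstft hω hω' h₁ hp0 hp u).trans_lt
    (ENNReal.mul_lt_top ENNReal.ofReal_lt_top h)⟩

theorem add_smul_mem_modSpace (hω : IsPolyWeight ω) (hp1 : 1 ≤ p) (hp : p ≠ ∞)
    {u w : 𝓢'(ℰ ι, ℂ)} (hu : u ∈ modSpace χ ω p p) (hw : w ∈ modSpace χ ω p p)
    (c : ℂ) : u + c • w ∈ modSpace χ ω p p := by
  obtain ⟨ω', k, C, hω', hC, h₁, h₂⟩ := exists_isContWeight hω.pos hω.moderate
  have hp0 : p ≠ 0 := (zero_lt_one.trans_le hp1).ne'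
  have hnn := fun z => (hω.pos z).le
  rw [mem_modSpace_iff hnn hω' hC.le h₁ h₂ hp0 hp] at hu hw ⊢
  rw [wstft_add_smul]
  refine (eLpNorm_add_le (continuous_wstft hω'.cont u).aestronglyMeasurable
    ((continuous_wstft hω'.cont w).const_smul c).aestronglyMeasurable hp1).trans_lt ?_
  rw [eLpNorm_const_smul]
  exact ENNReal.add_lt_top.2 ⟨hu, ENNReal.mul_lt_top enorm_lt_top hw⟩

theorem sub_mem_modSpace (hω : IsPolyWeight ω) (hp1 : 1 ≤ p) (hp : p ≠ ∞)
    {u w : 𝓢'(ℰ ι, ℂ)} (hu : u ∈ modSpace χ ω p p) (hw : w ∈ modSpace χ ω p p) :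
    u - w ∈ modSpace χ ω p p := by
  have := add_smul_mem_modSpace hω hp1 hp hu hw (-1)
  rwa [neg_one_smul, ← sub_eq_add_neg] at this

theorem modNorm_top_one_le_sliceSup (hω : ∀ z, 0 ≤ ω z) (h : ∀ z, ω z ≤ ω' z)
    (u : 𝓢'(ℰ ι, ℂ)) :
    modNorm χ ω ∞ 1 u ≤
      ENNReal.ofReal (stftConst ι) * ∫⁻ ξ, sliceSup (stft₀ χ u) ω' ξ := by
  rw [modNorm_top_one, ← lintegral_const_mul' _ _ ENNReal.ofReal_ne_top]
  refine lintegral_mono fun ξ => ?_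
  rw [modSlice, eLpNorm_exponent_top]
  refine essSup_le_of_ae_le _ (ae_of_all _ fun x => ?_)
  change ‖stft χ u x ξ * (ω (x, ξ) : ℂ)‖ₑ ≤ _
  rw [stft_eq, enorm_mul, enorm_mul, mul_assoc, ← ofReal_norm (stftConst ι : ℂ),
    Complex.norm_real, Real.norm_of_nonneg stftConst_pos.le, ← ofReal_norm (ω (x, ξ) : ℂ),
    Complex.norm_real, Real.norm_of_nonneg (hω _)]
  refine mul_le_mul_right (le_trans ?_ (le_sliceSup (stft₀ χ u) ω' (x, ξ))) _
  exact mul_le_mul_right (ENNReal.ofReal_le_ofReal (h _)) _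

theorem mem_modSpace_top_one_iff (hω : ∀ z, 0 ≤ ω z) (hω' : IsContWeight ω' k) (hC : 0 ≤ C)
    (h₁ : ∀ z, ω z ≤ ω' z) (h₂ : ∀ z, ω' z ≤ C * ω z) {u : 𝓢'(ℰ ι, ℂ)} :
    u ∈ modSpace χ ω ∞ 1 ↔ ∫⁻ ξ, sliceSup (stft₀ χ u) ω' ξ < ∞ :=
  ⟨fun h => (lintegral_sliceSup_le hω'.cont h₂ hC hω χ u).trans_lt
    (ENNReal.mul_lt_top ENNReal.ofReal_lt_top h),
  fun h => (modNorm_top_one_le_sliceSup hω h₁ u).trans_lt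
    (ENNReal.mul_lt_top ENNReal.ofReal_lt_top h)⟩

theorem add_smul_mem_modSpace_top_one (hω : IsPolyWeight ω) {u w : 𝓢'(ℰ ι, ℂ)}
    (hu : u ∈ modSpace χ ω ∞ 1) (hw : w ∈ modSpace χ ω ∞ 1) (c : ℂ) :
    u + c • w ∈ modSpace χ ω ∞ 1 := by
  obtain ⟨ω', k, C, hω', hC, h₁, h₂⟩ := exists_isContWeight hω.pos hω.moderate
  have hnn := fun z => (hω.pos z).le
  rw [mem_modSpace_top_one_iff hnn hω' hC.le h₁ h₂] at hu hw ⊢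
  have hle : ∀ ξ, sliceSup (stft₀ χ (u + c • w)) ω' ξ ≤
      sliceSup (stft₀ χ u) ω' ξ + ‖c‖ₑ * sliceSup (stft₀ χ w) ω' ξ := fun ξ =>
    iSup_le fun x => by
      rw [stft₀_add_smul]
      calc _ ≤ (‖stft₀ χ u (x, ξ)‖ₑ + ‖c‖ₑ * ‖stft₀ χ w (x, ξ)‖ₑ) * ENNReal.ofReal (ω' (x, ξ)) := by
            gcongr
            exact (enorm_add_le _ _).trans_eq (by rw [enorm_mul])
        _ = ‖stft₀ χ u (x, ξ)‖ₑ * ENNReal.ofReal (ω' (x, ξ)) +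
            ‖c‖ₑ * (‖stft₀ χ w (x, ξ)‖ₑ * ENNReal.ofReal (ω' (x, ξ))) := by ring
        _ ≤ _ := add_le_add (le_sliceSup (stft₀ χ u) ω' (x, ξ))
            (mul_le_mul_right (le_sliceSup (stft₀ χ w) ω' (x, ξ)) _)
  refine (lintegral_mono hle).trans_lt ?_
  rw [lintegral_add_left (measurable_sliceSup (continuous_stft₀ χ u) hω'.cont),
    lintegral_const_mul _ (measurable_sliceSup (continuous_stft₀ χ w) hω'.cont)]
  exact ENNReal.add_lt_top.2 ⟨hu, ENNReal.mul_lt_top enorm_lt_top hw⟩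

/-- Weighted short-time Fourier transforms of Schwartz functions decay rapidly. -/
theorem exists_norm_wstft_coe_le (χ : 𝓢(ℰ ι, ℂ)) (hω : IsContWeight ω k) (M : ℕ) :
    ∃ (M' : ℕ) (C : ℝ), 0 ≤ C ∧ ∀ (ψ : 𝓢(ℰ ι, ℂ)) z,
      ‖stft₀ χ (ψ : 𝓢'(ℰ ι, ℂ)) z‖ * ω z ≤
        C * schwartzNorm M' ψ * (decayFn M z.1 * decayFn M z.2) := by
  obtain ⟨M', C, hC, h⟩ := exists_norm_stft₀_coe_le χ (k + M)
  refine ⟨M', C * ω 0, mul_nonneg hC (hω.pos 0).le, fun ψ z => ?_⟩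
  have h1 : ω z ≤ ω 0 * ((1 + ‖z.1‖) ^ k * (1 + ‖z.2‖) ^ k) := by
    refine (hω.le_zero z).trans ?_
    rw [← mul_pow]
    have h0 := (hω.pos 0).le
    have := norm_nonneg z
    gcongr
    exact one_add_norm_prod_le z
  have hs := schwartzNorm_nonneg M' ψ
  have hd := fun M (x : ℰ ι) => decayFn_nonneg M x
  calc _ ≤ (C * schwartzNorm M' ψ * (decayFn (k + M) z.1 * decayFn (k + M) z.2)) *
        (ω 0 * ((1 + ‖z.1‖) ^ k * (1 + ‖z.2‖) ^ k)) := by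
        refine mul_le_mul (h ψ z.1 z.2) h1 (hω.pos z).le ?_
        exact mul_nonneg (mul_nonneg hC hs) (mul_nonneg (hd _ _) (hd _ _))
    _ = C * ω 0 * schwartzNorm M' ψ * (((1 + ‖z.1‖) ^ k * decayFn (k + M) z.1) *
        ((1 + ‖z.2‖) ^ k * decayFn (k + M) z.2)) := by ring
    _ = _ := by rw [pow_mul_decayFn_add, pow_mul_decayFn_add]

theorem coe_mem_modSpace_top_one (hω : IsPolyWeight ω) (ψ : 𝓢(ℰ ι, ℂ)) :
    (ψ : 𝓢'(ℰ ι, ℂ)) ∈ modSpace χ ω ∞ 1 := by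
  obtain ⟨ω', k, C, hω', hC, h₁, h₂⟩ := exists_isContWeight hω.pos hω.moderate
  rw [mem_modSpace_top_one_iff (fun z => (hω.pos z).le) hω' hC.le h₁ h₂]
  obtain ⟨M', C', hC', h⟩ := exists_norm_wstft_coe_le χ hω'
    (Module.finrank ℝ (ℰ ι) + 1)
  have hB : 0 ≤ C' * schwartzNorm M' ψ := mul_nonneg hC' (schwartzNorm_nonneg _ _)
  refine lt_of_le_of_lt (lintegral_mono fun ξ => iSup_le fun x => ?_)
    ((integrable_decayFn (Nat.lt_succ_self _)
      (volume : Measure (ℰ ι))).const_mul (C' * schwartzNorm M' ψ)).lintegral_lt_top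
  rw [← ofReal_norm, ← ENNReal.ofReal_mul (norm_nonneg _)]
  refine ENNReal.ofReal_le_ofReal ((h ψ (x, ξ)).trans ?_)
  exact mul_le_mul_of_nonneg_left
    (mul_le_of_le_one_left (decayFn_nonneg _ _) (decayFn_le_one _ _)) hB

theorem decayFn_mul_rpow_le (M : ℕ) {p : ℝ} (hp : 1 ≤ p) (z : ℰ ι × ℰ ι) :
    (decayFn M z.1 * decayFn M z.2) ^ p ≤ decayFn M z.1 * decayFn M z.2 := by
  have h0 : 0 ≤ decayFn M z.1 * decayFn M z.2 := mul_nonneg (decayFn_nonneg _ _) (decayFn_nonneg _ _)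
  have h1 : decayFn M z.1 * decayFn M z.2 ≤ 1 :=
    mul_le_one₀ (decayFn_le_one _ _) (decayFn_nonneg _ _) (decayFn_le_one _ _)
  exact Real.rpow_le_self_of_le_one h0 h1 hp

theorem eLpNorm_lt_top_of_decay {f : ℰ ι × ℰ ι → ℂ} {B : ℝ}
    (hp1 : 1 ≤ p) (hp : p ≠ ∞) {M : ℕ} (hM : Module.finrank ℝ (ℰ ι) < M)
    (h : ∀ z, ‖f z‖ ≤ B * (decayFn M z.1 * decayFn M z.2)) : eLpNorm f p volume < ∞ := by
  have hp0 : p ≠ 0 := (zero_lt_one.trans_le hp1).ne'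
  have hpr : 1 ≤ p.toReal := by
    rwa [← ENNReal.toReal_one, ENNReal.toReal_le_toReal ENNReal.one_ne_top hp]
  rw [eLpNorm_lt_top_iff_lintegral_rpow_enorm_lt_top hp0 hp]
  refine lt_of_le_of_lt (lintegral_mono fun z => ?_)
    ((integrable_decayFn_prod hM).const_mul (|B| ^ p.toReal)).lintegral_lt_top
  rw [← ofReal_norm, ENNReal.ofReal_rpow_of_nonneg (norm_nonneg _) (by linarith)]
  refine ENNReal.ofReal_le_ofReal ?_
  have h0 : 0 ≤ decayFn M z.1 * decayFn M z.2 := mul_nonneg (decayFn_nonneg _ _) (decayFn_nonneg _ _)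
  calc ‖f z‖ ^ p.toReal ≤ (|B| * (decayFn M z.1 * decayFn M z.2)) ^ p.toReal := by
        refine Real.rpow_le_rpow (norm_nonneg _) ((h z).trans ?_) (by linarith)
        exact mul_le_mul_of_nonneg_right (le_abs_self B) h0
    _ = |B| ^ p.toReal * (decayFn M z.1 * decayFn M z.2) ^ p.toReal :=
        Real.mul_rpow (abs_nonneg _) h0
    _ ≤ _ := by
        gcongr
        exact decayFn_mul_rpow_le M hpr z

theorem coe_mem_modSpace (hω : IsPolyWeight ω) (hp1 : 1 ≤ p) (hp : p ≠ ∞)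
    (ψ : 𝓢(ℰ ι, ℂ)) : (ψ : 𝓢'(ℰ ι, ℂ)) ∈ modSpace χ ω p p := by
  obtain ⟨ω', k, C, hω', hC, h₁, h₂⟩ := exists_isContWeight hω.pos hω.moderate
  rw [mem_modSpace_iff (fun z => (hω.pos z).le) hω' hC.le h₁ h₂
    (zero_lt_one.trans_le hp1).ne' hp]
  obtain ⟨M', C', hC', h⟩ := exists_norm_wstft_coe_le χ hω'
    (Module.finrank ℝ (ℰ ι) + 1)
  refine eLpNorm_lt_top_of_decay (B := C' * schwartzNorm M' ψ) hp1 hp (Nat.lt_succ_self _)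
    fun z => ?_
  · rw [wstft, norm_mul, Complex.norm_real, Real.norm_of_nonneg (hω'.pos z).le]
    exact h ψ z

/-- A distribution whose short-time Fourier transform vanishes is zero. -/
theorem eq_zero_of_stft₀_eq_zero (hχ : χ ≠ 0) {u : 𝓢'(ℰ ι, ℂ)}
    (h : ∀ z, stft₀ χ u z = 0) : u = 0 := by
  obtain ⟨γ, -, hγ⟩ := exists_windowPairing_ne_zero hχ
  ext ψ
  have h1 := (reproducing_formula χ γ ψ u).2
  simp only [h, mul_zero, integral_zero] at h1
  have := (mul_eq_zero.1 h1).resolve_left (mul_ne_zero (two_pi_pow_ne_zero _) hγ)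
  simpa using this

theorem eq_of_modNorm_sub_eq_zero (hχ : χ ≠ 0) (hω : IsPolyWeight ω) (hp0 : p ≠ 0) (hp : p ≠ ∞)
    {u w : 𝓢'(ℰ ι, ℂ)} (h : modNorm χ ω p p (u - w) = 0) : u = w := by
  obtain ⟨ω', k, C, hω', hC, h₁, h₂⟩ := exists_isContWeight hω.pos hω.moderate
  have h1 := eLpNorm_wstft_le_modNorm hω' hC.le h₂ hp0 hp (u - w) (χ := χ)
  rw [h, mul_zero, nonpos_iff_eq_zero] at h1
  have hc := continuous_wstft (χ := χ) hω'.cont (u - w)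
  rw [eLpNorm_eq_zero_iff hc.aestronglyMeasurable hp0] at h1
  have h2 : wstft χ ω' (u - w) = 0 := (hc.ae_eq_iff_eq volume continuous_const).1 h1
  refine sub_eq_zero.1 (eq_zero_of_stft₀_eq_zero hχ fun z => ?_)
  have h3 := congrFun h2 z
  rw [wstft] at h3
  exact (mul_eq_zero.1 h3).resolve_right (by exact_mod_cast (hω'.pos z).ne')

end ModSpaces

/-! ### Approximation by Schwartz functions -/

section Density

variable {ι : Type} [Fintype ι] {χ : 𝓢(ℰ ι, ℂ)}
  {ω ω' : ℰ ι × ℰ ι → ℝ} {k : ℕ} {C : ℝ} {p : ℝ≥0∞}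

/-- Localizing a distribution in phase space by a compactly supported factor `θ` gives a Schwartz
function; its short-time Fourier transform is compared with multiples of that of `u`. -/
theorem exists_truncation (hχ : χ ≠ 0) :
    ∃ (γ : 𝓢(ℰ ι, ℂ)) (c : ℂ),
      (∀ (u : 𝓢'(ℰ ι, ℂ)) (ψ : 𝓢(ℰ ι, ℂ)),
        Integrable (fun z : ℰ ι × ℰ ι =>
          stft₀ γ (ψ : 𝓢'(ℰ ι, ℂ)) (z.1, -z.2) * stft₀ χ u z) ∧
        u ψ = c * ∫ z : ℰ ι × ℰ ι,
          stft₀ γ (ψ : 𝓢'(ℰ ι, ℂ)) (z.1, -z.2) * stft₀ χ u z) ∧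
      ∀ (u : 𝓢'(ℰ ι, ℂ)) (θ : ℰ ι × ℰ ι → ℂ)
        (K : Set (ℰ ι × ℰ ι)), Measurable θ → (∀ z, ‖θ z‖ ≤ 1) →
        IsCompact K → (∀ z ∉ K, θ z = 0) →
        ∃ Ψ : 𝓢(ℰ ι, ℂ),
          (∀ z (s : ℂ), stft₀ χ (Ψ : 𝓢'(ℰ ι, ℂ)) z - s * stft₀ χ u z =
            c * ∫ z', (θ z' - s) * stft₀ χ u z' * tfKernel χ γ z z') ∧
          ∀ ψ : 𝓢(ℰ ι, ℂ), (Ψ : 𝓢'(ℰ ι, ℂ)) ψ =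
            c * ∫ z : ℰ ι × ℰ ι,
              θ z * (stft₀ γ (ψ : 𝓢'(ℰ ι, ℂ)) (z.1, -z.2) * stft₀ χ u z) := by
  obtain ⟨γ, -, hγ⟩ := exists_windowPairing_ne_zero hχ
  have hc : (2 * Real.pi : ℂ) ^ (Module.finrank ℝ (ℰ ι)) * windowPairing χ γ ≠ 0 :=
    mul_ne_zero (two_pi_pow_ne_zero _) hγ
  refine ⟨γ, ((2 * Real.pi : ℂ) ^ (Module.finrank ℝ (ℰ ι)) *
    windowPairing χ γ)⁻¹, fun u ψ => ?_, fun u θ K hθ hθ1 hK hθK => ?_⟩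
  · refine ⟨(reproducing_formula χ γ ψ u).1, ?_⟩
    rw [← (reproducing_formula χ γ ψ u).2, inv_mul_cancel_left₀ hc]
  obtain ⟨Ψ, hΨ⟩ := exists_synthesis χ γ u hθ hθ1 hK hθK
  set c := (2 * Real.pi : ℂ) ^ (Module.finrank ℝ (ℰ ι)) *
    windowPairing χ γ with hcdef
  have hcoe : ∀ φ : 𝓢(ℰ ι, ℂ), ((c⁻¹ • Ψ : 𝓢(ℰ ι, ℂ)) :
      𝓢'(ℰ ι, ℂ)) φ = c⁻¹ * (Ψ : 𝓢'(ℰ ι, ℂ)) φ := fun φ => by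
    simp only [coe_dist_apply, smul_apply, smul_eq_mul]
    rw [← integral_const_mul]
    refine integral_congr_ae (ae_of_all _ fun y => ?_)
    ring
  refine ⟨c⁻¹ • Ψ, fun z s => ?_, fun ψ => ?_⟩
  · have h1 := stft₀_synthesis hΨ z
    have h2 := stft₀_reproducing χ γ u z
    rw [← hcdef] at h2
    have h3 : ∫ z', (θ z' - s) * stft₀ χ u z' * tfKernel χ γ z z' =
        stft₀ χ (Ψ : 𝓢'(ℰ ι, ℂ)) z - s * (c * stft₀ χ u z) := by
      rw [h1.2, h2.2, ← integral_const_mul, ← integral_sub h1.1 (h2.1.const_mul s)]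
      refine integral_congr_ae (ae_of_all _ fun z' => ?_)
      simp only []
      ring
    rw [h3, stft₀, hcoe, ← stft₀]
    field_simp
  · rw [hcoe]
    have h1 := (hΨ (distCLM (ψ : 𝓢'(ℰ ι, ℂ)))).2
    rw [distCLM_apply, coe_dist_apply] at h1
    rw [coe_dist_apply]
    simp only [mul_comm (ψ _)] at h1 ⊢
    simp only [mul_comm (Ψ _)] at h1 ⊢
    rw [h1]
    congr 1
    refine integral_congr_ae (ae_of_all _ fun z => ?_)
    simp only [distCLM_apply, stft₀]
    ring

theorem exists_norm_tfKernel_mul_le (χ γ : 𝓢(ℰ ι, ℂ)) (hω : IsContWeight ω k)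
    (M : ℕ) : ∃ C : ℝ, 0 ≤ C ∧ ∀ z z', ‖tfKernel χ γ z z'‖ * ω z ≤
      C * (decayFn M (z.1 - z'.1) * decayFn M (z.2 - z'.2)) * ω z' := by
  obtain ⟨C, hC, h⟩ := exists_norm_tfKernel_le χ γ (k + M)
  refine ⟨C, hC, fun z z' => ?_⟩
  have h1 : ω z ≤ ω z' * ((1 + ‖z.1 - z'.1‖) ^ k * (1 + ‖z.2 - z'.2‖) ^ k) := by
    refine (hω.le_sub z z').trans ?_
    rw [← mul_pow]
    have h0 := (hω.pos z').le
    have := norm_nonneg (z - z')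
    gcongr
    exact one_add_norm_prod_le (z - z')
  have hd := fun M (x : ℰ ι) => decayFn_nonneg M x
  calc _ ≤ (C * (decayFn (k + M) (z.1 - z'.1) * decayFn (k + M) (z.2 - z'.2))) *
        (ω z' * ((1 + ‖z.1 - z'.1‖) ^ k * (1 + ‖z.2 - z'.2‖) ^ k)) := by
        refine mul_le_mul (h z z') h1 (hω.pos z).le ?_
        exact mul_nonneg hC (mul_nonneg (hd _ _) (hd _ _))
    _ = C * (((1 + ‖z.1 - z'.1‖) ^ k * decayFn (k + M) (z.1 - z'.1)) *
        ((1 + ‖z.2 - z'.2‖) ^ k * decayFn (k + M) (z.2 - z'.2))) * ω z' := by ring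
    _ = _ := by rw [pow_mul_decayFn_add, pow_mul_decayFn_add]

theorem enorm_integral_tfKernel_le (hω : IsContWeight ω k) {γ : 𝓢(ℰ ι, ℂ)} {M : ℕ}
    (hC : 0 ≤ C) (h : ∀ z z', ‖tfKernel χ γ z z'‖ * ω z ≤
      C * (decayFn M (z.1 - z'.1) * decayFn M (z.2 - z'.2)) * ω z')
    (b : ℰ ι × ℰ ι → ℂ) (u : 𝓢'(ℰ ι, ℂ))
    (z : ℰ ι × ℰ ι) :
    ‖∫ z', b z' * stft₀ χ u z' * tfKernel χ γ z z'‖ₑ * ENNReal.ofReal (ω z) ≤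
      ∫⁻ z', ENNReal.ofReal (C * (decayFn M (z.1 - z'.1) * decayFn M (z.2 - z'.2))) *
        (‖b z'‖ₑ * ‖wstft χ ω u z'‖ₑ) := by
  refine (mul_le_mul_left (enorm_integral_le_lintegral_enorm _) _).trans ?_
  rw [← lintegral_mul_const' _ _ ENNReal.ofReal_ne_top]
  refine lintegral_mono fun z' => ?_
  rw [enorm_mul, enorm_mul, enorm_wstft fun z => (hω.pos z).le]
  have hd : 0 ≤ C * (decayFn M (z.1 - z'.1) * decayFn M (z.2 - z'.2)) :=
    mul_nonneg hC (mul_nonneg (decayFn_nonneg _ _) (decayFn_nonneg _ _))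
  have h1 : ‖tfKernel χ γ z z'‖ₑ * ENNReal.ofReal (ω z) ≤
      ENNReal.ofReal (C * (decayFn M (z.1 - z'.1) * decayFn M (z.2 - z'.2))) *
        ENNReal.ofReal (ω z') := by
    rw [← ofReal_norm, ← ENNReal.ofReal_mul (norm_nonneg _), ← ENNReal.ofReal_mul hd]
    exact ENNReal.ofReal_le_ofReal (h z z')
  calc _ = ‖b z'‖ₑ * ‖stft₀ χ u z'‖ₑ * (‖tfKernel χ γ z z'‖ₑ * ENNReal.ofReal (ω z)) := by ring
    _ ≤ _ := mul_le_mul_right h1 _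
    _ = _ := by ring

theorem lintegral_decayFn_prod_lt_top {M : ℕ} (hM : Module.finrank ℝ (ℰ ι) < M)
    (C : ℝ) : ∫⁻ z : ℰ ι × ℰ ι,
      ENNReal.ofReal (C * (decayFn M z.1 * decayFn M z.2)) < ∞ :=
  ((integrable_decayFn_prod hM).const_mul C).lintegral_lt_top

/-- Convolution with a rapidly decaying function is bounded on `L^p`. -/
theorem lintegral_conv_decayFn_le {M : ℕ} (C : ℝ)
    {f : ℰ ι × ℰ ι → ℝ≥0∞} (hf : Measurable f) {p : ℝ}
    (hp : 1 ≤ p) :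
    ∫⁻ z : ℰ ι × ℰ ι,
      (∫⁻ z', ENNReal.ofReal (C * (decayFn M (z.1 - z'.1) * decayFn M (z.2 - z'.2))) * f z') ^ p
      ≤ (∫⁻ z : ℰ ι × ℰ ι,
          ENNReal.ofReal (C * (decayFn M z.1 * decayFn M z.2))) ^ p * ∫⁻ z, f z ^ p := by
  set A := ∫⁻ z : ℰ ι × ℰ ι,
    ENNReal.ofReal (C * (decayFn M z.1 * decayFn M z.2)) with hA
  have hcd : Continuous (decayFn M : ℰ ι → ℝ) := continuous_decayFn M
  have hm : Measurable (Function.uncurry fun z z' : ℰ ι × ℰ ι =>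
      ENNReal.ofReal (C * (decayFn M (z.1 - z'.1) * decayFn M (z.2 - z'.2)))) := by
    refine (ENNReal.continuous_ofReal.comp ?_).measurable
    have h1 : Continuous fun q : (ℰ ι × ℰ ι) ×
        (ℰ ι × ℰ ι) => decayFn M (q.1.1 - q.2.1) :=
      hcd.comp (by fun_prop)
    have h2 : Continuous fun q : (ℰ ι × ℰ ι) ×
        (ℰ ι × ℰ ι) => decayFn M (q.1.2 - q.2.2) :=
      hcd.comp (by fun_prop)
    exact continuous_const.mul (h1.mul h2)
  have : (volume : Measure (ℰ ι × ℰ ι)).IsAddHaarMeasure :=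
    Measure.prod.instIsAddHaarMeasure volume volume
  have h1 : ∀ z : ℰ ι × ℰ ι,
      ∫⁻ z' : ℰ ι × ℰ ι,
        ENNReal.ofReal (C * (decayFn M (z.1 - z'.1) * decayFn M (z.2 - z'.2))) = A := fun z =>
    have := Measure.IsAddHaarMeasure.isNegInvariant_of_regular (μ := (volume : Measure (ℰ ι × ℰ ι)))
    lintegral_sub_left_eq_self (μ := volume)
      (fun z : ℰ ι × ℰ ι =>
        ENNReal.ofReal (C * (decayFn M z.1 * decayFn M z.2))) z
  have h2 : ∀ z' : ℰ ι × ℰ ι,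
      ∫⁻ z : ℰ ι × ℰ ι,
        ENNReal.ofReal (C * (decayFn M (z.1 - z'.1) * decayFn M (z.2 - z'.2))) = A := fun z' =>
    lintegral_sub_right_eq_self (μ := volume)
      (fun z : ℰ ι × ℰ ι =>
        ENNReal.ofReal (C * (decayFn M z.1 * decayFn M z.2))) z'
  refine (lintegral_schur hm hf hp (fun z => (h1 z).le) fun z' => (h2 z').le).trans_eq ?_
  congr 1
  nth_rewrite 2 [← ENNReal.rpow_one A]
  rw [← ENNReal.rpow_add_of_nonneg _ _ (by linarith) zero_le_one, sub_add_cancel]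

/-- Schwartz functions are dense in `M^p_{(ω)}`. -/
theorem exists_seq_tendsto_modNorm (hχ : χ ≠ 0) (hω : IsPolyWeight ω) (hp1 : 1 ≤ p) (hp : p ≠ ∞)
    {u : 𝓢'(ℰ ι, ℂ)} (hu : u ∈ modSpace χ ω p p) :
    ∃ Ψ : ℕ → 𝓢(ℰ ι, ℂ), Tendsto (fun j =>
      modNorm χ ω p p ((Ψ j : 𝓢'(ℰ ι, ℂ)) - u)) atTop (𝓝 0) := by
  obtain ⟨ω', k, C, hω', hC, h₁, h₂⟩ := exists_isContWeight hω.pos hω.moderate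
  have hnn := fun z => (hω.pos z).le
  have hp0 : p ≠ 0 := (zero_lt_one.trans_le hp1).ne'
  have hpr : 1 ≤ p.toReal := by
    rwa [← ENNReal.toReal_one, ENNReal.toReal_le_toReal ENNReal.one_ne_top hp]
  rw [mem_modSpace_iff hnn hω' hC.le h₁ h₂ hp0 hp,
    eLpNorm_lt_top_iff_lintegral_rpow_enorm_lt_top hp0 hp] at hu
  obtain ⟨γ, c, -, hT⟩ := exists_truncation hχ
  let M := Module.finrank ℝ (ℰ ι) + 1
  obtain ⟨D, hD, hK⟩ := exists_norm_tfKernel_mul_le χ γ hω' M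
  -- truncation to large balls of phase space
  let B : ℕ → Set (ℰ ι × ℰ ι) := fun j => Metric.closedBall 0 j
  let θ : ℕ → ℰ ι × ℰ ι → ℂ := fun j => (B j).indicator fun _ => 1
  have hθm : ∀ j, Measurable (θ j) := fun j =>
    measurable_const.indicator Metric.isClosed_closedBall.measurableSet
  choose Ψ hΨ using fun j => hT u (θ j) (B j) (hθm j)
    (fun z => by by_cases hz : z ∈ B j <;> simp [θ, hz])
    (isCompact_closedBall _ _) (fun z hz => Set.indicator_of_notMem hz _)
  refine ⟨Ψ, ?_⟩
  have hVm : Measurable fun z => ‖wstft χ ω' u z‖ₑ :=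
    (continuous_wstft hω'.cont u).enorm.measurable
  have hbm : ∀ j, Measurable fun z => ‖θ j z - 1‖ₑ * ‖wstft χ ω' u z‖ₑ := fun j =>
    ((hθm j).sub_const 1).enorm.mul hVm
  -- the error is a convolution of the neglected part of the short-time Fourier transform with a
  -- rapidly decreasing function
  have hpt : ∀ j z, ‖wstft χ ω' ((Ψ j : 𝓢'(ℰ ι, ℂ)) - u) z‖ₑ ≤ ‖c‖ₑ *
      ∫⁻ z', ENNReal.ofReal (D * (decayFn M (z.1 - z'.1) * decayFn M (z.2 - z'.2))) *
        (‖θ j z' - 1‖ₑ * ‖wstft χ ω' u z'‖ₑ) := fun j z => by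
    have h := (hΨ j).1 z 1
    rw [one_mul] at h
    rw [enorm_wstft fun z => (hω'.pos z).le, stft₀_sub, h, enorm_mul, mul_assoc]
    exact mul_le_mul_right (enorm_integral_tfKernel_le hω' hD hK _ u z) _
  set A := ∫⁻ z : ℰ ι × ℰ ι,
    ENNReal.ofReal (D * (decayFn M z.1 * decayFn M z.2)) with hA
  have hAtop : A ≠ ∞ := (lintegral_decayFn_prod_lt_top (Nat.lt_succ_self _) D).ne
  have hle : ∀ j, modNorm χ ω p p ((Ψ j : 𝓢'(ℰ ι, ℂ)) - u) ≤
      ENNReal.ofReal (stftConst ι) * (‖c‖ₑ ^ p.toReal * (A ^ p.toReal *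
        ∫⁻ z, (‖θ j z - 1‖ₑ * ‖wstft χ ω' u z‖ₑ) ^ p.toReal)) ^ (1 / p.toReal) := fun j => by
    refine (modNorm_le_eLpNorm_wstft hnn hω' h₁ hp0 hp _).trans (mul_le_mul_right ?_ _)
    rw [eLpNorm_eq_lintegral_rpow_enorm_toReal hp0 hp]
    refine ENNReal.rpow_le_rpow ?_ (by positivity)
    refine (lintegral_mono fun z => ENNReal.rpow_le_rpow (hpt j z) (by linarith)).trans ?_
    simp only [ENNReal.mul_rpow_of_nonneg _ _ (zero_le_one.trans hpr)]
    rw [lintegral_const_mul' _ _ (ENNReal.rpow_ne_top_of_nonneg (by linarith) enorm_ne_top)]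
    refine mul_le_mul_right ?_ _
    simp only [← ENNReal.mul_rpow_of_nonneg _ _ (zero_le_one.trans hpr)]
    exact lintegral_conv_decayFn_le D (hbm j) hpr
  have hlim : Tendsto (fun j => ∫⁻ z, (‖θ j z - 1‖ₑ * ‖wstft χ ω' u z‖ₑ) ^ p.toReal) atTop
      (𝓝 0) := by
    have h0 : (0 : ℝ≥0∞) = ∫⁻ _ : ℰ ι × ℰ ι, 0 := by simp
    rw [h0]
    refine tendsto_lintegral_of_dominated_convergence
      (fun z => ‖wstft χ ω' u z‖ₑ ^ p.toReal) (fun j => (hbm j).pow_const _)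
      (fun j => ae_of_all _ fun z => ?_) hu.ne (ae_of_all _ fun z => ?_)
    · refine ENNReal.rpow_le_rpow (mul_le_of_le_one_left' ?_) (by linarith)
      by_cases hz : z ∈ B j <;> simp [θ, hz]
    · refine tendsto_const_nhds.congr' ?_
      filter_upwards [eventually_ge_atTop ⌈‖z‖⌉₊] with j hj
      have hz : z ∈ B j := by
        simp only [B, mem_closedBall_zero_iff]
        exact (Nat.le_ceil _).trans (by exact_mod_cast hj)
      simp [θ, hz, ENNReal.zero_rpow_of_pos (zero_lt_one.trans_le hpr)]
  refine tendsto_of_tendsto_of_tendsto_of_le_of_le tendsto_const_nhds ?_ (fun j => zero_le) hle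
  have h1 := (ENNReal.Tendsto.const_mul (a := ‖c‖ₑ ^ p.toReal)
    (ENNReal.Tendsto.const_mul (a := A ^ p.toReal) hlim
      (Or.inr (ENNReal.rpow_ne_top_of_nonneg (by linarith) hAtop)))
    (Or.inr (ENNReal.rpow_ne_top_of_nonneg (by linarith) enorm_ne_top))).ennrpow_const
    (1 / p.toReal)
  have h2 := ENNReal.Tendsto.const_mul (a := ENNReal.ofReal (stftConst ι)) h1
    (Or.inr ENNReal.ofReal_ne_top)
  rw [mul_zero, mul_zero, ENNReal.zero_rpow_of_pos (by positivity), mul_zero] at h2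
  exact h2

end Density

/-! ### Narrow approximation by Schwartz functions -/

theorem enorm_toReal_sub_toReal_le {a b r : ℝ≥0∞} (h₁ : a ≤ b + r) (h₂ : b ≤ a + r) :
    ‖a.toReal - b.toReal‖ₑ ≤ r := by
  rcases eq_or_ne r ∞ with hr | hr
  · simp [hr]
  rcases eq_or_ne a ∞ with ha | ha
  · have hb : b = ∞ := by
      by_contra hb
      exact (ENNReal.add_lt_top.2 ⟨Ne.lt_top hb, Ne.lt_top hr⟩).not_ge (ha ▸ h₁)
    simp [ha, hb]
  have hb : b ≠ ∞ := fun hb =>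
    (ENNReal.add_lt_top.2 ⟨Ne.lt_top ha, Ne.lt_top hr⟩).not_ge (hb ▸ h₂)
  rw [← ofReal_norm, ← ENNReal.ofReal_toReal hr]
  refine ENNReal.ofReal_le_ofReal ?_
  rw [Real.norm_eq_abs, abs_le]
  have h3 := ENNReal.toReal_mono (ENNReal.add_ne_top.2 ⟨hb, hr⟩) h₁
  have h4 := ENNReal.toReal_mono (ENNReal.add_ne_top.2 ⟨ha, hr⟩) h₂
  rw [ENNReal.toReal_add hb hr] at h3
  rw [ENNReal.toReal_add ha hr] at h4
  constructor <;> linarith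

/-- The continuous cut-off which is `1` on the ball of radius `R`, `0` outside the ball of radius
`2R` and `1/R`-Lipschitz. -/
noncomputable def ballCutoff {V : Type*} [NormedAddCommGroup V] (R : ℝ) (x : V) : ℝ :=
  max 0 (min 1 (2 - ‖x‖ / R))

section Cutoff

variable {V : Type*} [NormedAddCommGroup V] {R : ℝ}

theorem ballCutoff_nonneg (x : V) : 0 ≤ ballCutoff R x := le_max_left _ _

theorem ballCutoff_le_one (x : V) : ballCutoff R x ≤ 1 := max_le zero_le_one (min_le_left _ _)

theorem continuous_ballCutoff : Continuous (ballCutoff R : V → ℝ) := by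
  unfold ballCutoff
  fun_prop

theorem ballCutoff_eq_one (hR : 0 < R) {x : V} (hx : ‖x‖ ≤ R) : ballCutoff R x = 1 := by
  have : ‖x‖ / R ≤ 1 := (div_le_one hR).2 hx
  rw [ballCutoff, min_eq_left (by linarith), max_eq_right zero_le_one]

theorem ballCutoff_eq_zero (hR : 0 < R) {x : V} (hx : 2 * R ≤ ‖x‖) : ballCutoff R x = 0 := by
  have : 2 ≤ ‖x‖ / R := (le_div_iff₀ hR).2 hx
  rw [ballCutoff, max_eq_left]
  exact (min_le_right _ _).trans (by linarith)

theorem abs_ballCutoff_sub_le (hR : 0 < R) (x y : V) :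
    |ballCutoff R x - ballCutoff R y| ≤ ‖x - y‖ / R := by
  have h : |‖x‖ / R - ‖y‖ / R| ≤ ‖x - y‖ / R := by
    rw [← sub_div, abs_div, abs_of_pos hR]
    exact div_le_div_of_nonneg_right (abs_norm_sub_norm_le x y) hR.le
  have h0 : 0 ≤ ‖x - y‖ / R := by positivity
  unfold ballCutoff
  refine (abs_max_sub_max_le_max _ _ _ _).trans (max_le (by simpa using h0) ?_)
  refine (abs_min_sub_min_le_max _ _ _ _).trans (max_le (by simpa using h0) ?_)
  rw [abs_sub_comm, show 2 - ‖y‖ / R - (2 - ‖x‖ / R) = ‖x‖ / R - ‖y‖ / R by ring]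
  exact h

end Cutoff

section Narrow

variable {ι : Type} [Fintype ι] {χ : 𝓢(ℰ ι, ℂ)}
  {ω ω' : ℰ ι × ℰ ι → ℝ} {k : ℕ} {C : ℝ}

theorem decayFn_succ_mul_le (M : ℕ) {R t : ℝ} (hR : 0 < R) (ht : 0 ≤ t) {V : Type*}
    [NormedAddCommGroup V] (x : V) :
    decayFn (1 + M) x * (‖x‖ / R + t) ≤ decayFn M x * (1 / R + t) := by
  have h := pow_mul_decayFn_add 1 M x
  have h0 := decayFn_nonneg (1 + M) x
  have hx := norm_nonneg x
  rw [← h, pow_one]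
  have h1 : ‖x‖ / R + t ≤ (1 + ‖x‖) * (1 / R + t) := by
    have : 0 ≤ 1 / R := by positivity
    have : ‖x‖ / R = ‖x‖ * (1 / R) := by ring
    nlinarith [mul_nonneg hx ht]
  calc _ ≤ decayFn (1 + M) x * ((1 + ‖x‖) * (1 / R + t)) := mul_le_mul_of_nonneg_left h1 h0
    _ = _ := by ring

/-- The narrow density of the Schwartz functions: a distribution in `M^{∞,1}_{(ω)}` is cut off
in phase space. Since the cut-off in the position variable varies slowly, it almost commutes with
the short-time Fourier transform. -/
theorem exists_narrowTendsto (hχ : χ ≠ 0) (hω : IsPolyWeight ω)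
    {u : 𝓢'(ℰ ι, ℂ)} (hu : u ∈ modSpace χ ω ∞ 1) :
    ∃ Ψ : ℕ → 𝓢(ℰ ι, ℂ),
      NarrowTendsto χ ω ∞ 1 (fun j => (Ψ j : 𝓢'(ℰ ι, ℂ))) u := by
  obtain ⟨ω', k, C, hω', hC, h₁, h₂⟩ := exists_isContWeight hω.pos hω.moderate
  have hnn := fun z => (hω.pos z).le
  have hH := (mem_modSpace_top_one_iff hnn hω' hC.le h₁ h₂).1 hu
  obtain ⟨γ, c, hrec, hT⟩ := exists_truncation hχ
  let M := Module.finrank ℝ (ℰ ι) + 1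
  obtain ⟨D, hD, hK⟩ := exists_norm_tfKernel_mul_le χ γ hω' (1 + M)
  let E := ℰ ι
  -- the radii tend to infinity and never vanish
  let r : ℕ → ℝ := fun j => j + 1
  have hr : ∀ j, 0 < r j := fun j => by positivity
  have hrtop : Tendsto r atTop atTop :=
    tendsto_atTop_add_const_right _ _ tendsto_natCast_atTop_atTop
  -- a sharp cut-off is good enough in the dual variable, where the norm is an `L^1` norm
  let τ : ℕ → E → ℝ := fun j => (Metric.closedBall (0 : E) (r j)).indicator fun _ => 1
  have hτm : ∀ j, Measurable (τ j) := fun j =>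
    measurable_const.indicator Metric.isClosed_closedBall.measurableSet
  have hτ0 : ∀ j ξ, 0 ≤ τ j ξ := fun j ξ => Set.indicator_nonneg (fun _ _ => zero_le_one) _
  have hτ1 : ∀ j ξ, τ j ξ ≤ 1 := fun j ξ => Set.indicator_le_self' (fun _ _ => zero_le_one) ξ
  have hτe : ∀ ξ, ∀ᶠ j in atTop, τ j ξ = 1 := fun ξ => by
    filter_upwards [hrtop.eventually_ge_atTop ‖ξ‖] with j hj
    exact Set.indicator_of_mem (by simpa using hj) _
  have hψe : ∀ x : E, ∀ᶠ j in atTop, ballCutoff (r j) x = 1 := fun x => by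
    filter_upwards [hrtop.eventually_ge_atTop ‖x‖] with j hj
    exact ballCutoff_eq_one (hr j) hj
  let θ : ℕ → E × E → ℂ := fun j z => ((ballCutoff (r j) z.1 * τ j z.2 : ℝ) : ℂ)
  have hθn : ∀ j z, ‖θ j z‖ ≤ 1 := fun j z => by
    simp only [θ]
    rw [Complex.norm_real, Real.norm_of_nonneg (mul_nonneg (ballCutoff_nonneg _) (hτ0 j _))]
    exact mul_le_one₀ (ballCutoff_le_one _) (hτ0 j _) (hτ1 j _)
  have hθm : ∀ j, Measurable (θ j) := fun j => by
    have h1 : Measurable fun z : E × E => ballCutoff (r j) z.1 :=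
      (continuous_ballCutoff.comp continuous_fst).measurable
    have h2 : Measurable fun z : E × E => τ j z.2 := (hτm j).comp measurable_snd
    exact Complex.measurable_ofReal.comp (h1.mul h2)
  have hsupp : ∀ j, ∀ z ∉ Metric.closedBall (0 : E × E) (2 * r j), θ j z = 0 := fun j z hz => by
    simp only [mem_closedBall_zero_iff, Prod.norm_def, max_le_iff, not_and_or, not_le] at hz
    rcases hz with hz | hz
    · simp [θ, ballCutoff_eq_zero (hr j) hz.le]
    · have : z.2 ∉ Metric.closedBall (0 : E) (r j) := by
        simp only [mem_closedBall_zero_iff, not_le]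
        have := hr j
        linarith
      simp [θ, τ, Set.indicator_of_notMem this]
  choose Ψ hΨ using fun j => hT u (θ j) _ (hθm j) (hθn j) (isCompact_closedBall _ _) (hsupp j)
  -- the error made by commuting the cut-off past the short-time Fourier transform
  let e : ℕ → E → ℝ≥0∞ := fun j ξ => ENNReal.ofReal (1 / r j + (1 - τ j ξ)) * sliceSup (stft₀ χ u) ω' ξ
  have hSm : Measurable (sliceSup (stft₀ χ u) ω') :=
    measurable_sliceSup (continuous_stft₀ χ u) hω'.cont
  have hem : ∀ j, Measurable (e j) := fun j =>
    (ENNReal.measurable_ofReal.comp (measurable_const.add (measurable_const.sub (hτm j)))).mul hSm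
  let A : ℝ≥0∞ := ∫⁻ x : E, ENNReal.ofReal (decayFn M x)
  have hA : A ≠ ∞ := ((integrable_decayFn (Nat.lt_succ_self _)
    (volume : Measure E)).lintegral_lt_top).ne
  have hdm : Measurable fun x : E => ENNReal.ofReal (decayFn M x) :=
    (ENNReal.continuous_ofReal.comp (continuous_decayFn M)).measurable
  let ρ : ℕ → E → ℝ≥0∞ := fun j ξ => ENNReal.ofReal (stftConst ι) * (‖c‖ₑ * (ENNReal.ofReal D *
    (A * ∫⁻ ξ', ENNReal.ofReal (decayFn M (ξ - ξ')) * e j ξ')))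
  have hρm : ∀ j, Measurable (ρ j) := fun j => by
    have h1 : Measurable fun q : E × E => ENNReal.ofReal (decayFn M (q.1 - q.2)) * e j q.2 :=
      (hdm.comp (measurable_fst.sub measurable_snd)).mul ((hem j).comp measurable_snd)
    exact (((h1.lintegral_prod_right').const_mul A).const_mul _).const_mul _ |>.const_mul _
  have herr : ∀ j (z : E × E), ENNReal.ofReal (stftConst ι) *
      (‖stft₀ χ (Ψ j : 𝓢'(ℰ ι, ℂ)) z - (ballCutoff (r j) z.1 : ℂ) * stft₀ χ u z‖ₑ *
        ENNReal.ofReal (ω' z)) ≤ ρ j z.2 := fun j z => by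
    refine mul_le_mul_right ?_ _
    rw [(hΨ j).1 z, enorm_mul, mul_assoc]
    refine mul_le_mul_right ((enorm_integral_tfKernel_le hω' hD hK _ u z).trans ?_) _
    have hpt : ∀ z' : E × E, ENNReal.ofReal (D * (decayFn (1 + M) (z.1 - z'.1) *
        decayFn (1 + M) (z.2 - z'.2))) *
        (‖θ j z' - (ballCutoff (r j) z.1 : ℂ)‖ₑ * ‖wstft χ ω' u z'‖ₑ) ≤
        ENNReal.ofReal (decayFn M (z.1 - z'.1)) *
          (ENNReal.ofReal D * (ENNReal.ofReal (decayFn M (z.2 - z'.2)) * e j z'.2)) := fun z' => by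
      -- Lipschitz continuity of the cut-off in the position variable
      have h1 : ‖θ j z' - (ballCutoff (r j) z.1 : ℂ)‖ ≤ ‖z.1 - z'.1‖ / r j + (1 - τ j z'.2) := by
        simp only [θ]
        rw [← Complex.ofReal_sub, Complex.norm_real, Real.norm_eq_abs]
        have h2 := abs_ballCutoff_sub_le (hr j) z'.1 z.1
        have h3 := ballCutoff_nonneg (R := r j) z'.1
        have h4 := ballCutoff_le_one (R := r j) z'.1
        have h5 := hτ0 j z'.2
        have h6 := hτ1 j z'.2
        rw [norm_sub_rev] at h2
        rw [abs_le] at h2 ⊢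
        constructor <;> nlinarith [mul_nonneg h3 (sub_nonneg.2 h6),
          mul_nonneg (sub_nonneg.2 h4) (sub_nonneg.2 h6)]
      have h2 : ‖wstft χ ω' u z'‖ₑ ≤ sliceSup (stft₀ χ u) ω' z'.2 := by
        rw [enorm_wstft fun z => (hω'.pos z).le]
        exact le_sliceSup (stft₀ χ u) ω' z'
      have ht : 0 ≤ 1 - τ j z'.2 := sub_nonneg.2 (hτ1 j _)
      have hd := fun M (x : E) => decayFn_nonneg M x
      have h3 : ENNReal.ofReal (D * (decayFn (1 + M) (z.1 - z'.1) * decayFn (1 + M) (z.2 - z'.2))) *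
          ‖θ j z' - (ballCutoff (r j) z.1 : ℂ)‖ₑ ≤ ENNReal.ofReal (decayFn M (z.1 - z'.1)) *
          (ENNReal.ofReal D * (ENNReal.ofReal (decayFn M (z.2 - z'.2)) *
            ENNReal.ofReal (1 / r j + (1 - τ j z'.2)))) := by
        have h7 := mul_nonneg hD (mul_nonneg (hd (1 + M) (z.1 - z'.1)) (hd (1 + M) (z.2 - z'.2)))
        rw [← ofReal_norm, ← ENNReal.ofReal_mul h7, ← ENNReal.ofReal_mul (hd _ _),
          ← ENNReal.ofReal_mul hD, ← ENNReal.ofReal_mul (hd _ _)]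
        refine ENNReal.ofReal_le_ofReal ?_
        have h8 := decayFn_succ_mul_le M (hr j) ht (z.1 - z'.1)
        have h9 : decayFn (1 + M) (z.2 - z'.2) ≤ decayFn M (z.2 - z'.2) :=
          decayFn_anti (by omega) _
        have h10 : 0 ≤ 1 / r j + (1 - τ j z'.2) := add_nonneg (one_div_nonneg.2 (hr j).le) ht
        calc _ ≤ D * (decayFn (1 + M) (z.1 - z'.1) * decayFn (1 + M) (z.2 - z'.2)) *
              (‖z.1 - z'.1‖ / r j + (1 - τ j z'.2)) := mul_le_mul_of_nonneg_left h1 h7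
          _ = D * ((decayFn (1 + M) (z.1 - z'.1) * (‖z.1 - z'.1‖ / r j + (1 - τ j z'.2))) *
              decayFn (1 + M) (z.2 - z'.2)) := by ring
          _ ≤ D * ((decayFn M (z.1 - z'.1) * (1 / r j + (1 - τ j z'.2))) *
              decayFn M (z.2 - z'.2)) := by
              refine mul_le_mul_of_nonneg_left ?_ hD
              exact mul_le_mul h8 h9 (hd _ _) (mul_nonneg (hd _ _) h10)
          _ = _ := by ring
      rw [← mul_assoc]
      calc _ ≤ _ := mul_le_mul h3 h2 zero_le zero_le
        _ = _ := by simp only [e]; ring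
    refine (lintegral_mono hpt).trans_eq ?_
    have hm1 : Measurable fun x' : E => ENNReal.ofReal (decayFn M (z.1 - x')) :=
      hdm.comp (measurable_const.sub measurable_id)
    have hm2 : Measurable fun ξ' : E => ENNReal.ofReal D *
        (ENNReal.ofReal (decayFn M (z.2 - ξ')) * e j ξ') :=
      ((hdm.comp (measurable_const.sub measurable_id)).mul (hem j)).const_mul _
    rw [Measure.volume_eq_prod, lintegral_prod_mul hm1.aemeasurable hm2.aemeasurable,
      lintegral_const_mul' _ _ ENNReal.ofReal_ne_top,
      lintegral_sub_left_eq_self (fun x : E => ENNReal.ofReal (decayFn M x))]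
    simp only [A]
    ring
  have hstft : ∀ (w : 𝓢'(ℰ ι, ℂ)) (z : E × E) (t : ℝ), 0 ≤ t →
      ‖stft χ w z.1 z.2 * (t : ℂ)‖ₑ =
        ENNReal.ofReal (stftConst ι) * (‖stft₀ χ w z‖ₑ * ENNReal.ofReal t) := fun w z t ht => by
    rw [stft_eq, enorm_mul, enorm_mul, mul_assoc, ← ofReal_norm (stftConst ι : ℂ),
      Complex.norm_real, Real.norm_of_nonneg stftConst_pos.le, ← ofReal_norm (t : ℂ),
      Complex.norm_real, Real.norm_of_nonneg ht]
  -- the slices of `u` with the cut-off weight; they lie below those of `u` and, up to `ρ j`, below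
  -- those of `Ψ j`
  let P : ℕ → E → ℝ≥0∞ := fun j => modSlice χ (fun z => ballCutoff (r j) z.1 * ω z) ∞ u
  have hdiff : ∀ j (z : E × E), ENNReal.ofReal (stftConst ι) *
      (‖stft₀ χ (Ψ j : 𝓢'(ℰ ι, ℂ)) z - (ballCutoff (r j) z.1 : ℂ) * stft₀ χ u z‖ₑ *
        ENNReal.ofReal (ω z)) ≤ ρ j z.2 := fun j z =>
    le_trans (mul_le_mul_right (mul_le_mul_right (ENNReal.ofReal_le_ofReal (h₁ z)) _) _) (herr j z)
  have hcut : ∀ j (z : E × E), ‖(ballCutoff (r j) z.1 : ℂ) * stft₀ χ u z‖ₑ *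
      ENNReal.ofReal (ω z) = ‖stft₀ χ u z‖ₑ * ENNReal.ofReal (ballCutoff (r j) z.1 * ω z) :=
      fun j z => by
    rw [enorm_mul, ← ofReal_norm (ballCutoff (r j) z.1 : ℂ), Complex.norm_real,
      Real.norm_of_nonneg (ballCutoff_nonneg _), ENNReal.ofReal_mul (ballCutoff_nonneg _)]
    ring
  have hup : ∀ j ξ, modSlice χ ω ∞ (Ψ j : 𝓢'(ℰ ι, ℂ)) ξ ≤
      modSlice χ ω ∞ u ξ + ρ j ξ := fun j ξ => by
    refine essSup_le_of_ae_le _ ?_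
    filter_upwards [ae_le_eLpNormEssSup (f := fun x => stft χ u x ξ * (ω (x, ξ) : ℂ))
      (μ := volume)] with x hx
    refine le_trans ?_ (add_le_add (hx.trans_eq (eLpNorm_exponent_top).symm) (hdiff j (x, ξ)))
    rw [hstft _ (x, ξ) _ (hnn _), hstft _ (x, ξ) _ (hnn _), ← mul_add, ← add_mul]
    refine mul_le_mul_right (mul_le_mul_left ?_ _) _
    calc ‖stft₀ χ (Ψ j : 𝓢'(ℰ ι, ℂ)) (x, ξ)‖ₑ
        = ‖(ballCutoff (r j) x : ℂ) * stft₀ χ u (x, ξ) +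
          (stft₀ χ (Ψ j : 𝓢'(ℰ ι, ℂ)) (x, ξ) -
            (ballCutoff (r j) x : ℂ) * stft₀ χ u (x, ξ))‖ₑ := by rw [add_sub_cancel]
      _ ≤ _ := (enorm_add_le _ _).trans (add_le_add_left ?_ _)
    rw [enorm_mul, ← ofReal_norm (ballCutoff (r j) x : ℂ), Complex.norm_real,
      Real.norm_of_nonneg (ballCutoff_nonneg _)]
    exact mul_le_of_le_one_left' (by simpa using ballCutoff_le_one _)
  have hlow : ∀ j ξ, P j ξ ≤
      modSlice χ ω ∞ (Ψ j : 𝓢'(ℰ ι, ℂ)) ξ + ρ j ξ := fun j ξ => by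
    refine essSup_le_of_ae_le _ ?_
    filter_upwards [ae_le_eLpNormEssSup (f := fun x =>
      stft χ (Ψ j : 𝓢'(ℰ ι, ℂ)) x ξ * (ω (x, ξ) : ℂ)) (μ := volume)] with x hx
    refine le_trans ?_ (add_le_add (hx.trans_eq (eLpNorm_exponent_top).symm) (hdiff j (x, ξ)))
    have := hstft u (x, ξ) _ (mul_nonneg (ballCutoff_nonneg (R := r j) x) (hnn (x, ξ)))
    rw [this, hstft _ (x, ξ) _ (hnn _), ← mul_add, ← hcut j (x, ξ), ← add_mul]
    refine mul_le_mul_right (mul_le_mul_left ?_ _) _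
    calc ‖(ballCutoff (r j) x : ℂ) * stft₀ χ u (x, ξ)‖ₑ
        = ‖stft₀ χ (Ψ j : 𝓢'(ℰ ι, ℂ)) (x, ξ) -
          (stft₀ χ (Ψ j : 𝓢'(ℰ ι, ℂ)) (x, ξ) -
            (ballCutoff (r j) x : ℂ) * stft₀ χ u (x, ξ))‖ₑ := by rw [sub_sub_cancel]
      _ ≤ _ := enorm_sub_le
  have hPle : ∀ j ξ, P j ξ ≤ modSlice χ ω ∞ u ξ := fun j ξ => by
    have := modSlice_le_of_le (C := 1) (ω := fun z => ballCutoff (r j) z.1 * ω z) (ω' := ω)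
      (fun z => mul_nonneg (ballCutoff_nonneg _) (hnn z)) zero_le_one
      (fun z => mul_le_mul_of_nonneg_right (ballCutoff_le_one _) (hnn z)) χ ∞ u ξ
    simpa using this
  -- an essential supremum is the limit of the essential suprema over growing balls
  have hPlim : ∀ ξ, Tendsto (fun j => P j ξ) atTop (𝓝 (modSlice χ ω ∞ u ξ)) := fun ξ => by
    refine tendsto_of_le_liminf_of_limsup_le ?_
      (limsup_le_of_le (by isBoundedDefault) (Eventually.of_forall fun j => hPle j ξ))
    have hall : ∀ᵐ x : E, ∀ j, ‖stft χ u x ξ * ((ballCutoff (r j) x * ω (x, ξ) : ℝ) : ℂ)‖ₑ ≤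
        P j ξ := ae_all_iff.2 fun j => by
      filter_upwards [ae_le_eLpNormEssSup (f := fun x =>
        stft χ u x ξ * ((ballCutoff (r j) x * ω (x, ξ) : ℝ) : ℂ)) (μ := volume)] with x hx
      exact hx.trans_eq (eLpNorm_exponent_top).symm
    refine essSup_le_of_ae_le _ ?_
    filter_upwards [hall] with x hx
    refine le_liminf_of_le (by isBoundedDefault) ?_
    filter_upwards [hψe x] with j hj
    have := hx j
    rwa [hj, one_mul] at this
  have helim : Tendsto (fun j => ∫⁻ ξ, e j ξ) atTop (𝓝 0) := by
    have h0 : (0 : ℝ≥0∞) = ∫⁻ _ : E, 0 := by simp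
    rw [h0]
    refine tendsto_lintegral_of_dominated_convergence
      (fun ξ => ENNReal.ofReal 2 * sliceSup (stft₀ χ u) ω' ξ) hem
      (fun j => ae_of_all _ fun ξ => mul_le_mul_left (ENNReal.ofReal_le_ofReal ?_) _) ?_ ?_
    · have h1 : 1 / r j ≤ 1 := by
        rw [div_le_one (hr j)]
        simp [r]
      have := hτ0 j ξ
      linarith
    · rw [lintegral_const_mul _ hSm]
      exact ENNReal.mul_ne_top ENNReal.ofReal_ne_top hH.ne
    · filter_upwards [ae_lt_top hSm hH.ne] with ξ hξ
      have h1 : Tendsto (fun j => 1 / r j + (1 - τ j ξ)) atTop (𝓝 0) := by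
        have h2 : Tendsto (fun j => 1 - τ j ξ) atTop (𝓝 0) :=
          tendsto_const_nhds.congr' (by filter_upwards [hτe ξ] with j hj; simp [hj])
        simpa using (hrtop.const_div_atTop 1).add h2
      have h3 := ENNReal.Tendsto.mul_const (b := sliceSup (stft₀ χ u) ω' ξ)
        (ENNReal.tendsto_ofReal h1) (Or.inr hξ.ne)
      rw [ENNReal.ofReal_zero, zero_mul] at h3
      exact h3
  have hρlim : Tendsto (fun j => ∫⁻ ξ, ρ j ξ) atTop (𝓝 0) := by
    have h1 : ∀ j, ∫⁻ ξ, ρ j ξ = ENNReal.ofReal (stftConst ι) * (‖c‖ₑ * (ENNReal.ofReal D *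
        (A * (A * ∫⁻ ξ', e j ξ')))) := fun j => by
      have h2 : Measurable fun q : E × E => ENNReal.ofReal (decayFn M (q.1 - q.2)) * e j q.2 :=
        (hdm.comp (measurable_fst.sub measurable_snd)).mul ((hem j).comp measurable_snd)
      have h3 : ∫⁻ ξ, ∫⁻ ξ', ENNReal.ofReal (decayFn M (ξ - ξ')) * e j ξ' =
          A * ∫⁻ ξ', e j ξ' := by
        rw [lintegral_lintegral_swap h2.aemeasurable, ← lintegral_const_mul _ (hem j)]
        refine lintegral_congr fun ξ' => ?_
        have h4 : Measurable fun ξ : E => ENNReal.ofReal (decayFn M (ξ - ξ')) :=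
          hdm.comp (measurable_id.sub_const ξ')
        rw [lintegral_mul_const _ h4,
          lintegral_sub_right_eq_self (fun x : E => ENNReal.ofReal (decayFn M x))]
      simp only [ρ]
      rw [lintegral_const_mul' _ _ ENNReal.ofReal_ne_top, lintegral_const_mul' _ _ enorm_ne_top,
        lintegral_const_mul' _ _ ENNReal.ofReal_ne_top, lintegral_const_mul' _ _ hA, h3]
    simp only [h1]
    have h5 := ENNReal.Tendsto.const_mul (a := ENNReal.ofReal (stftConst ι) * (‖c‖ₑ *
      (ENNReal.ofReal D * (A * A)))) helim (Or.inr (ENNReal.mul_ne_top ENNReal.ofReal_ne_top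
        (ENNReal.mul_ne_top enorm_ne_top (ENNReal.mul_ne_top ENNReal.ofReal_ne_top
          (ENNReal.mul_ne_top hA hA)))))
    rw [mul_zero] at h5
    simpa only [mul_assoc] using h5
  have hHm := aemeasurable_modSlice_top hω.aemeasurable χ u
  have hHtop : ∫⁻ ξ, modSlice χ ω ∞ u ξ ≠ ∞ := by
    rw [← modNorm_top_one]
    exact (show modNorm χ ω ∞ 1 u < ∞ from hu).ne
  have hPm : ∀ j, AEMeasurable (P j) volume := fun j => by
    refine aemeasurable_modSlice_top ?_ χ u
    exact (continuous_ballCutoff.comp continuous_fst).measurable.aemeasurable.mul hω.aemeasurable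
  have hsub : Tendsto (fun j => ∫⁻ ξ, (modSlice χ ω ∞ u ξ - P j ξ)) atTop (𝓝 0) := by
    have h0 : (0 : ℝ≥0∞) = ∫⁻ _ : E, 0 := by simp
    rw [h0]
    refine tendsto_lintegral_of_dominated_convergence' _ (fun j => hHm.sub (hPm j))
      (fun j => ae_of_all _ fun ξ => tsub_le_self) hHtop ?_
    filter_upwards [ae_lt_top' hHm hHtop] with ξ hξ
    have := ENNReal.Tendsto.sub (tendsto_const_nhds (x := modSlice χ ω ∞ u ξ)) (hPlim ξ)
      (Or.inl hξ.ne)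
    simpa using this
  refine ⟨Ψ, fun j => coe_mem_modSpace_top_one hω _, hu, ?_, ?_⟩
  · refine PointwiseConvergenceCLM.tendsto_iff_forall_tendsto.2 fun ψ => ?_
    obtain ⟨hi, hv⟩ := hrec u ψ
    rw [hv]
    simp only [(hΨ _).2 ψ]
    refine Tendsto.const_mul c ?_
    refine tendsto_integral_of_dominated_convergence (fun z => ‖stft₀ γ
      (ψ : 𝓢'(ℰ ι, ℂ)) (z.1, -z.2) * stft₀ χ u z‖)
      (fun j => (hθm j).aestronglyMeasurable.mul hi.aestronglyMeasurable) hi.norm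
      (fun j => ae_of_all _ fun z => ?_) (ae_of_all _ fun z => ?_)
    · rw [norm_mul]
      exact mul_le_of_le_one_left (norm_nonneg _) (hθn j z)
    · refine tendsto_const_nhds.congr' ?_
      filter_upwards [hψe z.1, hτe z.2] with j h3 h4
      simp [θ, h3, h4]
  · have hle : ∀ j, eLpNorm (fun ξ => (modSlice χ ω ∞ (Ψ j : 𝓢'(ℰ ι, ℂ)) ξ).toReal -
        (modSlice χ ω ∞ u ξ).toReal) 1 volume ≤
        (∫⁻ ξ, ρ j ξ) + ∫⁻ ξ, (modSlice χ ω ∞ u ξ - P j ξ) := fun j => by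
      rw [eLpNorm_one_eq_lintegral_enorm, ← lintegral_add_left (hρm j)]
      refine lintegral_mono fun ξ => enorm_toReal_sub_toReal_le ?_ ?_
      · exact (hup j ξ).trans (add_le_add_right le_self_add _)
      · calc modSlice χ ω ∞ u ξ ≤ P j ξ + (modSlice χ ω ∞ u ξ - P j ξ) := le_add_tsub
          _ ≤ _ := by
            rw [← add_assoc]
            exact add_le_add_left (hlow j ξ) _
    refine tendsto_of_tendsto_of_tendsto_of_le_of_le tendsto_const_nhds ?_ (fun j => zero_le) hle
    simpa using hρlim.add hsub

end Narrow

/-! ### Splitting of the variables -/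

section ProdComm

variable {A B C D : Type*} [MeasurableSpace A] [MeasurableSpace B] [MeasurableSpace C]
  [MeasurableSpace D] {μA : Measure A} {μB : Measure B} {μC : Measure C} {μD : Measure D}
  [SFinite μA] [SFinite μB] [SFinite μC] [SFinite μD]

omit [SFinite μA] in
theorem lintegral_prod_prod_comm {f : (A × B) × (C × D) → ℝ≥0∞} (hf : Measurable f) :
    ∫⁻ q, f q ∂((μA.prod μB).prod (μC.prod μD)) =
      ∫⁻ s, ∫⁻ t, f ((s.1, t.1), (s.2, t.2)) ∂(μB.prod μD) ∂(μA.prod μC) := by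
  have h1 : Measurable fun s : A × B => ∫⁻ t, f (s, t) ∂(μC.prod μD) := hf.lintegral_prod_right'
  have h2 : Measurable fun r : (A × C) × (B × D) => f ((r.1.1, r.2.1), (r.1.2, r.2.2)) :=
    hf.comp (by fun_prop)
  have h3 : Measurable fun s : A × C => ∫⁻ t, f ((s.1, t.1), (s.2, t.2)) ∂(μB.prod μD) :=
    h2.lintegral_prod_right'
  rw [lintegral_prod _ hf.aemeasurable, lintegral_prod _ h1.aemeasurable,
    lintegral_prod _ h3.aemeasurable]
  refine lintegral_congr fun a => ?_
  have h4 : ∀ b, ∫⁻ t, f ((a, b), t) ∂(μC.prod μD) = ∫⁻ c, ∫⁻ d, f ((a, b), (c, d)) ∂μD ∂μC :=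
    fun b => lintegral_prod _ (hf.comp measurable_prodMk_left).aemeasurable
  have h5 : ∀ c, ∫⁻ t, f ((a, t.1), (c, t.2)) ∂(μB.prod μD) =
      ∫⁻ b, ∫⁻ d, f ((a, b), (c, d)) ∂μD ∂μB := fun c =>
    lintegral_prod _ (hf.comp (by fun_prop)).aemeasurable
  simp only [h4, h5]
  refine lintegral_lintegral_swap ?_
  have h6 : Measurable fun r : (B × C) × D => f ((a, r.1.1), (r.1.2, r.2)) :=
    hf.comp (by fun_prop)
  exact h6.lintegral_prod_right'.aemeasurable

end ProdComm

section Triple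

variable {n m : ℕ}

/-- The component `ζ` of `X = (x, y, ζ)`. -/
noncomputable def zPart (X : TripleSpace n m) : ℰ (Fin m) :=
  WithLp.toLp 2 (fun i => X (Sum.inr (Sum.inr i)))

@[simp] theorem xPart_triple (x y : ℰ (Fin n)) (ζ : ℰ (Fin m)) :
    xPart (triple x y ζ) = x := rfl

@[simp] theorem yPart_triple (x y : ℰ (Fin n)) (ζ : ℰ (Fin m)) :
    yPart (triple x y ζ) = y := rfl

@[simp] theorem zPart_triple (x y : ℰ (Fin n)) (ζ : ℰ (Fin m)) :
    zPart (triple x y ζ) = ζ := rfl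

theorem triple_parts (X : TripleSpace n m) : triple (xPart X) (yPart X) (zPart X) = X := by
  ext i
  rcases i with i | i | i <;> rfl

/-- The projection to the `x`-component as a linear map. -/
noncomputable def xCLM (n m : ℕ) : TripleSpace n m →L[ℝ] ℰ (Fin n) :=
  LinearMap.toContinuousLinearMap
    { toFun := xPart, map_add' := fun _ _ => rfl, map_smul' := fun _ _ => rfl }

/-- The projection to the `y`-component as a linear map. -/
noncomputable def yCLM (n m : ℕ) : TripleSpace n m →L[ℝ] ℰ (Fin n) :=
  LinearMap.toContinuousLinearMap
    { toFun := yPart, map_add' := fun _ _ => rfl, map_smul' := fun _ _ => rfl }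

/-- The projection to the `ζ`-component as a linear map. -/
noncomputable def zCLM (n m : ℕ) : TripleSpace n m →L[ℝ] ℰ (Fin m) :=
  LinearMap.toContinuousLinearMap
    { toFun := zPart, map_add' := fun _ _ => rfl, map_smul' := fun _ _ => rfl }

@[simp] theorem xCLM_apply (X : TripleSpace n m) : xCLM n m X = xPart X := rfl
@[simp] theorem yCLM_apply (X : TripleSpace n m) : yCLM n m X = yPart X := rfl
@[simp] theorem zCLM_apply (X : TripleSpace n m) : zCLM n m X = zPart X := rfl

/-- The isomorphism `ℝ^n × ℝ^n × ℝ^m → ℝ^{2n+m}`. -/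
noncomputable def tripleCLM (n m : ℕ) : (ℰ (Fin n) × ℰ (Fin n) ×
    ℰ (Fin m)) →L[ℝ] TripleSpace n m :=
  LinearMap.toContinuousLinearMap
    { toFun := fun q => triple q.1 q.2.1 q.2.2
      map_add' := fun p q => by ext i; rcases i with i | i | i <;> rfl
      map_smul' := fun c q => by ext i; rcases i with i | i | i <;> rfl }

@[simp] theorem tripleCLM_apply (q : ℰ (Fin n) × ℰ (Fin n) ×
    ℰ (Fin m)) : tripleCLM n m q = triple q.1 q.2.1 q.2.2 := rfl

@[fun_prop] theorem continuous_xPart : Continuous (xPart : TripleSpace n m → _) :=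
  (xCLM n m).continuous
@[fun_prop] theorem continuous_yPart : Continuous (yPart : TripleSpace n m → _) :=
  (yCLM n m).continuous
@[fun_prop] theorem continuous_zPart : Continuous (zPart : TripleSpace n m → _) :=
  (zCLM n m).continuous

@[fun_prop] theorem Continuous.triple {Z : Type*} [TopologicalSpace Z]
    {f g : Z → ℰ (Fin n)} {h : Z → ℰ (Fin m)} (hf : Continuous f)
    (hg : Continuous g) (hh : Continuous h) : Continuous fun z => triple (f z) (g z) (h z) :=
  (tripleCLM n m).continuous.comp (hf.prodMk (hg.prodMk hh))

@[fun_prop] theorem Measurable.triple {Z : Type*} [MeasurableSpace Z]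
    {f g : Z → ℰ (Fin n)} {h : Z → ℰ (Fin m)} (hf : Measurable f)
    (hg : Measurable g) (hh : Measurable h) : Measurable fun z => triple (f z) (g z) (h z) :=
  (tripleCLM n m).continuous.measurable.comp (hf.prodMk (hg.prodMk hh))

/-- Concatenation of coordinates preserves the Lebesgue measure. -/
theorem measurePreserving_sumElim {ι κ : Type} [Fintype ι] [Fintype κ] :
    MeasurePreserving (fun q : ℰ ι × ℰ κ =>
      (WithLp.toLp 2 (Sum.elim (fun i => q.1 i) (fun i => q.2 i)) : ℰ (ι ⊕ κ))) := by
  have h1 := (PiLp.volume_preserving_ofLp ι).prod (PiLp.volume_preserving_ofLp κ)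
  have h2 := (volume_measurePreserving_sumPiEquivProdPi (fun _ : ι ⊕ κ => ℝ)).symm
  have h3 := PiLp.volume_preserving_toLp (ι ⊕ κ)
  have h4 := h3.comp (h2.comp h1)
  rw [Measure.volume_eq_prod]
  convert h4 using 1
  ext q i
  rcases i with i | i <;> rfl

theorem measurePreserving_triple : MeasurePreserving (fun q : ℰ (Fin n) ×
    ℰ (Fin n) × ℰ (Fin m) => triple q.1 q.2.1 q.2.2) := by
  have h1 := (MeasurePreserving.id (volume : Measure (ℰ (Fin n)))).prod
    (measurePreserving_sumElim (ι := Fin n) (κ := Fin m))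
  have h2 := (measurePreserving_sumElim (ι := Fin n) (κ := Fin n ⊕ Fin m)).comp h1
  exact h2

theorem lintegral_triple {f : TripleSpace n m → ℝ≥0∞} (hf : Measurable f) :
    ∫⁻ X, f X = ∫⁻ x, ∫⁻ y, ∫⁻ ζ, f (triple x y ζ) := by
  rw [← measurePreserving_triple.lintegral_comp hf, Measure.volume_eq_prod]
  have h1 : Measurable fun q : ℰ (Fin n) × ℰ (Fin n) ×
      ℰ (Fin m) => f (triple q.1 q.2.1 q.2.2) := hf.comp (by fun_prop)
  rw [lintegral_prod _ h1.aemeasurable]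
  refine lintegral_congr fun x => ?_
  have h2 : Measurable fun q : ℰ (Fin n) × ℰ (Fin m) =>
      f (triple x q.1 q.2) := hf.comp (by fun_prop)
  exact lintegral_prod _ h2.aemeasurable

/-- Pairs of triples are regrouped into a triple of pairs. -/
theorem lintegral_triple_pair {f : TripleSpace n m × TripleSpace n m → ℝ≥0∞} (hf : Measurable f) :
    ∫⁻ q, f q = ∫⁻ s : ℰ (Fin n) × ℰ (Fin n),
      ∫⁻ t : ℰ (Fin n) × ℰ (Fin n),
      ∫⁻ u : ℰ (Fin m) × ℰ (Fin m),
        f (triple s.1 t.1 u.1, triple s.2 t.2 u.2) := by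
  have h0 := (measurePreserving_triple (n := n) (m := m)).prod
    (measurePreserving_triple (n := n) (m := m))
  rw [Measure.volume_eq_prod, ← h0.lintegral_comp hf]
  simp only [Measure.volume_eq_prod]
  have h1 : Measurable fun q : (ℰ (Fin n) × ℰ (Fin n) ×
      ℰ (Fin m)) × (ℰ (Fin n) × ℰ (Fin n) ×
      ℰ (Fin m)) => f (Prod.map (fun q => triple q.1 q.2.1 q.2.2)
        (fun q => triple q.1 q.2.1 q.2.2) q) := hf.comp h0.measurable
  rw [lintegral_prod_prod_comm h1]
  refine lintegral_congr fun s => ?_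
  rw [lintegral_prod_prod_comm]
  · rfl
  · exact h1.comp (by fun_prop)

end Triple

section Marginal

variable {E E' : Type*} [NormedAddCommGroup E] [MeasureSpace E] [BorelSpace E]
  [SecondCountableTopology E] [NormedAddCommGroup E'] [MeasureSpace E'] [BorelSpace E']
  [SecondCountableTopology E'] [(volume : Measure E).IsAddLeftInvariant]
  [(volume : Measure E').IsAddLeftInvariant] [(volume : Measure E).IsNegInvariant]
  [(volume : Measure E').IsNegInvariant] [SFinite (volume : Measure E)]
  [SFinite (volume : Measure E')]

/-- The bound for a marginal of the kernel of the operator: the frequency variable `t.2` is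
integrated out by translation invariance, and the remaining variables by a change of variables. -/
theorem lintegral_marginal_le {P₁ P₂ : E × E' → E} {P₃ : E × E' → E'} (hP₁ : Measurable P₁)
    (hP₂ : Measurable P₂) (hP₃ : Measurable P₃) {D : ℝ≥0∞}
    (hJ : ∀ g : E × E' → ℝ≥0∞, Measurable g → ∫⁻ w, g (P₂ w, P₃ w) ≤ D * ∫⁻ w, g w)
    {G : E × E × E' → ℝ≥0∞} (hG : Measurable G) {k : E' → ℝ≥0∞} (hk : Measurable k) (l : E) :
    ∫⁻ t : E × E, ∫⁻ u : E' × E', G (-t.2 - P₁ (t.1, u.1), -l - P₂ (t.1, u.1),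
      -u.2 - P₃ (t.1, u.1)) * k u.2 ≤ D * (∫⁻ w : E × E', ∫⁻ b, G (b, w.1, w.2)) * ∫⁻ c, k c := by
  have hGm : Measurable fun w : E × E' => ∫⁻ b, G (b, w.1, w.2) := by
    have : Measurable fun w : (E × E') × E => G (w.2, w.1.1, w.1.2) := hG.comp (by fun_prop)
    exact this.lintegral_prod_right'
  have h1 : Measurable fun q : (E × E) × (E' × E') => G (-q.1.2 - P₁ (q.1.1, q.2.1),
      -l - P₂ (q.1.1, q.2.1), -q.2.2 - P₃ (q.1.1, q.2.1)) * k q.2.2 := by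
    refine (hG.comp ?_).mul (hk.comp (by fun_prop))
    fun_prop
  have h2 := lintegral_prod_prod_comm (μA := (volume : Measure E)) (μB := (volume : Measure E))
    (μC := (volume : Measure E')) (μD := (volume : Measure E')) h1
  rw [lintegral_prod _ h1.aemeasurable] at h2
  simp only [Measure.volume_eq_prod] at h2 ⊢
  rw [h2]
  have h3 : ∀ s : E × E', ∫⁻ t : E × E', G (-t.1 - P₁ (s.1, s.2), -l - P₂ (s.1, s.2),
      -t.2 - P₃ (s.1, s.2)) * k t.2 ∂(volume.prod volume) =
      ∫⁻ ν, (∫⁻ b, G (b, -l - P₂ s, -ν - P₃ s)) * k ν := fun s => by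
    rw [lintegral_prod_symm _ (by
      refine Measurable.aemeasurable ((hG.comp ?_).mul (hk.comp (by fun_prop)))
      fun_prop)]
    refine lintegral_congr fun ν => ?_
    have h4 : Measurable fun b : E => G (-b - P₁ s, -l - P₂ s, -ν - P₃ s) := hG.comp (by fun_prop)
    simp only [Prod.mk.eta]
    rw [lintegral_mul_const _ h4]
    congr 1
    rw [lintegral_neg_eq_self (fun b : E => G (b - P₁ s, -l - P₂ s, -ν - P₃ s))]
    have h5 : ∀ b : E, b - P₁ s = -P₁ s + b := fun b => by abel
    simp only [h5]
    exact lintegral_add_left_eq_self (fun b : E => G (b, -l - P₂ s, -ν - P₃ s)) _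
  simp only [h3]
  have h6 : Measurable (Function.uncurry fun (s : E × E') ν =>
      (∫⁻ b, G (b, -l - P₂ s, -ν - P₃ s)) * k ν) := by
    refine Measurable.mul ?_ (hk.comp measurable_snd)
    exact hGm.comp (f := fun q : (E × E') × E' => (-l - P₂ q.1, -q.2 - P₃ q.1)) (by fun_prop)
  rw [lintegral_lintegral_swap h6.aemeasurable]
  have h7 : ∀ ν, ∫⁻ s : E × E', (∫⁻ b, G (b, -l - P₂ s, -ν - P₃ s)) * k ν ∂(volume.prod volume) ≤
      D * (∫⁻ w : E × E', ∫⁻ b, G (b, w.1, w.2) ∂volume ∂(volume.prod volume)) * k ν := fun ν => by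
    have h8 : Measurable fun w : E × E' => ∫⁻ b, G (b, -l - w.1, -ν - w.2) :=
      hGm.comp (f := fun w : E × E' => (-l - w.1, -ν - w.2)) (by fun_prop)
    have h9 : Measurable fun s : E × E' => ∫⁻ b, G (b, -l - P₂ s, -ν - P₃ s) :=
      h8.comp (f := fun s : E × E' => (P₂ s, P₃ s)) (by fun_prop)
    rw [lintegral_mul_const _ h9]
    refine mul_le_mul_left ((hJ _ h8).trans_eq ?_) _
    congr 1
    rw [Measure.volume_eq_prod, lintegral_prod _ h8.aemeasurable,
      lintegral_prod _ hGm.aemeasurable]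
    have h10 : ∀ a : E, ∫⁻ c : E', ∫⁻ b, G (b, -l - a, -ν - c) = ∫⁻ c : E', ∫⁻ b, G (b, -l - a, c) :=
      fun a => lintegral_sub_left_eq_self (fun c : E' => ∫⁻ b, G (b, -l - a, c)) (-ν)
    simp only [h10]
    exact lintegral_sub_left_eq_self (fun a : E => ∫⁻ c : E', ∫⁻ b, G (b, a, c)) (-l)
  refine (lintegral_mono h7).trans_eq ?_
  rw [lintegral_const_mul _ hk]

end Marginal

/-! ### The change of variables attached to the phase -/

instance {ι κ : Type} [Fintype ι] [Fintype κ] :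
    (volume : Measure (ℰ ι × ℰ κ)).IsAddHaarMeasure :=
  Measure.prod.instIsAddHaarMeasure volume volume

section Jacobian

variable {ι : Type} [Fintype ι] [DecidableEq ι] {φ : ℰ ι → ℝ}

/-- The Hessian of `φ` as an operator. -/
noncomputable def hessCLM (φ : ℰ ι → ℝ) (X : ℰ ι) :
    ℰ ι →L[ℝ] ℰ ι :=
  ∑ i, ∑ j, pderiv2 j i φ X •
    (EuclideanSpace.proj j : ℰ ι →L[ℝ] ℝ).smulRight (EuclideanSpace.single i (1 : ℝ))

theorem hessCLM_apply (X Y : ℰ ι) (i : ι) :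
    hessCLM φ X Y i = ∑ j, pderiv2 j i φ X * Y j := by
  simp only [hessCLM, sum_apply, WithLp.ofLp_sum, Finset.sum_apply]
  rw [Finset.sum_comm]
  refine Finset.sum_congr rfl fun j _ => ?_
  rw [Finset.sum_eq_single i (fun b _ hb => by simp [hb.symm]) (by simp)]
  simp

theorem hasFDerivAt_gradVec (hφ : ContDiff ℝ 2 φ) (X : ℰ ι) :
    HasFDerivAt (gradVec φ) (hessCLM φ X) X := by
  rw [← hasFDerivWithinAt_univ, hasFDerivWithinAt_euclidean]
  intro i
  rw [hasFDerivWithinAt_univ]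
  have h1 := ((contDiff_pderivAt hφ i).differentiable one_ne_zero X).hasFDerivAt
  refine HasFDerivAt.congr_fderiv h1 ?_
  ext Y
  simp only [fderiv_apply_eq_sum, ContinuousLinearMap.comp_apply, PiLp.proj_apply, hessCLM_apply,
    pderiv2, mul_comm]

theorem hessCLM_bounded_uniformContinuous (h : ∀ i j, (∃ C, ∀ X, ‖pderiv2 i j φ X‖ ≤ C) ∧
    UniformContinuous (pderiv2 i j φ)) :
    (∃ C, ∀ X, ‖hessCLM φ X‖ ≤ C) ∧ UniformContinuous (hessCLM φ) := by
  choose C hC using fun i j => (h i j).1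
  refine ⟨⟨∑ i, ∑ j, C j i * ‖(EuclideanSpace.proj j : ℰ ι →L[ℝ] ℝ).smulRight
    (EuclideanSpace.single i (1 : ℝ))‖, fun X => ?_⟩, ?_⟩
  · refine (norm_sum_le _ _).trans (Finset.sum_le_sum fun i _ => ?_)
    refine (norm_sum_le _ _).trans (Finset.sum_le_sum fun j _ => ?_)
    rw [norm_smul]
    exact mul_le_mul_of_nonneg_right (hC j i X) (norm_nonneg _)
  · have h1 : ∀ i j, UniformContinuous fun X => pderiv2 j i φ X •
        (EuclideanSpace.proj j : ℰ ι →L[ℝ] ℝ).smulRight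
          (EuclideanSpace.single i (1 : ℝ)) := fun i j => by
      have h2 := ((ContinuousLinearMap.toSpanSingleton ℝ
        ((EuclideanSpace.proj j : ℰ ι →L[ℝ] ℝ).smulRight
          (EuclideanSpace.single i (1 : ℝ)))).uniformContinuous).comp (h j i).2
      simpa only [Function.comp_def, ContinuousLinearMap.toSpanSingleton_apply] using h2
    exact Finset.uniformContinuous_sum _ fun i _ => Finset.uniformContinuous_sum _ fun j _ => h1 i j

variable {V : Type*} [NormedAddCommGroup V] [NormedSpace ℝ V] [FiniteDimensional ℝ V]
  [MeasurableSpace V] [BorelSpace V] {μ : Measure V} [μ.IsAddHaarMeasure]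

/-- Change of variables for the gradient of `φ` along an affine subspace `X₀ + A V`, seen through
the projection `L`. -/
theorem lintegral_gradVec_le (hφ : ContDiff ℝ 2 φ)
    (h : ∀ i j, (∃ C, ∀ X, ‖pderiv2 i j φ X‖ ≤ C) ∧ UniformContinuous (pderiv2 i j φ))
    (L : ℰ ι →L[ℝ] V) (A : V →L[ℝ] ℰ ι) {d : ℝ} (hd : 0 < d)
    (hdet : ∀ X, d ≤ |(L ∘L hessCLM φ X ∘L A).det|) (X₀ : ℰ ι) (G : V → ℝ≥0∞) :
    ∫⁻ w, G (L (gradVec φ (X₀ + A w))) ∂μ ≤ ENNReal.ofReal d⁻¹ * ∫⁻ w, G w ∂μ := by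
  obtain ⟨⟨C, hC⟩, huc⟩ := hessCLM_bounded_uniformContinuous h
  let F' : V → V →L[ℝ] V := fun w => L ∘L hessCLM φ (X₀ + A w) ∘L A
  have hF : ∀ w, HasFDerivAt (fun w => L (gradVec φ (X₀ + A w))) (F' w) w := fun w => by
    have h1 : HasFDerivAt (fun w => X₀ + A w) A w := A.hasFDerivAt.const_add X₀
    have h2 : HasFDerivAt (fun w => gradVec φ (X₀ + A w)) (hessCLM φ (X₀ + A w) ∘L A) w :=
      HasFDerivAt.comp (g := gradVec φ) w (hasFDerivAt_gradVec hφ (X₀ + A w)) h1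
    exact L.hasFDerivAt.comp w h2
  refine lintegral_comp_le_of_det_ge (M := ‖L‖ * (C * ‖A‖)) hF (fun w => ?_) hd
    (fun w => hdet _) ?_ G
  · refine (ContinuousLinearMap.opNorm_comp_le _ _).trans ?_
    gcongr
    refine (ContinuousLinearMap.opNorm_comp_le _ _).trans ?_
    gcongr
    exact hC _
  · have h1 : UniformContinuous fun w => X₀ + A w :=
      A.uniformContinuous.const_add X₀
    have h2 := huc.comp h1
    have h3 : UniformContinuous fun B : ℰ ι →L[ℝ] ℰ ι =>
        L ∘L B ∘L A :=
      (((ContinuousLinearMap.compL ℝ V (ℰ ι) V) L).uniformContinuous.comp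
        ((ContinuousLinearMap.compL ℝ V (ℰ ι)
          (ℰ ι)).flip A).uniformContinuous)
    exact h3.comp h2

end Jacobian

section TripleJacobian

variable {n m : ℕ} {φ : TripleSpace n m → ℝ}

/-- The standard basis of `ℝ^n × ℝ^m`. -/
noncomputable def pairBasis (n m : ℕ) : Module.Basis (Fin n ⊕ Fin m) ℝ
    (ℰ (Fin n) × ℰ (Fin m)) :=
  (EuclideanSpace.basisFun (Fin n) ℝ).toBasis.prod (EuclideanSpace.basisFun (Fin m) ℝ).toBasis

/-- The Jacobian of `(y, ζ) ↦ (φ'_x, φ'_ζ)`, for fixed `x`. -/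
theorem det_xz_eq (hφ : ContDiff ℝ 2 φ) (X : TripleSpace n m) :
    (((xCLM n m).prod (zCLM n m)) ∘L hessCLM φ X ∘L (tripleCLM n m ∘L
      ContinuousLinearMap.inr ℝ _ _)).det = (mixedHessian φ X).det := by
  rw [ContinuousLinearMap.det, ← LinearMap.det_toMatrix (pairBasis n m)]
  congr 1
  ext i j
  rw [LinearMap.toMatrix_apply]
  rcases i with i | i <;> rcases j with j | j <;>
    simp [pairBasis, mixedHessian, hessCLM_apply, xPart, zPart, triple]
  all_goals exact pderiv2_comm hφ _ _ _

/-- The Jacobian of `(x, ζ) ↦ (φ'_y, φ'_ζ)`, for fixed `y`; its matrix is the transpose of the mixed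
Hessian. -/
theorem det_yz_eq (X : TripleSpace n m) :
    (((yCLM n m).prod (zCLM n m)) ∘L hessCLM φ X ∘L (tripleCLM n m ∘L
      (ContinuousLinearMap.fst ℝ _ _).prod
        ((0 : ℰ (Fin n) × ℰ (Fin m) →L[ℝ] _).prod
          (ContinuousLinearMap.snd ℝ _ _)))).det = (mixedHessian φ X).det := by
  rw [ContinuousLinearMap.det, ← LinearMap.det_toMatrix (pairBasis n m), ← Matrix.det_transpose]
  congr 1
  ext j i
  rw [Matrix.transpose_apply, LinearMap.toMatrix_apply]
  rcases i with i | i <;> rcases j with j | j <;>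
    simp [pairBasis, mixedHessian, hessCLM_apply, yPart, zPart, triple]

variable {d : ℝ}

/-- The kernel, acting on weighted short-time Fourier transforms, which dominates the operator. -/
noncomputable def fioKernel (φ : TripleSpace n m → ℝ) (G : TripleSpace n m → ℝ≥0∞)
    (k : ℰ (Fin m) → ℝ≥0∞)
    (s t : ℰ (Fin n) × ℰ (Fin n)) : ℝ≥0∞ :=
  ∫⁻ u : ℰ (Fin m) × ℰ (Fin m),
    G (-triple s.2 t.2 u.2 - gradVec φ (triple s.1 t.1 u.1)) * k u.2

theorem continuous_gradVec (hφ : ContDiff ℝ 2 φ) : Continuous (gradVec φ) :=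
  continuous_iff_continuousAt.2 fun X => (hasFDerivAt_gradVec hφ X).continuousAt

variable {G : TripleSpace n m → ℝ≥0∞} {k : ℰ (Fin m) → ℝ≥0∞}

theorem measurable_fioKernel (hφ : ContDiff ℝ 2 φ) (hG : Measurable G) (hk : Measurable k) :
    Measurable (Function.uncurry (fioKernel φ G k)) := by
  have hg := (continuous_gradVec hφ).measurable
  have h1 : Measurable fun q : ((ℰ (Fin n) × ℰ (Fin n)) ×
      (ℰ (Fin n) × ℰ (Fin n))) ×
      (ℰ (Fin m) × ℰ (Fin m)) =>
      G (-triple q.1.1.2 q.1.2.2 q.2.2 - gradVec φ (triple q.1.1.1 q.1.2.1 q.2.1)) * k q.2.2 := by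
    refine (hG.comp (Measurable.sub (by fun_prop) (hg.comp (by fun_prop)))).mul
      (hk.comp (by fun_prop))
  exact h1.lintegral_prod_right'

theorem neg_triple_sub (l b : ℰ (Fin n)) (c : ℰ (Fin m))
    (Y : TripleSpace n m) :
    -triple l b c - Y = triple (-l - xPart Y) (-b - yPart Y) (-c - zPart Y) := by
  ext i
  rcases i with i | i | i <;> rfl

theorem triple_eq_add (x y : ℰ (Fin n)) (c : ℰ (Fin m)) :
    triple x y c = triple x 0 0 + triple 0 y c := by
  ext i
  rcases i with i | i | i <;> simp [triple]

theorem triple_eq_add' (x y : ℰ (Fin n)) (c : ℰ (Fin m)) :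
    triple x y c = triple 0 y 0 + triple x 0 c := by
  ext i
  rcases i with i | i | i <;> simp [triple]

theorem lintegral_fioKernel_right_le (hφ : ContDiff ℝ 2 φ)
    (h : ∀ i j, (∃ C, ∀ X, ‖pderiv2 i j φ X‖ ≤ C) ∧ UniformContinuous (pderiv2 i j φ))
    (hd : 0 < d) (hdet : ∀ X, d ≤ |(mixedHessian φ X).det|) (hG : Measurable G)
    (hk : Measurable k) (s : ℰ (Fin n) × ℰ (Fin n)) :
    ∫⁻ t, fioKernel φ G k s t ≤ ENNReal.ofReal d⁻¹ * (∫⁻ X, G X) * ∫⁻ c, k c := by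
  have hg := (continuous_gradVec hφ).measurable
  have hx : Measurable (xPart : TripleSpace n m → _) := continuous_xPart.measurable
  have hy : Measurable (yPart : TripleSpace n m → _) := continuous_yPart.measurable
  have hz : Measurable (zPart : TripleSpace n m → _) := continuous_zPart.measurable
  have hm : Measurable fun w : ℰ (Fin n) × ℰ (Fin m) =>
      gradVec φ (triple s.1 w.1 w.2) := hg.comp (by fun_prop)
  have := lintegral_marginal_le (hy.comp hm) (hx.comp hm) (hz.comp hm) (D := ENNReal.ofReal d⁻¹)
    (fun g _ => ?_) (G := fun q => G (triple q.2.1 q.1 q.2.2)) (hG.comp (by fun_prop)) hk s.2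
  · simp only [fioKernel, neg_triple_sub]
    refine this.trans_eq ?_
    congr 2
    rw [lintegral_triple hG]
    have h1 : Measurable fun q : (ℰ (Fin n) × ℰ (Fin m)) ×
        ℰ (Fin n) => G (triple q.1.1 q.2 q.1.2) := hG.comp (by fun_prop)
    rw [Measure.volume_eq_prod, lintegral_prod _ h1.lintegral_prod_right'.aemeasurable]
    refine lintegral_congr fun x => ?_
    have h2 : Measurable fun q : ℰ (Fin m) × ℰ (Fin n) =>
      G (triple x q.2 q.1) := hG.comp (by fun_prop)
    exact lintegral_lintegral_swap h2.aemeasurable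
  · have h1 := lintegral_gradVec_le (μ := (volume : Measure (ℰ (Fin n) ×
      ℰ (Fin m)))) hφ h ((xCLM n m).prod (zCLM n m))
      (tripleCLM n m ∘L ContinuousLinearMap.inr ℝ _ _) hd
      (fun X => (hdet X).trans_eq (by rw [det_xz_eq hφ])) (triple s.1 0 0) g
    simpa [← triple_eq_add] using h1

theorem lintegral_fioKernel_left_le (hφ : ContDiff ℝ 2 φ)
    (h : ∀ i j, (∃ C, ∀ X, ‖pderiv2 i j φ X‖ ≤ C) ∧ UniformContinuous (pderiv2 i j φ))
    (hd : 0 < d) (hdet : ∀ X, d ≤ |(mixedHessian φ X).det|) (hG : Measurable G)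
    (hk : Measurable k) (t : ℰ (Fin n) × ℰ (Fin n)) :
    ∫⁻ s, fioKernel φ G k s t ≤ ENNReal.ofReal d⁻¹ * (∫⁻ X, G X) * ∫⁻ c, k c := by
  have hg := (continuous_gradVec hφ).measurable
  have hx : Measurable (xPart : TripleSpace n m → _) := continuous_xPart.measurable
  have hy : Measurable (yPart : TripleSpace n m → _) := continuous_yPart.measurable
  have hz : Measurable (zPart : TripleSpace n m → _) := continuous_zPart.measurable
  have hm : Measurable fun w : ℰ (Fin n) × ℰ (Fin m) =>
      gradVec φ (triple w.1 t.1 w.2) := hg.comp (by fun_prop)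
  have := lintegral_marginal_le (hx.comp hm) (hy.comp hm) (hz.comp hm) (D := ENNReal.ofReal d⁻¹)
    (fun g _ => ?_) (G := fun q => G (triple q.1 q.2.1 q.2.2)) (hG.comp (by fun_prop)) hk t.2
  · simp only [fioKernel, neg_triple_sub]
    refine this.trans_eq ?_
    congr 2
    rw [lintegral_triple hG]
    have h1 : Measurable fun q : (ℰ (Fin n) × ℰ (Fin m)) ×
        ℰ (Fin n) => G (triple q.2 q.1.1 q.1.2) := hG.comp (by fun_prop)
    rw [lintegral_lintegral_swap h1.aemeasurable]
    refine lintegral_congr fun x => ?_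
    have h2 : Measurable fun q : ℰ (Fin n) × ℰ (Fin m) =>
      G (triple x q.1 q.2) := hG.comp (by fun_prop)
    exact lintegral_prod _ h2.aemeasurable
  · have h1 := lintegral_gradVec_le (μ := (volume : Measure (ℰ (Fin n) ×
      ℰ (Fin m)))) hφ h ((yCLM n m).prod (zCLM n m))
      (tripleCLM n m ∘L (ContinuousLinearMap.fst ℝ _ _).prod
        ((0 : ℰ (Fin n) × ℰ (Fin m) →L[ℝ] _).prod
          (ContinuousLinearMap.snd ℝ _ _))) hd
      (fun X => (hdet X).trans_eq (by rw [det_yz_eq])) (triple 0 t.1 0) g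
    simpa [← triple_eq_add'] using h1

end TripleJacobian

/-! ### The operator in phase space -/

section Form

variable {n m : ℕ}

theorem inner_triple (Y : TripleSpace n m) (l b : ℰ (Fin n))
    (c : ℰ (Fin m)) : inner ℝ Y (triple l b c) =
      inner ℝ (xPart Y) l + (inner ℝ (yPart Y) b + inner ℝ (zPart Y) c) := by
  simp only [PiLp.inner_apply, Fintype.sum_sum_type]
  rfl

theorem chr_neg_triple (Y : TripleSpace n m) (l b : ℰ (Fin n))
    (c : ℰ (Fin m)) : chr Y (-triple l b c) =
      chr (xPart Y) (-l) * (chr (yPart Y) (-b) * chr (zPart Y) (-c)) := by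
  simp only [chr, inner_neg_right, inner_triple, ← Complex.exp_add]
  push_cast
  ring_nf

theorem integral_triple_prod {f g : ℰ (Fin n) → ℂ} {h : ℰ (Fin m) → ℂ}
    (hf : Continuous f) (hg : Continuous g) (hh : Continuous h) :
    ∫ X : TripleSpace n m, f (xPart X) * (g (yPart X) * h (zPart X)) =
      (∫ x, f x) * ((∫ y, g y) * ∫ ζ, h ζ) := by
  have hc : Continuous fun X : TripleSpace n m => f (xPart X) * (g (yPart X) * h (zPart X)) := by
    fun_prop
  rw [← measurePreserving_triple.map_eq,
    integral_map measurePreserving_triple.measurable.aemeasurable hc.aestronglyMeasurable]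
  simp only [xPart_triple, yPart_triple, zPart_triple, Measure.volume_eq_prod]
  rw [integral_prod_mul f fun q : ℰ (Fin n) × ℰ (Fin m) =>
    g q.1 * h q.2, integral_prod_mul g h]

theorem integrable_triple_prod {f g : ℰ (Fin n) → ℂ}
    {h : ℰ (Fin m) → ℂ} (hf : Continuous f) (hg : Continuous g) (hh : Continuous h)
    (hf' : Integrable f) (hg' : Integrable g) (hh' : Integrable h) :
    Integrable fun X : TripleSpace n m => f (xPart X) * (g (yPart X) * h (zPart X)) := by
  have hc : Continuous fun X : TripleSpace n m => f (xPart X) * (g (yPart X) * h (zPart X)) := by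
    fun_prop
  rw [← measurePreserving_triple.integrable_comp hc.aestronglyMeasurable]
  exact hf'.mul_prod (hg'.mul_prod hh')

variable {V : Type*} [NormedAddCommGroup V] [InnerProductSpace ℝ V] [FiniteDimensional ℝ V]
  [MeasurableSpace V] [BorelSpace V]

/-- The windowed Fourier transform of `e^{iφ}`. -/
noncomputable def phaseStft {ι : Type} [Fintype ι] (χ₂ : 𝓢(ℰ ι, ℂ))
    (φ : ℰ ι → ℝ) (z : ℰ ι × ℰ ι) : ℂ :=
  hatF (fun Y => Complex.exp (Complex.I * (φ Y : ℂ)) * χ₂ (Y - z.1)) z.2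

theorem norm_cexp_I_mul (t : ℝ) : ‖Complex.exp (Complex.I * (t : ℂ))‖ = 1 := by
  rw [mul_comm, Complex.norm_exp_ofReal_mul_I]

theorem stronglyMeasurable_phaseStft {ι : Type} [Fintype ι] (χ₂ : 𝓢(ℰ ι, ℂ))
    {φ : ℰ ι → ℝ} (hφ : Continuous φ) : StronglyMeasurable (phaseStft χ₂ φ) := by
  have hc : Continuous fun q : (ℰ ι × ℰ ι) × ℰ ι =>
      chr q.2 q.1.2 * (Complex.exp (Complex.I * (φ q.2 : ℂ)) * χ₂ (q.2 - q.1.1)) := by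
    have := χ₂.continuous
    fun_prop
  exact hc.stronglyMeasurable.integral_prod_right'

/-- The integrand, over the positions `X = r.1` and the frequencies `Λ = r.2.1`, `Ξ = r.2.2`, of
the phase space form of the operator. The window of the variable `ζ` is `κ'`. -/
noncomputable def fioIntegrand (χ χ₂ : 𝓢(TripleSpace n m, ℂ))
    (κ χ₁ : 𝓢(ℰ (Fin n), ℂ)) (κ' : 𝓢(ℰ (Fin m), ℂ))
    (φ : TripleSpace n m → ℝ) (a : 𝓢'(TripleSpace n m, ℂ)) (f g : 𝓢'(ℰ (Fin n), ℂ))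
    (r : TripleSpace n m × TripleSpace n m × TripleSpace n m) : ℂ :=
  stft₀ χ a (r.1, r.2.2) * phaseStft χ₂ φ (r.1, -r.2.1 - r.2.2) *
    (stft₀ κ g (xPart r.1, xPart r.2.1) * (stft₀ χ₁ f (yPart r.1, yPart r.2.1) *
      (chr (zPart r.1) (zPart r.2.1) * hatF κ' (zPart r.2.1))))

variable {χ χ₂ : 𝓢(TripleSpace n m, ℂ)} {κ χ₁ : 𝓢(ℰ (Fin n), ℂ)}
  {κ' : 𝓢(ℰ (Fin m), ℂ)} {φ : TripleSpace n m → ℝ}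

theorem aestronglyMeasurable_fioIntegrand (hφ : Continuous φ) (a : 𝓢'(TripleSpace n m, ℂ))
    (f g : 𝓢'(ℰ (Fin n), ℂ)) :
    AEStronglyMeasurable (fioIntegrand χ χ₂ κ χ₁ κ' φ a f g) volume := by
  have h1 := continuous_stft₀ χ a
  have h2 := continuous_stft₀ κ g
  have h3 := continuous_stft₀ χ₁ f
  have h4 : Continuous (hatF κ') := continuous_hatF κ'.integrable
  have h5 : Continuous fun r : TripleSpace n m × TripleSpace n m × TripleSpace n m =>
      (stft₀ κ g (xPart r.1, xPart r.2.1) * (stft₀ χ₁ f (yPart r.1, yPart r.2.1) *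
      (chr (zPart r.1) (zPart r.2.1) * hatF κ' (zPart r.2.1)))) := by
    fun_prop
  have h6 : Continuous fun r : TripleSpace n m × TripleSpace n m × TripleSpace n m =>
      stft₀ χ a (r.1, r.2.2) := by fun_prop
  have h7 : StronglyMeasurable fun r : TripleSpace n m × TripleSpace n m × TripleSpace n m =>
      phaseStft χ₂ φ (r.1, -r.2.1 - r.2.2) :=
    (stronglyMeasurable_phaseStft χ₂ hφ).comp_measurable (by fun_prop)
  exact ((h6.stronglyMeasurable.mul h7).mul h5.stronglyMeasurable).aestronglyMeasurable

theorem hatF_comp_sub (κ' : 𝓢(V, ℂ)) (ζ ν : V) :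
    hatF (fun y => κ' (y - ζ)) ν = chr ζ ν * hatF κ' ν := by
  have h := integral_add_right_eq_self (μ := volume) (fun y => chr y ν * κ' (y - ζ)) ζ
  rw [hatF, ← h, hatF, ← integral_const_mul]
  refine integral_congr_ae (ae_of_all _ fun y => ?_)
  simp only [add_sub_cancel_right, chr_add_left]
  ring

/-- Localizing a symbol and two functions near `X`, the localized pairing is a superposition of
windowed Fourier transforms of `e^{iφ}`. -/
theorem integral_localized_eq (hφ : Continuous φ) (a : 𝓢(TripleSpace n m, ℂ))
    (f g : 𝓢(ℰ (Fin n), ℂ)) (X : TripleSpace n m) :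
    (2 * Real.pi : ℂ) ^ Module.finrank ℝ (TripleSpace n m) *
      ((2 * Real.pi : ℂ) ^ Module.finrank ℝ (ℰ (Fin n)) *
      ((2 * Real.pi : ℂ) ^ Module.finrank ℝ (ℰ (Fin n)) *
      (2 * Real.pi : ℂ) ^ Module.finrank ℝ (ℰ (Fin m)))) *
      ∫ Y, (a Y * Complex.exp (Complex.I * (φ Y : ℂ)) * f (yPart Y) * g (xPart Y)) *
        (χ (Y - X) * χ₂ (Y - X) * (κ (xPart (Y - X)) * (χ₁ (yPart (Y - X)) *
          κ' (zPart (Y - X))))) =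
      ∫ q : TripleSpace n m × TripleSpace n m, fioIntegrand χ χ₂ κ χ₁ κ' φ
        (a : 𝓢'(TripleSpace n m, ℂ)) (f : 𝓢'(ℰ (Fin n), ℂ))
        (g : 𝓢'(ℰ (Fin n), ℂ)) (X, q) := by
  set c₁ := (2 * Real.pi : ℂ) ^ Module.finrank ℝ (TripleSpace n m)
  set c₂ := (2 * Real.pi : ℂ) ^ Module.finrank ℝ (ℰ (Fin n))
  set c₃ := (2 * Real.pi : ℂ) ^ Module.finrank ℝ (ℰ (Fin m))
  let κζ : 𝓢(ℰ (Fin m), ℂ) := SchwartzMap.compSubConstCLM ℂ (zPart X) κ'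
  have hκζ : ∀ y, κζ y = κ' (y - zPart X) := fun y => SchwartzMap.compSubConstCLM_apply _ _ _
  let u₁ := prodFam a χ 1 X
  let ug := prodFam g κ 1 (xPart X)
  let uf := prodFam f χ₁ 1 (yPart X)
  let W : TripleSpace n m × TripleSpace n m → ℂ := fun q =>
    (hatF ug (xPart q.1) * (hatF uf (yPart q.1) * hatF κζ (zPart q.1))) * hatF u₁ q.2
  have hc : ∀ s : 𝓢(ℰ (Fin n), ℂ), Continuous (hatF s) := fun s =>
    continuous_hatF s.integrable
  have hc' : Continuous (hatF κζ) := continuous_hatF κζ.integrable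
  have hW : Integrable W :=
    (integrable_triple_prod (hc ug) (hc uf) hc' (integrable_hatF ug) (integrable_hatF uf)
      (integrable_hatF κζ)).mul_prod (integrable_hatF u₁)
  -- Fourier inversion for each of the four localised functions
  have hinv : ∀ Y, c₁ * (c₂ * (c₂ * c₃)) * (u₁ Y * (ug (xPart Y) * (uf (yPart Y) * κζ (zPart Y)))) =
      ∫ q, W q * chr Y (-(q.1 + q.2)) := fun Y => by
    have e1 := hatF_inversion u₁.continuous u₁.integrable (integrable_hatF u₁) Y
    have e2 := hatF_inversion ug.continuous ug.integrable (integrable_hatF ug) (xPart Y)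
    have e3 := hatF_inversion uf.continuous uf.integrable (integrable_hatF uf) (yPart Y)
    have e4 := hatF_inversion κζ.continuous κζ.integrable (integrable_hatF κζ) (zPart Y)
    have e5 := integral_triple_prod (n := n) (m := m) (f := fun l => chr (xPart Y) (-l) * hatF ug l)
      (g := fun l => chr (yPart Y) (-l) * hatF uf l)
      (h := fun l => chr (zPart Y) (-l) * hatF κζ l)
      ((by fun_prop : Continuous fun l => chr (xPart Y) (-l)).mul (hc ug))
      ((by fun_prop : Continuous fun l => chr (yPart Y) (-l)).mul (hc uf))
      ((by fun_prop : Continuous fun l => chr (zPart Y) (-l)).mul hc')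
    have e6 := integral_prod_mul (μ := (volume : Measure (TripleSpace n m)))
      (ν := (volume : Measure (TripleSpace n m)))
      (fun L : TripleSpace n m => chr (xPart Y) (-xPart L) * hatF ug (xPart L) *
        (chr (yPart Y) (-yPart L) * hatF uf (yPart L) *
          (chr (zPart Y) (-zPart L) * hatF κζ (zPart L))))
      (fun L : TripleSpace n m => chr Y (-L) * hatF u₁ L)
    rw [e5, e1, e2, e3, e4] at e6
    calc _ = _ := by ring
      _ = _ := e6.symm
      _ = _ := by
        rw [Measure.volume_eq_prod]
        refine integral_congr_ae (ae_of_all _ fun q => ?_)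
        simp only [W]
        rw [neg_add, chr_add_right, ← triple_parts q.1, chr_neg_triple]
        simp only [xPart_triple, yPart_triple, zPart_triple]
        ring
  have hu : Integrable fun Y => Complex.exp (Complex.I * (φ Y : ℂ)) * χ₂ (Y - X) := by
    refine (χ₂.integrable.comp_sub_right X).bdd_mul (c := 1) ?_
      (ae_of_all _ fun Y => (norm_cexp_I_mul _).le)
    exact (by fun_prop : Continuous fun Y => Complex.exp
      (Complex.I * (φ Y : ℂ))).aestronglyMeasurable
  -- the integral is a Fourier transform at the frequency `0`
  have key := hatF_mul_of_superposition hW (p := fun q => q.1 + q.2) (by fun_prop) hinv hu 0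
  have hl : hatF (fun Y => Complex.exp (Complex.I * (φ Y : ℂ)) * χ₂ (Y - X) *
      (c₁ * (c₂ * (c₂ * c₃)) * (u₁ Y * (ug (xPart Y) * (uf (yPart Y) * κζ (zPart Y)))))) 0 =
      c₁ * (c₂ * (c₂ * c₃)) * ∫ Y, (a Y * Complex.exp (Complex.I * (φ Y : ℂ)) * f (yPart Y) *
        g (xPart Y)) * (χ (Y - X) * χ₂ (Y - X) * (κ (xPart (Y - X)) * (χ₁ (yPart (Y - X)) *
          κ' (zPart (Y - X))))) := by
    rw [hatF, ← integral_const_mul]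
    refine integral_congr_ae (ae_of_all _ fun Y => ?_)
    have e1 : xPart (Y - X) = xPart Y - xPart X := rfl
    have e2 : yPart (Y - X) = yPart Y - yPart X := rfl
    have e3 : zPart (Y - X) = zPart Y - zPart X := rfl
    simp only [chr_zero_right, u₁, ug, uf, prodFam_apply, one_smul, hκζ, e1, e2, e3]
    ring
  rw [← hl, key]
  refine integral_congr_ae (ae_of_all _ fun q => ?_)
  have e1 : hatF κζ (zPart q.1) = chr (zPart X) (zPart q.1) * hatF κ' (zPart q.1) := by
    rw [← hatF_comp_sub]
    congr 1
  simp only [W, fioIntegrand, phaseStft, stft₀_coe, e1]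
  rw [show (0 : TripleSpace n m) - (q.1 + q.2) = -q.1 - q.2 by abel]
  simp only [u₁, ug, uf]
  ring

theorem exists_schwartz_apply_ne_zero {W : Type*} [NormedAddCommGroup W] [InnerProductSpace ℝ W]
    [FiniteDimensional ℝ W] (p : W) : ∃ s : 𝓢(W, ℂ), s p ≠ 0 := by
  let b : ContDiffBump p := default
  have hs : ContDiff ℝ (⊤ : ℕ∞) fun x => ((b x : ℝ) : ℂ) :=
    Complex.ofRealCLM.contDiff.comp b.contDiff
  have hc : HasCompactSupport fun x => ((b x : ℝ) : ℂ) :=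
    b.hasCompactSupport.comp_left (g := fun t : ℝ => (t : ℂ)) Complex.ofReal_zero
  refine ⟨hc.toSchwartzMap hs, ?_⟩
  have h1 : (b p : ℝ) = 1 := b.one_of_mem_closedBall (by simp [b.rIn_pos.le])
  simp [h1]

/-- The mean of the product of all the windows. -/
noncomputable def windowMean (χ χ₂ : 𝓢(TripleSpace n m, ℂ))
    (κ χ₁ : 𝓢(ℰ (Fin n), ℂ)) (κ' : 𝓢(ℰ (Fin m), ℂ)) : ℂ :=
  ∫ W, χ W * χ₂ W * (κ (xPart W) * (χ₁ (yPart W) * κ' (zPart W)))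

/-- Windows can be chosen in such a way that their product has nonzero mean; a translate of a given
window is used for the variable `y`. -/
theorem exists_windows (hχ : χ ≠ 0) {χ₀ : 𝓢(ℰ (Fin n), ℂ)} (hχ₀ : χ₀ ≠ 0) :
    ∃ (χ₂ : 𝓢(TripleSpace n m, ℂ)) (κ : 𝓢(ℰ (Fin n), ℂ))
      (κ' : 𝓢(ℰ (Fin m), ℂ)) (z : ℰ (Fin n)), HasCompactSupport χ₂ ∧
      windowMean χ χ₂ κ (SchwartzMap.compSubConstCLM ℂ z χ₀) κ' ≠ 0 := by
  -- `χ₀` is moved to a point where the product of the windows does not vanish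
  obtain ⟨Y, hY⟩ : ∃ Y, χ Y ≠ 0 := by
    by_contra! h
    exact hχ (by ext Y; simpa using h Y)
  obtain ⟨p, hp⟩ : ∃ p, χ₀ p ≠ 0 := by
    by_contra! h
    exact hχ₀ (by ext Y; simpa using h Y)
  obtain ⟨κ, hκ⟩ := exists_schwartz_apply_ne_zero (xPart Y)
  obtain ⟨κ', hκ'⟩ := exists_schwartz_apply_ne_zero (zPart Y)
  let χ₁ := SchwartzMap.compSubConstCLM ℂ (yPart Y - p) χ₀
  have hχ₁ : χ₁ (yPart Y) = χ₀ p := by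
    rw [SchwartzMap.compSubConstCLM_apply, sub_sub_cancel]
  have t1 : Function.HasTemperateGrowth fun W : TripleSpace n m => κ (xPart W) :=
    κ.hasTemperateGrowth.comp (xCLM n m).hasTemperateGrowth
  have t2 : Function.HasTemperateGrowth fun W : TripleSpace n m => χ₁ (yPart W) :=
    χ₁.hasTemperateGrowth.comp (yCLM n m).hasTemperateGrowth
  have t3 : Function.HasTemperateGrowth fun W : TripleSpace n m => κ' (zPart W) :=
    κ'.hasTemperateGrowth.comp (zCLM n m).hasTemperateGrowth
  let s : 𝓢(TripleSpace n m, ℂ) := SchwartzMap.smulLeftCLM ℂ (fun W => κ (xPart W))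
    (SchwartzMap.smulLeftCLM ℂ (fun W => χ₁ (yPart W))
      (SchwartzMap.smulLeftCLM ℂ (fun W => κ' (zPart W)) χ))
  have hs : ∀ W, s W = κ (xPart W) * (χ₁ (yPart W) * (κ' (zPart W) * χ W)) := fun W => by
    simp only [s]
    rw [SchwartzMap.smulLeftCLM_apply_apply t1, SchwartzMap.smulLeftCLM_apply_apply t2,
      SchwartzMap.smulLeftCLM_apply_apply t3]
    rfl
  have hs0 : s ≠ 0 := fun h => by
    have h1 := hs Y
    rw [h, hχ₁] at h1
    exact mul_ne_zero hκ (mul_ne_zero hp (mul_ne_zero hκ' hY)) h1.symm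
  obtain ⟨χ₂, hc, hne⟩ := exists_windowPairing_ne_zero hs0
  refine ⟨χ₂, κ, κ', yPart Y - p, hc, ?_⟩
  convert hne using 1
  rw [windowMean, windowPairing]
  refine integral_congr_ae (ae_of_all _ fun W => ?_)
  simp only [hs]
  ring

/-- The phase space form of the pairing defining the Fourier integral operator. -/
theorem exists_fioPairing_eq (h0 : windowMean χ χ₂ κ χ₁ κ' ≠ 0) :
    ∃ c : ℂ, ∀ φ : TripleSpace n m → ℝ, Continuous φ → ∀ (a : 𝓢(TripleSpace n m, ℂ))
      (f g : 𝓢(ℰ (Fin n), ℂ)),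
      Integrable (fioIntegrand χ χ₂ κ χ₁ κ' φ (a : 𝓢'(TripleSpace n m, ℂ))
        (f : 𝓢'(ℰ (Fin n), ℂ)) (g : 𝓢'(ℰ (Fin n), ℂ))) →
      fioPairing φ a f g = c * ∫ r, fioIntegrand χ χ₂ κ χ₁ κ' φ (a : 𝓢'(TripleSpace n m, ℂ))
        (f : 𝓢'(ℰ (Fin n), ℂ)) (g : 𝓢'(ℰ (Fin n), ℂ)) r := by
  set c₁ : ℂ := (2 * Real.pi : ℂ) ^ Module.finrank ℝ (TripleSpace n m) *
      ((2 * Real.pi : ℂ) ^ Module.finrank ℝ (ℰ (Fin n)) *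
      ((2 * Real.pi : ℂ) ^ Module.finrank ℝ (ℰ (Fin n)) *
      (2 * Real.pi : ℂ) ^ Module.finrank ℝ (ℰ (Fin m)))) with hc₁
  have hc₁0 : c₁ ≠ 0 := mul_ne_zero (two_pi_pow_ne_zero _) (mul_ne_zero (two_pi_pow_ne_zero _)
    (mul_ne_zero (two_pi_pow_ne_zero _) (two_pi_pow_ne_zero _)))
  refine ⟨(((2 * Real.pi) ^ (-(n : ℝ)) : ℝ) : ℂ) * ((windowMean χ χ₂ κ χ₁ κ')⁻¹ * c₁⁻¹),
    fun φ hφ a f g hint => ?_⟩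
  let P : TripleSpace n m → ℂ := fun Y =>
    a Y * Complex.exp (Complex.I * (φ Y : ℂ)) * f (yPart Y) * g (xPart Y)
  let R : TripleSpace n m → ℂ := fun W =>
    χ W * χ₂ W * (κ (xPart W) * (χ₁ (yPart W) * κ' (zPart W)))
  have hb : ∀ {W : Type} [NormedAddCommGroup W] [InnerProductSpace ℝ W] (s : 𝓢(W, ℂ)),
      ∃ C, ∀ x, ‖s x‖ ≤ C := fun s => ⟨_, fun x => SchwartzMap.norm_le_seminorm ℂ s x⟩
  have cχ := χ.continuous
  have cχ₂ := χ₂.continuous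
  have cκ := κ.continuous
  have cκ' := κ'.continuous
  have cχ₁ := χ₁.continuous
  have cf := f.continuous
  have cg := g.continuous
  have hP : Integrable P := by
    obtain ⟨Cf, hCf⟩ := hb f
    obtain ⟨Cg, hCg⟩ := hb g
    have h1 : Integrable fun Y => (Complex.exp (Complex.I * (φ Y : ℂ)) * f (yPart Y) *
        g (xPart Y)) * a Y := by
      refine a.integrable.bdd_mul (c := 1 * Cf * Cg) ?_ (ae_of_all _ fun Y => ?_)
      · exact (by fun_prop : Continuous fun Y => Complex.exp (Complex.I * (φ Y : ℂ)) *
          f (yPart Y) * g (xPart Y)).aestronglyMeasurable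
      · rw [norm_mul, norm_mul, norm_cexp_I_mul]
        have := (norm_nonneg _).trans (hCf (yPart Y))
        gcongr
        · exact hCf _
        · exact hCg _
    refine h1.congr (ae_of_all _ fun Y => ?_)
    simp only [P]
    ring
  have hR : Integrable R := by
    obtain ⟨C₁, hC₁⟩ := hb χ
    obtain ⟨C₂, hC₂⟩ := hb κ
    obtain ⟨C₃, hC₃⟩ := hb χ₁
    obtain ⟨C₄, hC₄⟩ := hb κ'
    have h1 : Integrable fun W => (χ W * (κ (xPart W) * (χ₁ (yPart W) * κ' (zPart W)))) * χ₂ W := by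
      refine χ₂.integrable.bdd_mul (c := C₁ * (C₂ * (C₃ * C₄))) ?_ (ae_of_all _ fun W => ?_)
      · exact (by fun_prop : Continuous fun W => χ W * (κ (xPart W) * (χ₁ (yPart W) *
          κ' (zPart W)))).aestronglyMeasurable
      · have i1 := (norm_nonneg _).trans (hC₁ W)
        have i2 := (norm_nonneg _).trans (hC₂ (xPart W))
        have i3 := (norm_nonneg _).trans (hC₃ (yPart W))
        rw [norm_mul, norm_mul, norm_mul]
        gcongr
        · exact hC₁ _
        · exact hC₂ _
        · exact hC₃ _
        · exact hC₄ _
    refine h1.congr (ae_of_all _ fun W => ?_)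
    simp only [R]
    ring
  -- averaging the localised pairing over all positions `X` gives back the pairing, up to the mean of
  -- the product of the windows
  have hconv : ∫ X, ∫ Y, P Y * R (Y - X) = (∫ Y, P Y) * ∫ W, R W := by
    have h1 := integral_convolution (ContinuousLinearMap.mul ℝ ℂ) (μ := volume) (ν := volume)
      hP hR.comp_neg
    rw [integral_neg_eq_self (fun W => R W)] at h1
    simp only [convolution_def, ContinuousLinearMap.mul_apply', neg_sub] at h1
    exact h1
  have hloc : ∀ X, c₁ * ∫ Y, P Y * R (Y - X) = ∫ q : TripleSpace n m × TripleSpace n m,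
      fioIntegrand χ χ₂ κ χ₁ κ' φ (a : 𝓢'(TripleSpace n m, ℂ))
        (f : 𝓢'(ℰ (Fin n), ℂ)) (g : 𝓢'(ℰ (Fin n), ℂ)) (X, q) :=
    fun X => integral_localized_eq hφ a f g X
  have hfub : ∫ r, fioIntegrand χ χ₂ κ χ₁ κ' φ (a : 𝓢'(TripleSpace n m, ℂ))
        (f : 𝓢'(ℰ (Fin n), ℂ)) (g : 𝓢'(ℰ (Fin n), ℂ)) r =
      c₁ * ((∫ Y, P Y) * windowMean χ χ₂ κ χ₁ κ') := by
    rw [Measure.volume_eq_prod] at hint ⊢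
    rw [integral_prod _ hint]
    simp only [← hloc]
    rw [integral_const_mul, hconv]
    rfl
  rw [hfub, fioPairing]
  field_simp
  rfl

end Form

/-! ### Majorization of the phase space form -/

section Majorant

variable {n m : ℕ} {φ : TripleSpace n m → ℝ}

/-- The integral which dominates the phase space form: `D` bounds the symbol, `q` the windowed
Fourier transform of `e^{iφ}`, `k` the window of the variable `ζ`, and `F`, `G` the two functions. -/
noncomputable def fioMajorant (φ : TripleSpace n m → ℝ)
    (D : TripleSpace n m × TripleSpace n m → ℝ≥0∞) (q : TripleSpace n m → ℝ≥0∞)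
    (k : ℰ (Fin m) → ℝ≥0∞)
    (F G : ℰ (Fin n) × ℰ (Fin n) → ℝ≥0∞) : ℝ≥0∞ :=
  ∫⁻ r : TripleSpace n m × TripleSpace n m × TripleSpace n m,
    D (r.1, r.2.2) * q (-r.2.1 - r.2.2 - gradVec φ r.1) *
      (k (zPart r.2.1) * (F (yPart r.1, yPart r.2.1) * G (xPart r.1, xPart r.2.1)))

variable {D : TripleSpace n m × TripleSpace n m → ℝ≥0∞} {H q : TripleSpace n m → ℝ≥0∞}
  {k : ℰ (Fin m) → ℝ≥0∞}
  {F G : ℰ (Fin n) × ℰ (Fin n) → ℝ≥0∞}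

theorem measurable_fioMajorant (hφ : ContDiff ℝ 2 φ) (hD : Measurable D) (hq : Measurable q)
    (hk : Measurable k) (hF : Measurable F) (hG : Measurable G) :
    Measurable fun r : TripleSpace n m × TripleSpace n m × TripleSpace n m =>
      D (r.1, r.2.2) * q (-r.2.1 - r.2.2 - gradVec φ r.1) *
      (k (zPart r.2.1) * (F (yPart r.1, yPart r.2.1) * G (xPart r.1, xPart r.2.1))) := by
  have hx : Measurable (xPart : TripleSpace n m → _) := continuous_xPart.measurable
  have hy : Measurable (yPart : TripleSpace n m → _) := continuous_yPart.measurable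
  have hz : Measurable (zPart : TripleSpace n m → _) := continuous_zPart.measurable
  have hg := (continuous_gradVec hφ).measurable
  have e1 : Measurable fun r : TripleSpace n m × TripleSpace n m × TripleSpace n m =>
      -r.2.1 - r.2.2 - gradVec φ r.1 :=
    Measurable.sub (by fun_prop) (hg.comp measurable_fst)
  have e2 : Measurable fun r : TripleSpace n m × TripleSpace n m × TripleSpace n m =>
      (yPart r.1, yPart r.2.1) :=
    (hy.comp measurable_fst).prodMk (hy.comp (measurable_fst.comp measurable_snd))
  have e3 : Measurable fun r : TripleSpace n m × TripleSpace n m × TripleSpace n m =>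
      (xPart r.1, xPart r.2.1) :=
    (hx.comp measurable_fst).prodMk (hx.comp (measurable_fst.comp measurable_snd))
  have e4 : Measurable fun r : TripleSpace n m × TripleSpace n m × TripleSpace n m =>
      (r.1, r.2.2) := by fun_prop
  exact ((hD.comp e4).mul (hq.comp e1)).mul
    ((hk.comp (hz.comp (measurable_fst.comp measurable_snd))).mul
      ((hF.comp e2).mul (hG.comp e3)))

/-- The convolution of two nonnegative functions. -/
noncomputable def lconv (H q : TripleSpace n m → ℝ≥0∞) (Θ : TripleSpace n m) : ℝ≥0∞ :=
  ∫⁻ Ξ, H Ξ * q (Θ - Ξ)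

theorem measurable_lconv (hH : Measurable H) (hq : Measurable q) : Measurable (lconv H q) := by
  have h1 : Measurable fun r : TripleSpace n m × TripleSpace n m => H r.2 * q (r.1 - r.2) :=
    (hH.comp measurable_snd).mul (hq.comp (measurable_fst.sub measurable_snd))
  exact h1.lintegral_prod_right'

theorem lintegral_lconv (hH : Measurable H) (hq : Measurable q) :
    ∫⁻ Θ, lconv H q Θ = (∫⁻ Ξ, H Ξ) * ∫⁻ Θ, q Θ := by
  have h1 : Measurable fun r : TripleSpace n m × TripleSpace n m => H r.2 * q (r.1 - r.2) :=
    (hH.comp measurable_snd).mul (hq.comp (measurable_fst.sub measurable_snd))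
  simp only [lconv]
  rw [lintegral_lintegral_swap h1.aemeasurable, ← lintegral_mul_const _ hH]
  refine lintegral_congr fun Ξ => ?_
  have h2 : Measurable fun Θ => q (Θ - Ξ) := hq.comp (measurable_id.sub_const Ξ)
  rw [lintegral_const_mul _ h2, lintegral_sub_right_eq_self q]

/-- If the bound for the symbol depends on the frequency only, the majorant is given by a kernel
operator. -/
theorem fioMajorant_le (hφ : ContDiff ℝ 2 φ) (hD : ∀ z, D z ≤ H z.2) (hH : Measurable H)
    (hq : Measurable q) (hk : Measurable k) (hF : Measurable F) (hG : Measurable G) :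
    fioMajorant φ D q k F G ≤
      ∫⁻ s, G s * ∫⁻ t, fioKernel φ (lconv H q) k s t * F t := by
  have hx : Measurable (xPart : TripleSpace n m → _) := continuous_xPart.measurable
  have hy : Measurable (yPart : TripleSpace n m → _) := continuous_yPart.measurable
  have hz : Measurable (zPart : TripleSpace n m → _) := continuous_zPart.measurable
  have hg := (continuous_gradVec hφ).measurable
  have hm := measurable_fioMajorant (D := fun z => H z.2) hφ (hH.comp measurable_snd) hq hk hF hG
  calc fioMajorant φ D q k F G ≤ fioMajorant φ (fun z => H z.2) q k F G := by
        refine lintegral_mono fun r => ?_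
        exact mul_le_mul_left (mul_le_mul_left (hD _) _) _
    _ = ∫⁻ p : TripleSpace n m × TripleSpace n m, ∫⁻ Ξ, H Ξ * q (-p.2 - Ξ - gradVec φ p.1) *
          (k (zPart p.2) * (F (yPart p.1, yPart p.2) * G (xPart p.1, xPart p.2))) := by
        rw [fioMajorant, ← volume_preserving_prodAssoc.lintegral_comp hm, Measure.volume_eq_prod]
        exact lintegral_prod _ (hm.comp MeasurableEquiv.prodAssoc.measurable).aemeasurable
    _ = ∫⁻ p : TripleSpace n m × TripleSpace n m, lconv H q (-p.2 - gradVec φ p.1) *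
          (k (zPart p.2) * (F (yPart p.1, yPart p.2) * G (xPart p.1, xPart p.2))) := by
        refine lintegral_congr fun p => ?_
        have h2 : Measurable fun Ξ => H Ξ * q (-p.2 - Ξ - gradVec φ p.1) :=
          hH.mul (hq.comp (by fun_prop))
        rw [lintegral_mul_const _ h2, lconv]
        congr 1
        refine lintegral_congr fun Ξ => ?_
        rw [sub_right_comm]
    _ = ∫⁻ s : ℰ (Fin n) × ℰ (Fin n),
        ∫⁻ t : ℰ (Fin n) × ℰ (Fin n),
        ∫⁻ u : ℰ (Fin m) × ℰ (Fin m),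
          lconv H q (-triple s.2 t.2 u.2 - gradVec φ (triple s.1 t.1 u.1)) *
            (k u.2 * (F t * G s)) := by
        have e1 : Measurable fun p : TripleSpace n m × TripleSpace n m =>
            lconv H q (-p.2 - gradVec φ p.1) :=
          (measurable_lconv hH hq).comp (Measurable.sub (by fun_prop) (hg.comp measurable_fst))
        have e2 : Measurable fun p : TripleSpace n m × TripleSpace n m => k (zPart p.2) :=
          hk.comp (hz.comp measurable_snd)
        have e3 : Measurable fun p : TripleSpace n m × TripleSpace n m =>
            F (yPart p.1, yPart p.2) :=
          hF.comp ((hy.comp measurable_fst).prodMk (hy.comp measurable_snd))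
        have e4 : Measurable fun p : TripleSpace n m × TripleSpace n m =>
            G (xPart p.1, xPart p.2) :=
          hG.comp ((hx.comp measurable_fst).prodMk (hx.comp measurable_snd))
        have e5 : Measurable fun p : TripleSpace n m × TripleSpace n m =>
            lconv H q (-p.2 - gradVec φ p.1) *
            (k (zPart p.2) * (F (yPart p.1, yPart p.2) * G (xPart p.1, xPart p.2))) :=
          e1.mul (e2.mul (e3.mul e4))
        rw [lintegral_triple_pair e5]
        simp only [xPart_triple, yPart_triple, zPart_triple]
    _ = _ := by
        refine lintegral_congr fun s => ?_
        have h3 : Measurable fun t => fioKernel φ (lconv H q) k s t :=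
          (measurable_fioKernel hφ (measurable_lconv hH hq) hk).of_uncurry_left
        have h5 : Measurable fun t => fioKernel φ (lconv H q) k s t * F t := h3.mul hF
        rw [← lintegral_const_mul _ h5]
        refine lintegral_congr fun t => ?_
        have h4 : Measurable fun u : ℰ (Fin m) × ℰ (Fin m) =>
            lconv H q (-triple s.2 t.2 u.2 - gradVec φ (triple s.1 t.1 u.1)) * k u.2 := by
          have e6 : Measurable fun u : ℰ (Fin m) × ℰ (Fin m) =>
              -triple s.2 t.2 u.2 - gradVec φ (triple s.1 t.1 u.1) :=
            Measurable.sub (by fun_prop) (hg.comp (by fun_prop))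
          exact ((measurable_lconv hH hq).comp e6).mul (hk.comp measurable_snd)
        rw [fioKernel, ← lintegral_mul_const _ h4, ← lintegral_const_mul _ (h4.mul_const _)]
        refine lintegral_congr fun u => ?_
        ring

variable {χ χ₂ : 𝓢(TripleSpace n m, ℂ)} {κ χ₁ : 𝓢(ℰ (Fin n), ℂ)}
  {κ' : 𝓢(ℰ (Fin m), ℂ)} {ω : TripleSpace n m × TripleSpace n m → ℝ}
  {w : TripleSpace n m → ℝ} {ω₁ ω₂ : ℰ (Fin n) × ℰ (Fin n) → ℝ}
  {h : TripleSpace n m → ℝ≥0∞} {B : ℝ}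

/-- The function standing for the dual variable in the majorant. -/
noncomputable def dualStft (κ : 𝓢(ℰ (Fin n), ℂ))
    (ω₂ : ℰ (Fin n) × ℰ (Fin n) → ℝ)
    (g : 𝓢'(ℰ (Fin n), ℂ))
    (s : ℰ (Fin n) × ℰ (Fin n)) : ℝ≥0∞ :=
  ‖stft₀ κ g s‖ₑ * ENNReal.ofReal (ω₂ (s.1, -s.2))⁻¹

/-- The window of the variable `ζ` in the majorant. -/
noncomputable def zWindow (κ' : 𝓢(ℰ (Fin m), ℂ)) (w : TripleSpace n m → ℝ)
    (ν : ℰ (Fin m)) : ℝ≥0∞ :=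
  ‖hatF κ' ν‖ₑ * ENNReal.ofReal (w (triple 0 0 ν))

theorem enorm_fioIntegrand_le (hω : ∀ z, 0 < ω z) (hω₁ : ∀ z, 0 < ω₁ z) (hω₂ : ∀ z, 0 < ω₂ z)
    (hw : ∀ z, 0 < w z)
    (hh : ∀ X Θ, ‖phaseStft χ₂ φ (X, Θ)‖ₑ ≤ h (Θ - gradVec φ X))
    (hB : ∀ X Ξ Λ, ω₂ (xPart X, -xPart Λ) ≤ B * (ω (X, Ξ) * w (-Λ - Ξ - gradVec φ X) *
      (w (triple 0 0 (zPart Λ)) * ω₁ (yPart X, yPart Λ))))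
    (a : 𝓢'(TripleSpace n m, ℂ)) (f g : 𝓢'(ℰ (Fin n), ℂ))
    (r : TripleSpace n m × TripleSpace n m × TripleSpace n m) :
    ‖fioIntegrand χ χ₂ κ χ₁ κ' φ a f g r‖ₑ ≤ ENNReal.ofReal B *
      (‖wstft χ ω a (r.1, r.2.2)‖ₑ * (fun Θ => h Θ * ENNReal.ofReal (w Θ))
          (-r.2.1 - r.2.2 - gradVec φ r.1) *
        (zWindow κ' w (zPart r.2.1) * (‖wstft χ₁ ω₁ f (yPart r.1, yPart r.2.1)‖ₑ *
          dualStft κ ω₂ g (xPart r.1, xPart r.2.1)))) := by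
  -- the weights are introduced by multiplication with a quantity which is at least `1`
  have h1 : (1 : ℝ≥0∞) ≤ ENNReal.ofReal B * (ENNReal.ofReal (ω (r.1, r.2.2)) *
      ENNReal.ofReal (w (-r.2.1 - r.2.2 - gradVec φ r.1)) *
      (ENNReal.ofReal (w (triple 0 0 (zPart r.2.1))) *
        ENNReal.ofReal (ω₁ (yPart r.1, yPart r.2.1))) *
      ENNReal.ofReal (ω₂ (xPart r.1, -xPart r.2.1))⁻¹) := by
    have i1 := (hω (r.1, r.2.2)).le
    have i2 := (hw (-r.2.1 - r.2.2 - gradVec φ r.1)).le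
    have i3 := (hw (triple 0 0 (zPart r.2.1))).le
    have i4 := (hω₁ (yPart r.1, yPart r.2.1)).le
    have i5 := hω₂ (xPart r.1, -xPart r.2.1)
    rw [← ENNReal.ofReal_mul i1, ← ENNReal.ofReal_mul i3,
      ← ENNReal.ofReal_mul (mul_nonneg i1 i2),
      ← ENNReal.ofReal_mul (mul_nonneg (mul_nonneg i1 i2) (mul_nonneg i3 i4)),
      ← ENNReal.ofReal_mul' (mul_nonneg (mul_nonneg (mul_nonneg i1 i2) (mul_nonneg i3 i4))
        (inv_nonneg.2 i5.le)), ← ENNReal.ofReal_one]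
    refine ENNReal.ofReal_le_ofReal ?_
    rw [← mul_assoc, ← div_eq_mul_inv, one_le_div i5]
    exact hB _ _ _
  have h2 := hh r.1 (-r.2.1 - r.2.2)
  rw [fioIntegrand, enorm_mul, enorm_mul, enorm_mul, enorm_mul, enorm_mul]
  have h3 : ‖chr (zPart r.1) (zPart r.2.1)‖ₑ = 1 := by
    rw [← ofReal_norm, norm_chr, ENNReal.ofReal_one]
  rw [h3, one_mul, enorm_wstft fun z => (hω z).le, enorm_wstft fun z => (hω₁ z).le, dualStft,
    zWindow]
  calc _ ≤ ‖stft₀ χ a (r.1, r.2.2)‖ₑ * h (-r.2.1 - r.2.2 - gradVec φ r.1) *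
        (‖stft₀ κ g (xPart r.1, xPart r.2.1)‖ₑ *
          (‖stft₀ χ₁ f (yPart r.1, yPart r.2.1)‖ₑ * ‖hatF κ' (zPart r.2.1)‖ₑ)) * 1 := by
        rw [mul_one]
        gcongr
    _ ≤ _ := mul_le_mul_right h1 _
    _ = _ := by ring

theorem lintegral_enorm_fioIntegrand_le (hω : ∀ z, 0 < ω z) (hω₁ : ∀ z, 0 < ω₁ z)
    (hω₂ : ∀ z, 0 < ω₂ z) (hw : ∀ z, 0 < w z)
    (hh : ∀ X Θ, ‖phaseStft χ₂ φ (X, Θ)‖ₑ ≤ h (Θ - gradVec φ X))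
    (hB : ∀ X Ξ Λ, ω₂ (xPart X, -xPart Λ) ≤ B * (ω (X, Ξ) * w (-Λ - Ξ - gradVec φ X) *
      (w (triple 0 0 (zPart Λ)) * ω₁ (yPart X, yPart Λ))))
    (a : 𝓢'(TripleSpace n m, ℂ)) (f g : 𝓢'(ℰ (Fin n), ℂ)) :
    ∫⁻ r, ‖fioIntegrand χ χ₂ κ χ₁ κ' φ a f g r‖ₑ ≤ ENNReal.ofReal B *
      fioMajorant φ (fun z => ‖wstft χ ω a z‖ₑ) (fun Θ => h Θ * ENNReal.ofReal (w Θ))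
        (zWindow κ' w) (fun t => ‖wstft χ₁ ω₁ f t‖ₑ) (dualStft κ ω₂ g) := by
  rw [fioMajorant, ← lintegral_const_mul' _ _ ENNReal.ofReal_ne_top]
  exact lintegral_mono fun r => enorm_fioIntegrand_le hω hω₁ hω₂ hw hh hB a f g r

end Majorant

/-! ### Operators from the Schwartz space to the tempered distributions -/

section Operators

variable {ι : Type} [Fintype ι]

theorem exists_distribution_of_bound {A : 𝓢(ℰ ι, ℂ) → ℂ}
    (hadd : ∀ f g, A (f + g) = A f + A g) (hsmul : ∀ (c : ℂ) f, A (c • f) = c * A f) {M : ℕ} {C : ℝ}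
    (hC : 0 ≤ C) (h : ∀ f, ‖A f‖ ≤ C * schwartzNorm M f) :
    ∃ u : 𝓢'(ℰ ι, ℂ), ∀ f, u f = A f :=
  ⟨SchwartzMap.mkCLMtoNormedSpace (σ := RingHom.id ℂ) A hadd hsmul ⟨_, C, hC, h⟩, fun _ => rfl⟩

theorem exists_clm_of_bound
    {A : 𝓢(ℰ ι, ℂ) → 𝓢'(ℰ ι, ℂ)}
    (hadd : ∀ f g, A (f + g) = A f + A g) (hsmul : ∀ (c : ℂ) f, A (c • f) = c • A f)
    (h : ∀ g, ∃ (M : ℕ) (C : ℝ), 0 ≤ C ∧ ∀ f, ‖A f g‖ ≤ C * schwartzNorm M f) :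
    ∃ T : 𝓢(ℰ ι, ℂ) →L[ℂ] 𝓢'(ℰ ι, ℂ), ∀ f, T f = A f := by
  refine ⟨{ toFun := A, map_add' := hadd, map_smul' := hsmul, cont := ?_ }, fun _ => rfl⟩
  refine PointwiseConvergenceCLM.continuous_of_continuous_eval fun g => ?_
  obtain ⟨M, C, hC, hb⟩ := h g
  obtain ⟨u, hu⟩ := exists_distribution_of_bound (A := fun f => A f g)
    (fun f f' => by rw [hadd]; rfl) (fun c f => by rw [hsmul]; rfl) hC hb
  have h1 : (fun f => A f g) = distCLM u := by
    ext f
    exact (hu f).symm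
  change Continuous fun f => A f g
  rw [h1]
  exact (distCLM u).continuous

/-- Bounds by a fixed seminorm give convergence in the topology of uniform convergence on bounded
sets. -/
theorem tendsto_clm_of_bound {α : Type*} {l : Filter α}
    {T : α → 𝓢(ℰ ι, ℂ) →L[ℂ] 𝓢'(ℰ ι, ℂ)}
    {T₀ : 𝓢(ℰ ι, ℂ) →L[ℂ] 𝓢'(ℰ ι, ℂ)}
    (h : ∀ g, ∃ (M : ℕ) (c : α → ℝ≥0∞), Tendsto c l (𝓝 0) ∧
      ∀ᶠ j in l, ∀ f, ‖T j f g - T₀ f g‖ₑ ≤ c j * ENNReal.ofReal (schwartzNorm M f)) :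
    Tendsto T l (𝓝 T₀) := by
  rw [← tendsto_sub_nhds_zero_iff]
  have hb := ContinuousLinearMap.hasBasis_nhds_zero_of_basis (σ := RingHom.id ℂ)
    (E := 𝓢(ℰ ι, ℂ)) (F := 𝓢'(ℰ ι, ℂ))
    (PointwiseConvergenceCLM.hasBasis_nhds_zero_of_basis (σ := RingHom.id ℂ)
      (E := 𝓢(ℰ ι, ℂ)) (F := ℂ) Metric.nhds_basis_ball)
  rw [hb.tendsto_right_iff]
  -- a basic neighbourhood of zero is given by a bounded set `s` of Schwartz functions, a finite set
  -- `t` of test functions and a radius `ε`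
  rintro ⟨s, t, ε⟩ ⟨hs, ht, hε⟩
  have ht' : Set.Finite t := ht
  have key : ∀ g ∈ t, ∀ᶠ j in l, ∀ f ∈ s, (T j - T₀) f g ∈ Metric.ball (0 : ℂ) ε := fun g _ => by
    obtain ⟨M, c, hc, hT⟩ := h g
    obtain ⟨r, hr, hsr⟩ :=
      ((schwartz_withSeminorms ℂ (ℰ ι) ℂ).isVonNBounded_iff_finset_seminorm_bounded.1
        hs) (Finset.Iic (M, M))
    have hc' : Tendsto (fun j => c j * ENNReal.ofReal r) l (𝓝 0) := by
      simpa using ENNReal.Tendsto.mul_const hc (Or.inr ENNReal.ofReal_ne_top)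
    have hε' : (0 : ℝ≥0∞) < ENNReal.ofReal ε := ENNReal.ofReal_pos.2 hε
    filter_upwards [hT, hc'.eventually_lt_const hε'] with j h1 h2 f hf
    rw [mem_ball_zero_iff]
    have h3 : ‖T j f g - T₀ f g‖ₑ < ENNReal.ofReal ε := by
      refine ((h1 f).trans (mul_le_mul_right (ENNReal.ofReal_le_ofReal (hsr f hf).le) _)).trans_lt h2
    rw [← ofReal_norm, ENNReal.ofReal_lt_ofReal_iff hε] at h3
    exact h3
  filter_upwards [(Filter.eventually_all_finite ht').2 key] with j hj f hf g hg
  exact hj g hg f hf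

end Operators

/-! ### Estimates for the phase space form -/

/-- The weight of the dual space, with the reflection which comes from a bilinear pairing. -/
theorem IsContWeight.inv_reflect {ι : Type} [Fintype ι]
    {ω : ℰ ι × ℰ ι → ℝ} {k : ℕ} (hω : IsContWeight ω k) :
    IsContWeight
    (fun z : ℰ ι × ℰ ι => (ω (z.1, -z.2))⁻¹) k where
  pos z := inv_pos.2 (hω.pos _)
  cont := (hω.cont.comp (continuous_fst.prodMk continuous_snd.neg)).inv₀ fun z => (hω.pos _).ne'
  moderate x y := by
    have h1 := hω.le_sub (x.1, -x.2) ((x + y).1, -(x + y).2)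
    have h2 : ‖((x.1, -x.2) : ℰ ι × ℰ ι) -
        ((x + y).1, -(x + y).2)‖ = ‖y‖ := by
      rw [Prod.norm_def, Prod.norm_def]
      simp
    rw [h2] at h1
    have i1 := hω.pos (x.1, -x.2)
    have i2 := hω.pos ((x + y).1, -(x + y).2)
    rw [inv_mul_eq_div, inv_le_iff_one_le_mul₀ i2, div_mul_eq_mul_div, one_le_div i1, mul_comm]
    exact h1

section Estimates

variable {n m : ℕ}

theorem lintegral_zWindow_ne_top (κ' : 𝓢(ℰ (Fin m), ℂ)) {w : TripleSpace n m → ℝ}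
    {k : ℕ} (hw : IsContWeight w k) : ∫⁻ ν, zWindow κ' w ν ≠ ∞ := by
  obtain ⟨M', C, hC, h⟩ := exists_hatF_decay (V := ℰ (Fin m))
    (k + (Module.finrank ℝ (ℰ (Fin m)) + 1))
  have h1 := ((integrable_decayFn (Nat.lt_succ_self _)
    (volume : Measure (ℰ (Fin m)))).const_mul
      (C * schwartzNorm M' κ' * w 0)).lintegral_lt_top
  refine (lt_of_le_of_lt (lintegral_mono fun ν => ?_) h1).ne
  rw [zWindow, ← ofReal_norm, ← ENNReal.ofReal_mul (norm_nonneg _)]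
  refine ENNReal.ofReal_le_ofReal ?_
  have hn : ‖(triple 0 0 ν : TripleSpace n m)‖ = ‖ν‖ := by
    rw [EuclideanSpace.norm_eq, EuclideanSpace.norm_eq]
    simp [triple]
  have h2 := hw.le_zero (triple 0 0 ν)
  rw [hn] at h2
  have h3 := mul_nonneg hC (schwartzNorm_nonneg M' κ')
  calc _ ≤ (C * schwartzNorm M' κ' * decayFn _ ν) * (w 0 * (1 + ‖ν‖) ^ k) :=
        mul_le_mul (h κ' ν) h2 (hw.pos _).le (mul_nonneg h3 (decayFn_nonneg _ _))
    _ = C * schwartzNorm M' κ' * w 0 * ((1 + ‖ν‖) ^ k * decayFn _ ν) := by ring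
    _ = _ := by rw [pow_mul_decayFn_add]

theorem measurable_zWindow (κ' : 𝓢(ℰ (Fin m), ℂ)) {w : TripleSpace n m → ℝ}
    (hw : Continuous w) : Measurable (zWindow κ' w) := by
  have h1 : Continuous (hatF κ') := continuous_hatF κ'.integrable
  exact h1.enorm.measurable.mul (ENNReal.continuous_ofReal.comp
    (hw.comp (by fun_prop : Continuous fun ν : ℰ (Fin m) =>
      (triple 0 0 ν : TripleSpace n m)))).measurable

/-- The standard rapidly decreasing integrable function on phase space. -/
noncomputable def phaseDecay (n : ℕ) (s : ℰ (Fin n) × ℰ (Fin n)) :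
    ℝ≥0∞ :=
  ENNReal.ofReal (decayFn (Module.finrank ℝ (ℰ (Fin n)) + 1) s.1 *
    decayFn (Module.finrank ℝ (ℰ (Fin n)) + 1) s.2)

theorem measurable_phaseDecay : Measurable (phaseDecay n) :=
  (ENNReal.continuous_ofReal.comp (((continuous_decayFn _).comp continuous_fst).mul
    ((continuous_decayFn _).comp continuous_snd))).measurable

theorem phaseDecay_le_one (s : ℰ (Fin n) × ℰ (Fin n)) :
    phaseDecay n s ≤ 1 := by
  rw [phaseDecay, ← ENNReal.ofReal_one]
  exact ENNReal.ofReal_le_ofReal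
    (mul_le_one₀ (decayFn_le_one _ _) (decayFn_nonneg _ _) (decayFn_le_one _ _))

theorem lintegral_phaseDecay_ne_top : ∫⁻ s, phaseDecay n s ≠ ∞ := by
  have h := lintegral_decayFn_prod_lt_top (ι := Fin n)
    (M := Module.finrank ℝ (ℰ (Fin n)) + 1) (Nat.lt_succ_self _) 1
  simp only [one_mul] at h
  exact h.ne

theorem exists_enorm_wstft_coe_le (κ : 𝓢(ℰ (Fin n), ℂ))
    {ω : ℰ (Fin n) × ℰ (Fin n) → ℝ} {k : ℕ}
    (hω : IsContWeight ω k) : ∃ (M : ℕ) (C : ℝ), 0 ≤ C ∧ ∀ (g : 𝓢(ℰ (Fin n), ℂ)) s,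
      ‖wstft κ ω (g : 𝓢'(ℰ (Fin n), ℂ)) s‖ₑ ≤
        ENNReal.ofReal (C * schwartzNorm M g) * phaseDecay n s := by
  obtain ⟨M', C, hC, h⟩ := exists_norm_wstft_coe_le κ hω
    (Module.finrank ℝ (ℰ (Fin n)) + 1)
  refine ⟨M', C, hC, fun g s => ?_⟩
  rw [enorm_wstft fun z => (hω.pos z).le, phaseDecay, ← ofReal_norm,
    ← ENNReal.ofReal_mul (norm_nonneg _),
    ← ENNReal.ofReal_mul (mul_nonneg hC (schwartzNorm_nonneg _ _))]
  exact ENNReal.ofReal_le_ofReal (h g s)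

theorem dualStft_eq {κ : 𝓢(ℰ (Fin n), ℂ)}
    {ω₂ : ℰ (Fin n) × ℰ (Fin n) → ℝ} (hω₂ : ∀ z, 0 < ω₂ z)
    (g : 𝓢'(ℰ (Fin n), ℂ)) :
    dualStft κ ω₂ g = fun s => ‖wstft κ (fun z => (ω₂ (z.1, -z.2))⁻¹) g s‖ₑ := by
  ext s
  rw [enorm_wstft fun z => (inv_pos.2 (hω₂ _)).le]
  rfl

/-- The quantities entering the estimates of a Fourier integral operator: the weights are
continuous, `h` dominates the windowed Fourier transform of `e^{iφ}`, and the last condition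
relates the weights of the two function spaces to the weight of the symbol. -/
structure FioSetting (χ₂ : 𝓢(TripleSpace n m, ℂ)) (φ : TripleSpace n m → ℝ)
    (ω : TripleSpace n m × TripleSpace n m → ℝ) (w : TripleSpace n m → ℝ)
    (ω₁ ω₂ : ℰ (Fin n) × ℰ (Fin n) → ℝ)
    (h : TripleSpace n m → ℝ≥0∞) (B d : ℝ) : Prop where
  contDiff : ContDiff ℝ 2 φ
  hess : ∀ i j, (∃ C, ∀ X, ‖pderiv2 i j φ X‖ ≤ C) ∧ UniformContinuous (pderiv2 i j φ)
  d_pos : 0 < d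
  det : ∀ X, d ≤ |(mixedHessian φ X).det|
  weight : ∃ k, IsContWeight ω k
  weight₁ : ∃ k, IsContWeight ω₁ k
  weight₂ : ∃ k, IsContWeight ω₂ k
  dualWeight : ∃ k, IsContWeight w k
  measurable : Measurable h
  lintegral_ne_top : ∫⁻ Θ, h Θ * ENNReal.ofReal (w Θ) ≠ ∞
  phase : ∀ X Θ, ‖phaseStft χ₂ φ (X, Θ)‖ₑ ≤ h (Θ - gradVec φ X)
  dom : ∀ X Ξ Λ, ω₂ (xPart X, -xPart Λ) ≤ B * (ω (X, Ξ) * w (-Λ - Ξ - gradVec φ X) *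
      (w (triple 0 0 (zPart Λ)) * ω₁ (yPart X, yPart Λ)))

namespace FioSetting

variable {χ χ₂ : 𝓢(TripleSpace n m, ℂ)} {κ χ₁ : 𝓢(ℰ (Fin n), ℂ)}
  {κ' : 𝓢(ℰ (Fin m), ℂ)} {φ : TripleSpace n m → ℝ}
  {ω : TripleSpace n m × TripleSpace n m → ℝ} {w : TripleSpace n m → ℝ}
  {ω₁ ω₂ : ℰ (Fin n) × ℰ (Fin n) → ℝ}
  {h : TripleSpace n m → ℝ≥0∞} {B d : ℝ}

theorem measurable_dualBound (S : FioSetting χ₂ φ ω w ω₁ ω₂ h B d) :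
    Measurable fun Θ => h Θ * ENNReal.ofReal (w Θ) := by
  obtain ⟨k, hw⟩ := S.dualWeight
  exact S.measurable.mul (ENNReal.continuous_ofReal.comp hw.cont).measurable

theorem measurable_zWindow (S : FioSetting χ₂ φ ω w ω₁ ω₂ h B d)
    (κ' : 𝓢(ℰ (Fin m), ℂ)) : Measurable (zWindow κ' w) := by
  obtain ⟨k, hw⟩ := S.dualWeight
  exact _root_.measurable_zWindow κ' hw.cont

theorem measurable_dualStft (S : FioSetting χ₂ φ ω w ω₁ ω₂ h B d)
    (g : 𝓢'(ℰ (Fin n), ℂ)) : Measurable (dualStft κ ω₂ g) := by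
  obtain ⟨k, hw⟩ := S.weight₂
  rw [dualStft_eq hw.pos]
  exact (continuous_wstft hw.inv_reflect.cont g).enorm.measurable

theorem measurable_wstft₁ (S : FioSetting χ₂ φ ω w ω₁ ω₂ h B d)
    (f : 𝓢'(ℰ (Fin n), ℂ)) : Measurable fun t => ‖wstft χ₁ ω₁ f t‖ₑ := by
  obtain ⟨k, hw⟩ := S.weight₁
  exact (continuous_wstft hw.cont f).enorm.measurable

theorem measurable_sliceSup (S : FioSetting χ₂ φ ω w ω₁ ω₂ h B d)
    (a : 𝓢'(TripleSpace n m, ℂ)) : Measurable (sliceSup (stft₀ χ a) ω) := by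
  obtain ⟨k, hw⟩ := S.weight
  exact _root_.measurable_sliceSup (continuous_stft₀ χ a) hw.cont

theorem enorm_wstft_le_sliceSup (S : FioSetting χ₂ φ ω w ω₁ ω₂ h B d)
    (a : 𝓢'(TripleSpace n m, ℂ)) (z : TripleSpace n m × TripleSpace n m) :
    ‖wstft χ ω a z‖ₑ ≤ sliceSup (stft₀ χ a) ω z.2 := by
  obtain ⟨k, hw⟩ := S.weight
  rw [enorm_wstft fun z => (hw.pos z).le]
  exact le_sliceSup (stft₀ χ a) ω z

/-- The bound for the norm of the kernel operator. -/
noncomputable def kernelBound (H h : TripleSpace n m → ℝ≥0∞) (w : TripleSpace n m → ℝ)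
    (κ' : 𝓢(ℰ (Fin m), ℂ)) (d : ℝ) : ℝ≥0∞ :=
  ENNReal.ofReal d⁻¹ * ((∫⁻ Ξ, H Ξ) * ∫⁻ Θ, h Θ * ENNReal.ofReal (w Θ)) * ∫⁻ ν, zWindow κ' w ν

theorem kernelBound_ne_top (S : FioSetting χ₂ φ ω w ω₁ ω₂ h B d) {H : TripleSpace n m → ℝ≥0∞}
    (hH : ∫⁻ Ξ, H Ξ ≠ ∞) : kernelBound H h w κ' d ≠ ∞ := by
  obtain ⟨k, hw⟩ := S.dualWeight
  exact ENNReal.mul_ne_top (ENNReal.mul_ne_top ENNReal.ofReal_ne_top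
    (ENNReal.mul_ne_top hH S.lintegral_ne_top)) (lintegral_zWindow_ne_top κ' hw)

variable {H : TripleSpace n m → ℝ≥0∞}
  {F : ℰ (Fin n) × ℰ (Fin n) → ℝ≥0∞}

theorem measurable_kernel (S : FioSetting χ₂ φ ω w ω₁ ω₂ h B d) (hH : Measurable H) :
    Measurable (Function.uncurry (fioKernel φ (lconv H fun Θ => h Θ * ENNReal.ofReal (w Θ))
      (zWindow κ' w))) :=
  measurable_fioKernel S.contDiff (measurable_lconv hH S.measurable_dualBound)
    (S.measurable_zWindow κ')

theorem lintegral_kernel_right_le (S : FioSetting χ₂ φ ω w ω₁ ω₂ h B d) (hH : Measurable H)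
    (s : ℰ (Fin n) × ℰ (Fin n)) :
    ∫⁻ t, fioKernel φ (lconv H fun Θ => h Θ * ENNReal.ofReal (w Θ)) (zWindow κ' w) s t ≤
      kernelBound H h w κ' d := by
  refine (lintegral_fioKernel_right_le S.contDiff S.hess S.d_pos S.det
    (measurable_lconv hH S.measurable_dualBound) (S.measurable_zWindow κ') s).trans_eq ?_
  rw [lintegral_lconv hH S.measurable_dualBound, kernelBound]

theorem lintegral_kernel_left_le (S : FioSetting χ₂ φ ω w ω₁ ω₂ h B d) (hH : Measurable H)
    (t : ℰ (Fin n) × ℰ (Fin n)) :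
    ∫⁻ s, fioKernel φ (lconv H fun Θ => h Θ * ENNReal.ofReal (w Θ)) (zWindow κ' w) s t ≤
      kernelBound H h w κ' d := by
  refine (lintegral_fioKernel_left_le S.contDiff S.hess S.d_pos S.det
    (measurable_lconv hH S.measurable_dualBound) (S.measurable_zWindow κ') t).trans_eq ?_
  rw [lintegral_lconv hH S.measurable_dualBound, kernelBound]

/-- The kernel operator is bounded on `L^p`. -/
theorem lintegral_kernel_rpow_le (S : FioSetting χ₂ φ ω w ω₁ ω₂ h B d) (hH : Measurable H)
    (hF : Measurable F) {p : ℝ} (hp : 1 ≤ p) :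
    ∫⁻ s, (∫⁻ t, fioKernel φ (lconv H fun Θ => h Θ * ENNReal.ofReal (w Θ)) (zWindow κ' w) s t *
      F t) ^ p ≤ kernelBound H h w κ' d ^ p * ∫⁻ t, F t ^ p := by
  refine (lintegral_schur (S.measurable_kernel hH) hF hp (S.lintegral_kernel_right_le hH)
    (S.lintegral_kernel_left_le hH)).trans_eq ?_
  congr 1
  nth_rewrite 2 [← ENNReal.rpow_one (kernelBound H h w κ' d)]
  rw [← ENNReal.rpow_add_of_nonneg _ _ (by linarith) zero_le_one, sub_add_cancel]

theorem lintegral_enorm_le (S : FioSetting χ₂ φ ω w ω₁ ω₂ h B d)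
    (a : 𝓢'(TripleSpace n m, ℂ)) (f g : 𝓢'(ℰ (Fin n), ℂ)) :
    ∫⁻ r, ‖fioIntegrand χ χ₂ κ χ₁ κ' φ a f g r‖ₑ ≤ ENNReal.ofReal B *
      fioMajorant φ (fun z => ‖wstft χ ω a z‖ₑ) (fun Θ => h Θ * ENNReal.ofReal (w Θ))
        (zWindow κ' w) (fun t => ‖wstft χ₁ ω₁ f t‖ₑ) (dualStft κ ω₂ g) := by
  obtain ⟨k, i⟩ := S.weight
  obtain ⟨k₁, i₁⟩ := S.weight₁
  obtain ⟨k₂, i₂⟩ := S.weight₂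
  obtain ⟨k₃, i₃⟩ := S.dualWeight
  exact lintegral_enorm_fioIntegrand_le i.pos i₁.pos i₂.pos i₃.pos S.phase S.dom a f g

theorem lintegral_enorm_le_kernel (S : FioSetting χ₂ φ ω w ω₁ ω₂ h B d)
    (a : 𝓢'(TripleSpace n m, ℂ)) (f g : 𝓢'(ℰ (Fin n), ℂ)) :
    ∫⁻ r, ‖fioIntegrand χ χ₂ κ χ₁ κ' φ a f g r‖ₑ ≤ ENNReal.ofReal B *
      ∫⁻ s, dualStft κ ω₂ g s * ∫⁻ t, fioKernel φ (lconv (sliceSup (stft₀ χ a) ω)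
        fun Θ => h Θ * ENNReal.ofReal (w Θ)) (zWindow κ' w) s t * ‖wstft χ₁ ω₁ f t‖ₑ :=
  (S.lintegral_enorm_le a f g).trans (mul_le_mul_right
    (fioMajorant_le S.contDiff (fun z => S.enorm_wstft_le_sliceSup a z) (S.measurable_sliceSup a)
      S.measurable_dualBound (S.measurable_zWindow κ') (S.measurable_wstft₁ f)
      (S.measurable_dualStft g)) _)

end FioSetting

end Estimates

/-! ### The phase space form -/

theorem norm_le_of_enorm_le {x : ℂ} {K : ℝ≥0∞} (hK : K ≠ ∞) {N : ℝ} (hN : 0 ≤ N)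
    (h : ‖x‖ₑ ≤ K * ENNReal.ofReal N) : ‖x‖ ≤ K.toReal * N := by
  have h1 := ENNReal.toReal_mono (ENNReal.mul_ne_top hK ENNReal.ofReal_ne_top) h
  rwa [toReal_enorm, ENNReal.toReal_mul, ENNReal.toReal_ofReal hN] at h1

theorem coe_add_smul {ι : Type} [Fintype ι] (f g : 𝓢(ℰ ι, ℂ)) (b : ℂ) :
    ((f + b • g : 𝓢(ℰ ι, ℂ)) : 𝓢'(ℰ ι, ℂ)) =
      (f : 𝓢'(ℰ ι, ℂ)) + b • (g : 𝓢'(ℰ ι, ℂ)) := by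
  rw [map_add, map_smul]

section FioForm

variable {n m : ℕ} {χ χ₂ : 𝓢(TripleSpace n m, ℂ)} {κ χ₁ : 𝓢(ℰ (Fin n), ℂ)}
  {κ' : 𝓢(ℰ (Fin m), ℂ)} {φ : TripleSpace n m → ℝ}

/-- The trilinear form which represents a Fourier integral operator in phase space. -/
noncomputable def fioForm (χ χ₂ : 𝓢(TripleSpace n m, ℂ))
    (κ χ₁ : 𝓢(ℰ (Fin n), ℂ)) (κ' : 𝓢(ℰ (Fin m), ℂ))
    (φ : TripleSpace n m → ℝ) (a : 𝓢'(TripleSpace n m, ℂ))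
    (f g : 𝓢'(ℰ (Fin n), ℂ)) : ℂ :=
  ∫ r, fioIntegrand χ χ₂ κ χ₁ κ' φ a f g r

theorem integrable_fioIntegrand (hφ : Continuous φ) {a : 𝓢'(TripleSpace n m, ℂ)}
    {f g : 𝓢'(ℰ (Fin n), ℂ)}
    (h : ∫⁻ r, ‖fioIntegrand χ χ₂ κ χ₁ κ' φ a f g r‖ₑ ≠ ∞) :
    Integrable (fioIntegrand χ χ₂ κ χ₁ κ' φ a f g) :=
  ⟨aestronglyMeasurable_fioIntegrand hφ a f g, h.lt_top⟩

theorem enorm_fioForm_le (a : 𝓢'(TripleSpace n m, ℂ)) (f g : 𝓢'(ℰ (Fin n), ℂ)) :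
    ‖fioForm χ χ₂ κ χ₁ κ' φ a f g‖ₑ ≤ ∫⁻ r, ‖fioIntegrand χ χ₂ κ χ₁ κ' φ a f g r‖ₑ :=
  enorm_integral_le_lintegral_enorm _

theorem fioForm_symbol_add_smul {a a' : 𝓢'(TripleSpace n m, ℂ)}
    {f g : 𝓢'(ℰ (Fin n), ℂ)} (h : Integrable (fioIntegrand χ χ₂ κ χ₁ κ' φ a f g))
    (h' : Integrable (fioIntegrand χ χ₂ κ χ₁ κ' φ a' f g)) (b : ℂ) :
    fioForm χ χ₂ κ χ₁ κ' φ (a + b • a') f g =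
      fioForm χ χ₂ κ χ₁ κ' φ a f g + b * fioForm χ χ₂ κ χ₁ κ' φ a' f g := by
  rw [fioForm, fioForm, fioForm, ← integral_const_mul, ← integral_add h (h'.const_mul b)]
  refine integral_congr_ae (ae_of_all _ fun r => ?_)
  simp only [fioIntegrand, stft₀_add_smul]
  ring

theorem fioForm_left_add_smul {a : 𝓢'(TripleSpace n m, ℂ)}
    {f f' g : 𝓢'(ℰ (Fin n), ℂ)}
    (h : Integrable (fioIntegrand χ χ₂ κ χ₁ κ' φ a f g))
    (h' : Integrable (fioIntegrand χ χ₂ κ χ₁ κ' φ a f' g)) (b : ℂ) :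
    fioForm χ χ₂ κ χ₁ κ' φ a (f + b • f') g =
      fioForm χ χ₂ κ χ₁ κ' φ a f g + b * fioForm χ χ₂ κ χ₁ κ' φ a f' g := by
  rw [fioForm, fioForm, fioForm, ← integral_const_mul, ← integral_add h (h'.const_mul b)]
  refine integral_congr_ae (ae_of_all _ fun r => ?_)
  simp only [fioIntegrand, stft₀_add_smul]
  ring

theorem fioForm_right_add_smul {a : 𝓢'(TripleSpace n m, ℂ)}
    {f g g' : 𝓢'(ℰ (Fin n), ℂ)}
    (h : Integrable (fioIntegrand χ χ₂ κ χ₁ κ' φ a f g))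
    (h' : Integrable (fioIntegrand χ χ₂ κ χ₁ κ' φ a f g')) (b : ℂ) :
    fioForm χ χ₂ κ χ₁ κ' φ a f (g + b • g') =
      fioForm χ χ₂ κ χ₁ κ' φ a f g + b * fioForm χ χ₂ κ χ₁ κ' φ a f g' := by
  rw [fioForm, fioForm, fioForm, ← integral_const_mul, ← integral_add h (h'.const_mul b)]
  refine integral_congr_ae (ae_of_all _ fun r => ?_)
  simp only [fioIntegrand, stft₀_add_smul]
  ring

end FioForm

namespace FioSetting

variable {n m : ℕ} {χ χ₂ : 𝓢(TripleSpace n m, ℂ)} {κ χ₁ : 𝓢(ℰ (Fin n), ℂ)}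
  {κ' : 𝓢(ℰ (Fin m), ℂ)} {φ : TripleSpace n m → ℝ}
  {ω : TripleSpace n m × TripleSpace n m → ℝ} {w : TripleSpace n m → ℝ}
  {ω₁ ω₂ : ℰ (Fin n) × ℰ (Fin n) → ℝ}
  {h : TripleSpace n m → ℝ≥0∞} {B d : ℝ}

/-- The integral which bounds the phase space form for a symbol dominated by `D` and for Schwartz
functions. -/
noncomputable def schwartzMajorant (φ : TripleSpace n m → ℝ) (h : TripleSpace n m → ℝ≥0∞)
    (w : TripleSpace n m → ℝ) (κ' : 𝓢(ℰ (Fin m), ℂ))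
    (D : TripleSpace n m × TripleSpace n m → ℝ≥0∞) : ℝ≥0∞ :=
  fioMajorant φ D (fun Θ => h Θ * ENNReal.ofReal (w Θ)) (zWindow κ' w) (phaseDecay n) fun _ => 1

/-- For Schwartz functions the phase space form is bounded by `schwartzMajorant`. The decay of the
second function is not needed, so that only its supremum enters. -/
theorem exists_lintegral_enorm_coe_le (S : FioSetting χ₂ φ ω w ω₁ ω₂ h B d)
    (χ : 𝓢(TripleSpace n m, ℂ)) (κ χ₁ : 𝓢(ℰ (Fin n), ℂ))
    (κ' : 𝓢(ℰ (Fin m), ℂ)) :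
    ∃ (M₁ M₂ : ℕ) (C : ℝ≥0∞), C ≠ ∞ ∧ ∀ (a : 𝓢'(TripleSpace n m, ℂ))
      (f g : 𝓢(ℰ (Fin n), ℂ)),
      ∫⁻ r, ‖fioIntegrand χ χ₂ κ χ₁ κ' φ a (f : 𝓢'(ℰ (Fin n), ℂ))
        (g : 𝓢'(ℰ (Fin n), ℂ)) r‖ₑ ≤
      C * schwartzMajorant φ h w κ' (fun z => ‖wstft χ ω a z‖ₑ) *
        (ENNReal.ofReal (schwartzNorm M₁ f) * ENNReal.ofReal (schwartzNorm M₂ g)) := by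
  obtain ⟨k₁, i₁⟩ := S.weight₁
  obtain ⟨k₂, i₂⟩ := S.weight₂
  obtain ⟨M₁, C₁, hC₁, b₁⟩ := exists_enorm_wstft_coe_le χ₁ i₁
  obtain ⟨M₂, C₂, hC₂, b₂⟩ := exists_enorm_wstft_coe_le κ i₂.inv_reflect
  refine ⟨M₁, M₂, ENNReal.ofReal B * (ENNReal.ofReal C₁ * ENNReal.ofReal C₂),
    ENNReal.mul_ne_top ENNReal.ofReal_ne_top
      (ENNReal.mul_ne_top ENNReal.ofReal_ne_top ENNReal.ofReal_ne_top), fun a f g => ?_⟩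
  refine (S.lintegral_enorm_le a _ _).trans ?_
  have h1 : fioMajorant φ (fun z => ‖wstft χ ω a z‖ₑ) (fun Θ => h Θ * ENNReal.ofReal (w Θ))
      (zWindow κ' w) (fun t => ‖wstft χ₁ ω₁ (f : 𝓢'(ℰ (Fin n), ℂ)) t‖ₑ)
      (dualStft κ ω₂ (g : 𝓢'(ℰ (Fin n), ℂ))) ≤
      (ENNReal.ofReal (C₁ * schwartzNorm M₁ f) * ENNReal.ofReal (C₂ * schwartzNorm M₂ g)) *
        schwartzMajorant φ h w κ' (fun z => ‖wstft χ ω a z‖ₑ) := by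
    rw [schwartzMajorant, fioMajorant, fioMajorant, ← lintegral_const_mul' _ _
      (ENNReal.mul_ne_top ENNReal.ofReal_ne_top ENNReal.ofReal_ne_top)]
    refine lintegral_mono fun r => ?_
    have e1 := b₁ f (yPart r.1, yPart r.2.1)
    have e2 : dualStft κ ω₂ (g : 𝓢'(ℰ (Fin n), ℂ)) (xPart r.1, xPart r.2.1) ≤
        ENNReal.ofReal (C₂ * schwartzNorm M₂ g) := by
      rw [dualStft_eq i₂.pos]
      exact (b₂ g _).trans (mul_le_of_le_one_right' (phaseDecay_le_one _))
    calc _ ≤ _ := mul_le_mul_right (mul_le_mul_right (mul_le_mul' e1 e2) _) _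
      _ = _ := by ring
  refine (mul_le_mul_right h1 _).trans_eq ?_
  rw [ENNReal.ofReal_mul hC₁, ENNReal.ofReal_mul hC₂]
  ring

theorem schwartzMajorant_le (S : FioSetting χ₂ φ ω w ω₁ ω₂ h B d)
    {D : TripleSpace n m × TripleSpace n m → ℝ≥0∞} {H : TripleSpace n m → ℝ≥0∞}
    (hH : Measurable H) (hD : ∀ z, D z ≤ H z.2) :
    schwartzMajorant φ h w κ' D ≤ kernelBound H h w κ' d * ∫⁻ s, phaseDecay n s := by
  refine (fioMajorant_le S.contDiff hD hH S.measurable_dualBound (S.measurable_zWindow κ')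
    measurable_phaseDecay measurable_const).trans ?_
  have hm := S.measurable_kernel (κ' := κ') hH
  have h1 : Measurable (Function.uncurry fun s t : ℰ (Fin n) ×
      ℰ (Fin n) => fioKernel φ (lconv H fun Θ => h Θ * ENNReal.ofReal (w Θ))
        (zWindow κ' w) s t * phaseDecay n t) :=
    hm.mul (measurable_phaseDecay.comp measurable_snd)
  simp only [one_mul]
  rw [lintegral_lintegral_swap h1.aemeasurable,
    ← lintegral_const_mul _ measurable_phaseDecay]
  refine lintegral_mono fun t => ?_
  have h2 : Measurable fun s => fioKernel φ (lconv H fun Θ => h Θ * ENNReal.ofReal (w Θ))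
      (zWindow κ' w) s t := hm.of_uncurry_right
  rw [lintegral_mul_const _ h2]
  exact mul_le_mul_left (S.lintegral_kernel_left_le hH t) _

theorem schwartzMajorant_wstft_ne_top (S : FioSetting χ₂ φ ω w ω₁ ω₂ h B d)
    {a : 𝓢'(TripleSpace n m, ℂ)} (ha : ∫⁻ Ξ, sliceSup (stft₀ χ a) ω Ξ ≠ ∞) :
    schwartzMajorant φ h w κ' (fun z => ‖wstft χ ω a z‖ₑ) ≠ ∞ :=
  ne_top_of_le_ne_top (ENNReal.mul_ne_top (S.kernelBound_ne_top ha) lintegral_phaseDecay_ne_top)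
    (S.schwartzMajorant_le (S.measurable_sliceSup a) fun z => S.enorm_wstft_le_sliceSup a z)

/-- For a function in the domain of the operator, the phase space form is a tempered distribution
in the remaining variable. -/
theorem exists_lintegral_enorm_right_le (S : FioSetting χ₂ φ ω w ω₁ ω₂ h B d)
    {a : 𝓢'(TripleSpace n m, ℂ)} (ha : ∫⁻ Ξ, sliceSup (stft₀ χ a) ω Ξ ≠ ∞) {p : ℝ} (hp : 1 ≤ p)
    {f : 𝓢'(ℰ (Fin n), ℂ)} (hf : ∫⁻ t, ‖wstft χ₁ ω₁ f t‖ₑ ^ p ≠ ∞)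
    (κ : 𝓢(ℰ (Fin n), ℂ)) (κ' : 𝓢(ℰ (Fin m), ℂ)) :
    ∃ (M : ℕ) (K : ℝ≥0∞), K ≠ ∞ ∧ ∀ g : 𝓢(ℰ (Fin n), ℂ),
      ∫⁻ r, ‖fioIntegrand χ χ₂ κ χ₁ κ' φ a f (g : 𝓢'(ℰ (Fin n), ℂ)) r‖ₑ ≤
        K * ENNReal.ofReal (schwartzNorm M g) := by
  obtain ⟨k₂, i₂⟩ := S.weight₂
  obtain ⟨M, C, hC, b⟩ := exists_enorm_wstft_coe_le κ i₂.inv_reflect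
  set L : ℰ (Fin n) × ℰ (Fin n) → ℝ≥0∞ := fun s =>
    ∫⁻ t, fioKernel φ (lconv (sliceSup (stft₀ χ a) ω) fun Θ => h Θ * ENNReal.ofReal (w Θ))
      (zWindow κ' w) s t * ‖wstft χ₁ ω₁ f t‖ₑ with hL
  have hS := S.measurable_sliceSup (χ := χ) a
  have hp0 : 0 ≤ p := zero_le_one.trans hp
  have hLp : ∫⁻ s, L s ^ p ≠ ∞ :=
    ne_top_of_le_ne_top (ENNReal.mul_ne_top
      (ENNReal.rpow_ne_top_of_nonneg hp0 (S.kernelBound_ne_top (κ' := κ') ha)) hf)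
      (S.lintegral_kernel_rpow_le hS (S.measurable_wstft₁ f) hp)
  have hK : ∫⁻ s, phaseDecay n s * L s ≠ ∞ := by
    -- `L` is in `L^p` and `phaseDecay` is bounded and integrable; Young's inequality is replaced by
    -- the distinction of `L ≤ 1` and `L ≤ L^p`
    have h1 : ∀ s, phaseDecay n s * L s ≤ phaseDecay n s + L s ^ p := fun s => by
      rcases le_total (L s) 1 with h | h
      · exact (mul_le_of_le_one_right' h).trans le_self_add
      · refine ((mul_le_of_le_one_left' (phaseDecay_le_one s)).trans ?_).trans le_add_self
        exact ENNReal.le_rpow_self_of_one_le h hp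
    refine ne_top_of_le_ne_top ?_ (lintegral_mono h1)
    rw [lintegral_add_left measurable_phaseDecay]
    exact ENNReal.add_ne_top.2 ⟨lintegral_phaseDecay_ne_top, hLp⟩
  refine ⟨M, ENNReal.ofReal B * (ENNReal.ofReal C * ∫⁻ s, phaseDecay n s * L s),
    ENNReal.mul_ne_top ENNReal.ofReal_ne_top (ENNReal.mul_ne_top ENNReal.ofReal_ne_top hK),
    fun g => (S.lintegral_enorm_le_kernel a f _).trans ?_⟩
  rw [mul_assoc]
  refine mul_le_mul_right ?_ _
  rw [mul_right_comm, ← ENNReal.ofReal_mul hC, ← lintegral_const_mul' _ _ ENNReal.ofReal_ne_top]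
  refine lintegral_mono fun s => ?_
  rw [dualStft_eq i₂.pos, ← mul_assoc]
  exact mul_le_mul_left (b g s) _

theorem integrable_fioIntegrand_right (S : FioSetting χ₂ φ ω w ω₁ ω₂ h B d)
    {a : 𝓢'(TripleSpace n m, ℂ)} (ha : ∫⁻ Ξ, sliceSup (stft₀ χ a) ω Ξ ≠ ∞) {p : ℝ} (hp : 1 ≤ p)
    {f : 𝓢'(ℰ (Fin n), ℂ)} (hf : ∫⁻ t, ‖wstft χ₁ ω₁ f t‖ₑ ^ p ≠ ∞)
    (g : 𝓢(ℰ (Fin n), ℂ)) :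
    Integrable (fioIntegrand χ χ₂ κ χ₁ κ' φ a f (g : 𝓢'(ℰ (Fin n), ℂ))) := by
  obtain ⟨M, K, hK, hb⟩ := S.exists_lintegral_enorm_right_le ha hp hf κ κ'
  exact integrable_fioIntegrand S.contDiff.continuous
    (ne_top_of_le_ne_top (ENNReal.mul_ne_top hK ENNReal.ofReal_ne_top) (hb g))

theorem exists_distribution (S : FioSetting χ₂ φ ω w ω₁ ω₂ h B d)
    {a : 𝓢'(TripleSpace n m, ℂ)} (ha : ∫⁻ Ξ, sliceSup (stft₀ χ a) ω Ξ ≠ ∞) {p : ℝ} (hp : 1 ≤ p)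
    {f : 𝓢'(ℰ (Fin n), ℂ)} (hf : ∫⁻ t, ‖wstft χ₁ ω₁ f t‖ₑ ^ p ≠ ∞)
    (κ : 𝓢(ℰ (Fin n), ℂ)) (κ' : 𝓢(ℰ (Fin m), ℂ)) (c : ℂ) :
    ∃ u : 𝓢'(ℰ (Fin n), ℂ), ∀ g : 𝓢(ℰ (Fin n), ℂ),
      u g = c * fioForm χ χ₂ κ χ₁ κ' φ a f (g : 𝓢'(ℰ (Fin n), ℂ)) := by
  obtain ⟨M, K, hK, hb⟩ := S.exists_lintegral_enorm_right_le ha hp hf κ κ'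
  have hi := fun g => S.integrable_fioIntegrand_right (κ := κ) (κ' := κ') ha hp hf g
  have hadd : ∀ (b : ℂ) (g g' : 𝓢(ℰ (Fin n), ℂ)),
      fioForm χ χ₂ κ χ₁ κ' φ a f ((g + b • g' : 𝓢(ℰ (Fin n), ℂ)) :
        𝓢'(ℰ (Fin n), ℂ)) =
      fioForm χ χ₂ κ χ₁ κ' φ a f (g : 𝓢'(ℰ (Fin n), ℂ)) +
        b * fioForm χ χ₂ κ χ₁ κ' φ a f (g' : 𝓢'(ℰ (Fin n), ℂ)) :=
    fun b g g' => by rw [coe_add_smul, fioForm_right_add_smul (hi g) (hi g')]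
  have h0 : fioForm χ χ₂ κ χ₁ κ' φ a f ((0 : 𝓢(ℰ (Fin n), ℂ)) :
      𝓢'(ℰ (Fin n), ℂ)) = 0 := by
    have := hadd (-1) 0 0
    rw [smul_zero, add_zero] at this
    linear_combination this
  have h1 : ∀ g g' : 𝓢(ℰ (Fin n), ℂ),
      c * fioForm χ χ₂ κ χ₁ κ' φ a f ((g + g' : 𝓢(ℰ (Fin n), ℂ)) :
        𝓢'(ℰ (Fin n), ℂ)) =
      c * fioForm χ χ₂ κ χ₁ κ' φ a f (g : 𝓢'(ℰ (Fin n), ℂ)) +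
        c * fioForm χ χ₂ κ χ₁ κ' φ a f (g' : 𝓢'(ℰ (Fin n), ℂ)) := fun g g' => by
    have := hadd 1 g g'
    rw [one_smul, one_mul] at this
    rw [this, mul_add]
  have h2 : ∀ (b : ℂ) (g : 𝓢(ℰ (Fin n), ℂ)),
      c * fioForm χ χ₂ κ χ₁ κ' φ a f ((b • g : 𝓢(ℰ (Fin n), ℂ)) :
        𝓢'(ℰ (Fin n), ℂ)) =
      b * (c * fioForm χ χ₂ κ χ₁ κ' φ a f (g : 𝓢'(ℰ (Fin n), ℂ))) := fun b g => by
    have := hadd b 0 g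
    rw [zero_add, h0, zero_add] at this
    rw [this, mul_left_comm]
  have h3 : ∀ g : 𝓢(ℰ (Fin n), ℂ),
      ‖c * fioForm χ χ₂ κ χ₁ κ' φ a f (g : 𝓢'(ℰ (Fin n), ℂ))‖ ≤
        ‖c‖ * K.toReal * schwartzNorm M g := fun g => by
    rw [norm_mul, mul_assoc]
    exact mul_le_mul_of_nonneg_left (norm_le_of_enorm_le hK (schwartzNorm_nonneg _ _)
      ((enorm_fioForm_le _ _ _).trans (hb g))) (norm_nonneg c)
  obtain ⟨A, hA⟩ : ∃ A : 𝓢(ℰ (Fin n), ℂ) → ℂ, ∀ g, A g =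
      c * fioForm χ χ₂ κ χ₁ κ' φ a f (g : 𝓢'(ℰ (Fin n), ℂ)) :=
    ⟨_, fun _ => rfl⟩
  simp only [← hA] at h1 h2 h3 ⊢
  exact exists_distribution_of_bound h1 h2 (mul_nonneg (norm_nonneg c) ENNReal.toReal_nonneg) h3

theorem lintegral_wstft_coe_ne_top (S : FioSetting χ₂ φ ω w ω₁ ω₂ h B d)
    (f : 𝓢(ℰ (Fin n), ℂ)) :
    ∫⁻ t, ‖wstft χ₁ ω₁ (f : 𝓢'(ℰ (Fin n), ℂ)) t‖ₑ ^ (1 : ℝ) ≠ ∞ := by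
  obtain ⟨k₁, i₁⟩ := S.weight₁
  obtain ⟨M₁, C₁, hC₁, b₁⟩ := exists_enorm_wstft_coe_le χ₁ i₁
  simp only [ENNReal.rpow_one]
  refine ne_top_of_le_ne_top ?_ (lintegral_mono (b₁ f))
  rw [lintegral_const_mul' _ _ ENNReal.ofReal_ne_top]
  exact ENNReal.mul_ne_top ENNReal.ofReal_ne_top lintegral_phaseDecay_ne_top

/-- For a symbol in `M^{∞,1}` the phase space form defines a continuous operator from the Schwartz
space to the tempered distributions. -/
theorem exists_clm (S : FioSetting χ₂ φ ω w ω₁ ω₂ h B d)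
    {a : 𝓢'(TripleSpace n m, ℂ)} (ha : ∫⁻ Ξ, sliceSup (stft₀ χ a) ω Ξ ≠ ∞)
    (κ χ₁ : 𝓢(ℰ (Fin n), ℂ)) (κ' : 𝓢(ℰ (Fin m), ℂ)) (c : ℂ) :
    ∃ T : 𝓢(ℰ (Fin n), ℂ) →L[ℂ] 𝓢'(ℰ (Fin n), ℂ),
      ∀ f g : 𝓢(ℰ (Fin n), ℂ),
      T f g = c * fioForm χ χ₂ κ χ₁ κ' φ a (f : 𝓢'(ℰ (Fin n), ℂ))
        (g : 𝓢'(ℰ (Fin n), ℂ)) := by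
  have hf := fun f => S.lintegral_wstft_coe_ne_top (χ₁ := χ₁) f
  have hi := fun f g => S.integrable_fioIntegrand_right (κ := κ) (κ' := κ') ha le_rfl (hf f) g
  choose A hA using fun f => S.exists_distribution ha le_rfl (hf f) κ κ' c
  obtain ⟨M₁, M₂, C, hC, hb⟩ := S.exists_lintegral_enorm_coe_le χ κ χ₁ κ'
  have hadd : ∀ (b : ℂ) (f f' : 𝓢(ℰ (Fin n), ℂ)),
      A (f + b • f') = A f + b • A f' := fun b f f' => by
    ext g
    change A (f + b • f') g = A f g + b * A f' g
    rw [hA, hA, hA, coe_add_smul, fioForm_left_add_smul (hi f g) (hi f' g)]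
    ring
  have h0 : A 0 = 0 := by simpa using hadd (-1) 0 0
  obtain ⟨T, hT⟩ := exists_clm_of_bound (A := A) (fun f f' => by simpa using hadd 1 f f')
    (fun b f => by simpa [h0] using hadd b 0 f) fun g => by
      set K := C * schwartzMajorant φ h w κ' (fun z => ‖wstft χ ω a z‖ₑ) *
        ENNReal.ofReal (schwartzNorm M₂ g)
      have hK : K ≠ ∞ := ENNReal.mul_ne_top
        (ENNReal.mul_ne_top hC (S.schwartzMajorant_wstft_ne_top ha)) ENNReal.ofReal_ne_top
      refine ⟨M₁, ‖c‖ * K.toReal, by positivity, fun f => ?_⟩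
      rw [hA, norm_mul, mul_assoc]
      refine mul_le_mul_of_nonneg_left ?_ (norm_nonneg c)
      refine norm_le_of_enorm_le hK (schwartzNorm_nonneg _ _)
        (((enorm_fioForm_le _ _ _).trans (hb a f g)).trans_eq ?_)
      simp only [K]
      ring
  exact ⟨T, fun f g => by rw [hT, hA]⟩

end FioSetting

/-! ### Continuity in the symbol -/

/-- Dominated convergence for truncated functions against an arbitrary weight. -/
theorem tendsto_lintegral_min_mul {α : Type*} [MeasurableSpace α] {μ : Measure α}
    {D : ℕ → α → ℝ≥0∞} {b W : α → ℝ≥0∞} (hD : ∀ j, Measurable (D j)) (hb : Measurable b)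
    (hW : Measurable W) (hfin : ∫⁻ x, b x * W x ∂μ ≠ ∞)
    (h : ∀ x, Tendsto (fun j => D j x) atTop (𝓝 0)) :
    Tendsto (fun j => ∫⁻ x, min (D j x) (b x) * W x ∂μ) atTop (𝓝 0) := by
  have h1 : Tendsto (fun j => ∫⁻ x, min (D j x) (b x) * W x ∂μ) atTop (𝓝 (∫⁻ _, 0 ∂μ)) := by
    refine tendsto_lintegral_of_dominated_convergence (fun x => b x * W x)
      (fun j => ((hD j).min hb).mul hW) (fun j => ae_of_all _ fun x =>
        mul_le_mul_left (min_le_right _ _) _) hfin ?_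
    filter_upwards [ae_lt_top (hb.mul hW) hfin] with x hx
    by_cases hWx : W x = ∞
    -- `b W` is finite, so `b` vanishes where the weight is infinite
    · have hbx : b x = 0 := by
        by_contra h0
        simp only [Pi.mul_apply, hWx, ENNReal.mul_top h0, lt_self_iff_false] at hx
      simp [hbx]
    · have h2 := ENNReal.Tendsto.mul_const (h x) (Or.inr hWx)
      rw [zero_mul] at h2
      exact tendsto_of_tendsto_of_tendsto_of_le_of_le tendsto_const_nhds h2 (fun j => zero_le)
        fun j => mul_le_mul_left (min_le_left _ _) _
  rwa [lintegral_zero] at h1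

theorem le_add_enorm_toReal_sub {a b : ℝ≥0∞} (ha : a ≠ ∞) (hb : b ≠ ∞) :
    a ≤ b + ‖a.toReal - b.toReal‖ₑ := by
  rw [← ofReal_norm]
  nth_rewrite 1 [← ENNReal.ofReal_toReal ha]
  nth_rewrite 1 [← ENNReal.ofReal_toReal hb]
  rw [← ENNReal.ofReal_add ENNReal.toReal_nonneg (norm_nonneg _)]
  refine ENNReal.ofReal_le_ofReal ?_
  have := le_abs_self (a.toReal - b.toReal)
  rw [Real.norm_eq_abs]
  linarith

namespace FioSetting

variable {n m : ℕ} {χ χ₂ : 𝓢(TripleSpace n m, ℂ)} {κ χ₁ : 𝓢(ℰ (Fin n), ℂ)}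
  {κ' : 𝓢(ℰ (Fin m), ℂ)} {φ : TripleSpace n m → ℝ}
  {ω : TripleSpace n m × TripleSpace n m → ℝ} {w : TripleSpace n m → ℝ}
  {ω₁ ω₂ : ℰ (Fin n) × ℰ (Fin n) → ℝ}
  {h : TripleSpace n m → ℝ≥0∞} {B d : ℝ}

theorem schwartzMajorant_eq (D : TripleSpace n m × TripleSpace n m → ℝ≥0∞) :
    schwartzMajorant φ h w κ' D =
      ∫⁻ r : TripleSpace n m × TripleSpace n m × TripleSpace n m, D (r.1, r.2.2) *
        ((h (-r.2.1 - r.2.2 - gradVec φ r.1) *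
          ENNReal.ofReal (w (-r.2.1 - r.2.2 - gradVec φ r.1))) *
        (zWindow κ' w (zPart r.2.1) * phaseDecay n (yPart r.1, yPart r.2.1))) := by
  rw [schwartzMajorant, fioMajorant]
  simp only [mul_one, mul_assoc]

theorem measurable_schwartzWeight (S : FioSetting χ₂ φ ω w ω₁ ω₂ h B d) :
    Measurable fun r : TripleSpace n m × TripleSpace n m × TripleSpace n m =>
      (h (-r.2.1 - r.2.2 - gradVec φ r.1) *
          ENNReal.ofReal (w (-r.2.1 - r.2.2 - gradVec φ r.1))) *
        (zWindow κ' w (zPart r.2.1) * phaseDecay n (yPart r.1, yPart r.2.1)) := by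
  have h1 := measurable_fioMajorant (D := fun _ => 1) (G := fun _ => 1) S.contDiff
    measurable_const S.measurable_dualBound (S.measurable_zWindow κ') measurable_phaseDecay
    measurable_const
  simpa only [one_mul, mul_one] using h1

theorem schwartzMajorant_le_add (S : FioSetting χ₂ φ ω w ω₁ ω₂ h B d)
    {D D' : TripleSpace n m × TripleSpace n m → ℝ≥0∞} {E : TripleSpace n m → ℝ≥0∞}
    (hE : Measurable E) (hD : ∀ᵐ Ξ : TripleSpace n m, ∀ X, D (X, Ξ) ≤ D' (X, Ξ) + E Ξ) :
    schwartzMajorant φ h w κ' D ≤ schwartzMajorant φ h w κ' D' +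
      kernelBound E h w κ' d * ∫⁻ s, phaseDecay n s := by
  have hW := S.measurable_schwartzWeight (κ' := κ')
  refine le_trans ?_ (add_le_add_right (S.schwartzMajorant_le (κ' := κ') (D := fun z => E z.2) hE
    fun _ => le_rfl) _)
  have hE' : Measurable fun r : TripleSpace n m × TripleSpace n m × TripleSpace n m => E r.2.2 :=
    hE.comp (measurable_snd.comp measurable_snd)
  have hm : Measurable fun r : TripleSpace n m × TripleSpace n m × TripleSpace n m => E r.2.2 *
      ((h (-r.2.1 - r.2.2 - gradVec φ r.1) *
          ENNReal.ofReal (w (-r.2.1 - r.2.2 - gradVec φ r.1))) *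
        (zWindow κ' w (zPart r.2.1) * phaseDecay n (yPart r.1, yPart r.2.1))) := hE'.mul hW
  rw [schwartzMajorant_eq, schwartzMajorant_eq, schwartzMajorant_eq, ← lintegral_add_right _ hm]
  have hq : Measure.QuasiMeasurePreserving
      (fun r : TripleSpace n m × TripleSpace n m × TripleSpace n m => r.2.2) volume volume :=
    Measure.quasiMeasurePreserving_snd.comp Measure.quasiMeasurePreserving_snd
  refine lintegral_mono_ae ?_
  filter_upwards [hq.ae hD] with r hr
  rw [← add_mul]
  exact mul_le_mul_left (hr r.1) _

theorem tendsto_kernelBound (S : FioSetting χ₂ φ ω w ω₁ ω₂ h B d) {α : Type*} {l : Filter α}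
    {E : α → TripleSpace n m → ℝ≥0∞} (hE : Tendsto (fun j => ∫⁻ Ξ, E j Ξ) l (𝓝 0)) :
    Tendsto (fun j => kernelBound (E j) h w κ' d * ∫⁻ s, phaseDecay n s) l (𝓝 0) := by
  obtain ⟨k, hw⟩ := S.dualWeight
  have h1 := ENNReal.Tendsto.mul_const (b := (∫⁻ Θ, h Θ * ENNReal.ofReal (w Θ)) *
    (ENNReal.ofReal d⁻¹ * (∫⁻ ν, zWindow κ' w ν) * ∫⁻ s, phaseDecay n s)) hE
    (Or.inr (ENNReal.mul_ne_top S.lintegral_ne_top (ENNReal.mul_ne_top (ENNReal.mul_ne_top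
      ENNReal.ofReal_ne_top (lintegral_zWindow_ne_top κ' hw)) lintegral_phaseDecay_ne_top)))
  rw [zero_mul] at h1
  refine h1.congr fun j => ?_
  rw [kernelBound]
  ring

/-- Continuity of the operators in the symbol, in terms of the majorant. -/
theorem tendsto_clm (S : FioSetting χ₂ φ ω w ω₁ ω₂ h B d) {α : Type*} {l : Filter α} {c : ℂ}
    {a : α → 𝓢'(TripleSpace n m, ℂ)} {a₀ : 𝓢'(TripleSpace n m, ℂ)}
    {T : α → 𝓢(ℰ (Fin n), ℂ) →L[ℂ] 𝓢'(ℰ (Fin n), ℂ)}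
    {T₀ : 𝓢(ℰ (Fin n), ℂ) →L[ℂ] 𝓢'(ℰ (Fin n), ℂ)}
    (ha : ∀ᶠ j in l, ∫⁻ Ξ, sliceSup (stft₀ χ (a j)) ω Ξ ≠ ∞)
    (ha₀ : ∫⁻ Ξ, sliceSup (stft₀ χ a₀) ω Ξ ≠ ∞)
    (hT : ∀ᶠ j in l, ∀ f g : 𝓢(ℰ (Fin n), ℂ),
      T j f g = c * fioForm χ χ₂ κ χ₁ κ' φ (a j) (f : 𝓢'(ℰ (Fin n), ℂ))
        (g : 𝓢'(ℰ (Fin n), ℂ)))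
    (hT₀ : ∀ f g : 𝓢(ℰ (Fin n), ℂ),
      T₀ f g = c * fioForm χ χ₂ κ χ₁ κ' φ a₀ (f : 𝓢'(ℰ (Fin n), ℂ))
        (g : 𝓢'(ℰ (Fin n), ℂ)))
    (h0 : Tendsto (fun j => schwartzMajorant φ h w κ' fun z => ‖wstft χ ω (a j - a₀) z‖ₑ) l
      (𝓝 0)) : Tendsto T l (𝓝 T₀) := by
  obtain ⟨M₁, M₂, C, hC, hb⟩ := S.exists_lintegral_enorm_coe_le χ κ χ₁ κ'
  refine tendsto_clm_of_bound fun g => ⟨M₁, fun j => schwartzMajorant φ h w κ'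
    (fun z => ‖wstft χ ω (a j - a₀) z‖ₑ) * (‖c‖ₑ * C * ENNReal.ofReal (schwartzNorm M₂ g)),
    ?_, ?_⟩
  · have h1 := ENNReal.Tendsto.mul_const (b := ‖c‖ₑ * C * ENNReal.ofReal (schwartzNorm M₂ g)) h0
      (Or.inr (ENNReal.mul_ne_top (ENNReal.mul_ne_top enorm_ne_top hC) ENNReal.ofReal_ne_top))
    rwa [zero_mul] at h1
  · filter_upwards [ha, hT] with j hj hTj f
    have hf := S.lintegral_wstft_coe_ne_top (χ₁ := χ₁) f
    have hs : a j - a₀ = a j + (-1 : ℂ) • a₀ := by rw [neg_one_smul, sub_eq_add_neg]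
    have h2 : T j f g - T₀ f g = c * fioForm χ χ₂ κ χ₁ κ' φ (a j - a₀)
        (f : 𝓢'(ℰ (Fin n), ℂ)) (g : 𝓢'(ℰ (Fin n), ℂ)) := by
      rw [hTj, hT₀, hs, fioForm_symbol_add_smul
        (S.integrable_fioIntegrand_right hj le_rfl hf g)
        (S.integrable_fioIntegrand_right ha₀ le_rfl hf g)]
      ring
    rw [h2, enorm_mul]
    refine (mul_le_mul_right ((enorm_fioForm_le _ _ _).trans (hb _ f g)) _).trans_eq ?_
    ring

theorem tendsto_schwartzMajorant_of_sliceSup (S : FioSetting χ₂ φ ω w ω₁ ω₂ h B d) {α : Type*}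
    {l : Filter α} {a : α → 𝓢'(TripleSpace n m, ℂ)}
    (ha : Tendsto (fun j => ∫⁻ Ξ, sliceSup (stft₀ χ (a j)) ω Ξ) l (𝓝 0)) :
    Tendsto (fun j => schwartzMajorant φ h w κ' fun z => ‖wstft χ ω (a j) z‖ₑ) l (𝓝 0) :=
  tendsto_of_tendsto_of_tendsto_of_le_of_le tendsto_const_nhds (S.tendsto_kernelBound ha)
    (fun _ => zero_le) fun j => S.schwartzMajorant_le (S.measurable_sliceSup (a j))
      fun z => S.enorm_wstft_le_sliceSup (a j) z

/-- Narrow convergence makes the majorant of the differences tend to zero. With `H_j`, `H` the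
slices of `a_j`, `a`, the differences `D_j` are bounded by `K (H_j + H) ≤ 2 K H + K |H_j - H|`. The
part of `D_j` below `2 K H` is treated by dominated convergence, since `D_j` tends to zero pointwise;
the rest is at most `K |H_j - H|`, which tends to zero in `L^1`. -/
theorem tendsto_schwartzMajorant_of_narrowTendsto (S : FioSetting χ₂ φ ω w ω₁ ω₂ h B d)
    {ω₀ : TripleSpace n m × TripleSpace n m → ℝ} (hω₀ : IsPolyWeight ω₀) {C : ℝ} (hC : 0 ≤ C)
    (hle : ∀ z, ω z ≤ C * ω₀ z) {a : ℕ → 𝓢'(TripleSpace n m, ℂ)} {a₀ : 𝓢'(TripleSpace n m, ℂ)}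
    (ha : NarrowTendsto χ ω₀ ∞ 1 a a₀) :
    Tendsto (fun j => schwartzMajorant φ h w κ' fun z => ‖wstft χ ω (a j - a₀) z‖ₑ) atTop
      (𝓝 0) := by
  obtain ⟨k, hω⟩ := S.weight
  obtain ⟨haj, ha₀, hdist, hlim⟩ := ha
  set K := ENNReal.ofReal (C * (stftConst (TripleIdx n m))⁻¹) with hK
  have hKt : K ≠ ∞ := ENNReal.ofReal_ne_top
  set H₀ := modSlice χ ω₀ ∞ a₀ with hH₀
  have m₀ : AEMeasurable H₀ := aemeasurable_modSlice_top hω₀.aemeasurable χ a₀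
  have mj := fun j => aemeasurable_modSlice_top hω₀.aemeasurable χ (a j)
  have hfin : ∀ {u : 𝓢'(TripleSpace n m, ℂ)}, u ∈ modSpace χ ω₀ ∞ 1 →
      ∫⁻ Ξ, modSlice χ ω₀ ∞ u Ξ ≠ ∞ := fun {u} hu => by
    rw [← modNorm_top_one]
    exact (show modNorm χ ω₀ ∞ 1 u < ∞ from hu).ne
  set E : ℕ → TripleSpace n m → ℝ≥0∞ := fun j Ξ =>
    ‖(modSlice χ ω₀ ∞ (a j) Ξ).toReal - (H₀ Ξ).toReal‖ₑ with hE
  have mE : ∀ j, AEMeasurable (E j) := fun j =>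
    ((mj j).ennreal_toReal.sub m₀.ennreal_toReal).enorm
  -- the slices are only almost everywhere measurable, whence the measurable representatives
  set b : TripleSpace n m → ℝ≥0∞ := fun Ξ => K * (2 * m₀.mk H₀ Ξ) with hb
  have mb : Measurable b := (m₀.measurable_mk.const_mul 2).const_mul K
  have hbfin : ∫⁻ Ξ, b Ξ ≠ ∞ := by
    rw [hb, lintegral_const_mul' _ _ hKt, lintegral_const_mul' _ _ ENNReal.ofNat_ne_top,
      ← lintegral_congr_ae m₀.ae_eq_mk]
    exact ENNReal.mul_ne_top hKt (ENNReal.mul_ne_top ENNReal.ofNat_ne_top (hfin ha₀))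
  have hElim : Tendsto (fun j => ∫⁻ Ξ, K * (mE j).mk (E j) Ξ) atTop (𝓝 0) := by
    have h1 := ENNReal.Tendsto.const_mul (a := K) hlim (Or.inr hKt)
    rw [mul_zero] at h1
    refine h1.congr fun j => ?_
    rw [lintegral_const_mul' _ _ hKt, ← lintegral_congr_ae (mE j).ae_eq_mk,
      eLpNorm_one_eq_lintegral_enorm]
  set D : ℕ → TripleSpace n m × TripleSpace n m → ℝ≥0∞ := fun j z => ‖wstft χ ω (a j - a₀) z‖ₑ
    with hD
  have mD : ∀ j, Measurable (D j) := fun j => (continuous_wstft hω.cont _).enorm.measurable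
  have hDlim : ∀ z, Tendsto (fun j => D j z) atTop (𝓝 0) := fun z => by
    have h1 : Tendsto (fun j => a j (tfAtom χ z.1 z.2)) atTop (𝓝 (a₀ (tfAtom χ z.1 z.2))) :=
      ((PointwiseConvergenceCLM.evalCLM (RingHom.id ℂ) ℂ (tfAtom χ z.1 z.2)).continuous.tendsto
        a₀).comp hdist
    have h2 : Tendsto (fun j => wstft χ ω (a j - a₀) z) atTop (𝓝 0) := by
      have := (h1.sub_const (a₀ (tfAtom χ z.1 z.2))).mul_const (ω z : ℂ)
      rw [sub_self, zero_mul] at this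
      exact this
    have := h2.enorm
    rwa [enorm_zero] at this
  have hDle : ∀ j, ∀ᵐ Ξ : TripleSpace n m, ∀ X,
      D j (X, Ξ) ≤ min (D j (X, Ξ)) (b Ξ) + K * (mE j).mk (E j) Ξ := fun j => by
    filter_upwards [m₀.ae_eq_mk, (mE j).ae_eq_mk, ae_lt_top' m₀ (hfin ha₀),
      ae_lt_top' (mj j) (hfin (haj j))] with Ξ e1 e2 e3 e4 X
    have h1 : D j (X, Ξ) ≤ K * modSlice χ ω₀ ∞ (a j) Ξ + K * H₀ Ξ := by
      have i1 := enorm_stft₀_mul_le_modSlice hω.cont hle hC (fun z => (hω₀.pos z).le) χ (a j)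
        (X, Ξ)
      have i2 := enorm_stft₀_mul_le_modSlice hω.cont hle hC (fun z => (hω₀.pos z).le) χ a₀
        (X, Ξ)
      rw [← enorm_wstft fun z => (hω.pos z).le] at i1 i2
      simp only [hD, wstft_sub, Pi.sub_apply]
      exact enorm_sub_le.trans (add_le_add i1 i2)
    have h2 : modSlice χ ω₀ ∞ (a j) Ξ ≤ H₀ Ξ + E j Ξ := le_add_enorm_toReal_sub e4.ne e3.ne
    have h3 : D j (X, Ξ) ≤ b Ξ + K * (mE j).mk (E j) Ξ := by
      have e0 : b Ξ = K * (2 * H₀ Ξ) := by rw [e1]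
      rw [e0, ← e2]
      calc _ ≤ K * (H₀ Ξ + E j Ξ) + K * H₀ Ξ := h1.trans (by gcongr)
        _ = _ := by ring
    rcases le_total (D j (X, Ξ)) (b Ξ) with h4 | h4
    · rw [min_eq_left h4]
      exact le_self_add
    · rwa [min_eq_right h4]
  have hmin : Tendsto (fun j => schwartzMajorant φ h w κ' fun z => min (D j z) (b z.2)) atTop
      (𝓝 0) := by
    simp only [schwartzMajorant_eq]
    have mr : Measurable fun r : TripleSpace n m × TripleSpace n m × TripleSpace n m =>
        (r.1, r.2.2) := by fun_prop
    have mr' : Measurable fun r : TripleSpace n m × TripleSpace n m × TripleSpace n m =>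
        b r.2.2 := mb.comp (by fun_prop)
    refine tendsto_lintegral_min_mul (D := fun j (r : TripleSpace n m × TripleSpace n m ×
      TripleSpace n m) => D j (r.1, r.2.2)) (fun j => (mD j).comp mr) mr'
      S.measurable_schwartzWeight ?_ fun r => hDlim _
    have h1 := S.schwartzMajorant_le (κ' := κ') (D := fun z => b z.2) mb fun _ => le_rfl
    rw [schwartzMajorant_eq] at h1
    exact ne_top_of_le_ne_top (ENNReal.mul_ne_top (S.kernelBound_ne_top hbfin)
      lintegral_phaseDecay_ne_top) h1
  have hsum := hmin.add (S.tendsto_kernelBound (κ' := κ') hElim)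
  rw [add_zero] at hsum
  exact tendsto_of_tendsto_of_tendsto_of_le_of_le tendsto_const_nhds hsum (fun j => zero_le)
    fun j => S.schwartzMajorant_le_add ((mE j).measurable_mk.const_mul K) (hDle j)

end FioSetting

/-! ### Boundedness between modulation spaces -/

section WindowShift

variable {ι : Type} [Fintype ι]

/-- Translation of the window amounts to translation in phase space. -/
theorem stft₀_compSubConst (χ : 𝓢(ℰ ι, ℂ)) (x : ℰ ι)
    (u : 𝓢'(ℰ ι, ℂ)) (z : ℰ ι × ℰ ι) :
    stft₀ (SchwartzMap.compSubConstCLM ℂ x χ) u z = stft₀ χ u (z + (x, 0)) := by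
  have h : tfAtom (SchwartzMap.compSubConstCLM ℂ x χ) z.1 z.2 =
      tfAtom χ (z + (x, 0)).1 (z + (x, 0)).2 := by
    ext y
    simp only [tfAtom_apply, SchwartzMap.compSubConstCLM_apply, Prod.fst_add, Prod.snd_add,
      add_zero, sub_sub]
  rw [stft₀, h, stft₀]

theorem eLpNorm_wstft_compSubConst_le {ω : ℰ ι × ℰ ι → ℝ} {k : ℕ}
    (hω : IsContWeight ω k) (χ : 𝓢(ℰ ι, ℂ)) (x : ℰ ι) (p : ℝ≥0∞)
    (u : 𝓢'(ℰ ι, ℂ)) :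
    eLpNorm (wstft (SchwartzMap.compSubConstCLM ℂ x χ) ω u) p volume ≤
      ENNReal.ofReal ((1 + ‖x‖) ^ k) * eLpNorm (wstft χ ω u) p volume := by
  have h1 : ∀ z : ℰ ι × ℰ ι,
      ‖wstft (SchwartzMap.compSubConstCLM ℂ x χ) ω u z‖ ≤
      (1 + ‖x‖) ^ k * ‖wstft χ ω u (z + (x, 0))‖ := fun z => by
    have h2 := hω.le_sub z (z + (x, 0))
    have h3 : ‖z - (z + (x, (0 : ℰ ι)))‖ = ‖x‖ := by
      rw [sub_add_cancel_left, norm_neg, Prod.norm_mk, norm_zero, max_eq_left (norm_nonneg x)]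
    rw [h3] at h2
    rw [wstft, wstft, stft₀_compSubConst, norm_mul, norm_mul, Complex.norm_real, Complex.norm_real,
      Real.norm_of_nonneg (hω.pos _).le, Real.norm_of_nonneg (hω.pos _).le]
    calc _ ≤ ‖stft₀ χ u (z + (x, 0))‖ * (ω (z + (x, 0)) * (1 + ‖x‖) ^ k) :=
          mul_le_mul_of_nonneg_left h2 (norm_nonneg _)
      _ = _ := by ring
  have h4 : MeasurePreserving (fun z : ℰ ι × ℰ ι => z + (x, 0))
      volume volume := measurePreserving_add_right volume _
  have h6 : AEStronglyMeasurable (wstft χ ω u) volume :=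
    (continuous_wstft hω.cont u).aestronglyMeasurable
  have h5 : eLpNorm (fun z => wstft χ ω u (z + (x, 0))) p volume = eLpNorm (wstft χ ω u) p volume :=
    eLpNorm_comp_measurePreserving (g := wstft χ ω u)
      (f := fun z : ℰ ι × ℰ ι => z + (x, 0)) h6 h4
  rw [← h5]
  exact eLpNorm_le_mul_eLpNorm_of_ae_le_mul (ae_of_all _ h1) p

end WindowShift

namespace FioSetting

variable {n m : ℕ} {χ χ₂ : 𝓢(TripleSpace n m, ℂ)} {κ χ₁ : 𝓢(ℰ (Fin n), ℂ)}
  {κ' : 𝓢(ℰ (Fin m), ℂ)} {φ : TripleSpace n m → ℝ}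
  {ω : TripleSpace n m × TripleSpace n m → ℝ} {w : TripleSpace n m → ℝ}
  {ω₁ ω₂ : ℰ (Fin n) × ℰ (Fin n) → ℝ}
  {h : TripleSpace n m → ℝ≥0∞} {B d : ℝ}

theorem measurable_kernelOperator (S : FioSetting χ₂ φ ω w ω₁ ω₂ h B d)
    (a : 𝓢'(TripleSpace n m, ℂ)) (f : 𝓢'(ℰ (Fin n), ℂ)) :
    Measurable fun s => ∫⁻ t, fioKernel φ (lconv (sliceSup (stft₀ χ a) ω)
      fun Θ => h Θ * ENNReal.ofReal (w Θ)) (zWindow κ' w) s t * ‖wstft χ₁ ω₁ f t‖ₑ := by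
  have h1 := (S.measurable_kernel (κ' := κ') (S.measurable_sliceSup (χ := χ) a)).mul
    ((S.measurable_wstft₁ (χ₁ := χ₁) f).comp measurable_snd)
  exact h1.lintegral_prod_right'

theorem measurePreserving_reflect : MeasurePreserving
    (fun s : ℰ (Fin n) × ℰ (Fin n) => (s.1, -s.2))
    volume volume :=
  (MeasurePreserving.id volume).prod (Measure.measurePreserving_neg volume)

/-- Pointwise bound for the short-time Fourier transform of the image, obtained by testing with the
time-frequency atoms. -/
theorem enorm_wstft_image_le (S : FioSetting χ₂ φ ω w ω₁ ω₂ h B d)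
    {χ₀ : 𝓢(ℰ (Fin n), ℂ)} {M : ℕ} {D : ℝ}
    (hK : ∀ z z', ‖tfKernel χ₀ κ z z'‖ * ω₂ z ≤
      D * (decayFn M (z.1 - z'.1) * decayFn M (z.2 - z'.2)) * ω₂ z')
    {a : 𝓢'(TripleSpace n m, ℂ)} {f u : 𝓢'(ℰ (Fin n), ℂ)} {c : ℂ}
    (hu : ∀ g : 𝓢(ℰ (Fin n), ℂ),
      u g = c * fioForm χ χ₂ κ χ₁ κ' φ a f (g : 𝓢'(ℰ (Fin n), ℂ)))
    (z : ℰ (Fin n) × ℰ (Fin n)) :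
    ‖wstft χ₀ ω₂ u z‖ₑ ≤ ‖c‖ₑ * ENNReal.ofReal B *
      ∫⁻ z' : ℰ (Fin n) × ℰ (Fin n),
        ENNReal.ofReal (D * (decayFn M (z.1 - z'.1) * decayFn M (z.2 - z'.2))) *
        ∫⁻ t, fioKernel φ (lconv (sliceSup (stft₀ χ a) ω)
          fun Θ => h Θ * ENNReal.ofReal (w Θ)) (zWindow κ' w) (z'.1, -z'.2) t *
            ‖wstft χ₁ ω₁ f t‖ₑ := by
  obtain ⟨k₂, i₂⟩ := S.weight₂
  have hL := S.measurable_kernelOperator (χ := χ) (χ₁ := χ₁) (κ' := κ') a f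
  set L := fun s => ∫⁻ t, fioKernel φ (lconv (sliceSup (stft₀ χ a) ω)
    fun Θ => h Θ * ENNReal.ofReal (w Θ)) (zWindow κ' w) s t * ‖wstft χ₁ ω₁ f t‖ₑ
  set g : 𝓢'(ℰ (Fin n), ℂ) := (tfAtom χ₀ z.1 z.2 : 𝓢'(ℰ (Fin n), ℂ))
    with hg
  have h1 : ‖stft₀ χ₀ u z‖ₑ ≤ ‖c‖ₑ * (ENNReal.ofReal B * ∫⁻ s, dualStft κ ω₂ g s * L s) := by
    rw [stft₀, hu, enorm_mul]
    exact mul_le_mul_right ((enorm_fioForm_le _ _ _).trans (S.lintegral_enorm_le_kernel a f g)) _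
  have hm : Measurable fun s => dualStft κ ω₂ g s * L s := (S.measurable_dualStft g).mul hL
  rw [← measurePreserving_reflect.lintegral_comp hm] at h1
  rw [enorm_wstft fun z => (i₂.pos z).le]
  refine (mul_le_mul_left h1 _).trans ?_
  rw [← mul_assoc, mul_assoc (‖c‖ₑ * ENNReal.ofReal B)]
  refine mul_le_mul_right ?_ _
  rw [← lintegral_mul_const' _ _ ENNReal.ofReal_ne_top]
  refine lintegral_mono fun z' => ?_
  have h2 : dualStft κ ω₂ g (z'.1, -z'.2) * ENNReal.ofReal (ω₂ z) ≤
      ENNReal.ofReal (D * (decayFn M (z.1 - z'.1) * decayFn M (z.2 - z'.2))) := by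
    have i3 := i₂.pos z'
    rw [dualStft, neg_neg, ← ofReal_norm, ← ENNReal.ofReal_mul (norm_nonneg _),
      ← ENNReal.ofReal_mul (mul_nonneg (norm_nonneg _) (inv_nonneg.2 i3.le))]
    refine ENNReal.ofReal_le_ofReal ?_
    rw [mul_right_comm, ← div_eq_mul_inv, div_le_iff₀ i3]
    exact hK z z'
  calc _ = dualStft κ ω₂ g (z'.1, -z'.2) * ENNReal.ofReal (ω₂ z) * L (z'.1, -z'.2) := by ring
    _ ≤ _ := mul_le_mul_left h2 _

/-- The operators are bounded on weighted `L^p` spaces of short-time Fourier transforms, with a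
bound which depends on the phase only through the norm of the kernel operator. -/
theorem exists_eLpNorm_wstft_le (χ₀ κ : 𝓢(ℰ (Fin n), ℂ)) {k₂ : ℕ}
    (hω₂ : IsContWeight ω₂ k₂) {p : ℝ≥0∞} (hp1 : 1 ≤ p) (hp : p ≠ ∞) :
    ∃ A : ℝ≥0∞, A ≠ ∞ ∧ ∀ (φ : TripleSpace n m → ℝ) (h : TripleSpace n m → ℝ≥0∞) (d : ℝ),
      FioSetting χ₂ φ ω w ω₁ ω₂ h B d →
      ∀ (a : 𝓢'(TripleSpace n m, ℂ)) (f u : 𝓢'(ℰ (Fin n), ℂ)) (c : ℂ),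
      (∀ g : 𝓢(ℰ (Fin n), ℂ),
        u g = c * fioForm χ χ₂ κ χ₁ κ' φ a f (g : 𝓢'(ℰ (Fin n), ℂ))) →
      eLpNorm (wstft χ₀ ω₂ u) p volume ≤ ‖c‖ₑ * ENNReal.ofReal B * A *
        kernelBound (sliceSup (stft₀ χ a) ω) h w κ' d * eLpNorm (wstft χ₁ ω₁ f) p volume := by
  set M := Module.finrank ℝ (ℰ (Fin n)) + 1
  obtain ⟨D, hD, hK⟩ := exists_norm_tfKernel_mul_le χ₀ κ hω₂ M
  have hA := (lintegral_decayFn_prod_lt_top (ι := Fin n) (M := M) (Nat.lt_succ_self _) D).ne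
  set A := ∫⁻ z : ℰ (Fin n) × ℰ (Fin n),
    ENNReal.ofReal (D * (decayFn M z.1 * decayFn M z.2)) with hAdef
  refine ⟨A, hA, fun φ h d S a f u c hu => ?_⟩
  have hp0 : p ≠ 0 := (zero_lt_one.trans_le hp1).ne'
  have hpr : 1 ≤ p.toReal := by
    rwa [← ENNReal.toReal_one, ENNReal.toReal_le_toReal ENNReal.one_ne_top hp]
  have hpr0 : 0 < p.toReal := zero_lt_one.trans_le hpr
  have hL := S.measurable_kernelOperator (χ := χ) (χ₁ := χ₁) (κ' := κ') a f
  have hLp := S.lintegral_kernel_rpow_le (κ' := κ') (S.measurable_sliceSup (χ := χ) a)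
    (S.measurable_wstft₁ (χ₁ := χ₁) f) hpr
  set L := fun s => ∫⁻ t, fioKernel φ (lconv (sliceSup (stft₀ χ a) ω)
    fun Θ => h Θ * ENNReal.ofReal (w Θ)) (zWindow κ' w) s t * ‖wstft χ₁ ω₁ f t‖ₑ
  have hb : ∀ z : ℰ (Fin n) × ℰ (Fin n),
      ‖wstft χ₀ ω₂ u z‖ₑ ^ p.toReal ≤ (‖c‖ₑ * ENNReal.ofReal B) ^ p.toReal *
        (∫⁻ z' : ℰ (Fin n) × ℰ (Fin n),
          ENNReal.ofReal (D * (decayFn M (z.1 - z'.1) * decayFn M (z.2 - z'.2))) *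
            L (z'.1, -z'.2)) ^ p.toReal := fun z => by
    rw [← ENNReal.mul_rpow_of_nonneg _ _ hpr0.le]
    exact ENNReal.rpow_le_rpow (S.enorm_wstft_image_le hK hu z) hpr0.le
  set Q := kernelBound (sliceSup (stft₀ χ a) ω) h w κ' d
  have hLr : Measurable fun z' : ℰ (Fin n) × ℰ (Fin n) =>
    L (z'.1, -z'.2) := hL.comp measurePreserving_reflect.measurable
  have hconv := lintegral_conv_decayFn_le (M := M) D hLr hpr
  have hLm : Measurable fun s => L s ^ p.toReal := hL.pow_const p.toReal
  have href : ∫⁻ z' : ℰ (Fin n) × ℰ (Fin n),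
      L (z'.1, -z'.2) ^ p.toReal = ∫⁻ s, L s ^ p.toReal :=
    measurePreserving_reflect.lintegral_comp hLm
  rw [eLpNorm_eq_lintegral_rpow_enorm_toReal hp0 hp, eLpNorm_eq_lintegral_rpow_enorm_toReal hp0 hp]
  have hroot : ∀ x : ℝ≥0∞, (x ^ p.toReal) ^ (1 / p.toReal) = x := fun x => by
    rw [← ENNReal.rpow_mul, mul_one_div_cancel hpr0.ne', ENNReal.rpow_one]
  have hfin : ∫⁻ z, ‖wstft χ₀ ω₂ u z‖ₑ ^ p.toReal ≤
      (‖c‖ₑ * ENNReal.ofReal B * A * Q) ^ p.toReal * ∫⁻ t, ‖wstft χ₁ ω₁ f t‖ₑ ^ p.toReal := by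
    refine (lintegral_mono hb).trans ?_
    rw [lintegral_const_mul' _ _ (ENNReal.rpow_ne_top_of_nonneg hpr0.le
      (ENNReal.mul_ne_top enorm_ne_top ENNReal.ofReal_ne_top))]
    calc _ ≤ (‖c‖ₑ * ENNReal.ofReal B) ^ p.toReal * (A ^ p.toReal *
            (Q ^ p.toReal * ∫⁻ t, ‖wstft χ₁ ω₁ f t‖ₑ ^ p.toReal)) :=
          mul_le_mul_right (hconv.trans (mul_le_mul_right (href.trans_le hLp) _)) _
      _ = _ := by
          rw [ENNReal.mul_rpow_of_nonneg _ Q hpr0.le, ENNReal.mul_rpow_of_nonneg _ A hpr0.le]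
          ring
  refine (ENNReal.rpow_le_rpow hfin (by positivity)).trans_eq ?_
  rw [ENNReal.mul_rpow_of_nonneg _ _ (by positivity), hroot]

end FioSetting

/-! ### Uniqueness of the extensions -/

section Uniqueness

variable {n m : ℕ}

/-- Narrowly continuous extensions agree, by narrow density of the Schwartz functions and uniqueness
of limits. -/
theorem eqOn_of_isNarrowlyContinuous {χ : 𝓢(TripleSpace n m, ℂ)} (hχ : χ ≠ 0)
    {ω : TripleSpace n m × TripleSpace n m → ℝ} (hω : IsPolyWeight ω) {φ : TripleSpace n m → ℝ}
    {T T' : 𝓢'(TripleSpace n m, ℂ) →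
      (𝓢(ℰ (Fin n), ℂ) →L[ℂ] 𝓢'(ℰ (Fin n), ℂ))}
    (hT : ExtendsFIO φ T) (hT' : ExtendsFIO φ T') (hc : IsNarrowlyContinuous χ ω T)
    (hc' : IsNarrowlyContinuous χ ω T') : Set.EqOn T' T (modSpace χ ω ∞ 1) := fun a ha => by
  obtain ⟨Ψ, hΨ⟩ := exists_narrowTendsto hχ hω ha
  refine tendsto_nhds_unique (hc' _ _ hΨ) ((hc _ _ hΨ).congr fun j => ?_)
  ext f g
  rw [hT, hT']

/-- A triangle inequality up to a constant, which comes from passing to a continuous weight. -/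
theorem exists_modNorm_sub_le {ι : Type} [Fintype ι] (χ₀ : 𝓢(ℰ ι, ℂ))
    {ω : ℰ ι × ℰ ι → ℝ} (hω : IsPolyWeight ω) {p : ℝ≥0∞}
    (hp1 : 1 ≤ p) (hp : p ≠ ∞) : ∃ K : ℝ≥0∞, K ≠ ∞ ∧ ∀ u v w : 𝓢'(ℰ ι, ℂ),
      modNorm χ₀ ω p p (v - w) ≤ K * (modNorm χ₀ ω p p (u - w) + modNorm χ₀ ω p p (u - v)) := by
  obtain ⟨ω', k, C, hω', hC, h₁, h₂⟩ := exists_isContWeight hω.pos hω.moderate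
  have hp0 : p ≠ 0 := (zero_lt_one.trans_le hp1).ne'
  refine ⟨ENNReal.ofReal (stftConst ι) * ENNReal.ofReal (C * (stftConst ι)⁻¹),
    ENNReal.mul_ne_top ENNReal.ofReal_ne_top ENNReal.ofReal_ne_top, fun u v w => ?_⟩
  refine (modNorm_le_eLpNorm_wstft (fun z => (hω.pos z).le) hω' h₁ hp0 hp _).trans ?_
  have h3 : wstft χ₀ ω' (v - w) = wstft χ₀ ω' (u - w) - wstft χ₀ ω' (u - v) := by
    simp only [wstft_sub]
    abel
  have hm := fun u => (continuous_wstft (χ := χ₀) hω'.cont u).aestronglyMeasurable (μ := volume)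
  rw [h3, mul_assoc, mul_add]
  refine mul_le_mul_right ((eLpNorm_sub_le (hm _) (hm _) hp1).trans (add_le_add ?_ ?_)) _ <;>
  exact eLpNorm_wstft_le_modNorm hω' hC.le h₂ hp0 hp _

/-- Continuous extensions to `M^p` agree, by density of the Schwartz functions. -/
theorem eqOn_of_isContinuousModMap {χ₀ : 𝓢(ℰ (Fin n), ℂ)} (hχ₀ : χ₀ ≠ 0)
    {ω₁ ω₂ : ℰ (Fin n) × ℰ (Fin n) → ℝ} (hω₁ : IsPolyWeight ω₁)
    (hω₂ : IsPolyWeight ω₂) {p : ℝ≥0∞} (hp1 : 1 ≤ p) (hp : p ≠ ∞)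
    {S S' : 𝓢'(ℰ (Fin n), ℂ) → 𝓢'(ℰ (Fin n), ℂ)}
    (h : ∀ f : 𝓢(ℰ (Fin n), ℂ),
      S' (f : 𝓢'(ℰ (Fin n), ℂ)) = S (f : 𝓢'(ℰ (Fin n), ℂ)))
    (hS : IsContinuousModMap χ₀ ω₁ ω₂ p S) (hS' : IsContinuousModMap χ₀ ω₁ ω₂ p S') :
    Set.EqOn S' S (modSpace χ₀ ω₁ p p) := fun f hf => by
  obtain ⟨Ψ, hΨ⟩ := exists_seq_tendsto_modNorm hχ₀ hω₁ hp1 hp hf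
  obtain ⟨K, hK, hKle⟩ := exists_modNorm_sub_le χ₀ hω₂ hp1 hp
  have hlim : Tendsto (fun j => (Ψ j : 𝓢'(ℰ (Fin n), ℂ))) atTop
      (modNhds χ₀ ω₁ p p f) :=
    tendsto_inf.2 ⟨tendsto_comap_iff.2 hΨ,
      tendsto_principal.2 (Eventually.of_forall fun j => coe_mem_modSpace hω₁ hp1 hp (Ψ j))⟩
  have h1 := (hS.2 f hf).comp hlim
  have h2 := (hS'.2 f hf).comp hlim
  have h3 := ENNReal.Tendsto.const_mul (a := K) (h1.add h2) (Or.inr hK)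
  rw [add_zero, mul_zero] at h3
  have h4 : modNorm χ₀ ω₂ p p (S' f - S f) = 0 := by
    refine le_antisymm (ge_of_tendsto' h3 fun j => ?_) zero_le
    have := hKle (S (Ψ j : 𝓢'(ℰ (Fin n), ℂ))) (S' f) (S f)
    simpa only [Function.comp_apply, h] using this
  exact eq_of_modNorm_sub_eq_zero hχ₀ hω₂ (zero_lt_one.trans_le hp1).ne' hp h4

end Uniqueness

/-! ### Existence of the extensions -/

namespace FioSetting

variable {n m : ℕ} {χ χ₂ : 𝓢(TripleSpace n m, ℂ)} {κ χ₁ : 𝓢(ℰ (Fin n), ℂ)}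
  {κ' : 𝓢(ℰ (Fin m), ℂ)} {φ : TripleSpace n m → ℝ}
  {ω ω' : TripleSpace n m × TripleSpace n m → ℝ} {w : TripleSpace n m → ℝ}
  {ω₁ ω₁' ω₂ : ℰ (Fin n) × ℰ (Fin n) → ℝ}
  {h : TripleSpace n m → ℝ≥0∞} {B d C : ℝ}

/-- The extension of `a ↦ Op_φ(a)` to `M^{∞,1}` given by the phase space form. -/
theorem exists_symbolExtension (S : FioSetting χ₂ φ ω' w ω₁ ω₂ h B d) (hω : IsPolyWeight ω)
    (hC : 0 ≤ C) (h₁ : ∀ z, ω z ≤ ω' z) (h₂ : ∀ z, ω' z ≤ C * ω z) {c : ℂ}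
    (hc : ∀ (a : 𝓢(TripleSpace n m, ℂ)) (f g : 𝓢(ℰ (Fin n), ℂ)),
      Integrable (fioIntegrand χ χ₂ κ χ₁ κ' φ (a : 𝓢'(TripleSpace n m, ℂ))
        (f : 𝓢'(ℰ (Fin n), ℂ)) (g : 𝓢'(ℰ (Fin n), ℂ))) →
      fioPairing φ a f g = c * ∫ r, fioIntegrand χ χ₂ κ χ₁ κ' φ (a : 𝓢'(TripleSpace n m, ℂ))
        (f : 𝓢'(ℰ (Fin n), ℂ)) (g : 𝓢'(ℰ (Fin n), ℂ)) r) :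
    ∃ T : 𝓢'(TripleSpace n m, ℂ) →
        (𝓢(ℰ (Fin n), ℂ) →L[ℂ] 𝓢'(ℰ (Fin n), ℂ)),
      (∀ a ∈ modSpace χ ω ∞ 1, ∀ f g : 𝓢(ℰ (Fin n), ℂ),
        T a f g = c * fioForm χ χ₂ κ χ₁ κ' φ a (f : 𝓢'(ℰ (Fin n), ℂ))
          (g : 𝓢'(ℰ (Fin n), ℂ))) ∧
      ExtendsFIO φ T ∧ IsLinearOnSet T (modSpace χ ω ∞ 1) ∧
      (∀ a ∈ modSpace χ ω ∞ 1, Tendsto T (modNhds χ ω ∞ 1 a) (𝓝 (T a))) ∧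
      IsNarrowlyContinuous χ ω T := by
  classical
  obtain ⟨k, hω'⟩ := S.weight
  have hnn := fun z => (hω.pos z).le
  have hmem : ∀ {a : 𝓢'(TripleSpace n m, ℂ)}, a ∈ modSpace χ ω ∞ 1 →
      ∫⁻ Ξ, sliceSup (stft₀ χ a) ω' Ξ ≠ ∞ := fun {a} ha =>
    ((mem_modSpace_top_one_iff hnn hω' hC h₁ h₂).1 ha).ne
  -- outside `M^{∞,1}`, where the form need not converge, the extension is set to zero
  have hex : ∀ a : 𝓢'(TripleSpace n m, ℂ), ∃ T : 𝓢(ℰ (Fin n), ℂ) →L[ℂ]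
      𝓢'(ℰ (Fin n), ℂ), a ∈ modSpace χ ω ∞ 1 →
      ∀ f g : 𝓢(ℰ (Fin n), ℂ),
        T f g = c * fioForm χ χ₂ κ χ₁ κ' φ a (f : 𝓢'(ℰ (Fin n), ℂ))
          (g : 𝓢'(ℰ (Fin n), ℂ)) := fun a => by
    by_cases ha : a ∈ modSpace χ ω ∞ 1
    · obtain ⟨T, hT⟩ := S.exists_clm (hmem ha) κ χ₁ κ' c
      exact ⟨T, fun _ => hT⟩
    · exact ⟨0, fun h => absurd h ha⟩
  choose T hT using hex
  have hi : ∀ {a : 𝓢'(TripleSpace n m, ℂ)}, a ∈ modSpace χ ω ∞ 1 →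
      ∀ f g : 𝓢(ℰ (Fin n), ℂ), Integrable (fioIntegrand χ χ₂ κ χ₁ κ' φ a
        (f : 𝓢'(ℰ (Fin n), ℂ)) (g : 𝓢'(ℰ (Fin n), ℂ))) :=
    fun ha f g => S.integrable_fioIntegrand_right (hmem ha) le_rfl
      (S.lintegral_wstft_coe_ne_top f) g
  refine ⟨T, hT, fun a f g => ?_, fun a ha b hb s => ?_, fun a ha => ?_, fun a a₀ ha => ?_⟩
  · have ha := coe_mem_modSpace_top_one (χ := χ) hω a
    rw [hT _ ha, hc _ _ _ (hi ha f g), fioForm]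
  · ext f g
    change T (a + s • b) f g = T a f g + s * T b f g
    rw [hT _ (add_smul_mem_modSpace_top_one hω ha hb s), hT _ ha, hT _ hb,
      fioForm_symbol_add_smul (hi ha f g) (hi hb f g)]
    ring
  · have hl : ∀ᶠ a' in modNhds χ ω ∞ 1 a, a' ∈ modSpace χ ω ∞ 1 :=
      mem_inf_of_right (mem_principal_self _)
    have hlim : Tendsto (fun a' => modNorm χ ω ∞ 1 (a' - a)) (modNhds χ ω ∞ 1 a) (𝓝 0) :=
      tendsto_comap.mono_left inf_le_left
    have h3 := ENNReal.Tendsto.const_mul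
      (a := ENNReal.ofReal (C * (stftConst (TripleIdx n m))⁻¹)) hlim (Or.inr ENNReal.ofReal_ne_top)
    rw [mul_zero] at h3
    refine S.tendsto_clm (a := fun a' => a') (hl.mono fun a' => hmem) (hmem ha)
      (hl.mono fun a' ha' => hT a' ha') (hT a ha) (S.tendsto_schwartzMajorant_of_sliceSup ?_)
    exact tendsto_of_tendsto_of_tendsto_of_le_of_le tendsto_const_nhds h3 (fun _ => zero_le)
      fun a' => lintegral_sliceSup_le hω'.cont h₂ hC hnn χ (a' - a)
  · exact S.tendsto_clm (Eventually.of_forall fun j => hmem (ha.1 j)) (hmem ha.2.1)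
      (Eventually.of_forall fun j => hT _ (ha.1 j)) (hT _ ha.2.1)
      (S.tendsto_schwartzMajorant_of_narrowTendsto hω hC h₂ ha)

/-- The extension of `Op_φ(a)` to `M^p` given by the phase space form. -/
theorem exists_modExtension (S : FioSetting χ₂ φ ω' w ω₁' ω₂ h B d) (hω₁ : IsPolyWeight ω₁)
    {ω₂' : ℰ (Fin n) × ℰ (Fin n) → ℝ}
    {χ₀ : 𝓢(ℰ (Fin n), ℂ)} {p : ℝ≥0∞} (hp1 : 1 ≤ p) (hp : p ≠ ∞)
    {a : 𝓢'(TripleSpace n m, ℂ)} (ha : ∫⁻ Ξ, sliceSup (stft₀ χ a) ω' Ξ ≠ ∞)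
    (hfin : ∀ f ∈ modSpace χ₀ ω₁ p p, ∫⁻ t, ‖wstft χ₁ ω₁' f t‖ₑ ^ p.toReal ≠ ∞)
    {c : ℂ} {K : ℝ≥0∞} (hK : K ≠ ∞)
    (hb : ∀ f u : 𝓢'(ℰ (Fin n), ℂ), (∀ g : 𝓢(ℰ (Fin n), ℂ),
        u g = c * fioForm χ χ₂ κ χ₁ κ' φ a f (g : 𝓢'(ℰ (Fin n), ℂ))) →
      modNorm χ₀ ω₂' p p u ≤ K * modNorm χ₀ ω₁ p p f)
    {T : 𝓢(ℰ (Fin n), ℂ) →L[ℂ] 𝓢'(ℰ (Fin n), ℂ)}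
    (hT : ∀ f g : 𝓢(ℰ (Fin n), ℂ),
      T f g = c * fioForm χ χ₂ κ χ₁ κ' φ a (f : 𝓢'(ℰ (Fin n), ℂ))
        (g : 𝓢'(ℰ (Fin n), ℂ))) :
    ∃ A : 𝓢'(ℰ (Fin n), ℂ) → 𝓢'(ℰ (Fin n), ℂ),
      (∀ f : 𝓢(ℰ (Fin n), ℂ),
        A (f : 𝓢'(ℰ (Fin n), ℂ)) = T f) ∧
      IsLinearOnSet A (modSpace χ₀ ω₁ p p) ∧ IsContinuousModMap χ₀ ω₁ ω₂' p A ∧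
      ∀ f ∈ modSpace χ₀ ω₁ p p, modNorm χ₀ ω₂' p p (A f) ≤ K * modNorm χ₀ ω₁ p p f := by
  classical
  have hpr : 1 ≤ p.toReal := by
    rwa [← ENNReal.toReal_one, ENNReal.toReal_le_toReal ENNReal.one_ne_top hp]
  have hex : ∀ f : 𝓢'(ℰ (Fin n), ℂ), ∃ u : 𝓢'(ℰ (Fin n), ℂ),
      f ∈ modSpace χ₀ ω₁ p p → ∀ g : 𝓢(ℰ (Fin n), ℂ),
        u g = c * fioForm χ χ₂ κ χ₁ κ' φ a f (g : 𝓢'(ℰ (Fin n), ℂ)) := fun f => by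
    by_cases hf : f ∈ modSpace χ₀ ω₁ p p
    · obtain ⟨u, hu⟩ := S.exists_distribution ha hpr (hfin f hf) κ κ' c
      exact ⟨u, fun _ => hu⟩
    · exact ⟨0, fun h => absurd h hf⟩
  choose A hA using hex
  have hi : ∀ {f : 𝓢'(ℰ (Fin n), ℂ)}, f ∈ modSpace χ₀ ω₁ p p →
      ∀ g : 𝓢(ℰ (Fin n), ℂ), Integrable (fioIntegrand χ χ₂ κ χ₁ κ' φ a f
        (g : 𝓢'(ℰ (Fin n), ℂ))) :=
    fun hf g => S.integrable_fioIntegrand_right ha hpr (hfin _ hf) g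
  have hlin : ∀ {f f' : 𝓢'(ℰ (Fin n), ℂ)}, f ∈ modSpace χ₀ ω₁ p p →
      f' ∈ modSpace χ₀ ω₁ p p → ∀ s : ℂ, A (f + s • f') = A f + s • A f' :=
    fun {f f'} hf hf' s => by
      ext g
      change A (f + s • f') g = A f g + s * A f' g
      rw [hA _ (add_smul_mem_modSpace hω₁ hp1 hp hf hf' s), hA _ hf, hA _ hf',
        fioForm_left_add_smul (hi hf g) (hi hf' g)]
      ring
  have hbound : ∀ f ∈ modSpace χ₀ ω₁ p p,
      modNorm χ₀ ω₂' p p (A f) ≤ K * modNorm χ₀ ω₁ p p f := fun f hf => hb f _ (hA f hf)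
  refine ⟨A, fun f => ?_, fun f hf f' hf' s => hlin hf hf' s, ⟨fun f hf => ?_, fun f hf => ?_⟩,
    hbound⟩
  · ext g
    rw [hA _ (coe_mem_modSpace hω₁ hp1 hp f), hT]
  · exact (hbound f hf).trans_lt (ENNReal.mul_lt_top hK.lt_top hf)
  · have hl : ∀ᶠ f' in modNhds χ₀ ω₁ p p f, f' ∈ modSpace χ₀ ω₁ p p :=
      mem_inf_of_right (mem_principal_self _)
    have hlim : Tendsto (fun f' => modNorm χ₀ ω₁ p p (f' - f)) (modNhds χ₀ ω₁ p p f) (𝓝 0) :=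
      tendsto_comap.mono_left inf_le_left
    have h3 := ENNReal.Tendsto.const_mul (a := K) hlim (Or.inr hK)
    rw [mul_zero] at h3
    refine tendsto_of_tendsto_of_tendsto_of_le_of_le' tendsto_const_nhds h3
      (Eventually.of_forall fun _ => zero_le) (hl.mono fun f' hf' => ?_)
    have h4 : A f' - A f = A (f' - f) := by
      rw [sub_eq_add_neg f', ← neg_one_smul ℂ f, hlin hf' hf, neg_one_smul, ← sub_eq_add_neg]
    rw [h4]
    exact hbound _ (sub_mem_modSpace hω₁ hp1 hp hf' hf)

end FioSetting

/-! ### The weights -/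

section Weights

variable {n m : ℕ}

/-- A submultiplicative weight independent of the position is equivalent to a continuous weight on
the dual space, which inherits the submultiplicativity and the scaling condition. -/
theorem exists_isSubWeight {ι : Type} [Fintype ι]
    {v : ℰ ι × ℰ ι → ℝ} (hv : IsPolyWeight v)
    (hv_sub : IsSubmultiplicative v) (hv_const : ∀ X Y Ξ, v (X, Ξ) = v (Y, Ξ))
    (hv_scale : ∃ C : ℝ, ∀ t ∈ Set.Icc (0 : ℝ) 1, ∀ X Ξ, v (X, t • Ξ) ≤ C * v (X, Ξ)) :
    ∃ (w : ℰ ι → ℝ) (k : ℕ) (A D : ℝ), IsSubWeight w k A ∧ 0 < D ∧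
      (∀ z, v z ≤ w z.2) ∧ ∀ z, w z.2 ≤ D * v z := by
  obtain ⟨C₁, k₁, h₁⟩ := hv.moderate
  obtain ⟨w, k, D, hw, hD, hle, hge⟩ := exists_isContWeight (ω := fun Ξ => v (0, Ξ))
    (fun Ξ => hv.pos _) ⟨C₁, k₁, fun x y => by
      have := h₁ (0, x) (0, y)
      simpa only [Prod.mk_add_mk, add_zero, Prod.norm_mk, norm_zero,
        max_eq_right (norm_nonneg y)] using this⟩
  obtain ⟨C₂, h₂⟩ := hv_sub
  obtain ⟨C₃, h₃⟩ := hv_scale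
  have hC₂ : 0 < C₂ := by
    have i1 := h₂ 0 0
    have i2 := hv.pos 0
    rw [add_zero] at i1
    by_contra! h
    nlinarith [mul_nonneg (neg_nonneg.2 h) (mul_pos i2 i2).le]
  have hC₃ : 0 < C₃ := by
    have i1 := h₃ 1 (by simp) 0 0
    have i2 := hv.pos (0, 0)
    rw [smul_zero] at i1
    by_contra! h
    nlinarith
  refine ⟨w, k, D * C₂ + D * C₃, D, ⟨hw, fun x y => ?_, fun t ht x => ?_⟩, hD, fun z => ?_,
    fun z => ?_⟩
  · have i1 := h₂ (0, x) (0, y)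
    rw [Prod.mk_add_mk, add_zero] at i1
    have p1 := hw.pos x
    have p2 := hw.pos y
    calc w (x + y) ≤ D * v (0, x + y) := hge _
      _ ≤ D * (C₂ * v (0, x) * v (0, y)) := mul_le_mul_of_nonneg_left i1 hD.le
      _ ≤ D * (C₂ * w x * w y) := by
          have e1 := hle x
          have e2 := hle y
          have e3 := (hv.pos (0, y)).le
          gcongr
      _ ≤ D * (C₂ * w x * w y) + D * C₃ * (w x * w y) :=
          le_add_of_nonneg_right (by positivity)
      _ = _ := by ring
  · have p1 := hw.pos x
    calc w (t • x) ≤ D * v (0, t • x) := hge _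
      _ ≤ D * (C₃ * v (0, x)) := mul_le_mul_of_nonneg_left (h₃ t ht 0 x) hD.le
      _ ≤ D * (C₃ * w x) := by
          have e1 := hle x
          gcongr
      _ ≤ D * (C₃ * w x) + D * C₂ * w x := le_add_of_nonneg_right (by positivity)
      _ = _ := by ring
  · rw [show z = (z.1, z.2) from rfl, hv_const z.1 0]
    exact hle z.2
  · rw [show v z = v (0, z.2) from hv_const z.1 0 z.2]
    exact hge z.2

/-- The condition on the weights, in the form in which it enters the estimates. -/
theorem exists_weight_bound {ω ω' v : TripleSpace n m × TripleSpace n m → ℝ}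
    {w : TripleSpace n m → ℝ}
    {ω₁ ω₁' ω₂ ω₂' : ℰ (Fin n) × ℰ (Fin n) → ℝ} (hω : ∀ z, 0 < ω z)
    (hv : ∀ z, 0 < v z) (hω₁ : ∀ z, 0 < ω₁ z) (hω₂ : ∀ z, 0 < ω₂ z)
    (hv_sub : IsSubmultiplicative v) (hvw : ∀ z, v z ≤ w z.2)
    (hωv : ∃ C : ℝ, ∀ X Ξ Ξ' : TripleSpace n m, ω (X, Ξ + Ξ') ≤ C * ω (X, Ξ) * v (X, Ξ'))
    (hω' : ∀ z, ω z ≤ ω' z) (hω₁' : ∀ z, ω₁ z ≤ ω₁' z) {C₂ : ℝ} (hC₂ : 0 < C₂)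
    (hω₂' : ∀ z, ω₂' z ≤ C₂ * ω₂ z) (C₀ : ℝ) :
    ∃ B : ℝ, ∀ φ : TripleSpace n m → ℝ,
      (∀ (X : TripleSpace n m) (ξ η : ℰ (Fin n)),
          ω₂ (xPart X, ξ) / ω₁ (yPart X, -η) ≤ C₀ * ω (X, triple ξ η 0 - gradVec φ X)) →
      ∀ X Ξ Λ, ω₂' (xPart X, -xPart Λ) ≤ B * (ω' (X, Ξ) * w (-Λ - Ξ - gradVec φ X) *
        (w (triple 0 0 (zPart Λ)) * ω₁' (yPart X, yPart Λ))) := by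
  obtain ⟨C₃, h₃⟩ := hv_sub
  obtain ⟨C₄, h₄⟩ := hωv
  refine ⟨C₂ * (C₀ * (C₄ * C₃)), fun φ hφ X Ξ Λ => ?_⟩
  set a := -Λ - Ξ - gradVec φ X with ha
  set b : TripleSpace n m := triple 0 0 (zPart Λ) with hb
  have h1 := hφ X (-xPart Λ) (-yPart Λ)
  rw [neg_neg, div_le_iff₀ (hω₁ _)] at h1
  -- the argument of the weight, as the frequency of the symbol, the deviation of the frequency of
  -- `e^{iφ}` from the gradient, and the frequency of the window in `ζ`
  have hsum : triple (-xPart Λ) (-yPart Λ) 0 - gradVec φ X = Ξ + (a + b) := by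
    have h2 : (triple (-xPart Λ) (-yPart Λ) 0 : TripleSpace n m) = -Λ + b := by
      ext i
      rcases i with i | i | i <;> simp [hb, triple, xPart, yPart, zPart]
    rw [h2, ha]
    abel
  rw [hsum] at h1
  -- the constants are positive because the weights are
  have hC₀ : 0 < C₀ := by
    have i1 := (hω₂ (xPart X, -xPart Λ)).trans_le h1
    exact pos_of_mul_pos_left (pos_of_mul_pos_left i1 (hω₁ _).le) (hω _).le
  have h2 := h₄ X Ξ (a + b)
  have hC₄ : 0 < C₄ :=
    pos_of_mul_pos_left (pos_of_mul_pos_left ((hω _).trans_le h2) (hv _).le) (hω _).le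
  have h3 := h₃ (X, a) (0, b)
  rw [Prod.mk_add_mk, add_zero] at h3
  have hC₃ : 0 < C₃ :=
    pos_of_mul_pos_left (pos_of_mul_pos_left ((hv _).trans_le h3) (hv _).le) (hv _).le
  have e1 := hvw (X, a)
  have e2 := hvw (0, b)
  have e3 := hω' (X, Ξ)
  have e4 := hω₁' (yPart X, yPart Λ)
  have p1 := hv (X, a)
  have p2 := hv (0, b)
  have p3 := hω (X, Ξ)
  have p4 := hω₁ (yPart X, yPart Λ)
  simp only at e1 e2
  have q1 := p1.trans_le e1
  have q2 := p2.trans_le e2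
  have q3 := p3.trans_le e3
  calc ω₂' (xPart X, -xPart Λ) ≤ C₂ * ω₂ (xPart X, -xPart Λ) := hω₂' _
    _ ≤ C₂ * (C₀ * (C₄ * ω (X, Ξ) * (C₃ * v (X, a) * v (0, b))) * ω₁ (yPart X, yPart Λ)) := by
        refine mul_le_mul_of_nonneg_left (h1.trans ?_) hC₂.le
        refine mul_le_mul_of_nonneg_right (mul_le_mul_of_nonneg_left (h2.trans ?_) hC₀.le) p4.le
        exact mul_le_mul_of_nonneg_left h3 (mul_pos hC₄ p3).le
    _ ≤ C₂ * (C₀ * (C₄ * ω' (X, Ξ) * (C₃ * w a * w b)) * ω₁' (yPart X, yPart Λ)) := by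
        gcongr
    _ = _ := by ring

end Weights

/-! ### The norm estimate -/

section Bound

variable {n m : ℕ} {χ χ₂ : 𝓢(TripleSpace n m, ℂ)} {ω ω' : TripleSpace n m × TripleSpace n m → ℝ}
  {w : TripleSpace n m → ℝ}
  {ω₁ ω₁' ω₂ ω₂' : ℰ (Fin n) × ℰ (Fin n) → ℝ} {B : ℝ}

/-- The norm estimate, with a constant which does not depend on the symbol, the phase function and
the lower bound of the determinant. -/
theorem exists_modNorm_image_le (κ χ₀ : 𝓢(ℰ (Fin n), ℂ))
    (κ' : 𝓢(ℰ (Fin m), ℂ)) (x : ℰ (Fin n)) (c : ℂ)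
    {k k₁ k₂ k₃ : ℕ} {C C₁ : ℝ} (hω : ∀ z, 0 ≤ ω z) (hω₂ : ∀ z, 0 ≤ ω₂ z)
    (hω' : IsContWeight ω' k) (hω₁' : IsContWeight ω₁' k₁) (hω₂' : IsContWeight ω₂' k₂)
    (hw : IsContWeight w k₃) (hC : 0 ≤ C) (h : ∀ z, ω' z ≤ C * ω z) (hC₁ : 0 ≤ C₁)
    (h₁ : ∀ z, ω₁' z ≤ C₁ * ω₁ z) (h₂ : ∀ z, ω₂ z ≤ ω₂' z) {p : ℝ≥0∞} (hp1 : 1 ≤ p)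
    (hp : p ≠ ∞) :
    ∃ K : ℝ≥0∞, K ≠ ∞ ∧ ∀ (φ : TripleSpace n m → ℝ) (h : TripleSpace n m → ℝ≥0∞) (d : ℝ),
      FioSetting χ₂ φ ω' w ω₁' ω₂' h B d →
      ∀ (a : 𝓢'(TripleSpace n m, ℂ)) (f u : 𝓢'(ℰ (Fin n), ℂ)),
      (∀ g : 𝓢(ℰ (Fin n), ℂ),
        u g = c * fioForm χ χ₂ κ (SchwartzMap.compSubConstCLM ℂ x χ₀) κ' φ a f
          (g : 𝓢'(ℰ (Fin n), ℂ))) →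
      modNorm χ₀ ω₂ p p u ≤ K * ENNReal.ofReal d⁻¹ * modNorm χ ω ∞ 1 a *
        (∫⁻ Θ, h Θ * ENNReal.ofReal (w Θ)) * modNorm χ₀ ω₁ p p f := by
  have hp0 : p ≠ 0 := (zero_lt_one.trans_le hp1).ne'
  obtain ⟨A, hA, hb⟩ := FioSetting.exists_eLpNorm_wstft_le (χ := χ) (χ₂ := χ₂) (κ' := κ')
    (χ₁ := SchwartzMap.compSubConstCLM ℂ x χ₀) (ω := ω') (w := w) (ω₁ := ω₁') (B := B) χ₀ κ hω₂'
    hp1 hp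
  have htop := fun t : ℝ => ENNReal.ofReal_ne_top (r := t)
  refine ⟨ENNReal.ofReal (stftConst (Fin n)) * (‖c‖ₑ * ENNReal.ofReal B * A) *
    (ENNReal.ofReal (C * (stftConst (TripleIdx n m))⁻¹) * ∫⁻ ν, zWindow κ' w ν) *
    (ENNReal.ofReal ((1 + ‖x‖) ^ k₁) * ENNReal.ofReal (C₁ * (stftConst (Fin n))⁻¹)), ?_,
    fun φ q d S a f u hu => ?_⟩
  · exact ENNReal.mul_ne_top (ENNReal.mul_ne_top (ENNReal.mul_ne_top (htop _)
      (ENNReal.mul_ne_top (ENNReal.mul_ne_top enorm_ne_top (htop _)) hA))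
      (ENNReal.mul_ne_top (htop _) (lintegral_zWindow_ne_top κ' hw)))
      (ENNReal.mul_ne_top (htop _) (htop _))
  have e1 := modNorm_le_eLpNorm_wstft (χ := χ₀) hω₂ hω₂' h₂ hp0 hp u
  have e2 := hb φ q d S a f u c hu
  have e3 := lintegral_sliceSup_le hω'.cont h hC hω χ a
  have e4 := eLpNorm_wstft_compSubConst_le hω₁' χ₀ x p f
  have e5 := eLpNorm_wstft_le_modNorm (χ := χ₀) hω₁' hC₁ h₁ hp0 hp f
  have e6 := e4.trans (mul_le_mul_right e5 _)
  rw [FioSetting.kernelBound] at e2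
  refine e1.trans ((mul_le_mul_right e2 _).trans ?_)
  calc _ ≤ ENNReal.ofReal (stftConst (Fin n)) * (‖c‖ₑ * ENNReal.ofReal B * A *
        (ENNReal.ofReal d⁻¹ * (ENNReal.ofReal (C * (stftConst (TripleIdx n m))⁻¹) *
          modNorm χ ω ∞ 1 a * ∫⁻ Θ, q Θ * ENNReal.ofReal (w Θ)) * ∫⁻ ν, zWindow κ' w ν) *
        (ENNReal.ofReal ((1 + ‖x‖) ^ k₁) *
          (ENNReal.ofReal (C₁ * (stftConst (Fin n))⁻¹) * modNorm χ₀ ω₁ p p f))) := by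
        gcongr
    _ = _ := by ring

/-- One constant serves both as the factor and in the exponent. -/
theorem ofReal_constants_le {K : ℝ≥0∞} (hK : K ≠ ∞) {C d t : ℝ} (hC : 0 < C) (ht : 0 ≤ t)
    {I x y : ℝ≥0∞} (hI : I ≤ ENNReal.ofReal (C * Real.exp (C * t))) :
    K * ENNReal.ofReal d⁻¹ * x * I * y ≤
      ENNReal.ofReal ((C + C * K.toReal) * d⁻¹) * x *
        ENNReal.ofReal (Real.exp ((C + C * K.toReal) * t)) * y := by
  have hK0 : 0 ≤ C * K.toReal := mul_nonneg hC.le ENNReal.toReal_nonneg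
  have h1 : I ≤ ENNReal.ofReal C * ENNReal.ofReal (Real.exp ((C + C * K.toReal) * t)) := by
    rw [← ENNReal.ofReal_mul hC.le]
    refine hI.trans (ENNReal.ofReal_le_ofReal (mul_le_mul_of_nonneg_left ?_ hC.le))
    refine Real.exp_le_exp.2 (mul_le_mul_of_nonneg_right ?_ ht)
    linarith
  have h2 : K * ENNReal.ofReal C ≤ ENNReal.ofReal (C + C * K.toReal) := by
    rw [mul_comm]
    nth_rewrite 1 [← ENNReal.ofReal_toReal hK]
    rw [← ENNReal.ofReal_mul hC.le]
    exact ENNReal.ofReal_le_ofReal (by linarith)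
  calc _ ≤ K * ENNReal.ofReal d⁻¹ * x * (ENNReal.ofReal C *
        ENNReal.ofReal (Real.exp ((C + C * K.toReal) * t))) * y := by gcongr
    _ = K * ENNReal.ofReal C * ENNReal.ofReal d⁻¹ * x *
        ENNReal.ofReal (Real.exp ((C + C * K.toReal) * t)) * y := by ring
    _ ≤ ENNReal.ofReal (C + C * K.toReal) * ENNReal.ofReal d⁻¹ * x *
        ENNReal.ofReal (Real.exp ((C + C * K.toReal) * t)) * y := by gcongr
    _ = _ := by rw [ENNReal.ofReal_mul (by positivity)]

end Bound

theorem mainTheorem2 (n m : ℕ) (p : ℝ≥0∞) (hp₁ : 1 < p) (hp : p < ∞)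
    (ω v : TripleSpace n m × TripleSpace n m → ℝ)
    (ω₁ ω₂ : EuclideanSpace ℝ (Fin n) × EuclideanSpace ℝ (Fin n) → ℝ)
    (hω : IsPolyWeight ω) (hv : IsPolyWeight v)
    (hω₁ : IsPolyWeight ω₁) (hω₂ : IsPolyWeight ω₂)
    (hv_sub : IsSubmultiplicative v)
    (hv_const : ∀ X Y Ξ : TripleSpace n m, v (X, Ξ) = v (Y, Ξ))
    (hv_scale : ∃ C : ℝ, ∀ t ∈ Set.Icc (0 : ℝ) 1, ∀ X Ξ : TripleSpace n m,
      v (X, t • Ξ) ≤ C * v (X, Ξ))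
    (hωv : ∃ C : ℝ, ∀ X Ξ Ξ' : TripleSpace n m, ω (X, Ξ + Ξ') ≤ C * ω (X, Ξ) * v (X, Ξ'))
    (χ : 𝓢(TripleSpace n m, ℂ)) (hχ : χ ≠ 0)
    (χ₀ : 𝓢(EuclideanSpace ℝ (Fin n), ℂ)) (hχ₀ : χ₀ ≠ 0) (C₀ : ℝ) :
    ∃ C : ℝ, 0 < C ∧
      ∀ (d : ℝ) (_ : 0 < d) (φ : TripleSpace n m → ℝ) (_ : ContDiff ℝ 2 φ)
        (_ : hessNorm χ v φ < ∞)
        (_ : ∀ X, d ≤ |(mixedHessian φ X).det|)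
        (_ : ∀ (X : TripleSpace n m) (ξ η : EuclideanSpace ℝ (Fin n)),
          ω₂ (xPart X, ξ) / ω₁ (yPart X, -η) ≤ C₀ * ω (X, triple ξ η 0 - gradVec φ X)),
      ∃ T : 𝓢'(TripleSpace n m, ℂ) →
          (𝓢(EuclideanSpace ℝ (Fin n), ℂ) →L[ℂ] 𝓢'(EuclideanSpace ℝ (Fin n), ℂ)),
        -- `T` is a linear, norm continuous and narrowly continuous extension of `a ↦ Op_φ(a)`
        (ExtendsFIO φ T ∧
          IsLinearOnSet T (modSpace χ ω ∞ 1) ∧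
          (∀ a ∈ modSpace χ ω ∞ 1, Tendsto T (modNhds χ ω ∞ 1 a) (𝓝 (T a))) ∧
          IsNarrowlyContinuous χ ω T) ∧
        -- it is the only narrowly continuous extension
        (∀ T' : 𝓢'(TripleSpace n m, ℂ) →
            (𝓢(EuclideanSpace ℝ (Fin n), ℂ) →L[ℂ] 𝓢'(EuclideanSpace ℝ (Fin n), ℂ)),
          ExtendsFIO φ T' → IsNarrowlyContinuous χ ω T' →
            Set.EqOn T' T (modSpace χ ω ∞ 1)) ∧
        -- each `T a` extends uniquely to a continuous operator `M^p_{(ω₁)} → M^p_{(ω₂)}`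
        (∀ a ∈ modSpace χ ω ∞ 1,
          ∃ S : 𝓢'(EuclideanSpace ℝ (Fin n), ℂ) → 𝓢'(EuclideanSpace ℝ (Fin n), ℂ),
            (∀ f : 𝓢(EuclideanSpace ℝ (Fin n), ℂ),
              S (f : 𝓢'(EuclideanSpace ℝ (Fin n), ℂ)) = T a f) ∧
            IsLinearOnSet S (modSpace χ₀ ω₁ p p) ∧
            IsContinuousModMap χ₀ ω₁ ω₂ p S ∧
            (∀ f ∈ modSpace χ₀ ω₁ p p,
              modNorm χ₀ ω₂ p p (S f) ≤
                ENNReal.ofReal (C * d⁻¹) * modNorm χ ω ∞ 1 a *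
                  ENNReal.ofReal (Real.exp (C * (hessNorm χ v φ).toReal)) *
                  modNorm χ₀ ω₁ p p f) ∧
            ∀ S' : 𝓢'(EuclideanSpace ℝ (Fin n), ℂ) → 𝓢'(EuclideanSpace ℝ (Fin n), ℂ),
              (∀ f : 𝓢(EuclideanSpace ℝ (Fin n), ℂ),
                S' (f : 𝓢'(EuclideanSpace ℝ (Fin n), ℂ)) = T a f) →
              IsContinuousModMap χ₀ ω₁ ω₂ p S' →
                Set.EqOn S' S (modSpace χ₀ ω₁ p p)) := by
  have hp' : p ≠ ∞ := hp.ne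
  have hp1 : 1 ≤ p := hp₁.le
  have hp0 : p ≠ 0 := (zero_lt_one.trans_le hp1).ne'
  -- the window for the argument of the operator is the translate of `χ₀` by `x`, since norms in
  -- `M^p_{(ω₁)}` are measured with `χ₀`; the translation makes the mean of the windows nonzero
  obtain ⟨χ₂, κ, κ', x, hχ₂, hmean⟩ := exists_windows (m := m) hχ hχ₀
  obtain ⟨c, hc⟩ := exists_fioPairing_eq hmean
  -- the weights are only measurable and are replaced by equivalent continuous ones
  obtain ⟨ω', k, D, hω', hD, hle, hge⟩ := exists_isContWeight hω.pos hω.moderate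
  obtain ⟨ω₁', k₁, D₁, hω₁', hD₁, hle₁, hge₁⟩ := exists_isContWeight hω₁.pos hω₁.moderate
  obtain ⟨ω₂', k₂, D₂, hω₂', hD₂, hle₂, hge₂⟩ := exists_isContWeight hω₂.pos hω₂.moderate
  obtain ⟨w, k₃, A, D₃, hw, hD₃, hvw, hwv⟩ := exists_isSubWeight hv hv_sub hv_const hv_scale
  have hvnn := fun z => (hv.pos z).le
  obtain ⟨B, hB⟩ := exists_weight_bound hω.pos hv.pos hω₁.pos hω₂.pos hv_sub hvw hωv hle hle₁ hD₂
    hge₂ C₀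
  obtain ⟨C₁, hC₁, hphase⟩ := exists_phase_bound hχ hvnn hw hD₃.le hwv χ₂ hχ₂
  obtain ⟨K, hK, hbound⟩ := exists_modNorm_image_le (χ := χ) (χ₂ := χ₂) (B := B) κ χ₀ κ' x c
    (fun z => (hω.pos z).le) (fun z => (hω₂.pos z).le) hω' hω₁' hω₂' hw.toIsContWeight hD.le hge
    hD₁.le hge₁ hle₂ hp1 hp'
  -- one constant serves as the factor, `C₁ * K` or more, and in the exponent, `C₁` or more
  refine ⟨C₁ + C₁ * K.toReal, by positivity, fun d hd φ hφ hess hdet hdom => ?_⟩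
  obtain ⟨h, hh, hhint, hhle⟩ := hphase φ hφ hess
  have S : FioSetting χ₂ φ ω' w ω₁' ω₂' h B d :=
    { contDiff := hφ
      hess := pderiv2_bounded_uniformContinuous hχ hvnn hw hD₃.le hwv hφ hess
      d_pos := hd
      det := hdet
      weight := ⟨k, hω'⟩
      weight₁ := ⟨k₁, hω₁'⟩
      weight₂ := ⟨k₂, hω₂'⟩
      dualWeight := ⟨k₃, hw.toIsContWeight⟩
      measurable := hh
      lintegral_ne_top := ne_top_of_le_ne_top ENNReal.ofReal_ne_top hhint
      phase := hhle
      dom := hB φ hdom }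
  obtain ⟨T, hT, hext, hlin, hnorm, hnarrow⟩ := S.exists_symbolExtension hω hD.le hle hge
    (hc φ hφ.continuous)
  refine ⟨T, ⟨hext, hlin, hnorm, hnarrow⟩, fun T' hext' hnarrow' =>
    eqOn_of_isNarrowlyContinuous hχ hω hext hext' hnarrow hnarrow', fun a ha => ?_⟩
  have hfin : ∀ f ∈ modSpace χ₀ ω₁ p p,
      ∫⁻ t, ‖wstft (SchwartzMap.compSubConstCLM ℂ x χ₀) ω₁' f t‖ₑ ^ p.toReal ≠ ∞ := fun f hf => by
    refine ((eLpNorm_lt_top_iff_lintegral_rpow_enorm_lt_top hp0 hp').1 ?_).ne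
    exact (eLpNorm_wstft_compSubConst_le hω₁' χ₀ x p f).trans_lt (ENNReal.mul_lt_top
      ENNReal.ofReal_lt_top ((mem_modSpace_iff (fun z => (hω₁.pos z).le) hω₁' hD₁.le hle₁ hge₁ hp0
        hp').1 hf))
  have haK : ENNReal.ofReal ((C₁ + C₁ * K.toReal) * d⁻¹) * modNorm χ ω ∞ 1 a *
      ENNReal.ofReal (Real.exp ((C₁ + C₁ * K.toReal) * (hessNorm χ v φ).toReal)) ≠ ∞ :=
    ENNReal.mul_ne_top (ENNReal.mul_ne_top ENNReal.ofReal_ne_top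
      (show modNorm χ ω ∞ 1 a < ∞ from ha).ne) ENNReal.ofReal_ne_top
  obtain ⟨A, hAT, hAlin, hAcont, hAle⟩ := S.exists_modExtension hω₁ hp1 hp'
    ((mem_modSpace_top_one_iff (fun z => (hω.pos z).le) hω' hD.le hle hge).1 ha).ne hfin haK
    (fun f u hu => (hbound φ h d S a f u hu).trans
      (ofReal_constants_le hK hC₁ ENNReal.toReal_nonneg hhint)) (hT a ha)
  exact ⟨A, hAT, hAlin, hAcont, hAle, fun S' hS' hcont' =>
    eqOn_of_isContinuousModMap hχ₀ hω₁ hω₂ hp1 hp' (fun f => by rw [hS', hAT]) hAcont hcont'⟩
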